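/- Let $X$ be a smooth proper scheme over $\mathbb{C}$, of pure dimension $n$, with an action of a finite group $G$ (not necessarily abelian), such that the global-quotient orbifold $[X/G]$ is Calabi–Yau, i.e. $X$ has a nowhere vanishing algebraic $n$-form that is invariant under $G$. For $g\in G$ let $X^g$ be the fixed locus, $c_g$ its codimension in $X$, $\omega_g=\bigwedge^{c_g}N_{X^g/X}$ the dualizing sheaf of $X^g\hookrightarrow X$, and $\iota(g)=\sum_j r_j$ the age of $g$, where $e^{2\pi i r_j}$, $0\le r_j<1$, are the eigenvalues (with multiplicity) of the differential of $g$ on the tangent space $T_xX$ at a point $x\in X^g$; both $c_g$ and $\iota(g)$ may depend on the connected component of $X^g$, and the groups below are understood as sums over the components. For integers $q,p$ put $$HT^{q,p}(X;G)=\bigoplus_{g\in G}H^{p-\iota(g)}\bigl(X^g,\textstyle\bigwedge^{q+\iota(g)-c_g}T_{X^g}\otimes\omega_g\bigr),\qquad H\Omega^{q,p}(X;G)=\bigoplus_{g\in G}H^{p-\iota(g)}\bigl(X^g,\Omega^{q-\iota(g)}_{X^g}\bigr),$$ where summands whose degrees are not non-negative integers are zero. The group $G$ acts on both spaces, $h\in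 G$ mapping the summands of $g$ to those of $hgh^{-1}$ through the isomorphism $X^g\to X^{hgh^{-1}}$, $x\mapsto hx$; let $HT^{q,p}([X/G])$ and $H\Omega^{q,p}([X/G])$ be the $G$-invariant parts. Then there are $\mathcal O$-linear isomorphisms $\kappa_g:\omega_g\cong\omega_{X^g}=\Omega^{\dim X^g}_{X^g}$, compatible with the action of $G$, and for all $q,p\in\mathbb{Z}$ a $\mathbb{C}$-linear isomorphism $$e:HT^{q,p}(X;G)\;\cong\;H\Omega^{n-q,p}(X;G)$$ with the following properties. On each summand $e$ is induced by an isomorphism of sheaves $\Phi:\bigwedge^{b}T_{X^g}\otimes\omega_g\cong\Omega^{b'}_{X^g}$, with $b=q+\iota(g)-c_g$ and $b'=n-q-\iota(g)=\dim X^g-b$, that is determined by $\kappa_g$ and the wedge pairing: $\eta\wedge\Phi(P\otimes\nu)=\langle\eta,P\rangle\,\kappa_g(\nu)$ for all local sections $\eta$ of $\Omega^b_{X^g}$, $P$ of $\bigwedge^bT_{X^g}$ and $\nu$ of $\omega_g$. Moreover $e$ is $G$-equivariant, and hence restricts to an isomorphism $HT^{q,p}([X/G])\cong H\Omega^{n-q,p}([X/G])$.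 -/

import Mathlib

open CategoryTheory Limits AlgebraicGeometry TopologicalSpace Opposite
open scoped TensorProduct DirectSum

noncomputable section

namespace OrbifoldHodge

section Algebra

variable {A B C : Type} [CommRing A] [CommRing B] [CommRing C]
variable {M N P : Type} [AddCommGroup M] [Module A M] [AddCommGroup N] [Module B N]
  [AddCommGroup P] [Module C P]

/-- The map `⋀ʳ M → ⋀ʳ N`, `m₁ ∧ ⋯ ∧ mᵣ ↦ f m₁ ∧ ⋯ ∧ f mᵣ`, induced by a semilinear map. -/
def extMap {φ : A →+* B} (f : M →ₛₗ[φ] N) (r : ℕ) : (⋀[A]^r M) →ₛₗ[φ] (⋀[B]^r N) :=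
  letI : Module A (⋀[B]^r N) := Module.compHom _ φ
  let g : M [⋀^Fin r]→ₗ[A] (⋀[B]^r N) :=
    { toFun := fun v => exteriorPower.ιMulti B r (fun i => f (v i))
      map_update_add' := fun v i x y => by
        have h : ∀ z, (fun j => f (Function.update v i z j)) =
            Function.update (fun j => f (v j)) i (f z) := fun z => by
          funext j; by_cases hj : j = i
          · subst hj; simp
          · simp [hj]
        simp only [h, map_add, AlternatingMap.map_update_add]
      map_update_smul' := fun v i a x => by
        have h : ∀ z, (fun j => f (Function.update v i z j)) =
            Function.update (fun j => f (v j)) i (f z) := fun z => by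
          funext j; by_cases hj : j = i
          · subst hj; simp
          · simp [hj]
        simp only [h, map_smulₛₗ, AlternatingMap.map_update_smul]
        rfl
      map_eq_zero_of_eq' := fun v i j hv hij =>
        (exteriorPower.ιMulti B r).map_eq_zero_of_eq _ (by simp [hv]) hij }
  let L : (⋀[A]^r M) →ₗ[A] (⋀[B]^r N) := exteriorPower.alternatingMapLinearEquiv g
  { toFun := L
    map_add' := L.map_add
    map_smul' := L.map_smul }

lemma extMap_ιMulti {φ : A →+* B} (f : M →ₛₗ[φ] N) (r : ℕ) (v : Fin r → M) :
    extMap f r (exteriorPower.ιMulti A r v) = exteriorPower.ιMulti B r (fun i => f (v i)) :=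
  letI : Module A (⋀[B]^r N) := Module.compHom _ φ
  exteriorPower.alternatingMapLinearEquiv_apply_ιMulti _ _

lemma ext_induction {r : ℕ} {p : (⋀[A]^r M) → Prop} (x : ⋀[A]^r M)
    (h₁ : ∀ v, p (exteriorPower.ιMulti A r v)) (h₀ : p 0)
    (h₂ : ∀ x y, p x → p y → p (x + y)) (h₃ : ∀ (a : A) x, p x → p (a • x)) : p x := by
  have hx : x ∈ Submodule.span A (Set.range (exteriorPower.ιMulti A r (M := M))) := by
    rw [exteriorPower.ιMulti_span]; trivial
  induction hx using Submodule.span_induction with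
  | mem x h => obtain ⟨v, rfl⟩ := h; exact h₁ v
  | zero => exact h₀
  | add x y _ _ hx hy => exact h₂ x y hx hy
  | smul a x _ hx => exact h₃ a x hx

lemma extMap_id {φ : A →+* A} (f : M →ₛₗ[φ] M) (hφ : ∀ a, φ a = a) (hf : ∀ m, f m = m)
    (r : ℕ) (x : ⋀[A]^r M) : extMap f r x = x := by
  induction x using ext_induction with
  | h₁ v => simp [extMap_ιMulti, hf]
  | h₀ => simp
  | h₂ x y hx hy => simp [hx, hy]
  | h₃ a x hx => rw [map_smulₛₗ, hx, hφ]

lemma extMap_comp {φ : A →+* B} {ψ : B →+* C} {χ : A →+* C}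
    (f : M →ₛₗ[φ] N) (g : N →ₛₗ[ψ] P) (k : M →ₛₗ[χ] P)
    (hφ : ∀ a, ψ (φ a) = χ a) (hf : ∀ m, g (f m) = k m)
    (r : ℕ) (x : ⋀[A]^r M) : extMap g r (extMap f r x) = extMap k r x := by
  induction x using ext_induction with
  | h₁ v => simp [extMap_ιMulti, hf]
  | h₀ => simp
  | h₂ x y hx hy => simp [hx, hy]
  | h₃ a x hx => simp only [map_smulₛₗ, hx, hφ]

variable {M' N' P' : Type} [AddCommGroup M'] [Module A M'] [AddCommGroup N'] [Module B N']
  [AddCommGroup P'] [Module C P']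

/-- The map `⋀ᵇ M ⊗ ⋀ᶜ M' → ⋀ᵇ N ⊗ ⋀ᶜ N'` induced by semilinear maps. -/
def polMap {φ : A →+* B} (f : M →ₛₗ[φ] N) (f' : M' →ₛₗ[φ] N') (b c : ℕ) :
    ((⋀[A]^b M) ⊗[A] (⋀[A]^c M')) →ₛₗ[φ] ((⋀[B]^b N) ⊗[B] (⋀[B]^c N')) :=
  TensorProduct.map (extMap f b) (extMap f' c)

lemma polMap_tmul {φ : A →+* B} (f : M →ₛₗ[φ] N) (f' : M' →ₛₗ[φ] N') (b c : ℕ)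
    (x : ⋀[A]^b M) (y : ⋀[A]^c M') :
    polMap f f' b c (x ⊗ₜ y) = extMap f b x ⊗ₜ extMap f' c y :=
  TensorProduct.map_tmul _ _ _ _

lemma polMap_id {φ : A →+* A} (f : M →ₛₗ[φ] M) (f' : M' →ₛₗ[φ] M') (hφ : ∀ a, φ a = a)
    (hf : ∀ m, f m = m) (hf' : ∀ m, f' m = m) (b c : ℕ)
    (x : (⋀[A]^b M) ⊗[A] (⋀[A]^c M')) : polMap f f' b c x = x := by
  induction x using TensorProduct.induction_on with
  | zero => rw [map_zero]
  | add x y hx hy => rw [map_add, hx, hy]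
  | tmul x y => rw [polMap_tmul, extMap_id f hφ hf, extMap_id f' hφ hf']

lemma polMap_comp {φ : A →+* B} {ψ : B →+* C} {χ : A →+* C}
    (f : M →ₛₗ[φ] N) (g : N →ₛₗ[ψ] P) (k : M →ₛₗ[χ] P)
    (f' : M' →ₛₗ[φ] N') (g' : N' →ₛₗ[ψ] P') (k' : M' →ₛₗ[χ] P')
    (hφ : ∀ a, ψ (φ a) = χ a) (hf : ∀ m, g (f m) = k m) (hf' : ∀ m, g' (f' m) = k' m) (b c : ℕ)
    (x : (⋀[A]^b M) ⊗[A] (⋀[A]^c M')) :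
    polMap g g' b c (polMap f f' b c x) = polMap k k' b c x := by
  induction x using TensorProduct.induction_on with
  | zero => rw [map_zero, map_zero, map_zero]
  | add x y hx hy => rw [map_add, map_add, hx, hy, map_add]
  | tmul x y =>
    rw [polMap_tmul, polMap_tmul, polMap_tmul, extMap_comp f g k hφ hf,
      extMap_comp f' g' k' hφ hf']

variable [Algebra ℂ A] [Algebra ℂ B] [Algebra ℂ C]

/-- The map `Ω_A → Ω_B`, `a₁ da₂ ↦ φ(a₁) dφ(a₂)`, induced by `φ : A → B`. -/
def kaehlerMap (φ : A →ₐ[ℂ] B) : Ω[A⁄ℂ] →ₛₗ[(φ : A →+* B)] Ω[B⁄ℂ] :=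
  letI : Algebra A B := (φ : A →+* B).toAlgebra
  haveI : IsScalarTower ℂ A B := IsScalarTower.of_algebraMap_eq fun x => (φ.commutes x).symm
  let L := KaehlerDifferential.map ℂ ℂ A B
  { toFun := L
    map_add' := L.map_add
    map_smul' := fun a x => by
      rw [L.map_smul, ← IsScalarTower.algebraMap_smul B a (L x)]; rfl }

lemma kaehlerMap_D (φ : A →ₐ[ℂ] B) (a : A) :
    kaehlerMap φ (KaehlerDifferential.D ℂ A a) = KaehlerDifferential.D ℂ B (φ a) :=
  letI : Algebra A B := (φ : A →+* B).toAlgebra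
  haveI : IsScalarTower ℂ A B := IsScalarTower.of_algebraMap_eq fun x => (φ.commutes x).symm
  KaehlerDifferential.map_D ℂ ℂ A B a

lemma kaehler_induction {p : Ω[A⁄ℂ] → Prop} (x : Ω[A⁄ℂ])
    (h₁ : ∀ a, p (KaehlerDifferential.D ℂ A a)) (h₀ : p 0)
    (h₂ : ∀ x y, p x → p y → p (x + y)) (h₃ : ∀ (a : A) x, p x → p (a • x)) : p x := by
  have hx : x ∈ Submodule.span A (Set.range (KaehlerDifferential.D ℂ A)) := by
    rw [KaehlerDifferential.span_range_derivation]; trivial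
  induction hx using Submodule.span_induction with
  | mem x h => obtain ⟨v, rfl⟩ := h; exact h₁ v
  | zero => exact h₀
  | add x y _ _ hx hy => exact h₂ x y hx hy
  | smul a x _ hx => exact h₃ a x hx

lemma kaehlerMap_id (φ : A →ₐ[ℂ] A) (hφ : ∀ a, φ a = a) (x : Ω[A⁄ℂ]) : kaehlerMap φ x = x := by
  induction x using kaehler_induction with
  | h₁ v => simp [kaehlerMap_D, hφ]
  | h₀ => simp
  | h₂ x y hx hy => simp [hx, hy]
  | h₃ a x hx => rw [map_smulₛₗ, hx]; congr 1; exact hφ a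

lemma kaehlerMap_comp (φ : A →ₐ[ℂ] B) (ψ : B →ₐ[ℂ] C) (χ : A →ₐ[ℂ] C)
    (h : ∀ a, ψ (φ a) = χ a) (x : Ω[A⁄ℂ]) : kaehlerMap ψ (kaehlerMap φ x) = kaehlerMap χ x := by
  induction x using kaehler_induction with
  | h₁ v => simp [kaehlerMap_D, h]
  | h₀ => simp
  | h₂ x y hx hy => simp [hx, hy]
  | h₃ a x hx =>
    simp only [map_smulₛₗ, hx]; congr 1; exact h a

/-- An `A`-module regarded as a complex vector space. -/
abbrev asVect (A : Type) [CommRing A] [Algebra ℂ A] (M : Type) [AddCommGroup M] [Module A M] :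
    ModuleCat.{0} ℂ :=
  (ModuleCat.restrictScalars (algebraMap ℂ A)).obj (ModuleCat.of A M)

/-- A map semilinear over a homomorphism of complex algebras, as a map of vector spaces. -/
def vectMap (φ : A →ₐ[ℂ] B) (f : M →ₛₗ[(φ : A →+* B)] N) : asVect A M ⟶ asVect B N :=
  ModuleCat.ofHom (X := asVect A M) (Y := asVect B N)
    { toFun := fun m => (f (show M from m) : N)
      map_add' := fun x y => f.map_add x y
      map_smul' := fun z x => by
        have := f.map_smulₛₗ (algebraMap ℂ A z) (show M from x)
        refine this.trans ?_
        have h : (φ : A →+* B) (algebraMap ℂ A z) = algebraMap ℂ B z := φ.commutes z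
        rw [h]; rfl }

lemma vectMap_apply (φ : A →ₐ[ℂ] B) (f : M →ₛₗ[(φ : A →+* B)] N) (m : M) :
    (vectMap φ f).hom (show asVect A M from m) = (show asVect B N from f m) := rfl

end Algebra

/-! ### Complex schemes and their functions -/

/-- The spectrum of the complex numbers. -/
abbrev SpecC : Scheme.{0} := Spec (CommRingCat.of ℂ)

lemma le_preimage_top (Y : Over SpecC) (W : Y.left.Opens) : W ≤ Y.hom ⁻¹ᵁ ⊤ := fun _ _ => trivial

/-- The `ℂ`-algebra structure on the functions on an open subset of a `ℂ`-scheme. -/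
instance algebraSections (Y : Over SpecC) (U : Y.left.Opens) : Algebra ℂ Γ(Y.left, U) :=
  ((Scheme.ΓSpecIso (CommRingCat.of ℂ)).inv ≫ Y.hom.appLE ⊤ U (le_preimage_top Y U)).hom.toAlgebra

/-- Pull-back of functions along a morphism `f : Z ⟶ Y` of `ℂ`-schemes, from an open subset `W`
of `Y` to an open subset `V` of `Z` with `V ⊆ f⁻¹(W)`. For `f = 𝟙 Y` this is restriction. -/
def pull {Z Y : Over SpecC} (f : Z ⟶ Y) (W : Y.left.Opens) (V : Z.left.Opens)
    (h : V ≤ f.left ⁻¹ᵁ W) : Γ(Y.left, W) →ₐ[ℂ] Γ(Z.left, V) :=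
  { (f.left.appLE W V h).hom with
    commutes' := fun z => by
      have h₁ : Y.hom.appLE ⊤ W (le_preimage_top Y W) ≫ f.left.appLE W V h = Z.hom.appLE ⊤ V (le_preimage_top Z V) := by
        rw [Scheme.Hom.appLE_comp_appLE]
        congr 1
        exact Over.w f
      change (((Scheme.ΓSpecIso (CommRingCat.of ℂ)).inv ≫ Y.hom.appLE ⊤ W (le_preimage_top Y W)) ≫
        f.left.appLE W V h).hom z = _
      rw [Category.assoc, h₁]
      rfl }

lemma pull_id (Y : Over SpecC) (W : Y.left.Opens) (h : W ≤ (𝟙 Y : Y ⟶ Y).left ⁻¹ᵁ W)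
    (x : Γ(Y.left, W)) : pull (𝟙 Y) W W h x = x := by
  change ((𝟙 Y : Y ⟶ Y).left.appLE W W h).hom x = x
  have : (𝟙 Y : Y ⟶ Y).left.appLE W W h = 𝟙 _ := by
    simp only [Scheme.Hom.appLE, Over.id_left, Scheme.Hom.id_app]
    exact (Category.id_comp _).trans (Y.left.presheaf.map_id _)
  rw [this]; rfl

lemma pull_pull {Z Y X : Over SpecC} (f : Z ⟶ Y) (g : Y ⟶ X) (k : Z ⟶ X) (hk : f ≫ g = k)
    (U : X.left.Opens) (V : Y.left.Opens) (W : Z.left.Opens)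
    (h₁ : V ≤ g.left ⁻¹ᵁ U) (h₂ : W ≤ f.left ⁻¹ᵁ V) (h₃ : W ≤ k.left ⁻¹ᵁ U)
    (x : Γ(X.left, U)) : pull f V W h₂ (pull g U V h₁ x) = pull k U W h₃ x := by
  subst hk
  change (g.left.appLE U V h₁ ≫ f.left.appLE V W h₂).hom x = _
  rw [Scheme.Hom.appLE_comp_appLE]
  rfl

lemma pull_eq {Z Y X X' : Over SpecC} {f : Z ⟶ Y} {g : Y ⟶ X} {f' : Z ⟶ X'} {g' : X' ⟶ X}
    (hk : f ≫ g = f' ≫ g') {U : X.left.Opens} {V : Y.left.Opens} {V' : X'.left.Opens}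
    {W : Z.left.Opens} {h₁ : V ≤ g.left ⁻¹ᵁ U} {h₂ : W ≤ f.left ⁻¹ᵁ V}
    {h₁' : V' ≤ g'.left ⁻¹ᵁ U} {h₂' : W ≤ f'.left ⁻¹ᵁ V'}
    (x : Γ(X.left, U)) :
    pull f V W h₂ (pull g U V h₁ x) = pull f' V' W h₂' (pull g' U V' h₁' x) := by
  have h₃ : W ≤ (f ≫ g).left ⁻¹ᵁ U := fun z hz => h₁ (h₂ hz)
  rw [pull_pull f g (f ≫ g) rfl U V W h₁ h₂ h₃, pull_pull f' g' (f ≫ g) hk.symm]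

/-- Restriction of functions. -/
abbrev res (Y : Over SpecC) {V V' : Y.left.Opens} (h : V' ≤ V) :
    Γ(Y.left, V) →ₐ[ℂ] Γ(Y.left, V') := pull (𝟙 Y) V V' h

/-! ### Derivations and normal fields along a morphism -/

/-- A morphism of `ℂ`-schemes. -/
structure Mor where
  /-- The source. -/
  src : Over SpecC
  /-- The target. -/
  tgt : Over SpecC
  /-- The morphism. -/
  hom : src ⟶ tgt

namespace Mor

/-- Open subsets of the target whose preimage lies in `V`. -/
abbrev Idx (f : Mor) (V : f.src.left.Opens) : Type :=
  {W : f.tgt.left.Opens // f.hom.left ⁻¹ᵁ W ≤ V}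

/-- The functions on the target that are defined on `W`. -/
abbrev Fun (f : Mor) (W : f.tgt.left.Opens) : Type := Γ(f.tgt.left, W)

/-- The functions on the preimage of `W`. -/
abbrev Fib (f : Mor) (W : f.tgt.left.Opens) : Type := Γ(f.src.left, f.hom.left ⁻¹ᵁ W)

/-- `f^♯` on an open subset `W` of the target. -/
abbrev sharp (f : Mor) (W : f.tgt.left.Opens) : f.Fun W →ₐ[ℂ] f.Fib W :=
  pull f.hom W (f.hom.left ⁻¹ᵁ W) le_rfl

/-- The ideal `ker (f^♯)`; for a closed immersion this is the ideal of the closed subscheme. -/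
abbrev ideal (f : Mor) (W : f.tgt.left.Opens) : Ideal (f.Fun W) :=
  RingHom.ker (f.sharp W : f.Fun W →+* f.Fib W)

/-- Families of additive maps `O_Y(W) → O_Z(f⁻¹ W)`. -/
def TanFam (f : Mor) (V : f.src.left.Opens) : Type :=
  ∀ W : f.Idx V, f.Fun W.1 →ₗ[ℂ] f.Fib W.1

instance (f : Mor) (V : f.src.left.Opens) : AddCommGroup (f.TanFam V) :=
  inferInstanceAs (AddCommGroup (∀ W : f.Idx V, f.Fun W.1 →ₗ[ℂ] f.Fib W.1))

/-- Families of `O_Y(W)`-linear maps `I(W) → O_Z(f⁻¹ W)`, `I = ker (f^♯)`. -/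
def NorFam (f : Mor) (V : f.src.left.Opens) : Type :=
  ∀ W : f.Idx V, f.ideal W.1 →ₛₗ[(f.sharp W.1 : f.Fun W.1 →+* f.Fib W.1)] f.Fib W.1

instance (f : Mor) (V : f.src.left.Opens) : AddCommGroup (f.NorFam V) :=
  inferInstanceAs (AddCommGroup
    (∀ W : f.Idx V, f.ideal W.1 →ₛₗ[(f.sharp W.1 : f.Fun W.1 →+* f.Fib W.1)] f.Fib W.1))

/-- The restrictions of functions on `V` to all the `f⁻¹(W) ⊆ V`. -/
def resFam (f : Mor) (V : f.src.left.Opens) :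
    Γ(f.src.left, V) →+* ∀ W : f.Idx V, f.Fib W.1 :=
  RingHom.pi fun W => (res f.src W.2 : Γ(f.src.left, V) →+* f.Fib W.1)

/-- `(a • D)_W = a|_{f⁻¹ W} · D_W`. -/
instance (f : Mor) (V : f.src.left.Opens) : Module Γ(f.src.left, V) (f.TanFam V) :=
  letI : Module (∀ W : f.Idx V, f.Fib W.1) (f.TanFam V) :=
    inferInstanceAs (Module (∀ W : f.Idx V, f.Fib W.1)
      (∀ W : f.Idx V, f.Fun W.1 →ₗ[ℂ] f.Fib W.1))
  Module.compHom _ (f.resFam V)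

/-- `(a • ν)_W = a|_{f⁻¹ W} · ν_W`. -/
instance (f : Mor) (V : f.src.left.Opens) : Module Γ(f.src.left, V) (f.NorFam V) :=
  letI : Module (∀ W : f.Idx V, f.Fib W.1) (f.NorFam V) :=
    inferInstanceAs (Module (∀ W : f.Idx V, f.Fib W.1)
      (∀ W : f.Idx V, f.ideal W.1 →ₛₗ[(f.sharp W.1 : f.Fun W.1 →+* f.Fib W.1)] f.Fib W.1))
  Module.compHom _ (f.resFam V)

/-- The member of a family at the index `W`. -/
def TanFam.ev {f : Mor} {V : f.src.left.Opens} (D : f.TanFam V) (W : f.Idx V) :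
    f.Fun W.1 →ₗ[ℂ] f.Fib W.1 := D W

/-- The member of a family at the index `W`. -/
def NorFam.ev {f : Mor} {V : f.src.left.Opens} (D : f.NorFam V) (W : f.Idx V) :
    f.ideal W.1 →ₛₗ[(f.sharp W.1 : f.Fun W.1 →+* f.Fib W.1)] f.Fib W.1 := D W

lemma tan_ext {f : Mor} {V : f.src.left.Opens} {D E : f.TanFam V}
    (h : ∀ W a, D.ev W a = E.ev W a) : D = E :=
  funext fun W => LinearMap.ext (h W)

lemma nor_ext {f : Mor} {V : f.src.left.Opens} {D E : f.NorFam V}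
    (h : ∀ W a, D.ev W a = E.ev W a) : D = E :=
  funext fun W => LinearMap.ext (h W)

lemma tan_add_apply {f : Mor} {V : f.src.left.Opens} (D E : f.TanFam V) (W : f.Idx V)
    (a : f.Fun W.1) : (D + E).ev W a = D.ev W a + E.ev W a := rfl

lemma tan_zero_apply {f : Mor} {V : f.src.left.Opens} (W : f.Idx V)
    (a : f.Fun W.1) : (0 : f.TanFam V).ev W a = 0 := rfl

lemma tan_smul_apply {f : Mor} {V : f.src.left.Opens} (b : Γ(f.src.left, V)) (D : f.TanFam V)
    (W : f.Idx V) (a : f.Fun W.1) : (b • D).ev W a = res f.src W.2 b * D.ev W a := rfl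

lemma nor_add_apply {f : Mor} {V : f.src.left.Opens} (D E : f.NorFam V) (W : f.Idx V)
    (a : f.ideal W.1) : (D + E).ev W a = D.ev W a + E.ev W a := rfl

lemma nor_zero_apply {f : Mor} {V : f.src.left.Opens} (W : f.Idx V)
    (a : f.ideal W.1) : (0 : f.NorFam V).ev W a = 0 := rfl

lemma nor_smul_apply {f : Mor} {V : f.src.left.Opens} (b : Γ(f.src.left, V)) (D : f.NorFam V)
    (W : f.Idx V) (a : f.ideal W.1) : (b • D).ev W a = res f.src W.2 b * D.ev W a := rfl

lemma preimage_mono (f : Mor) {W W' : f.tgt.left.Opens} (h : W' ≤ W) :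
    f.hom.left ⁻¹ᵁ W' ≤ f.hom.left ⁻¹ᵁ W := fun _ hz => h hz

lemma sharp_res (f : Mor) {W W' : f.tgt.left.Opens} (h : W' ≤ W) (a : f.Fun W) :
    f.sharp W' (res f.tgt h a) = res f.src (f.preimage_mono h) (f.sharp W a) :=
  pull_eq (by simp) a

lemma res_mem_ideal (f : Mor) {W W' : f.tgt.left.Opens} (h : W' ≤ W) {a : f.Fun W}
    (ha : a ∈ f.ideal W) : res f.tgt h a ∈ f.ideal W' := by
  have h₁ : f.sharp W a = 0 := ha
  change f.sharp W' (res f.tgt h a) = 0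
  rw [sharp_res, h₁, map_zero]

/-- The `ℂ`-derivations `O_Y → f_* O_Z` over the open subset `V` of `Z`: compatible families of
derivations `O_Y(W) → O_Z(f⁻¹ W)`, for `W ⊆ Y` open with `f⁻¹(W) ⊆ V`.
For `f = 𝟙 Y` this is the module of sections over `V` of the tangent sheaf of `Y`, and for a point
`f : Spec ℂ ⟶ Y` it is the tangent space of `Y` at this point. -/
def Tan (f : Mor) (V : f.src.left.Opens) : Submodule Γ(f.src.left, V) (f.TanFam V) where
  carrier := {D | (∀ (W : f.Idx V) (a b : f.Fun W.1),
      D.ev W (a * b) = f.sharp W.1 a * D.ev W b + f.sharp W.1 b * D.ev W a) ∧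
    ∀ (W W' : f.Idx V) (h : W'.1 ≤ W.1) (a : f.Fun W.1),
      D.ev W' (res f.tgt h a) = res f.src (f.preimage_mono h) (D.ev W a)}
  add_mem' := fun {D E} hD hE =>
    ⟨fun W a b => by simp only [tan_add_apply, hD.1, hE.1]; ring,
      fun W W' h a => by simp only [tan_add_apply, hD.2 W W' h, hE.2 W W' h, map_add]⟩
  zero_mem' := ⟨fun W a b => by simp [tan_zero_apply], fun W W' h a => by simp [tan_zero_apply]⟩
  smul_mem' := fun c D hD =>
    ⟨fun W a b => by simp only [tan_smul_apply, hD.1]; ring,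
      fun W W' h a => by
        simp only [tan_smul_apply, hD.2 W W' h, map_mul]
        congr 1
        exact (pull_pull _ _ _ (by simp) _ _ _ _ _ _ c).symm⟩

/-- The sections over `V` of the normal sheaf `Hom_{O_Y}(I, O_Z)` of an immersion `f : Z ⟶ Y` with
ideal sheaf `I`: compatible families of `O_Y(W)`-linear maps `I(W) → O_Z(f⁻¹ W)`,
for `W ⊆ Y` open with `f⁻¹(W) ⊆ V`. -/
def Nor (f : Mor) (V : f.src.left.Opens) : Submodule Γ(f.src.left, V) (f.NorFam V) where
  carrier := {D | ∀ (W W' : f.Idx V) (h : W'.1 ≤ W.1) (a : f.ideal W.1),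
      D.ev W' ⟨res f.tgt h a.1, f.res_mem_ideal h a.2⟩ = res f.src (f.preimage_mono h) (D.ev W a)}
  add_mem' := fun {D E} hD hE W W' h a => by
    simp only [nor_add_apply, hD W W' h, hE W W' h, map_add]
  zero_mem' := fun W W' h a => by simp [nor_zero_apply]
  smul_mem' := fun c D hD W W' h a => by
    simp only [nor_smul_apply, hD W W' h, map_mul]
    congr 1
    exact (pull_pull _ _ _ (by simp) _ _ _ _ _ _ c).symm

end Mor

/-! ### Functoriality under isomorphisms -/

/-- An isomorphism of morphisms: isomorphisms `φ` of the sources and `σ` of the targets forming a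
commutative square. -/
structure MorIso (f f' : Mor) where
  /-- The isomorphism `φ` of the sources. -/
  left : f.src ≅ f'.src
  /-- The isomorphism `σ` of the targets. -/
  right : f.tgt ≅ f'.tgt
  w : left.hom ≫ f'.hom = f.hom ≫ right.hom

namespace MorIso

/-- The identity. -/
@[simps] def refl (f : Mor) : MorIso f f := ⟨Iso.refl _, Iso.refl _, by simp⟩

/-- The inverse. -/
@[simps] def symm {f f' : Mor} (e : MorIso f f') : MorIso f' f :=
  ⟨e.left.symm, e.right.symm, by
    rw [Iso.symm_hom, Iso.symm_hom, Iso.inv_comp_eq, ← Category.assoc, e.w]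
    simp⟩

/-- Composition. -/
@[simps] def trans {f f' f'' : Mor} (e : MorIso f f') (e' : MorIso f' f'') : MorIso f f'' :=
  ⟨e.left ≪≫ e'.left, e.right ≪≫ e'.right, by
    rw [Iso.trans_hom, Iso.trans_hom, Category.assoc, e'.w, ← Category.assoc, e.w, Category.assoc]⟩

lemma w_inv {f f' : Mor} (e : MorIso f f') : e.left.inv ≫ f.hom = f'.hom ≫ e.right.inv :=
  e.symm.w

end MorIso

namespace Mor

section Pull

variable {f f' f'' : Mor}

lemma iso_inv_preimage (e : MorIso f f') (W : f.tgt.left.Opens) :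
    f'.hom.left ⁻¹ᵁ (e.right.inv.left ⁻¹ᵁ W) = e.left.inv.left ⁻¹ᵁ (f.hom.left ⁻¹ᵁ W) :=
  (congrArg (fun k : f'.src ⟶ f.tgt => k.left ⁻¹ᵁ W) e.w_inv).symm

lemma iso_hom_inv_preimage (e : MorIso f f') (V : f.src.left.Opens) :
    e.left.hom.left ⁻¹ᵁ (e.left.inv.left ⁻¹ᵁ V) = V := by
  exact congrArg (fun k : f.src ⟶ f.src => k.left ⁻¹ᵁ V) e.left.hom_inv_id

lemma iso_inv_hom_preimage (e : MorIso f f') (V : f'.src.left.Opens) :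
    e.left.inv.left ⁻¹ᵁ (e.left.hom.left ⁻¹ᵁ V) = V := iso_hom_inv_preimage e.symm V

lemma iso_idx_le (e : MorIso f f') {V : f.src.left.Opens} {V' : f'.src.left.Opens}
    (h : V ≤ e.left.hom.left ⁻¹ᵁ V') (W : f.Idx V) :
    f'.hom.left ⁻¹ᵁ (e.right.inv.left ⁻¹ᵁ W.1) ≤ V' := by
  rw [iso_inv_preimage]
  intro z hz
  have h₁ : z ∈ e.left.inv.left ⁻¹ᵁ (e.left.hom.left ⁻¹ᵁ V') := h (W.2 hz)
  rwa [iso_inv_hom_preimage] at h₁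

lemma iso_fib_le (e : MorIso f f') (W : f.tgt.left.Opens) :
    f.hom.left ⁻¹ᵁ W ≤ e.left.hom.left ⁻¹ᵁ (f'.hom.left ⁻¹ᵁ (e.right.inv.left ⁻¹ᵁ W)) := by
  rw [iso_inv_preimage, iso_hom_inv_preimage]

/-- The index in `f'` corresponding to an index in `f`. -/
abbrev isoIdx (e : MorIso f f') {V : f.src.left.Opens} {V' : f'.src.left.Opens}
    (h : V ≤ e.left.hom.left ⁻¹ᵁ V') (W : f.Idx V) : f'.Idx V' :=
  ⟨e.right.inv.left ⁻¹ᵁ W.1, iso_idx_le e h W⟩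

/-- Transport of functions on `W` by the isomorphism of targets. -/
abbrev isoFun (e : MorIso f f') (W : f.tgt.left.Opens) :
    f.Fun W →ₐ[ℂ] f'.Fun (e.right.inv.left ⁻¹ᵁ W) := pull e.right.inv W _ le_rfl

/-- Pull-back of functions on the preimage of `W` by the isomorphism of sources. -/
abbrev isoFib (e : MorIso f f') (W : f.tgt.left.Opens) :
    f'.Fib (e.right.inv.left ⁻¹ᵁ W) →ₐ[ℂ] f.Fib W := pull e.left.hom _ _ (iso_fib_le e W)

lemma isoFib_sharp (e : MorIso f f') (W : f.tgt.left.Opens) (a : f.Fun W) :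
    isoFib e W (f'.sharp _ (isoFun e W a)) = f.sharp W a := by
  have h₀ : e.left.hom ≫ f'.hom ≫ e.right.inv = f.hom := by
    rw [← Category.assoc, e.w]
    simp
  rw [pull_pull f'.hom e.right.inv (f'.hom ≫ e.right.inv) rfl W _ _ _ _ (by exact le_rfl)]
  exact pull_pull _ _ _ h₀ _ _ _ _ _ _ _

/-- The derivation `φ^♯ ∘ D ∘ (σ⁻¹)^♯`, for an isomorphism `(φ, σ)` of morphisms. -/
def tanPullFun (e : MorIso f f') {V : f.src.left.Opens} {V' : f'.src.left.Opens}
    (h : V ≤ e.left.hom.left ⁻¹ᵁ V') (D : f'.Tan V') : f.Tan V :=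
  ⟨fun W => (isoFib e W.1).toLinearMap ∘ₗ D.1.ev (isoIdx e h W) ∘ₗ
      (isoFun e W.1).toLinearMap, by
    refine ⟨fun W a b => ?_, fun W W' hW a => ?_⟩
    · change isoFib e W.1 (D.1.ev (isoIdx e h W) (isoFun e W.1 (a * b))) =
        f.sharp W.1 a * isoFib e W.1 (D.1.ev (isoIdx e h W) (isoFun e W.1 b)) +
        f.sharp W.1 b * isoFib e W.1 (D.1.ev (isoIdx e h W) (isoFun e W.1 a))
      rw [map_mul, D.2.1, map_add, map_mul, map_mul]
      congr 1 <;> congr 1 <;> exact isoFib_sharp e W.1 _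
    · change isoFib e W'.1 (D.1.ev (isoIdx e h W') (isoFun e W'.1 (res f.tgt hW a))) =
        res f.src (f.preimage_mono hW) (isoFib e W.1 (D.1.ev (isoIdx e h W) (isoFun e W.1 a)))
      have hW' : (isoIdx e h W').1 ≤ (isoIdx e h W).1 := fun z hz => hW hz
      have h₁ : isoFun e W'.1 (res f.tgt hW a) = res f'.tgt hW' (isoFun e W.1 a) :=
        pull_eq (by simp) a
      rw [h₁, D.2.2 (isoIdx e h W) (isoIdx e h W') hW']
      exact pull_eq (by simp) _⟩

lemma tanPullFun_apply (e : MorIso f f') {V : f.src.left.Opens} {V' : f'.src.left.Opens}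
    (h : V ≤ e.left.hom.left ⁻¹ᵁ V') (D : f'.Tan V') (W : f.Idx V) (a : f.Fun W.1) :
    (tanPullFun e h D).1.ev W a = isoFib e W.1 (D.1.ev (isoIdx e h W) (isoFun e W.1 a)) := rfl

lemma iso_res_smul (e : MorIso f f') {V : f.src.left.Opens} {V' : f'.src.left.Opens}
    (h : V ≤ e.left.hom.left ⁻¹ᵁ V') (W : f.Idx V) (c : Γ(f'.src.left, V')) :
    isoFib e W.1 (res f'.src (isoIdx e h W).2 c) = res f.src W.2 (pull e.left.hom V' V h c) :=
  pull_eq (by simp) c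

/-- The pull-back of derivations along an isomorphism of morphisms. -/
def tanPull (e : MorIso f f') {V : f.src.left.Opens} {V' : f'.src.left.Opens}
    (h : V ≤ e.left.hom.left ⁻¹ᵁ V') :
    f'.Tan V' →ₛₗ[(pull e.left.hom V' V h : Γ(f'.src.left, V') →+* Γ(f.src.left, V))]
      f.Tan V where
  toFun := tanPullFun e h
  map_add' D E := by
    apply Subtype.ext
    apply tan_ext
    intro W a
    exact map_add (isoFib e W.1) _ _
  map_smul' c D := by
    apply Subtype.ext
    apply tan_ext
    intro W a
    rw [tanPullFun_apply, Submodule.coe_smul, tan_smul_apply, map_mul, iso_res_smul,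
      Submodule.coe_smul, tan_smul_apply, tanPullFun_apply]
    rfl

lemma tanPull_apply (e : MorIso f f') {V : f.src.left.Opens} {V' : f'.src.left.Opens}
    (h : V ≤ e.left.hom.left ⁻¹ᵁ V') (D : f'.Tan V') (W : f.Idx V) (a : f.Fun W.1) :
    (tanPull e h D).1.ev W a = isoFib e W.1 (D.1.ev (isoIdx e h W) (isoFun e W.1 a)) := rfl

lemma isoFun_mem (e : MorIso f f') (W : f.tgt.left.Opens) (a : f.Fun W) (ha : a ∈ f.ideal W) :
    isoFun e W a ∈ f'.ideal (e.right.inv.left ⁻¹ᵁ W) := by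
  have h₁ : f.sharp W a = 0 := ha
  change f'.sharp _ (isoFun e W a) = 0
  have h₂ : f'.sharp _ (isoFun e W a) =
      pull e.left.inv (f.hom.left ⁻¹ᵁ W) _ (iso_inv_preimage e W).le (f.sharp W a) :=
    pull_eq e.w_inv.symm a
  rw [h₂, h₁, map_zero]

/-- The normal field `φ^♯ ∘ ν ∘ (σ⁻¹)^♯`, for an isomorphism `(φ, σ)` of morphisms. -/
def norPullFun (e : MorIso f f') {V : f.src.left.Opens} {V' : f'.src.left.Opens}
    (h : V ≤ e.left.hom.left ⁻¹ᵁ V') (D : f'.Nor V') : f.Nor V :=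
  ⟨fun W =>
      { toFun := fun a =>
          isoFib e W.1 (D.1.ev (isoIdx e h W) ⟨isoFun e W.1 a.1, isoFun_mem e W.1 a.1 a.2⟩)
        map_add' := fun a b => by
          rw [← map_add, ← map_add]
          congr 2
          exact Subtype.ext (map_add (isoFun e W.1) _ _)
        map_smul' := fun a b => by
          have h₁ : (⟨isoFun e W.1 (a • b).1, isoFun_mem e W.1 _ (a • b).2⟩ :
              f'.ideal (isoIdx e h W).1) =
              isoFun e W.1 a • ⟨isoFun e W.1 b.1, isoFun_mem e W.1 b.1 b.2⟩ :=
            Subtype.ext (map_mul (isoFun e W.1) _ _)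
          rw [h₁, map_smulₛₗ, smul_eq_mul, map_mul, smul_eq_mul]
          congr 1
          exact isoFib_sharp e W.1 a }, by
    intro W W' hW a
    change isoFib e W'.1 (D.1.ev (isoIdx e h W') ⟨isoFun e W'.1 (res f.tgt hW a.1), _⟩) =
      res f.src (f.preimage_mono hW) (isoFib e W.1 (D.1.ev (isoIdx e h W)
        ⟨isoFun e W.1 a.1, isoFun_mem e W.1 a.1 a.2⟩))
    have hW' : (isoIdx e h W').1 ≤ (isoIdx e h W).1 := fun z hz => hW hz
    have h₁ : isoFun e W'.1 (res f.tgt hW a.1) = res f'.tgt hW' (isoFun e W.1 a.1) :=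
      pull_eq (by simp) a.1
    have h₂ := D.2 (isoIdx e h W) (isoIdx e h W') hW'
      ⟨isoFun e W.1 a.1, isoFun_mem e W.1 a.1 a.2⟩
    have h₃ : isoFib e W'.1 (res f'.src (f'.preimage_mono hW') (D.1.ev (isoIdx e h W)
          ⟨isoFun e W.1 a.1, isoFun_mem e W.1 a.1 a.2⟩)) =
        res f.src (f.preimage_mono hW) (isoFib e W.1 (D.1.ev (isoIdx e h W)
          ⟨isoFun e W.1 a.1, isoFun_mem e W.1 a.1 a.2⟩)) := pull_eq (by simp) _
    rw [← h₃, ← h₂]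
    congr 2
    exact Subtype.ext h₁⟩

lemma norPullFun_apply (e : MorIso f f') {V : f.src.left.Opens} {V' : f'.src.left.Opens}
    (h : V ≤ e.left.hom.left ⁻¹ᵁ V') (D : f'.Nor V') (W : f.Idx V) (a : f.ideal W.1) :
    (norPullFun e h D).1.ev W a = 
      isoFib e W.1 (D.1.ev (isoIdx e h W) ⟨isoFun e W.1 a.1, isoFun_mem e W.1 a.1 a.2⟩) := rfl

/-- The pull-back of normal fields along an isomorphism of morphisms. -/
def norPull (e : MorIso f f') {V : f.src.left.Opens} {V' : f'.src.left.Opens}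
    (h : V ≤ e.left.hom.left ⁻¹ᵁ V') :
    f'.Nor V' →ₛₗ[(pull e.left.hom V' V h : Γ(f'.src.left, V') →+* Γ(f.src.left, V))]
      f.Nor V where
  toFun := norPullFun e h
  map_add' D E := by
    apply Subtype.ext
    apply nor_ext
    intro W a
    exact map_add (isoFib e W.1) _ _
  map_smul' c D := by
    apply Subtype.ext
    apply nor_ext
    intro W a
    rw [norPullFun_apply, Submodule.coe_smul, nor_smul_apply, map_mul, iso_res_smul,
      Submodule.coe_smul, nor_smul_apply, norPullFun_apply]
    rfl

lemma norPull_apply (e : MorIso f f') {V : f.src.left.Opens} {V' : f'.src.left.Opens}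
    (h : V ≤ e.left.hom.left ⁻¹ᵁ V') (D : f'.Nor V') (W : f.Idx V) (a : f.ideal W.1) :
    (norPull e h D).1.ev W a =
      isoFib e W.1 (D.1.ev (isoIdx e h W) ⟨isoFun e W.1 a.1, isoFun_mem e W.1 a.1 a.2⟩) := rfl

end Pull

end Mor

namespace Mor

section PullLemmas

variable {f f' f'' : Mor}

lemma pull_congr {Z Y : Over SpecC} {f g : Z ⟶ Y} (hfg : f = g) {W : Y.left.Opens}
    {V : Z.left.Opens} (h : V ≤ f.left ⁻¹ᵁ W) (h' : V ≤ g.left ⁻¹ᵁ W) (x : Γ(Y.left, W)) :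
    pull f W V h x = pull g W V h' x := by
  subst hfg; rfl

lemma isoIdx_comp_le (e : MorIso f f') (e' : MorIso f' f'') (k : MorIso f f'')
    (hr : e'.right.inv ≫ e.right.inv = k.right.inv) (W : f.tgt.left.Opens) :
    k.right.inv.left ⁻¹ᵁ W ≤ e'.right.inv.left ⁻¹ᵁ (e.right.inv.left ⁻¹ᵁ W) := by
  rw [← hr]; exact le_rfl

lemma isoFun_comp (e : MorIso f f') (e' : MorIso f' f'') (k : MorIso f f'')
    (hr : e'.right.inv ≫ e.right.inv = k.right.inv) (W : f.tgt.left.Opens) (a : f.Fun W) :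
    isoFun k W a =
      res f''.tgt (isoIdx_comp_le e e' k hr W) (isoFun e' _ (isoFun e W a)) := by
  have h₁ : isoFun e' _ (isoFun e W a) =
      pull (e'.right.inv ≫ e.right.inv) W _ le_rfl a := pull_pull _ _ _ rfl _ _ _ _ _ _ _
  rw [h₁]
  exact (pull_pull _ _ _ (by rw [Category.id_comp, hr]) _ _ _ _ _ _ _).symm

lemma isoFib_comp (e : MorIso f f') (e' : MorIso f' f'') (k : MorIso f f'')
    (hl : e.left.hom ≫ e'.left.hom = k.left.hom)
    (hr : e'.right.inv ≫ e.right.inv = k.right.inv) (W : f.tgt.left.Opens)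
    (x : f''.Fib (e'.right.inv.left ⁻¹ᵁ (e.right.inv.left ⁻¹ᵁ W))) :
    isoFib k W (res f''.src (f''.preimage_mono (isoIdx_comp_le e e' k hr W)) x) =
      isoFib e W (isoFib e' _ x) :=
  pull_eq (by rw [hl, Category.comp_id]) x

lemma isoIdx_id_le (e : MorIso f f) (hr : e.right.inv = 𝟙 f.tgt) (W : f.tgt.left.Opens) :
    e.right.inv.left ⁻¹ᵁ W ≤ W := by
  rw [hr]; exact le_rfl

lemma isoFun_id (e : MorIso f f) (hr : e.right.inv = 𝟙 f.tgt) (W : f.tgt.left.Opens)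
    (a : f.Fun W) : isoFun e W a = res f.tgt (isoIdx_id_le e hr W) a :=
  pull_congr hr _ _ _

lemma isoFib_id (e : MorIso f f) (hl : e.left.hom = 𝟙 f.src) (hr : e.right.inv = 𝟙 f.tgt)
    (W : f.tgt.left.Opens) (x : f.Fib W) :
    isoFib e W (res f.src (f.preimage_mono (isoIdx_id_le e hr W)) x) = x := by
  have h₁ : e.left.hom ≫ 𝟙 f.src = 𝟙 f.src := by rw [hl, Category.comp_id]
  have h₂ : f.hom.left ⁻¹ᵁ W ≤ (𝟙 f.src : f.src ⟶ f.src).left ⁻¹ᵁ (f.hom.left ⁻¹ᵁ W) := le_rfl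
  have h₃ := pull_pull e.left.hom (𝟙 f.src) (𝟙 f.src) h₁ (f.hom.left ⁻¹ᵁ W) _ (f.hom.left ⁻¹ᵁ W)
    (f.preimage_mono (isoIdx_id_le e hr W)) (iso_fib_le e W) h₂ x
  rw [h₃, pull_id]

lemma tanPull_comp (e : MorIso f f') (e' : MorIso f' f'') (k : MorIso f f'')
    (hl : e.left.hom ≫ e'.left.hom = k.left.hom)
    (hr : e'.right.inv ≫ e.right.inv = k.right.inv)
    {V : f.src.left.Opens} {V' : f'.src.left.Opens} {V'' : f''.src.left.Opens}
    (h : V ≤ e.left.hom.left ⁻¹ᵁ V') (h' : V' ≤ e'.left.hom.left ⁻¹ᵁ V'')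
    (h'' : V ≤ k.left.hom.left ⁻¹ᵁ V'') (D : f''.Tan V'') :
    tanPull e h (tanPull e' h' D) = tanPull k h'' D := by
  apply Subtype.ext
  apply tan_ext
  intro W a
  rw [tanPull_apply, tanPull_apply, tanPull_apply, isoFun_comp e e' k hr W.1,
    D.2.2 (isoIdx e' h' (isoIdx e h W)) (isoIdx k h'' W) (isoIdx_comp_le e e' k hr W.1)]
  exact (isoFib_comp e e' k hl hr W.1 _).symm

lemma tanPull_id (e : MorIso f f) (hl : e.left.hom = 𝟙 f.src) (hr : e.right.inv = 𝟙 f.tgt)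
    {V : f.src.left.Opens} (h : V ≤ e.left.hom.left ⁻¹ᵁ V) (D : f.Tan V) :
    tanPull e h D = D := by
  apply Subtype.ext
  apply tan_ext
  intro W a
  rw [tanPull_apply, isoFun_id e hr, D.2.2 W (isoIdx e h W) (isoIdx_id_le e hr W.1)]
  exact isoFib_id e hl hr W.1 _

lemma norPull_comp (e : MorIso f f') (e' : MorIso f' f'') (k : MorIso f f'')
    (hl : e.left.hom ≫ e'.left.hom = k.left.hom)
    (hr : e'.right.inv ≫ e.right.inv = k.right.inv)
    {V : f.src.left.Opens} {V' : f'.src.left.Opens} {V'' : f''.src.left.Opens}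
    (h : V ≤ e.left.hom.left ⁻¹ᵁ V') (h' : V' ≤ e'.left.hom.left ⁻¹ᵁ V'')
    (h'' : V ≤ k.left.hom.left ⁻¹ᵁ V'') (D : f''.Nor V'') :
    norPull e h (norPull e' h' D) = norPull k h'' D := by
  apply Subtype.ext
  apply nor_ext
  intro W a
  rw [norPull_apply, norPull_apply, norPull_apply]
  have h₁ : (⟨isoFun k W.1 a.1, isoFun_mem k W.1 a.1 a.2⟩ : f''.ideal (isoIdx k h'' W).1) =
      ⟨res f''.tgt (isoIdx_comp_le e e' k hr W.1) (isoFun e' _ (isoFun e W.1 a.1)),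
        f''.res_mem_ideal _ (isoFun_mem e' _ _ (isoFun_mem e W.1 a.1 a.2))⟩ :=
    Subtype.ext (isoFun_comp e e' k hr W.1 a.1)
  rw [h₁, D.2 (isoIdx e' h' (isoIdx e h W)) (isoIdx k h'' W) (isoIdx_comp_le e e' k hr W.1)
    ⟨isoFun e' _ (isoFun e W.1 a.1), isoFun_mem e' _ _ (isoFun_mem e W.1 a.1 a.2)⟩]
  exact (isoFib_comp e e' k hl hr W.1 _).symm

lemma norPull_id (e : MorIso f f) (hl : e.left.hom = 𝟙 f.src) (hr : e.right.inv = 𝟙 f.tgt)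
    {V : f.src.left.Opens} (h : V ≤ e.left.hom.left ⁻¹ᵁ V) (D : f.Nor V) :
    norPull e h D = D := by
  apply Subtype.ext
  apply nor_ext
  intro W a
  rw [norPull_apply]
  have h₁ : (⟨isoFun e W.1 a.1, isoFun_mem e W.1 a.1 a.2⟩ : f.ideal (isoIdx e h W).1) =
      ⟨res f.tgt (isoIdx_id_le e hr W.1) a.1, f.res_mem_ideal _ a.2⟩ :=
    Subtype.ext (isoFun_id e hr W.1 a.1)
  rw [h₁, D.2 W (isoIdx e h W) (isoIdx_id_le e hr W.1) a]
  exact isoFib_id e hl hr W.1 _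

end PullLemmas

end Mor

/-! ### The sheaves -/

/-- Presheaves of complex vector spaces on a `ℂ`-scheme. -/
abbrev Psh (Y : Over SpecC) := Y.left.Opensᵒᵖ ⥤ ModuleCat.{0} ℂ

/-- Sheaves of complex vector spaces on a `ℂ`-scheme (for the Zariski topology). -/
abbrev Shv (Y : Over SpecC) := Sheaf (Opens.grothendieckTopology Y.left) (ModuleCat.{0} ℂ)

/-- The sheaf associated with a presheaf. -/
abbrev shf {Y : Over SpecC} (P : Psh Y) : Shv Y :=
  (presheafToSheaf (Opens.grothendieckTopology Y.left) (ModuleCat.{0} ℂ)).obj P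

/-- The section of the associated sheaf given by a section of a presheaf. -/
def toShf {Y : Over SpecC} (P : Psh Y) (V : Y.left.Opens) :
    P.obj (op V) →ₗ[ℂ] (shf P).obj.obj (op V) :=
  ((toSheafify (Opens.grothendieckTopology Y.left) P).app (op V)).hom

/-- Algebraic differential forms of degree `r`. -/
abbrev Form (r : ℕ) (A : Type) [CommRing A] [Algebra ℂ A] : Type := ⋀[A]^r Ω[A⁄ℂ]

/-- Pull-back of differential forms. -/
def formPull {Z Y : Over SpecC} (f : Z ⟶ Y) (r : ℕ) {W : Y.left.Opens} {V : Z.left.Opens}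
    (h : V ≤ f.left ⁻¹ᵁ W) :
    Form r Γ(Y.left, W) →ₛₗ[(pull f W V h : Γ(Y.left, W) →+* Γ(Z.left, V))] Form r Γ(Z.left, V) :=
  extMap (kaehlerMap (pull f W V h)) r

lemma formPull_comp {X Y Z : Over SpecC} (f : Z ⟶ Y) (g : Y ⟶ X) (k : Z ⟶ X) (hk : f ≫ g = k)
    (r : ℕ) {U : X.left.Opens} {V : Y.left.Opens} {W : Z.left.Opens}
    (h₁ : V ≤ g.left ⁻¹ᵁ U) (h₂ : W ≤ f.left ⁻¹ᵁ V) (h₃ : W ≤ k.left ⁻¹ᵁ U)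
    (x : Form r Γ(X.left, U)) : formPull f r h₂ (formPull g r h₁ x) = formPull k r h₃ x :=
  extMap_comp _ _ _ (fun a => pull_pull f g k hk U V W h₁ h₂ h₃ a)
    (fun m => kaehlerMap_comp _ _ _ (fun a => pull_pull f g k hk U V W h₁ h₂ h₃ a) m) r x

lemma formPull_id {Y : Over SpecC} (r : ℕ) {V : Y.left.Opens} (h : V ≤ (𝟙 Y : Y ⟶ Y).left ⁻¹ᵁ V)
    (x : Form r Γ(Y.left, V)) : formPull (𝟙 Y) r h x = x :=
  extMap_id _ (fun a => pull_id Y V h a)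
    (fun m => kaehlerMap_id _ (fun a => pull_id Y V h a) m) r x

/-- The presheaf `V ↦ ⋀ʳ Ω_{O(V)}`. -/
def formPsh (Y : Over SpecC) (r : ℕ) : Psh Y where
  obj V := asVect Γ(Y.left, V.unop) (Form r Γ(Y.left, V.unop))
  map {V V'} i := vectMap (pull (𝟙 Y) V.unop V'.unop (leOfHom i.unop))
    (formPull (𝟙 Y) r (leOfHom i.unop))
  map_id V := by
    ext x
    exact formPull_id r _ x
  map_comp {V V' V''} i j := by
    ext x
    exact (formPull_comp (𝟙 Y) (𝟙 Y) (𝟙 Y) (Category.comp_id _) r (leOfHom i.unop) (leOfHom j.unop)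
      (leOfHom (i ≫ j).unop) x).symm

/-- The sheaf `Ωʳ_Y` of differential forms of degree `r`. -/
abbrev formSheaf (Y : Over SpecC) (r : ℕ) : Shv Y := shf (formPsh Y r)

namespace Mor

/-- The identity of the source of `f`; its derivations are the vector fields on the source. -/
abbrev idSrc (f : Mor) : Mor := ⟨f.src, f.src, 𝟙 f.src⟩

/-- The isomorphism of sources. -/
abbrev idIso {f f' : Mor} (e : MorIso f f') : MorIso f.idSrc f'.idSrc :=
  ⟨e.left, e.left, by simp⟩

/-- The vector fields on the open subset `V` of the source. -/
abbrev Vec (f : Mor) (V : f.src.left.Opens) : Type := f.idSrc.Tan V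

/-- `⋀ᵇ T_Z ⊗ ⋀ᶜ N_f` on an open subset `V` of `Z`, for `f : Z ⟶ Y`. -/
abbrev Pol (f : Mor) (b c : ℕ) (V : f.src.left.Opens) : Type :=
  (⋀[Γ(f.src.left, V)]^b (f.Vec V)) ⊗[Γ(f.src.left, V)] (⋀[Γ(f.src.left, V)]^c (f.Nor V))

/-- Pull-back along an isomorphism of arrows. -/
def polPull {f f' : Mor} (e : MorIso f f') (b c : ℕ) {V : f.src.left.Opens} {V' : f'.src.left.Opens}
    (h : V ≤ e.left.hom.left ⁻¹ᵁ V') :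
    f'.Pol b c V' →ₛₗ[(pull e.left.hom V' V h : Γ(f'.src.left, V') →+* Γ(f.src.left, V))]
      f.Pol b c V :=
  polMap (tanPull (idIso e) h) (norPull e h) b c

lemma polPull_id {f : Mor} (e : MorIso f f) (hl : e.left.hom = 𝟙 f.src)
    (hr : e.right.inv = 𝟙 f.tgt) (b c : ℕ) {V : f.src.left.Opens}
    (h : V ≤ e.left.hom.left ⁻¹ᵁ V) (x : f.Pol b c V) : polPull e b c h x = x := by
  have hl' : (idIso e).right.inv = 𝟙 f.src := by
    have h₁ : e.left = Iso.refl _ := Iso.ext hl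
    exact congrArg Iso.inv h₁
  have hp : ∀ a, pull e.left.hom V V h a = a := fun a =>
    (pull_congr hl _ le_rfl _).trans (pull_id _ _ _ a)
  exact polMap_id _ _ hp (fun m => tanPull_id (idIso e) hl hl' h m)
    (fun m => norPull_id e hl hr h m) b c x

lemma polPull_comp {f f' f'' : Mor} (e : MorIso f f') (e' : MorIso f' f'') (k : MorIso f f'')
    (hl : e.left.hom ≫ e'.left.hom = k.left.hom)
    (hr : e'.right.inv ≫ e.right.inv = k.right.inv) (b c : ℕ)
    {V : f.src.left.Opens} {V' : f'.src.left.Opens} {V'' : f''.src.left.Opens}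
    (h : V ≤ e.left.hom.left ⁻¹ᵁ V') (h' : V' ≤ e'.left.hom.left ⁻¹ᵁ V'')
    (h'' : V ≤ k.left.hom.left ⁻¹ᵁ V'') (x : f''.Pol b c V'') :
    polPull e b c h (polPull e' b c h' x) = polPull k b c h'' x := by
  have hl' : (idIso e').right.inv ≫ (idIso e).right.inv = (idIso k).right.inv := by
    have h₁ : e.left ≪≫ e'.left = k.left := Iso.ext hl
    exact congrArg Iso.inv h₁
  have hp : ∀ a, pull e.left.hom V' V h (pull e'.left.hom V'' V' h' a) =
      pull k.left.hom V'' V h'' a := fun a => pull_pull _ _ _ hl _ _ _ _ _ _ a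
  exact polMap_comp _ _ _ _ _ _ hp
    (fun m => tanPull_comp (idIso e) (idIso e') (idIso k) hl hl' h h' h'' m)
    (fun m => norPull_comp e e' k hl hr h h' h'' m) b c x

/-- The presheaf `V ↦ ⋀ᵇ T(V) ⊗ ⋀ᶜ N(V)`. -/
def polPsh (f : Mor) (b c : ℕ) : Psh f.src where
  obj V := asVect Γ(f.src.left, V.unop) (f.Pol b c V.unop)
  map {V V'} i := vectMap (pull (𝟙 f.src) V.unop V'.unop (leOfHom i.unop))
    (polPull (MorIso.refl f) b c (leOfHom i.unop))
  map_id V := by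
    ext x
    exact polPull_id (MorIso.refl f) rfl rfl b c _ x
  map_comp {V V' V''} i j := by
    ext x
    exact (polPull_comp (MorIso.refl f) (MorIso.refl f) (MorIso.refl f) (Category.comp_id _)
      (Category.comp_id _) b c (V := V''.unop) (V' := V'.unop) (V'' := V.unop)
      (leOfHom j.unop) (leOfHom i.unop) (leOfHom (i ≫ j).unop) x).symm

/-- The sheaf `⋀ᵇ T_Z ⊗ ⋀ᶜ N_f`. When `f : Z ⟶ Y` is an immersion of smooth schemes of
codimension `c`, then `⋀ᶜ N_f` is the dualizing sheaf of `f`. -/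
abbrev polSheaf (f : Mor) (b c : ℕ) : Shv f.src := shf (f.polPsh b c)

end Mor

/-! ### Cohomology -/

/-- The constant sheaf with value `ℂ`. -/
abbrev cst (Y : Over SpecC) : Shv Y :=
  (constantSheaf (Opens.grothendieckTopology Y.left) (ModuleCat.{0} ℂ)).obj (ModuleCat.of ℂ ℂ)

/-- The cohomology `Hⁿ(Y, F) = Extⁿ(ℂ_Y, F)` of a sheaf of complex vector spaces. -/
abbrev Coh {Y : Over SpecC} (F : Shv Y) (n : ℕ) : Type := Abelian.Ext.{0} (cst Y) F n

/-- The map on cohomology induced by a morphism of sheaves. -/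
def cohMap {Y : Over SpecC} {F F' : Shv Y} (φ : F ⟶ F') (n : ℕ) : Coh F n →ₗ[ℂ] Coh F' n :=
  (Abelian.Ext.bilinearCompOfLinear ℂ (cst Y) F F' n 0 n (add_zero n)).flip (Abelian.Ext.mk₀ φ)

section Transport

variable {Z Z' : Over SpecC} (a : Z ≅ Z')

/-- The homeomorphism underlying an isomorphism of `ℂ`-schemes. -/
abbrev homeo : Scheme.forgetToTop.obj Z.left ≅ Scheme.forgetToTop.obj Z'.left :=
  Scheme.forgetToTop.mapIso ((Over.forget SpecC).mapIso a)

/-- The induced bijection `V' ↦ a⁻¹(V')` of open subsets. -/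
abbrev opensEquiv : Z'.left.Opens ≌ Z.left.Opens := Opens.mapMapIso (homeo a)

lemma opensEquiv_functor_obj (V : Z'.left.Opens) :
    (opensEquiv a).functor.obj V = a.hom.left ⁻¹ᵁ V := rfl

lemma opensEquiv_inverse_obj (V : Z.left.Opens) :
    (opensEquiv a).inverse.obj V = a.inv.left ⁻¹ᵁ V := rfl

lemma map_isCocontinuous {T T' : TopCat.{0}} (H : T ≅ T') :
    (Opens.map H.hom).IsCocontinuous (Opens.grothendieckTopology T')
      (Opens.grothendieckTopology T) where
  cover_lift := by
    intro U S hS x hx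
    have hx' : H.hom (H.inv x) = x := by simp
    obtain ⟨V, i, hi, hV⟩ := hS (H.inv x) (show H.hom (H.inv x) ∈ U by rwa [hx'])
    have hVV : (Opens.map H.hom).obj ((Opens.map H.inv).obj V) = V := by
      ext y; simp
    refine ⟨(Opens.map H.inv).obj V, homOfLE fun y hy => ?_, ?_, hV⟩
    · have h₁ : H.inv y ∈ (Opens.map H.hom).obj U := leOfHom i hy
      have h₂ : H.hom (H.inv y) = y := by simp
      change H.hom (H.inv y) ∈ U at h₁
      rwa [h₂] at h₁
    · exact S.downward_closed hi (eqToHom hVV)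

instance : (opensEquiv a).inverse.IsDenseSubsite (Opens.grothendieckTopology Z.left)
    (Opens.grothendieckTopology Z'.left) :=
  haveI : (opensEquiv a).functor.IsCocontinuous (Opens.grothendieckTopology Z'.left)
    (Opens.grothendieckTopology Z.left) := map_isCocontinuous (homeo a)
  haveI : (opensEquiv a).inverse.IsCocontinuous (Opens.grothendieckTopology Z.left)
    (Opens.grothendieckTopology Z'.left) := map_isCocontinuous (homeo a).symm
  (opensEquiv a).isDenseSubsite_inverse_of_isCocontinuous _ _

/-- The equivalence between sheaves on `Z'` and sheaves on `Z`; its functor is the pull-back along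
`a`, `F ↦ (V ↦ F(a(V)))`, and its inverse is the push-forward `F ↦ (V' ↦ F(a⁻¹(V')))`. -/
abbrev shvEquiv : Shv Z' ≌ Shv Z :=
  (opensEquiv a).sheafCongr (Opens.grothendieckTopology Z'.left)
    (Opens.grothendieckTopology Z.left) (ModuleCat.{0} ℂ)

instance : (shvEquiv a).functor.Additive where
  map_add := rfl

instance : (shvEquiv a).functor.Linear ℂ where
  map_smul _ _ := rfl

/-- The isomorphism from the constant sheaf to the pull-back of the constant sheaf. -/
def cstMap : cst Z ⟶ (shvEquiv a).functor.obj (cst Z') :=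
  ((sheafificationAdjunction (Opens.grothendieckTopology Z.left) (ModuleCat.{0} ℂ)).homEquiv
    ((Functor.const _).obj (ModuleCat.of ℂ ℂ)) _).symm
    (Functor.whiskerLeft (opensEquiv a).inverse.op
      (toSheafify (Opens.grothendieckTopology Z'.left)
        ((Functor.const _).obj (ModuleCat.of ℂ ℂ))))

/-- The map of sheaves `a^* (shf P') → shf P` given by maps `P'(V') → P(a⁻¹(V'))`. -/
def shfMap {P : Psh Z} {P' : Psh Z'} (τ : P' ⟶ (opensEquiv a).functor.op ⋙ P) :
    (shvEquiv a).functor.obj (shf P') ⟶ shf P :=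
  ((shvEquiv a).toAdjunction.homEquiv _ _).symm
    (((sheafificationAdjunction (Opens.grothendieckTopology Z'.left) (ModuleCat.{0} ℂ)).homEquiv
      P' _).symm
      (τ ≫ Functor.whiskerLeft (opensEquiv a).functor.op
        (toSheafify (Opens.grothendieckTopology Z.left) P)))

/-- The map on cohomology `Hⁿ(Z', shf P') → Hⁿ(Z, shf P)` given by an isomorphism
`a : Z ≅ Z'` and maps `P'(V') → P(a⁻¹(V'))`. -/
def cohPull {P : Psh Z} {P' : Psh Z'} (τ : P' ⟶ (opensEquiv a).functor.op ⋙ P) (n : ℕ) :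
    Coh (shf P') n →ₗ[ℂ] Coh (shf P) n :=
  cohMap (shfMap a τ) n ∘ₗ
    (Abelian.Ext.bilinearCompOfLinear ℂ _ _ _ 0 n n (zero_add n) (Abelian.Ext.mk₀ (cstMap a))) ∘ₗ
    (shvEquiv a).functor.mapExtLinearMap ℂ (cst Z') (shf P') n

end Transport

/-- Pull-back of differential forms, as a map of presheaves. -/
def formTrans {Z Z' : Over SpecC} (a : Z ≅ Z') (r : ℕ) :
    formPsh Z' r ⟶ (opensEquiv a).functor.op ⋙ formPsh Z r where
  app V' := vectMap (pull a.hom V'.unop (a.hom.left ⁻¹ᵁ V'.unop) le_rfl)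
    (formPull a.hom r le_rfl)
  naturality {V W} i := by
    ext x
    have hW : a.hom.left ⁻¹ᵁ W.unop ≤ a.hom.left ⁻¹ᵁ V.unop := fun z hz => leOfHom i.unop hz
    exact (formPull_comp a.hom (𝟙 Z') a.hom (Category.comp_id _) r (leOfHom i.unop) le_rfl
      hW x).trans (formPull_comp (𝟙 Z) a.hom a.hom (Category.id_comp _) r le_rfl hW hW x).symm

/-- Pull-back of polyvectors with values in the exterior powers of the normal sheaf, as a map of
presheaves. -/
def polTrans {f f' : Mor} (e : MorIso f f') (b c : ℕ) :
    f'.polPsh b c ⟶ (opensEquiv e.left).functor.op ⋙ f.polPsh b c where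
  app V' := vectMap (pull e.left.hom V'.unop (e.left.hom.left ⁻¹ᵁ V'.unop) le_rfl)
    (Mor.polPull e b c le_rfl)
  naturality {V W} i := by
    ext x
    have hW : e.left.hom.left ⁻¹ᵁ W.unop ≤ e.left.hom.left ⁻¹ᵁ V.unop :=
      fun z hz => leOfHom i.unop hz
    exact (Mor.polPull_comp e (MorIso.refl f') e (Category.comp_id _) (Category.id_comp _) b c
      (V'' := V.unop) le_rfl (leOfHom i.unop) hW x).trans
      (Mor.polPull_comp (MorIso.refl f) e e (Category.id_comp _) (Category.comp_id _) b c
      (V := e.left.hom.left ⁻¹ᵁ W.unop) (V' := e.left.hom.left ⁻¹ᵁ V.unop) (V'' := V.unop)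
        hW le_rfl hW x).symm

/-! ### Ages -/

section Age

variable {V V' : Type} [AddCommGroup V] [Module ℂ V] [AddCommGroup V'] [Module ℂ V']

/-- The sum `∑ rⱼ`, where `exp (2πi rⱼ)`, `0 ≤ rⱼ < 1`, are the eigenvalues of an automorphism of
finite order of a finite-dimensional complex vector space, listed with multiplicities. -/
def ageOf (T : Module.End ℂ V) : ℝ :=
  ∑ᶠ z : ℂ, Module.finrank ℂ (T.maxGenEigenspace z) * Int.fract (Complex.arg z / (2 * Real.pi))

lemma ageOf_eq (T : Module.End ℂ V) (T' : Module.End ℂ V') (e : V ≃ₗ[ℂ] V')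
    (h : ∀ v, T' (e v) = e (T v)) : ageOf T = ageOf T' := by
  have h₁ : ∀ z : ℂ, (T.maxGenEigenspace z).map (e : V →ₗ[ℂ] V') = T'.maxGenEigenspace z := by
    intro z
    have h₂ : ∀ (k : ℕ) (v : V), ((T' - z • 1) ^ k) (e v) = e (((T - z • 1) ^ k) v) := by
      intro k
      induction k with
      | zero => intro v; simp
      | succ k ih =>
        intro v
        rw [pow_succ, pow_succ, Module.End.mul_apply, Module.End.mul_apply, ← ih]
        congr 1
        simp [h]
    ext w
    rw [Module.End.mem_maxGenEigenspace, Submodule.mem_map]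
    constructor
    · rintro ⟨v, hv, rfl⟩
      obtain ⟨k, hk⟩ := (Module.End.mem_maxGenEigenspace _ _ _).1 hv
      exact ⟨k, by rw [LinearEquiv.coe_coe, h₂, hk, map_zero]⟩
    · rintro ⟨k, hk⟩
      refine ⟨e.symm w, (Module.End.mem_maxGenEigenspace _ _ _).2 ⟨k, ?_⟩, by simp⟩
      apply e.injective
      rw [← h₂, LinearEquiv.apply_symm_apply, hk, map_zero]
  unfold ageOf
  congr 1
  funext z
  rw [← h₁ z, LinearEquiv.finrank_map_eq]

end Age

/-- The complex scheme `Spec ℂ`. -/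
abbrev pt : Over SpecC := Over.mk (𝟙 SpecC)

/-- A complex point of `X`, as a morphism. -/
abbrev ptMor {X : Over SpecC} (x : pt ⟶ X) : Mor := ⟨pt, X, x⟩

/-- The tangent space of `X` at the complex point `x`: the derivations `O_X → x_* ℂ`. -/
abbrev TangentSp {X : Over SpecC} (x : pt ⟶ X) : ModuleCat.{0} ℂ :=
  asVect Γ(pt.left, ⊤) ((ptMor x).Tan ⊤)

/-- The isomorphism `(𝟙, σ)` from the point `x` to the point `σ(x)`. -/
abbrev ptIso {X X' : Over SpecC} (σ : X ≅ X') (x : pt ⟶ X) (x' : pt ⟶ X') (h : x ≫ σ.hom = x') :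
    MorIso (ptMor x) (ptMor x') :=
  ⟨Iso.refl _, σ, (Category.id_comp _).trans h.symm⟩

/-- The differential `D ↦ D ∘ σ^♯` of an isomorphism `σ : X ≅ X'` at a point `x` with
image `x'`. -/
def differential {X X' : Over SpecC} (σ : X ≅ X') (x : pt ⟶ X) (x' : pt ⟶ X')
    (h : x ≫ σ.hom = x') : TangentSp x ⟶ TangentSp x' :=
  vectMap _ (Mor.tanPull (ptIso σ x x' h).symm (V := ⊤) (V' := ⊤) (fun _ _ => trivial))

lemma differential_comp {X X' X'' : Over SpecC} (σ : X ≅ X') (τ : X' ≅ X'') (k : X ≅ X'')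
    (hk : σ.hom ≫ τ.hom = k.hom) (x : pt ⟶ X) (x' : pt ⟶ X') (x'' : pt ⟶ X'')
    (h : x ≫ σ.hom = x') (h' : x' ≫ τ.hom = x'') (h'' : x ≫ k.hom = x'') (v : TangentSp x) :
    differential τ x' x'' h' (differential σ x x' h v) = differential k x x'' h'' v :=
  Mor.tanPull_comp (ptIso τ x' x'' h').symm (ptIso σ x x' h).symm (ptIso k x x'' h'').symm
    (Category.comp_id _) hk _ _ _ v

lemma differential_id {X : Over SpecC} (k : X ≅ X) (hk : k.hom = 𝟙 X) (x : pt ⟶ X)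
    (h : x ≫ k.hom = x) (v : TangentSp x) : differential k x x h v = v :=
  Mor.tanPull_id (ptIso k x x h).symm rfl hk _ v

/-- The differential at a point, as a linear isomorphism. -/
def differentialEquiv {X X' : Over SpecC} (σ : X ≅ X') (x : pt ⟶ X) (x' : pt ⟶ X')
    (h : x ≫ σ.hom = x') : TangentSp x ≃ₗ[ℂ] TangentSp x' :=
  have h' : x' ≫ σ.symm.hom = x := by rw [← h]; simp
  LinearEquiv.ofLinearMap (differential σ x x' h).hom (differential σ.symm x' x h').hom
    (LinearMap.ext fun v =>
      (differential_comp σ.symm σ (Iso.refl _) σ.inv_hom_id x' x x' h' h (Category.comp_id _)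
        v).trans (differential_id (Iso.refl _) rfl _ _ v))
    (LinearMap.ext fun v =>
      (differential_comp σ σ.symm (Iso.refl _) σ.hom_inv_id x x' x h h' (Category.comp_id _)
        v).trans (differential_id (Iso.refl _) rfl _ _ v))

/-! ### Open subschemes -/

section Opens

/-- An open subscheme. -/
abbrev opn (Y : Over SpecC) (U : Y.left.Opens) : Over SpecC := Over.mk (U.ι ≫ Y.hom)

/-- The inclusion of an open subscheme. -/
abbrev opnι (Y : Over SpecC) (U : Y.left.Opens) : opn Y U ⟶ Y := Over.homMk U.ι

instance {Y Y' : Over SpecC} (b : Y ≅ Y') : IsIso b.hom.left :=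
  inferInstanceAs (IsIso ((Over.forget SpecC).map b.hom))

lemma range_opn {Y Y' : Over SpecC} (b : Y ≅ Y') (U : Y.left.Opens) (U' : Y'.left.Opens)
    (h : b.hom.left ⁻¹ᵁ U' = U) : Set.range (U.ι ≫ b.hom.left) = Set.range U'.ι := by
  subst h
  ext y
  have h₀ : y ∈ Set.range U'.ι ↔ y ∈ U' := by
    rw [Scheme.Opens.range_ι]; rfl
  rw [h₀]
  constructor
  · rintro ⟨⟨z, hz⟩, rfl⟩
    exact hz
  · intro hy
    have h₁ : b.hom.left (b.inv.left y) = y :=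
      congrArg (fun k : Y' ⟶ Y' => k.left y) b.inv_hom_id
    refine ⟨⟨b.inv.left y, ?_⟩, h₁⟩
    change b.hom.left (b.inv.left y) ∈ U'
    rwa [h₁]

/-- The restriction of an isomorphism `b : Y ≅ Y'` to open subschemes `b⁻¹(U') ≅ U'`. -/
def opnIso {Y Y' : Over SpecC} (b : Y ≅ Y') (U : Y.left.Opens) (U' : Y'.left.Opens)
    (h : b.hom.left ⁻¹ᵁ U' = U) : opn Y U ≅ opn Y' U' :=
  Over.isoMk (IsOpenImmersion.isoOfRangeEq (U.ι ≫ b.hom.left) U'.ι (range_opn b U U' h)) (by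
    change _ ≫ U'.ι ≫ Y'.hom = U.ι ≫ Y.hom
    rw [IsOpenImmersion.isoOfRangeEq_hom_fac_assoc, Category.assoc, Over.w])

lemma opnIso_w {Y Y' : Over SpecC} (b : Y ≅ Y') (U : Y.left.Opens) (U' : Y'.left.Opens)
    (h : b.hom.left ⁻¹ᵁ U' = U) : (opnIso b U U' h).hom ≫ opnι Y' U' = opnι Y U ≫ b.hom := by
  ext1
  exact IsOpenImmersion.isoOfRangeEq_hom_fac (U.ι ≫ b.hom.left) U'.ι (range_opn b U U' h)

end Opens

/-! ### Fixed loci, ages and sectors -/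

section Orbifold

variable {X : Over SpecC} {G : Type} [Group G] (ρ : G →* Aut X)

/-- The fixed locus `X^g`. -/
abbrev fixedLocus (g : G) : Over SpecC := equalizer (ρ g).hom (𝟙 X)

/-- The inclusion of the fixed locus. -/
abbrev fixedι (g : G) : fixedLocus ρ g ⟶ X := equalizer.ι (ρ g).hom (𝟙 X)

lemma fixedι_w (g : G) : fixedι ρ g ≫ (ρ g).hom = fixedι ρ g :=
  (equalizer.condition _ _).trans (Category.comp_id _)

lemma rho_hom_comp (g h k : G) (hk : h * g = k) : (ρ g).hom ≫ (ρ h).hom = (ρ k).hom := by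
  subst hk
  rw [map_mul]; rfl

lemma rho_hom_one : (ρ 1).hom = 𝟙 X := by
  rw [map_one]; rfl

/-- The map `X^g → X^{g'}` given by `h`, if `g' = h g h⁻¹`. -/
def fixedMap (h g g' : G) (hg : h * g = g' * h) : fixedLocus ρ g ⟶ fixedLocus ρ g' :=
  equalizer.lift (fixedι ρ g ≫ (ρ h).hom) (by
    rw [Category.assoc, rho_hom_comp ρ h g' _ rfl, ← hg, ← rho_hom_comp ρ g h _ rfl,
      ← Category.assoc, fixedι_w, Category.comp_id])

lemma fixedMap_ι (h g g' : G) (hg : h * g = g' * h) :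
    fixedMap ρ h g g' hg ≫ fixedι ρ g' = fixedι ρ g ≫ (ρ h).hom := equalizer.lift_ι _ _

/-- The isomorphism `X^g ≅ X^{g'}` given by `h`, if `g' = h g h⁻¹`. -/
def fixedIso (h g g' : G) (hg : h * g = g' * h) : fixedLocus ρ g ≅ fixedLocus ρ g' where
  hom := fixedMap ρ h g g' hg
  inv := fixedMap ρ h⁻¹ g' g (by rw [inv_mul_eq_iff_eq_mul, ← mul_assoc, hg]; simp)
  hom_inv_id := by
    apply equalizer.hom_ext
    rw [Category.assoc, fixedMap_ι, ← Category.assoc, fixedMap_ι, Category.assoc,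
      rho_hom_comp ρ h h⁻¹ 1 (by simp), rho_hom_one, Category.id_comp, Category.comp_id]
  inv_hom_id := by
    apply equalizer.hom_ext
    rw [Category.assoc, fixedMap_ι, ← Category.assoc, fixedMap_ι, Category.assoc,
      rho_hom_comp ρ h⁻¹ h 1 (by simp), rho_hom_one, Category.id_comp, Category.comp_id]

lemma fixed_pt (g : G) (s : pt ⟶ fixedLocus ρ g) :
    (s ≫ fixedι ρ g) ≫ (ρ g).hom = s ≫ fixedι ρ g := by
  rw [Category.assoc, fixedι_w]

/-- The age of `g` at a complex point `s` of `X^g`: the sum of the `rⱼ`, where the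
`exp (2πi rⱼ)`, `0 ≤ rⱼ < 1`, are the eigenvalues of the differential of `g` on the tangent space
of `X` at `s`. -/
def age (g : G) (s : pt ⟶ fixedLocus ρ g) : ℝ :=
  ageOf (differential (ρ g) (s ≫ fixedι ρ g) (s ≫ fixedι ρ g) (fixed_pt ρ g s)).hom

lemma age_conj (h g g' : G) (hg : h * g = g' * h) (s : pt ⟶ fixedLocus ρ g) :
    age ρ g' (s ≫ fixedMap ρ h g g' hg) = age ρ g s := by
  have h₁ : (s ≫ fixedι ρ g) ≫ (ρ h).hom = (s ≫ fixedMap ρ h g g' hg) ≫ fixedι ρ g' := by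
    rw [Category.assoc, Category.assoc, fixedMap_ι]
  symm
  refine ageOf_eq _ _ (differentialEquiv (ρ h) _ _ h₁) fun v => ?_
  have h₂ : (s ≫ fixedι ρ g) ≫ (ρ (h * g)).hom =
      (s ≫ fixedMap ρ h g g' hg) ≫ fixedι ρ g' := by
    rw [← rho_hom_comp ρ g h _ rfl, ← Category.assoc, fixed_pt, h₁]
  exact (differential_comp (ρ h) (ρ g') (ρ (h * g)) (by rw [rho_hom_comp ρ h g' _ rfl, hg])
    _ _ _ h₁ (fixed_pt ρ g' _) h₂ v).trans
    (differential_comp (ρ g) (ρ h) (ρ (h * g)) (rho_hom_comp ρ g h _ rfl)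
    _ _ _ (fixed_pt ρ g s) h₁ h₂ v).symm

/-- The union of the connected components of `X^g` of codimension `c` in `X` on which `g` has the
age `r`, if `X` is smooth of dimension `n`: the largest open subset of `X^g` that is smooth of
dimension `n - c` and at all of whose complex points the age of `g` is `r`. -/
def stratum (n : ℕ) (g : G) (r : ℝ) (c : ℕ) : (fixedLocus ρ g).left.Opens :=
  sSup {V | (∃ d : ℕ, d + c = n ∧ SmoothOfRelativeDimension d (opn (fixedLocus ρ g) V).hom) ∧
    ∀ s : pt ⟶ fixedLocus ρ g, ⊤ ≤ s.left ⁻¹ᵁ V → age ρ g s = r}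

lemma stratum_le (n : ℕ) (h g g' : G) (hg : h * g = g' * h) (r : ℝ) (c : ℕ) :
    (fixedIso ρ h g g' hg).hom.left ⁻¹ᵁ (stratum ρ n g' r c) ≤ stratum ρ n g r c := by
  intro x hx
  obtain ⟨V, ⟨⟨d, hd, hs⟩, ha⟩, hxV⟩ := Opens.mem_sSup.1 hx
  refine Opens.mem_sSup.2 ⟨(fixedIso ρ h g g' hg).hom.left ⁻¹ᵁ V, ⟨⟨d, hd, ?_⟩, ?_⟩, hxV⟩
  · have h₁ := Over.w (opnIso (fixedIso ρ h g g' hg) _ V rfl).hom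
    rw [← h₁, ← zero_add d]
    infer_instance
  · intro s hs'
    rw [← age_conj ρ h g g' hg s]
    exact ha _ fun y hy => hs' hy

lemma stratum_eq (n : ℕ) (h g g' : G) (hg : h * g = g' * h) (r : ℝ) (c : ℕ) :
    (fixedIso ρ h g g' hg).hom.left ⁻¹ᵁ (stratum ρ n g' r c) = stratum ρ n g r c := by
  refine le_antisymm (stratum_le ρ n h g g' hg r c) fun x hx => ?_
  have hg' : h⁻¹ * g' = g * h⁻¹ := by
    rw [inv_mul_eq_iff_eq_mul, ← mul_assoc, hg]; simp
  apply stratum_le ρ n h⁻¹ g' g hg' r c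
  have h₁ : (fixedIso ρ h⁻¹ g' g hg').hom.left ((fixedIso ρ h g g' hg).hom.left x) = x :=
    congrArg (fun k : fixedLocus ρ g ⟶ fixedLocus ρ g => k.left x)
      (fixedIso ρ h g g' hg).hom_inv_id
  change (fixedIso ρ h⁻¹ g' g hg').hom.left ((fixedIso ρ h g g' hg).hom.left x) ∈
    stratum ρ n g r c
  rw [h₁]
  exact hx

/-- The index `(g, r, c)` of the part of `X^g` of age `r` and codimension `c`. -/
structure Sector (G : Type) where
  /-- The group element. -/
  elt : G
  /-- The age. -/
  age : ℝ
  /-- The codimension. -/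
  codim : ℕ

/-- The action of `h` on the indices, `(g, r, c) ↦ (h g h⁻¹, r, c)`. -/
abbrev Sector.conj (h : G) (s : Sector G) : Sector G := ⟨h * s.elt * h⁻¹, s.age, s.codim⟩

/-- The inclusion into `X` of the part of `X^g` of age `r` and codimension `c`. -/
abbrev strMor (n : ℕ) (g : G) (r : ℝ) (c : ℕ) : Mor :=
  ⟨opn (fixedLocus ρ g) (stratum ρ n g r c), X, opnι _ _ ≫ fixedι ρ g⟩

/-- The isomorphism of the parts of age `r` and codimension `c` of `X^g` and `X^{g'}` that is
given by `h`, if `g' = h g h⁻¹`. -/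
def strIso (n : ℕ) (h g g' : G) (hg : h * g = g' * h) (r : ℝ) (c : ℕ) :
    MorIso (strMor ρ n g r c) (strMor ρ n g' r c) where
  left := opnIso (fixedIso ρ h g g' hg) _ _ (stratum_eq ρ n h g g' hg r c)
  right := ρ h
  w := by
    change _ ≫ opnι _ _ ≫ fixedι ρ _ = (opnι _ _ ≫ fixedι ρ g) ≫ (ρ h).hom
    rw [← Category.assoc, opnIso_w, Category.assoc, Category.assoc]
    congr 1
    exact fixedMap_ι ρ h g g' hg

/-- The inclusion into `X` of the part of a fixed locus with a given index. -/
abbrev secMor (n : ℕ) (s : Sector G) : Mor := strMor ρ n s.elt s.age s.codim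

/-- The isomorphism from the part of `X^g` of age `r` and codimension `c` to the corresponding
part of the fixed locus of `h g h⁻¹` that is given by `h`. -/
abbrev secIso (n : ℕ) (h : G) (s : Sector G) : MorIso (secMor ρ n s) (secMor ρ n (s.conj h)) :=
  strIso ρ n h s.elt (h * s.elt * h⁻¹) (by simp) s.age s.codim

/-! ### Orbifold Hochschild homology and cohomology -/

/-- The group `H^a(Z, ⋀ᵇ T_Z ⊗ ω_g)`, for the part `Z` of `X^g` of age `r` and codimension `c`. -/
def HTSum (n : ℕ) (g : G) (r : ℝ) (c b a : ℕ) : Type := Coh ((strMor ρ n g r c).polSheaf b c) a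

instance (n : ℕ) (g : G) (r : ℝ) (c b a : ℕ) : AddCommGroup (HTSum ρ n g r c b a) :=
  inferInstanceAs (AddCommGroup (Coh ((strMor ρ n g r c).polSheaf b c) a))

instance (n : ℕ) (g : G) (r : ℝ) (c b a : ℕ) : Module ℂ (HTSum ρ n g r c b a) :=
  inferInstanceAs (Module ℂ (Coh ((strMor ρ n g r c).polSheaf b c) a))

/-- Pull-back along the inverse of the isomorphism of parts of `X^g` and `X^{g'}` given by `h`,
if `g' = h g h⁻¹`. -/
def HTSum.map (n : ℕ) (h g g' : G) (hg : h * g = g' * h) (r : ℝ) (c b a : ℕ) :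
    HTSum ρ n g r c b a →ₗ[ℂ] HTSum ρ n g' r c b a :=
  cohPull (strIso ρ n h g g' hg r c).symm.left (polTrans (strIso ρ n h g g' hg r c).symm b c) a

/-- The group `H^a(Z, Ωᵇ_Z)`, for the part `Z` of `X^g` of age `r` and codimension `c`. -/
def HΩSum (n : ℕ) (g : G) (r : ℝ) (c b a : ℕ) : Type := Coh (formSheaf (strMor ρ n g r c).src b) a

instance (n : ℕ) (g : G) (r : ℝ) (c b a : ℕ) : AddCommGroup (HΩSum ρ n g r c b a) :=
  inferInstanceAs (AddCommGroup (Coh (formSheaf (strMor ρ n g r c).src b) a))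

instance (n : ℕ) (g : G) (r : ℝ) (c b a : ℕ) : Module ℂ (HΩSum ρ n g r c b a) :=
  inferInstanceAs (Module ℂ (Coh (formSheaf (strMor ρ n g r c).src b) a))

/-- Pull-back along the inverse of the isomorphism of parts of `X^g` and `X^{g'}` given by `h`,
if `g' = h g h⁻¹`. -/
def HΩSum.map (n : ℕ) (h g g' : G) (hg : h * g = g' * h) (r : ℝ) (c b a : ℕ) :
    HΩSum ρ n g r c b a →ₗ[ℂ] HΩSum ρ n g' r c b a :=
  cohPull (strIso ρ n h g g' hg r c).symm.left (formTrans (strIso ρ n h g g' hg r c).symm.left b) a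

/-- The summands of `HT^{q,p}`: the groups `H^a(X^g, ⋀ᵇ T ⊗ ω_g)` with `a = p - r` and
`b = q + r - c`, for the part of `X^g` of age `r` and codimension `c`. -/
structure HTIndex (G : Type) (q p : ℤ) where
  /-- The part of a fixed locus. -/
  sec : Sector G
  /-- The cohomological degree. -/
  a : ℕ
  /-- The degree of the polyvector fields. -/
  b : ℕ
  ha : (a : ℝ) = p - sec.age
  hb : (b : ℝ) = q + sec.age - sec.codim

/-- The summands of `HΩ^{q,p}`: the groups `H^a(X^g, Ωᵇ)` with `a = p - r` and `b = q - r`, for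
the part of `X^g` of age `r`. -/
structure HΩIndex (G : Type) (q p : ℤ) where
  /-- The part of a fixed locus. -/
  sec : Sector G
  /-- The cohomological degree. -/
  a : ℕ
  /-- The degree of the differential forms. -/
  b : ℕ
  ha : (a : ℝ) = p - sec.age
  hb : (b : ℝ) = q - sec.age

/-- The conjugation action on the summands. -/
abbrev HTIndex.conj {q p : ℤ} (h : G) (i : HTIndex G q p) : HTIndex G q p :=
  ⟨i.sec.conj h, i.a, i.b, i.ha, i.hb⟩

/-- The conjugation action on the summands. -/
abbrev HΩIndex.conj {q p : ℤ} (h : G) (i : HΩIndex G q p) : HΩIndex G q p :=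
  ⟨i.sec.conj h, i.a, i.b, i.ha, i.hb⟩

/-- The summand of `HT^{q,p}` with a given index. -/
abbrev HT.Summand (n : ℕ) {q p : ℤ} (i : HTIndex G q p) : Type :=
  HTSum ρ n i.sec.elt i.sec.age i.sec.codim i.b i.a

/-- `HT^{q,p}(X; G) = ⨁_g H^{p - ι(g)}(X^g, ⋀^{q + ι(g) - c_g} T_{X^g} ⊗ ω_g)`. -/
abbrev HT (n : ℕ) (q p : ℤ) : Type := ⨁ i : HTIndex G q p, HT.Summand ρ n i

open Classical in
/-- The inclusion of a summand. -/
def HT.of (n : ℕ) {q p : ℤ} (i : HTIndex G q p) : HT.Summand ρ n i →ₗ[ℂ] HT ρ n q p :=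
  DirectSum.lof ℂ (HTIndex G q p) (HT.Summand ρ n) i

/-- Pull-back along the inverse of the isomorphism `X^g ≅ X^{h g h⁻¹}` given by `h`. -/
def HT.actSummand (n : ℕ) {q p : ℤ} (h : G) (i : HTIndex G q p) :
    HT.Summand ρ n i →ₗ[ℂ] HT.Summand ρ n (i.conj h) :=
  HTSum.map ρ n h i.sec.elt (h * i.sec.elt * h⁻¹) (by simp) i.sec.age i.sec.codim i.b i.a

open Classical in
/-- The action of `h : G`, which maps the summands of `g` to those of `h g h⁻¹`. -/
def HT.act (n : ℕ) (q p : ℤ) (h : G) : HT ρ n q p →ₗ[ℂ] HT ρ n q p :=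
  DirectSum.toModule ℂ (HTIndex G q p) (HT ρ n q p) fun i =>
    HT.of ρ n (i.conj h) ∘ₗ HT.actSummand ρ n h i

/-- The summand of `HΩ^{q,p}` with a given index. -/
abbrev HΩ.Summand (n : ℕ) {q p : ℤ} (i : HΩIndex G q p) : Type :=
  HΩSum ρ n i.sec.elt i.sec.age i.sec.codim i.b i.a

/-- `HΩ^{q,p}(X; G) = ⨁_g H^{p - ι(g)}(X^g, Ω^{q - ι(g)}_{X^g})`. -/
abbrev HΩ (n : ℕ) (q p : ℤ) : Type := ⨁ i : HΩIndex G q p, HΩ.Summand ρ n i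

open Classical in
/-- The inclusion of a summand. -/
def HΩ.of (n : ℕ) {q p : ℤ} (i : HΩIndex G q p) : HΩ.Summand ρ n i →ₗ[ℂ] HΩ ρ n q p :=
  DirectSum.lof ℂ (HΩIndex G q p) (HΩ.Summand ρ n) i

/-- Pull-back along the inverse of the isomorphism `X^g ≅ X^{h g h⁻¹}` given by `h`. -/
def HΩ.actSummand (n : ℕ) {q p : ℤ} (h : G) (i : HΩIndex G q p) :
    HΩ.Summand ρ n i →ₗ[ℂ] HΩ.Summand ρ n (i.conj h) :=
  HΩSum.map ρ n h i.sec.elt (h * i.sec.elt * h⁻¹) (by simp) i.sec.age i.sec.codim i.b i.a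

open Classical in
/-- The action of `h : G`, which maps the summands of `g` to those of `h g h⁻¹`. -/
def HΩ.act (n : ℕ) (q p : ℤ) (h : G) : HΩ ρ n q p →ₗ[ℂ] HΩ ρ n q p :=
  DirectSum.toModule ℂ (HΩIndex G q p) (HΩ ρ n q p) fun i =>
    HΩ.of ρ n (i.conj h) ∘ₗ HΩ.actSummand ρ n h i

/-- The vectors that are fixed by a family of endomorphisms. -/
def invariants {V : Type} [AddCommGroup V] [Module ℂ V] (T : G → V →ₗ[ℂ] V) : Submodule ℂ V :=
  ⨅ h, LinearMap.eqLocus (T h) LinearMap.id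

/-- `HT^{q,p}([X/G])`, the `G`-invariant part of `HT^{q,p}(X; G)`. -/
abbrev HTOrb (n : ℕ) (q p : ℤ) : Submodule ℂ (HT ρ n q p) := invariants (HT.act ρ n q p)

/-- `HΩ^{q,p}([X/G])`, the `G`-invariant part of `HΩ^{q,p}(X; G)`. -/
abbrev HΩOrb (n : ℕ) (q p : ℤ) : Submodule ℂ (HΩ ρ n q p) := invariants (HΩ.act ρ n q p)

/-- The orbifold `[X/G]` is Calabi–Yau of dimension `n`: `X` is smooth and proper of dimension `n`
and has a nowhere vanishing `G`-invariant form `ω` of degree `n`, given by its restrictions to the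
affine open subsets. -/
structure IsCalabiYau (n : ℕ) : Prop where
  proper : IsProper X.hom
  smooth : SmoothOfRelativeDimension n X.hom
  exists_form : ∃ ω : ∀ U : X.left.affineOpens, Form n Γ(X.left, U.1),
    (∀ (U V : X.left.affineOpens) (hV : V.1 ≤ U.1), formPull (𝟙 X) n hV (ω U) = ω V) ∧
    (∀ U : X.left.affineOpens, Function.Bijective fun f : Γ(X.left, U.1) => f • ω U) ∧
    ∀ (g : G) (U V : X.left.affineOpens) (hV : V.1 ≤ (ρ g).hom.left ⁻¹ᵁ U.1),
      formPull (ρ g).hom n hV (ω U) = ω V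

/-- A `G`-equivariant isomorphism `ω_g ≅ ω_{X^g}`, for all `g`, between the dualizing sheaf
`ω_g = ⋀ᶜ N` of the inclusion of `X^g` into `X` and the sheaf of forms of top degree `n - c` on
`X^g`: a family of linear isomorphisms on the affine open subsets. -/
structure DualizingIso (n : ℕ) where
  /-- The isomorphism on an affine open subset. -/
  iso (s : Sector G) (V : (secMor ρ n s).src.left.affineOpens) :
    (⋀[Γ((secMor ρ n s).src.left, V.1)]^s.codim ((secMor ρ n s).Nor V.1))
      ≃ₗ[Γ((secMor ρ n s).src.left, V.1)] Form (n - s.codim) Γ((secMor ρ n s).src.left, V.1)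
  iso_res (s : Sector G) (V V' : (secMor ρ n s).src.left.affineOpens) (hV : V'.1 ≤ V.1)
    (ν : ⋀[Γ((secMor ρ n s).src.left, V.1)]^s.codim ((secMor ρ n s).Nor V.1)) :
    formPull (𝟙 _) (n - s.codim) hV (iso s V ν) =
      iso s V' (extMap (Mor.norPull (MorIso.refl (secMor ρ n s)) hV) s.codim ν)
  iso_equivariant (h : G) (s : Sector G) (V : (secMor ρ n s).src.left.affineOpens)
    (V' : (secMor ρ n (s.conj h)).src.left.affineOpens)
    (hV : V.1 ≤ (secIso ρ n h s).left.hom.left ⁻¹ᵁ V'.1)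
    (ν : ⋀[Γ((secMor ρ n (s.conj h)).src.left, V'.1)]^s.codim ((secMor ρ n (s.conj h)).Nor V'.1)) :
    formPull (secIso ρ n h s).left.hom (n - s.codim) hV (iso (s.conj h) V' ν) =
      iso s V (extMap (Mor.norPull (secIso ρ n h s) hV) s.codim ν)

end Orbifold

/-- The derivation of `O(V)` given by a vector field on `V`. -/
def vecDer (f : Mor) (V : f.src.left.Opens) (D : f.Vec V) :
    Derivation ℂ Γ(f.src.left, V) Γ(f.src.left, V) :=
  Derivation.mk' ((pull (𝟙 f.src) ((𝟙 f.src : f.src ⟶ f.src).left ⁻¹ᵁ V) V le_rfl).toLinearMap ∘ₗ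
    D.1.ev ⟨V, le_rfl⟩) fun x y => by
      have h₀ : ∀ z, pull (𝟙 f.src) ((𝟙 f.src : f.src ⟶ f.src).left ⁻¹ᵁ V) V le_rfl
          (f.idSrc.sharp V z) = z := fun z =>
        (pull_pull _ _ (𝟙 f.src) (Category.comp_id _) _ _ _ _ _ le_rfl z).trans (pull_id _ _ _ z)
      change pull (𝟙 f.src) ((𝟙 f.src : f.src ⟶ f.src).left ⁻¹ᵁ V) V le_rfl
        (D.1.ev ⟨V, le_rfl⟩ (x * y)) = _
      rw [D.2.1 ⟨V, le_rfl⟩ x y, map_add, map_mul, map_mul]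
      exact congrArg₂ _ (congrArg₂ _ (h₀ x) rfl) (congrArg₂ _ (h₀ y) rfl)

/-- The pairing of vector fields with differential forms of degree one, `⟨D, da⟩ = D(a)`. -/
def vecDual (f : Mor) (V : f.src.left.Opens) :
    f.Vec V →ₗ[Γ(f.src.left, V)] Module.Dual Γ(f.src.left, V) Ω[Γ(f.src.left, V)⁄ℂ] where
  toFun D := (vecDer f V D).liftKaehlerDifferential
  map_add' D E := by
    apply Derivation.liftKaehlerDifferential_unique
    ext x
    change _ = (vecDer f V D).liftKaehlerDifferential (KaehlerDifferential.D ℂ _ x) +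
      (vecDer f V E).liftKaehlerDifferential (KaehlerDifferential.D ℂ _ x)
    rw [Derivation.liftKaehlerDifferential_comp, Derivation.liftKaehlerDifferential_comp_D,
      Derivation.liftKaehlerDifferential_comp_D]
    exact map_add (pull (𝟙 f.src) ((𝟙 f.src : f.src ⟶ f.src).left ⁻¹ᵁ V) V le_rfl) _ _
  map_smul' c D := by
    apply Derivation.liftKaehlerDifferential_unique
    ext x
    change _ = c * (vecDer f V D).liftKaehlerDifferential (KaehlerDifferential.D ℂ _ x)
    rw [Derivation.liftKaehlerDifferential_comp, Derivation.liftKaehlerDifferential_comp_D]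
    refine (map_mul (pull (𝟙 f.src) ((𝟙 f.src : f.src ⟶ f.src).left ⁻¹ᵁ V) V le_rfl) _ _).trans ?_
    congr 1
    exact (pull_pull _ _ (𝟙 f.src) (Category.comp_id _) _ _ _ _ _ le_rfl c).trans
      (pull_id _ _ _ c)

/-- The pairing of polyvector fields with differential forms of the same degree,
`⟨η₁ ∧ ⋯ ∧ η_b, D₁ ∧ ⋯ ∧ D_b⟩ = det ⟨ηᵢ, Dⱼ⟩`. -/
def vecPairing (f : Mor) (V : f.src.left.Opens) (b : ℕ) (η : Form b Γ(f.src.left, V))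
    (P : ⋀[Γ(f.src.left, V)]^b (f.Vec V)) : Γ(f.src.left, V) :=
  exteriorPower.pairingDual Γ(f.src.left, V) Ω[Γ(f.src.left, V)⁄ℂ] b
    (exteriorPower.map b (vecDual f V) P) η

/-- The morphism `Φ : ⋀ᵇ T ⊗ ω_g → Ω^{b'}` is the one given by `κ : ω_g ≅ ω_{X^g}` and the wedge
pairing `Ωᵇ ⊗ Ω^{b'} → ω_{X^g}`: the form `w = Φ(P ⊗ ν)` satisfies `η ∧ w = ⟨η, P⟩ κ(ν)` for all
forms `η` of degree `b`. -/
def IsWedgeDual {X : Over SpecC} {G : Type} [Group G] {ρ : G →* Aut X} {n : ℕ}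
    (κ : DualizingIso ρ n) (s : Sector G) (b b' : ℕ)
    (Φ : (secMor ρ n s).polSheaf b s.codim ⟶ formSheaf (secMor ρ n s).src b') : Prop :=
  ∀ (V : (secMor ρ n s).src.left.affineOpens)
    (P : ⋀[Γ((secMor ρ n s).src.left, V.1)]^b ((secMor ρ n s).Vec V.1))
    (ν : ⋀[Γ((secMor ρ n s).src.left, V.1)]^s.codim ((secMor ρ n s).Nor V.1)),
    ∃ w : Form b' Γ((secMor ρ n s).src.left, V.1),
      (Φ.hom.app (op V.1)).hom (toShf ((secMor ρ n s).polPsh b s.codim) V.1 (P ⊗ₜ ν)) =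
        toShf (formPsh (secMor ρ n s).src b') V.1 w ∧
      ∀ η : Form b Γ((secMor ρ n s).src.left, V.1),
        (η : ExteriorAlgebra Γ((secMor ρ n s).src.left, V.1) Ω[Γ((secMor ρ n s).src.left, V.1)⁄ℂ])
            * (w : ExteriorAlgebra _ _) =
          vecPairing (secMor ρ n s) V.1 b η P • (κ.iso s V ν : ExteriorAlgebra _ _)

end OrbifoldHodge

end

open OrbifoldHodge

/-! An invariant volume form `ω` on `X` identifies normal and cotangent determinants along the fixed
loci. Let `Z` be the part of `X^g` of age `r` and codimension `c`, with ideal `I` and dimension `d =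
n - c`. For every `ν` in `⋀ᶜ N` there is exactly one top form `w` on `Z` such that `di₁ ∧ ⋯ ∧ di_c ∧
α = ⟨i₁ ∧ ⋯ ∧ i_c, ν⟩ ω` along `Z`, for all functions `iₖ` in `I` and all local extensions `α` of
`w` to `X`. The assignment `κ_g(ν) = w` is an isomorphism; it is the adjunction formula with the
canonical sheaf of `X` trivialized by `ω`. Its defining condition contains no choices, so it is
respected by every isomorphism that respects `ω`, in particular by restriction and by `G`.

On `Z` the sheaf of differentials is locally free of rank `d`. Hence for `b + b' = d` the wedge
product gives `Ωᵇ' ≅ Hom(Ωᵇ, Ωᵈ) ≅ ⋀ᵇ T ⊗ Ωᵈ`, and together with `κ_g` this gives `Φ`. With `b = q +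
r - c` and `b' = n - q - r` the ages cancel in `b + b' = d`, while the cohomological degree `p - r`
is the same on both sides. Summands that have no partner vanish, because the polyvectors or forms
have degree above `d` or the stratum is empty. Equivariance of `e` is naturality of all these maps.

In a chart with equations `i` and forms restricting to a basis, the condition on `(ν, w)` becomes
one scalar equation (`AlgChart.isDual_iff`), because both sides are alternating in functions of `I`
and vanish on `I²`. Charts exist near every point by smoothness (`IsVolumeImmersion.exists_chart`).
Normal fields and forms localize on affine open subsets (`norRes_isLoc`, `formPull_isLoc`), so the
chart isomorphisms glue to `kap`. The wedge duality is `existsUnique_wedge_eq`, and its combination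
with `kap` is `polIso`, natural by `polIso_pull`. Maps on affine open subsets determine maps of
sheaves (`exists_shf_iso`), and `cohPull_comm` carries naturality to cohomology. -/

noncomputable section

namespace OrbifoldHodge

section

/-! ### Localization away from one element, for semilinear maps -/

section Localization

variable {A B : Type} [CommRing A] [CommRing B]

/-- The ring homomorphism `φ` is a localization away from `s`. -/
structure IsLocRing (φ : A →+* B) (s : A) : Prop where
  unit : IsUnit (φ s)
  surj : ∀ y : B, ∃ (x : A) (k : ℕ), φ x = φ s ^ k * y
  inj : ∀ x : A, φ x = 0 → ∃ k : ℕ, s ^ k * x = 0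

/-- The semilinear map `f` is a localization away from `s`. -/
structure IsLoc {M N : Type} [AddCommGroup M] [Module A M] [AddCommGroup N] [Module B N]
    {φ : A →+* B} (s : A) (f : M →ₛₗ[φ] N) : Prop where
  unit : IsUnit (φ s)
  surj : ∀ y : N, ∃ (x : M) (k : ℕ), f x = φ s ^ k • y
  inj : ∀ x : M, f x = 0 → ∃ k : ℕ, s ^ k • x = 0

lemma IsLocRing.isLocalization {φ : A →+* B} {s : A} (h : IsLocRing φ s) :
    letI := φ.toAlgebra
    IsLocalization.Away s B := by
  let := φ.toAlgebra
  refine { map_units := ?_, surj := ?_, exists_of_eq := ?_ }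
  · rintro ⟨_, k, rfl⟩
    change IsUnit (φ (s ^ k))
    rw [map_pow]
    exact h.unit.pow k
  · intro y
    obtain ⟨x, k, hx⟩ := h.surj y
    refine ⟨⟨x, s ^ k, k, rfl⟩, ?_⟩
    change y * φ (s ^ k) = φ x
    rw [hx, map_pow, mul_comm]
  · intro x y hxy
    have hxy' : φ x = φ y := hxy
    obtain ⟨k, hk⟩ := h.inj (x - y) (by rw [map_sub, hxy', sub_self])
    refine ⟨⟨s ^ k, k, rfl⟩, ?_⟩
    rw [mul_sub, sub_eq_zero] at hk
    exact hk

lemma isLocRing_of_isLocalization [Algebra A B] (s : A) [IsLocalization.Away s B] :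
    IsLocRing (algebraMap A B) s where
  unit := IsLocalization.Away.algebraMap_isUnit s
  surj y := by
    obtain ⟨⟨x, _, k, rfl⟩, hx⟩ := IsLocalization.surj (M := .powers s) y
    refine ⟨x, k, ?_⟩
    rw [← hx, map_pow, mul_comm]
  inj x hx := by
    obtain ⟨⟨_, k, rfl⟩, hk⟩ := IsLocalization.exists_of_eq (M := .powers s)
      (show algebraMap A B x = algebraMap A B 0 by rw [hx, map_zero])
    exact ⟨k, by simpa using hk⟩

variable {M N : Type} [AddCommGroup M] [Module A M] [AddCommGroup N] [Module B N]

lemma IsLoc.isLocalizedModule {φ : A →+* B} {s : A} {f : M →ₛₗ[φ] N} (h : IsLoc s f) :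
    letI : Module A N := Module.compHom N φ
    letI f' : M →ₗ[A] N := { toFun := f, map_add' := f.map_add, map_smul' := f.map_smulₛₗ }
    IsLocalizedModule (.powers s) f' := by
  let _ : Module A N := Module.compHom N φ
  let f' : M →ₗ[A] N := { toFun := f, map_add' := f.map_add, map_smul' := f.map_smulₛₗ }
  have hs : ∀ (k : ℕ) (y : N), s ^ k • y = φ s ^ k • y := fun k y => by
    rw [← map_pow]; rfl
  refine ⟨?_, ?_, ?_⟩
  · rintro ⟨_, k, rfl⟩
    obtain ⟨u, hu⟩ := h.unit.pow k
    rw [Module.End.isUnit_iff]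
    constructor
    · intro x y hxy
      have hxy' : φ s ^ k • x = φ s ^ k • y := by rw [← hs, ← hs]; exact hxy
      have := congrArg (fun z => (↑u⁻¹ : B) • z) hxy'
      simpa [← hu, smul_smul] using this
    · intro y
      refine ⟨(↑u⁻¹ : B) • y, ?_⟩
      change s ^ k • (↑u⁻¹ : B) • y = y
      rw [hs, ← hu, smul_smul, Units.mul_inv, one_smul]
  · intro y
    obtain ⟨x, k, hx⟩ := h.surj y
    refine ⟨⟨x, s ^ k, k, rfl⟩, ?_⟩
    change s ^ k • y = f x
    rw [hs, hx]
  · intro x y hxy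
    have hxy' : f x = f y := hxy
    obtain ⟨k, hk⟩ := h.inj (x - y) (by rw [map_sub, hxy', sub_self])
    refine ⟨⟨s ^ k, k, rfl⟩, ?_⟩
    rw [smul_sub, sub_eq_zero] at hk
    exact hk

lemma IsLoc.surj_finite {φ : A →+* B} {s : A} {f : M →ₛₗ[φ] N} (h : IsLoc s f) {r : ℕ}
    (y : Fin r → N) : ∃ (x : Fin r → M) (k : ℕ), ∀ j, f (x j) = φ s ^ k • y j := by
  choose x k hx using fun j => h.surj (y j)
  -- Multiplying each numerator by the powers of `s` that belong to the other entries gives all of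
  -- them the same exponent.
  refine ⟨fun j => s ^ (∑ i ∈ Finset.univ.erase j, k i) • x j, ∑ i, k i, fun j => ?_⟩
  rw [map_smulₛₗ, hx, smul_smul, map_pow, ← pow_add, Finset.sum_erase_add _ _ (Finset.mem_univ j)]

/-- Exterior powers commute with localization. Surjectivity is a matter of clearing denominators.
For injectivity one maps the exterior algebra of `N` to `B ⊗ E`, the localization of the exterior
algebra `E` of `M`: an element of the kernel dies there and is therefore killed by a power of `s`.
-/
lemma IsLoc.extMap {φ : A →+* B} {s : A} (hφ : IsLocRing φ s) {f : M →ₛₗ[φ] N}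
    (h : IsLoc s f) (r : ℕ) : IsLoc s (extMap f r) where
  unit := h.unit
  surj y := by
    induction y using ext_induction with
    | h₁ v =>
      obtain ⟨x, k, hx⟩ := h.surj_finite v
      refine ⟨exteriorPower.ιMulti A r x, k * r, ?_⟩
      rw [extMap_ιMulti]
      simp only [hx]
      rw [AlternatingMap.map_smul_univ]
      simp [pow_mul]
    | h₀ => exact ⟨0, 0, by simp⟩
    | h₂ x y hx hy =>
      obtain ⟨x', k, hx⟩ := hx
      obtain ⟨y', l, hy⟩ := hy
      refine ⟨s ^ l • x' + s ^ k • y', k + l, ?_⟩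
      rw [map_add, map_smulₛₗ, map_smulₛₗ, hx, hy, map_pow, map_pow, smul_smul, smul_smul,
        smul_add, ← pow_add, ← pow_add, add_comm l k]
    | h₃ a x hx =>
      obtain ⟨x', k, hx⟩ := hx
      obtain ⟨b, l, hb⟩ := hφ.surj a
      refine ⟨b • x', k + l, ?_⟩
      rw [map_smulₛₗ, hx, hb, smul_smul, smul_smul]
      congr 1
      ring
  inj x hx := by
    let _ := φ.toAlgebra
    have := hφ.isLocalization
    let _ : Module A N := Module.compHom N φ
    have : IsScalarTower A B N := ⟨fun a b y => by
      change (φ a * b) • y = φ a • b • y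
      rw [mul_smul]⟩
    let f' : M →ₗ[A] N := { toFun := f, map_add' := f.map_add, map_smul' := f.map_smulₛₗ }
    have : IsLocalizedModule (.powers s) f' := h.isLocalizedModule
    let E := ExteriorAlgebra A M
    let i : M →ₗ[A] B ⊗[A] E :=
      (TensorProduct.mk A B E 1) ∘ₗ ExteriorAlgebra.ι A
    have hu : ∀ t : Submonoid.powers s, IsUnit (algebraMap A (Module.End A (B ⊗[A] E)) t) :=
      IsLocalizedModule.map_units (TensorProduct.mk A B E 1)
    -- As `N` is the localization of `M`, the map `m ↦ 1 ⊗ ι m` extends from `M` to `N`.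
    let j₀ : N →ₗ[A] B ⊗[A] E := IsLocalizedModule.lift (.powers s) f' i hu
    let j : N →ₗ[B] B ⊗[A] E := LinearMap.extendScalarsOfIsLocalization (.powers s) B j₀
    have hj : ∀ m, j (f m) = 1 ⊗ₜ ExteriorAlgebra.ι A m := fun m =>
      IsLocalizedModule.lift_apply (.powers s) f' i hu m
    -- The square vanishes on the image of `M`, and every `y` is a unit multiple of an element of
    -- that image.
    have hj2 : ∀ y, j y * j y = 0 := by
      intro y
      obtain ⟨m, k, hm⟩ := h.surj y
      have h1 : j (f m) * j (f m) = 0 := by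
        rw [hj, Algebra.TensorProduct.tmul_mul_tmul, ExteriorAlgebra.ι_sq_zero,
          TensorProduct.tmul_zero]
      rw [hm, map_smul, smul_mul_smul_comm] at h1
      have h2 : IsUnit (φ s ^ k * φ s ^ k) := (h.unit.pow k).mul (h.unit.pow k)
      obtain ⟨u, hu⟩ := h2
      rw [← hu] at h1
      have := congrArg (fun z => (↑u⁻¹ : B) • z) h1
      simpa [smul_smul] using this
    let J : ExteriorAlgebra B N →ₐ[B] B ⊗[A] E := ExteriorAlgebra.lift B ⟨j, hj2⟩
    have hJ : ∀ x : ⋀[A]^r M, J (OrbifoldHodge.extMap f r x) = 1 ⊗ₜ (x : E) := by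
      intro x
      induction x using ext_induction with
      | h₁ v =>
        rw [extMap_ιMulti]
        change J (ExteriorAlgebra.ιMulti B r _) = 1 ⊗ₜ ExteriorAlgebra.ιMulti A r v
        clear hx x
        induction r with
        | zero =>
          simp only [ExteriorAlgebra.ιMulti_zero_apply, map_one]; rfl
        | succ r ih =>
          rw [ExteriorAlgebra.ιMulti_succ_apply, ExteriorAlgebra.ιMulti_succ_apply, map_mul]
          have h3 := ih (Matrix.vecTail v)
          change J (ExteriorAlgebra.ιMulti B r (Matrix.vecTail fun i => f (v i))) = _ at h3
          rw [h3, ExteriorAlgebra.lift_ι_apply, hj, Algebra.TensorProduct.tmul_mul_tmul, one_mul]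
      | h₀ => simp
      | h₂ x y hx hy => simp [hx, hy, TensorProduct.tmul_add]
      | h₃ a x hx =>
        rw [map_smulₛₗ, Submodule.coe_smul, map_smul, hx, Submodule.coe_smul,
          TensorProduct.tmul_smul]
        rfl
    -- The comparison takes place in the localization of the whole algebra `E`; the power of `s`
    -- found there also kills `x` in the submodule `⋀[A]^r M`.
    have h4 : (TensorProduct.mk A B E 1) (x : E) = TensorProduct.mk A B E 1 0 := by
      rw [map_zero]
      refine (hJ x).symm.trans ?_
      rw [hx]; simp
    obtain ⟨⟨_, k, rfl⟩, hk⟩ := IsLocalizedModule.exists_of_eq (S := .powers s) h4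
    refine ⟨k, Subtype.ext ?_⟩
    rw [smul_zero] at hk
    exact hk

end Localization

/-! ### Local-to-global principles over basic open covers -/

section Gluing

variable {A : Type} [CommRing A] {ι : Type} (s : ι → A)
  {M : Type} [AddCommGroup M] [Module A M]

/-- The elements `a` with `a • x ∈ P` form an ideal whose radical contains all `s i`, so it is the
unit ideal. -/
lemma mem_of_pow_smul_mem (hs : Ideal.span (Set.range s) = ⊤) (P : Submodule A M) (x : M)
    (h : ∀ i, ∃ k : ℕ, s i ^ k • x ∈ P) : x ∈ P := by
  let J : Ideal A := P.comap (LinearMap.toSpanSingleton A M x)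
  have h₁ : J.radical = ⊤ := by
    rw [eq_top_iff, ← hs, Ideal.span_le]
    rintro _ ⟨i, rfl⟩
    obtain ⟨k, hk⟩ := h i
    exact ⟨k, hk⟩
  have h₂ : (1 : A) ∈ J := by
    rw [Ideal.radical_eq_top.1 h₁]; trivial
  simpa [J] using h₂

variable {B : ι → Type} [∀ i, CommRing (B i)] {φ : ∀ i, A →+* B i}
  {M' : ι → Type} [∀ i, AddCommGroup (M' i)] [∀ i, Module (B i) (M' i)]
  {f : ∀ i, M →ₛₗ[φ i] M' i}

lemma eq_zero_of_isLoc (hs : Ideal.span (Set.range s) = ⊤) (hf : ∀ i, IsLoc (s i) (f i)) (x : M)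
    (h : ∀ i, f i x = 0) : x = 0 := by
  refine (Submodule.mem_bot A).1 (mem_of_pow_smul_mem s hs ⊥ x fun i => ?_)
  obtain ⟨k, hk⟩ := (hf i).inj x (h i)
  exact ⟨k, by rw [hk]; exact Submodule.zero_mem _⟩

/-- Surjectivity is local because the image of `u` is a submodule: a local preimage lifts after
multiplication by a power of `s i`, which puts a multiple of `y` by such a power into the image. -/
lemma bijective_of_isLoc (hs : Ideal.span (Set.range s) = ⊤) (hf : ∀ i, IsLoc (s i) (f i))
    {N : Type} [AddCommGroup N] [Module A N]
    {N' : ι → Type} [∀ i, AddCommGroup (N' i)] [∀ i, Module (B i) (N' i)]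
    {g : ∀ i, N →ₛₗ[φ i] N' i} (hg : ∀ i, IsLoc (s i) (g i))
    (u : M →ₗ[A] N) (u' : ∀ i, M' i →ₗ[B i] N' i) (hu : ∀ i x, g i (u x) = u' i (f i x))
    (hu' : ∀ i, Function.Bijective (u' i)) : Function.Bijective u := by
  constructor
  · rw [injective_iff_map_eq_zero]
    intro x hx
    refine eq_zero_of_isLoc s hs hf x fun i => (hu' i).1 ?_
    rw [← hu, hx, map_zero, map_zero]
  · intro y
    suffices h : y ∈ LinearMap.range u from h
    refine mem_of_pow_smul_mem s hs _ y fun i => ?_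
    obtain ⟨z, hz⟩ := (hu' i).2 (g i y)
    obtain ⟨x, k, hx⟩ := (hf i).surj z
    obtain ⟨l, hl⟩ := (hg i).inj (u x - s i ^ k • y) (by
      rw [map_sub, hu, hx, map_smul, hz, map_smulₛₗ, map_pow, sub_self])
    refine ⟨l + k, s i ^ l • x, ?_⟩
    rw [smul_sub, sub_eq_zero, smul_smul, ← pow_add] at hl
    rw [map_smul, hl]

/-- Elements of localizations of a module that agree on the overlaps come from the module. -/
lemma exists_of_isLoc [Finite ι] (hs : Ideal.span (Set.range s) = ⊤)
    (hf : ∀ i, IsLoc (s i) (f i)) (x : ∀ i, M' i)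
    (hx : ∀ i j (y z : M) (k : ℕ), f i y = φ i (s i) ^ k • x i → f j z = φ j (s j) ^ k • x j →
      ∃ l : ℕ, (s i * s j) ^ l • (s j ^ k • y - s i ^ k • z) = 0) : ∃ y : M, ∀ i, f i y = x i := by
  have := Fintype.ofFinite ι
  classical
  choose y₀ k₀ hy₀ using fun i => (hf i).surj (x i)
  -- All local elements are written with numerators `y i` over one common exponent `k`.
  obtain ⟨y, k, hy⟩ : ∃ (y : ι → M) (k : ℕ), ∀ i, f i (y i) = φ i (s i) ^ k • x i := by
    refine ⟨fun i => s i ^ (∑ j ∈ Finset.univ.erase i, k₀ j) • y₀ i, ∑ j, k₀ j, fun i => ?_⟩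
    rw [map_smulₛₗ, hy₀, smul_smul, map_pow, ← pow_add,
      Finset.sum_erase_add _ _ (Finset.mem_univ i)]
  choose l₀ hl₀ using fun i j => hx i j (y i) (y j) k (hy i) (hy j)
  -- A larger power still annihilates, so the sum of the finitely many exponents serves all pairs.
  obtain ⟨l, hl⟩ : ∃ l : ℕ, ∀ i j, (s i * s j) ^ l • (s j ^ k • y i - s i ^ k • y j) = 0 := by
    refine ⟨∑ i, ∑ j, l₀ i j, fun i j => ?_⟩
    have h₁ : l₀ i j ≤ ∑ i, ∑ j, l₀ i j :=
      (Finset.single_le_sum (f := fun j => l₀ i j) (fun _ _ => Nat.zero_le _)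
        (Finset.mem_univ j)).trans
      (Finset.single_le_sum (f := fun i => ∑ j, l₀ i j) (fun _ _ => Nat.zero_le _)
        (Finset.mem_univ i))
    rw [← Nat.sub_add_cancel h₁, pow_add, mul_smul, hl₀, smul_zero]
  have hl' : ∀ i j, s j ^ (k + l) • s i ^ l • y i = s i ^ (k + l) • s j ^ l • y j := by
    intro i j
    have := hl i j
    rw [smul_sub, sub_eq_zero, smul_smul, smul_smul] at this
    rw [smul_smul, smul_smul]
    convert this using 2 <;> ring
  -- The powers of the `s i` still generate the unit ideal. The coefficients `a` obtained from this
  -- act as a partition of unity in the definition of the glued element.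
  have h₁ : (1 : A) ∈ Ideal.span (Set.range fun i => s i ^ (k + l)) :=
    mem_of_pow_smul_mem s hs _ 1 fun i =>
      ⟨k + l, by simpa using Ideal.subset_span (Set.mem_range_self i)⟩
  obtain ⟨a, ha⟩ := (Ideal.mem_span_range_iff_exists_fun).1 h₁
  refine ⟨∑ i, a i • s i ^ l • y i, fun j => ?_⟩
  -- Over the `j`-th localization `s j ^ (k + l)` is invertible and can be cancelled from the
  -- compatibility `hl'`.
  have h₂ : ∀ i, f j (s i ^ l • y i) = φ j (s i ^ (k + l)) • x j := by
    intro i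
    obtain ⟨u, hu⟩ := (hf j).unit.pow (k + l)
    have h₃ := congrArg (f j) (hl' i j)
    rw [map_smulₛₗ (f j) (s j ^ (k + l)), map_pow, map_smulₛₗ (f j) (s i ^ (k + l)),
      map_smulₛₗ (f j) (s j ^ l), hy, map_pow _ (s j), smul_smul _ _ (x j), ← pow_add, add_comm l k,
      smul_comm, ← hu] at h₃
    have := congrArg (fun z => (↑u⁻¹ : B j) • z) h₃
    simpa [smul_smul] using this
  have h₃ : ∀ i, f j (a i • s i ^ l • y i) = φ j (a i * s i ^ (k + l)) • x j := fun i => by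
    rw [map_smulₛₗ (f j) (a i), h₂, smul_smul, ← map_mul]
  rw [map_sum, Finset.sum_congr rfl fun i _ => h₃ i, ← Finset.sum_smul, ← map_sum, ha, map_one,
    one_smul]

end Gluing

end

section

/-! ### Perfect pairing between exterior powers of a module and of its dual -/

section Duality

variable {R : Type} [CommRing R] {M N : Type} [AddCommGroup M] [Module R M]
  [AddCommGroup N] [Module R N]

/-- Adjointness of the pairing; it lets a projective module inherit duality as a retract of a free
one. -/
lemma pairingDual_map (r : ℕ) (h : M →ₗ[R] N) (P : ⋀[R]^r (Module.Dual R N)) (x : ⋀[R]^r M) :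
    exteriorPower.pairingDual R M r (exteriorPower.map r h.dualMap P) x =
      exteriorPower.pairingDual R N r P (exteriorPower.map r h x) := by
  induction P using ext_induction with
  | h₁ D =>
    induction x using ext_induction with
    | h₁ v => simp
    | h₀ => simp
    | h₂ x y hx hy => rw [map_add, map_add, map_add, hx, hy]
    | h₃ a x hx => rw [map_smul, map_smul, map_smul, hx]
  | h₀ => simp
  | h₂ x y hx hy => simp only [map_add, LinearMap.add_apply, hx, hy]
  | h₃ a x hx => simp only [map_smul, LinearMap.smul_apply, hx]

/-- The pairing carries the wedge monomials in the dual basis to the dual basis of the wedge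
monomials. -/
lemma pairingDual_bijective_of_basis {m : ℕ} (b : Module.Basis (Fin m) R M) (r : ℕ) :
    Function.Bijective (exteriorPower.pairingDual R M r) := by
  classical
  let e := (b.dualBasis.exteriorPower (n := r)).equiv (b.exteriorPower (n := r)).dualBasis
    (Equiv.refl _)
  have h : exteriorPower.pairingDual R M r = e := by
    refine (b.dualBasis.exteriorPower (n := r)).ext fun s => ?_
    rw [LinearEquiv.coe_coe, Module.Basis.equiv_apply, Equiv.refl_apply,
      exteriorPower.basis_apply, Module.Basis.coe_dualBasis, Module.Basis.coe_dualBasis,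
      exteriorPower.basis_coord]
    rfl
  rw [h]
  exact e.bijective

/-- The exterior powers of the dual of a finitely generated projective module are dual to the
exterior powers of the module. -/
lemma pairingDual_bijective [Module.Finite R M] [Module.Projective R M] (r : ℕ) :
    Function.Bijective (exteriorPower.pairingDual R M r) := by
  -- Here `g` is a section of a surjection `f` from a free module, so `M` is a retract of it;
  -- bijectivity passes to retracts by naturality.
  obtain ⟨m, f, g, -, -, hfg⟩ := Module.Finite.exists_comp_eq_id_of_projective R M
  have hF := pairingDual_bijective_of_basis (Pi.basisFun R (Fin m)) r
  have hgf : g.dualMap ∘ₗ f.dualMap = LinearMap.id := by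
    ext D x
    exact congrArg D (LinearMap.congr_fun hfg x)
  have hm : ∀ P, exteriorPower.map r g.dualMap (exteriorPower.map r f.dualMap P) = P := fun P => by
    rw [← LinearMap.comp_apply, ← exteriorPower.map_comp, hgf, exteriorPower.map_id]; rfl
  have hm' : ∀ x, exteriorPower.map r f (exteriorPower.map r g x) = x := fun x => by
    rw [← LinearMap.comp_apply, ← exteriorPower.map_comp, hfg, exteriorPower.map_id]; rfl
  constructor
  · rw [injective_iff_map_eq_zero]
    intro P hP
    have h₁ : exteriorPower.map r f.dualMap P = 0 := hF.1 (LinearMap.ext fun x => by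
      rw [pairingDual_map, hP, map_zero]; rfl)
    rw [← hm P, h₁, map_zero]
  · intro l
    obtain ⟨P, hP⟩ := hF.2 (l ∘ₗ exteriorPower.map r f)
    refine ⟨exteriorPower.map r g.dualMap P, LinearMap.ext fun x => ?_⟩
    rw [pairingDual_map, hP, LinearMap.comp_apply, hm']

end Duality

instance exteriorPower_projective {R : Type} [CommRing R] {M : Type} [AddCommGroup M] [Module R M]
    [Module.Finite R M] [Module.Projective R M] (r : ℕ) : Module.Projective R (⋀[R]^r M) := by
  obtain ⟨m, f, g, -, -, hfg⟩ := Module.Finite.exists_comp_eq_id_of_projective R M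
  refine Module.Projective.of_split (exteriorPower.map r g) (exteriorPower.map r f) ?_
  rw [← exteriorPower.map_comp, hfg, exteriorPower.map_id]

/-! ### Contraction and the wedge pairing into top degree -/

section Contraction

variable {R : Type} [CommRing R] {M : Type} [AddCommGroup M] [Module R M]

lemma wedge_induction {r : ℕ} {p : ExteriorAlgebra R M → Prop} {x : ExteriorAlgebra R M}
    (hx : x ∈ ⋀[R]^r M)
    (h₁ : ∀ v, p (ExteriorAlgebra.ιMulti R r v)) (h₀ : p 0)
    (h₂ : ∀ x y, p x → p y → p (x + y)) (h₃ : ∀ (a : R) x, p x → p (a • x)) : p x :=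
  ext_induction (p := fun y : ⋀[R]^r M => p y) (⟨x, hx⟩ : ⋀[R]^r M) h₁ h₀
    (fun x y => h₂ x y) (fun a x => h₃ a x)

lemma ι_mul_ιMulti {r : ℕ} (a : M) (v : Fin r → M) :
    ExteriorAlgebra.ι R a * ExteriorAlgebra.ιMulti R r v =
      (-1 : R) ^ r • (ExteriorAlgebra.ιMulti R r v * ExteriorAlgebra.ι R a) := by
  induction r with
  | zero => simp
  | succ r ih =>
    rw [ExteriorAlgebra.ιMulti_succ_apply, ← mul_assoc,
      eq_neg_of_add_eq_zero_left (ExteriorAlgebra.ι_add_mul_swap a (v 0)), neg_mul, mul_assoc, ih,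
      pow_succ, mul_smul_comm, mul_assoc, mul_neg_one, neg_smul]

lemma ιMulti_mul_comm {r t : ℕ} (v : Fin r → M) (w : Fin t → M) :
    ExteriorAlgebra.ιMulti R r v * ExteriorAlgebra.ιMulti R t w =
      (-1 : R) ^ (r * t) • (ExteriorAlgebra.ιMulti R t w * ExteriorAlgebra.ιMulti R r v) := by
  induction r with
  | zero => simp
  | succ r ih =>
    rw [ExteriorAlgebra.ιMulti_succ_apply, mul_assoc, ih, mul_smul_comm, ← mul_assoc,
      ι_mul_ιMulti, smul_mul_assoc, smul_smul, ← pow_add, mul_assoc]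
    congr 2
    ring

/-- Graded commutativity; it exchanges the two factors in the uniqueness part of
`existsUnique_wedge_eq`. -/
lemma wedge_comm {r t : ℕ} {x y : ExteriorAlgebra R M} (hx : x ∈ ⋀[R]^r M) (hy : y ∈ ⋀[R]^t M) :
    x * y = (-1 : R) ^ (r * t) • (y * x) := by
  refine wedge_induction (p := fun x => x * y = (-1 : R) ^ (r * t) • (y * x)) hx (fun v => ?_)
    (by simp) (fun x y hx hy => by rw [add_mul, hx, hy, mul_add, smul_add])
    (fun a x hx => by rw [smul_mul_assoc, hx, mul_smul_comm, smul_comm])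
  refine wedge_induction (p := fun y => ExteriorAlgebra.ιMulti R r v * y =
    (-1 : R) ^ (r * t) • (y * ExteriorAlgebra.ιMulti R r v)) hy (fun w => ?_)
    (by simp) (fun x y hx hy => by rw [mul_add, hx, hy, add_mul, smul_add])
    (fun a x hx => by rw [mul_smul_comm, hx, smul_mul_assoc, smul_comm])
  exact ιMulti_mul_comm v w

lemma wedge_mem {r t : ℕ} {x y : ExteriorAlgebra R M} (hx : x ∈ ⋀[R]^r M) (hy : y ∈ ⋀[R]^t M) :
    x * y ∈ ⋀[R]^(r + t) M := by
  change _ ∈ LinearMap.range _ ^ (r + t)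
  rw [pow_add]
  exact Submodule.mul_mem_mul hx hy

open CliffordAlgebra in
-- Contraction with a covector is an antiderivation; this is its Leibniz rule iterated over the
-- first `r + 1` factors.
lemma contractLeft_ιMulti_mul (D : Module.Dual R M) {r : ℕ} (v : Fin (r + 1) → M)
    (y : ExteriorAlgebra R M) :
    contractLeft (Q := (0 : QuadraticForm R M)) D (ExteriorAlgebra.ιMulti R (r + 1) v * y) =
      ∑ j : Fin (r + 1), ((-1 : R) ^ (j : ℕ) * D (v j)) •
        (ExteriorAlgebra.ιMulti R r (fun i => v (j.succAbove i)) * y) +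
      (-1 : R) ^ (r + 1) • (ExteriorAlgebra.ιMulti R (r + 1) v *
        contractLeft (Q := (0 : QuadraticForm R M)) D y) := by
  induction r with
  | zero =>
    rw [ExteriorAlgebra.ιMulti_succ_apply, ExteriorAlgebra.ιMulti_zero_apply, mul_one]
    refine (contractLeft_ι_mul D _ _).trans ?_
    simp [sub_eq_add_neg]
  | succ r ih =>
    rw [ExteriorAlgebra.ιMulti_succ_apply, mul_assoc]
    refine (contractLeft_ι_mul D _ _).trans ?_
    rw [ih, Fin.sum_univ_succ (n := r + 1), mul_add, sub_eq_add_neg, neg_add, ← add_assoc]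
    congr 1
    · congr 1
      · simp only [Matrix.vecTail, Function.comp_def, Fin.val_zero, pow_zero, one_mul,
          Fin.zero_succAbove]
      · rw [Finset.mul_sum, ← Finset.sum_neg_distrib]
        refine Finset.sum_congr rfl fun j _ => ?_
        rw [ExteriorAlgebra.ιMulti_succ_apply, mul_smul_comm, ← neg_smul, mul_assoc]
        congr 2
        · simp [Matrix.vecTail, pow_succ]
        · congr 3
          funext i
          simp [Matrix.vecTail]
    · rw [mul_smul_comm, ← neg_smul, mul_assoc]
      congr 1
      ring

open CliffordAlgebra in
lemma contractLeft_mem (D : Module.Dual R M) {r : ℕ} {x : ExteriorAlgebra R M}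
    (hx : x ∈ ⋀[R]^(r + 1) M) :
    contractLeft (Q := (0 : QuadraticForm R M)) D x ∈ ⋀[R]^r M := by
  refine wedge_induction (p := fun x => contractLeft (Q := (0 : QuadraticForm R M)) D x ∈ ⋀[R]^r M)
    hx (fun v => ?_) (by rw [map_zero]; exact Submodule.zero_mem _)
    (fun x y hx hy => by rw [map_add]; exact Submodule.add_mem _ hx hy)
    (fun a x hx => by rw [map_smul]; exact Submodule.smul_mem _ a hx)
  have := contractLeft_ιMulti_mul D v 1
  rw [mul_one, contractLeft_one, mul_zero, smul_zero, add_zero] at this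
  rw [this]
  refine Submodule.sum_mem _ fun j _ => Submodule.smul_mem _ _ ?_
  rw [mul_one]
  exact ExteriorAlgebra.ιMulti_range R r ⟨_, rfl⟩

/-- Successive contraction with several covectors. -/
def contractMulti : (b : ℕ) → (Fin b → Module.Dual R M) → ExteriorAlgebra R M →
    ExteriorAlgebra R M
  | 0, _, x => x
  -- The sign compensates for moving the contraction past `b + 1` forms, so that
  -- `ιMulti_mul_contractMulti` gives the determinant without a sign.
  | b + 1, D, x => (-1 : R) ^ b •
      CliffordAlgebra.contractLeft (Q := (0 : QuadraticForm R M)) (D 0)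
        (contractMulti b (fun i => D i.succ) x)

lemma contractMulti_mem {b b' : ℕ} (D : Fin b → Module.Dual R M) {x : ExteriorAlgebra R M}
    (hx : x ∈ ⋀[R]^(b' + b) M) : contractMulti b D x ∈ ⋀[R]^b' M := by
  induction b generalizing b' with
  | zero => exact hx
  | succ b ih =>
    refine Submodule.smul_mem _ _ (contractLeft_mem _ (ih _ ?_))
    rwa [add_assoc, add_comm 1 b]

/-- The product of `b + 1` forms with an element that was contracted only `b` times has degree `d +
1` and vanishes. Contracting this zero with `D 0` and applying the Leibniz rule expresses the wanted
product as a Laplace expansion along the column of `D 0`. -/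
lemma ιMulti_mul_contractMulti {d : ℕ} (htop : ∀ x ∈ ⋀[R]^(d + 1) M, x = 0)
    {b b' : ℕ} (h : b' + b = d) (D : Fin b → Module.Dual R M) (η : Fin b → M)
    {x : ExteriorAlgebra R M} (hx : x ∈ ⋀[R]^d M) :
    ExteriorAlgebra.ιMulti R b η * contractMulti b D x =
      (Matrix.of fun i j => D j (η i)).det • x := by
  induction b generalizing b' with
  | zero => simp [contractMulti]
  | succ b ih =>
    have hy : contractMulti b (fun i => D i.succ) x ∈ ⋀[R]^(b' + 1) M :=
      contractMulti_mem _ (by rwa [add_assoc, add_comm 1 b, h])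
    have h₁ : ExteriorAlgebra.ιMulti R (b + 1) η * contractMulti b (fun i => D i.succ) x = 0 := by
      apply htop
      have := wedge_mem (ExteriorAlgebra.ιMulti_range R (b + 1) ⟨η, rfl⟩) hy
      rwa [show b + 1 + (b' + 1) = d + 1 by omega] at this
    have h₂ := contractLeft_ιMulti_mul (D 0) η (contractMulti b (fun i => D i.succ) x)
    rw [h₁, map_zero] at h₂
    have h₃ : ∀ j : Fin (b + 1), ExteriorAlgebra.ιMulti R b (fun i => η (j.succAbove i)) *
        contractMulti b (fun i => D i.succ) x =
        (Matrix.of fun i k => D k.succ (η (j.succAbove i))).det • x := fun j =>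
      ih (b' := b' + 1) (by omega) _ _
    simp only [h₃, smul_smul] at h₂
    rw [← Finset.sum_smul] at h₂
    rw [contractMulti, mul_smul_comm]
    rw [Matrix.det_succ_column_zero]
    have h₄ := eq_neg_of_add_eq_zero_right h₂.symm
    rw [pow_succ, mul_neg_one, neg_smul, neg_inj] at h₄
    rw [h₄]
    congr 1

variable (M) in
/-- The exterior powers of `M` of degree `b'` are dual to those of degree `b`, with values in those
of degree `b + b'`, if this is the top degree. -/
lemma existsUnique_wedge_eq [Module.Finite R M] [Module.Projective R M] {b b' d : ℕ}
    (h : b + b' = d) (htop : ∀ x ∈ ⋀[R]^(d + 1) M, x = 0)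
    (hf : ∀ a : R, (∀ x : ⋀[R]^d M, a • x = 0) → a = 0) (g : ⋀[R]^b M →ₗ[R] ⋀[R]^d M) :
    ∃! w : ⋀[R]^b' M, ∀ η : ⋀[R]^b M, (η : ExteriorAlgebra R M) * (w : ExteriorAlgebra R M) =
      (g η : ExteriorAlgebra R M) := by
  refine existsUnique_of_exists_of_unique ?_ ?_
  · obtain ⟨t, rfl⟩ := (dualTensorHom_bijective (M := ⋀[R]^b M) (N := ⋀[R]^d M) (R := R)).2 g
    induction t using TensorProduct.induction_on with
    | zero => exact ⟨0, fun η => by simp⟩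
    | add t t' ht ht' =>
      obtain ⟨w, hw⟩ := ht
      obtain ⟨w', hw'⟩ := ht'
      exact ⟨w + w', fun η => by simp [mul_add, hw, hw']⟩
    | tmul l δ =>
      obtain ⟨P, rfl⟩ := (pairingDual_bijective (R := R) (M := M) b).2 l
      simp only [dualTensorHom_apply]
      induction P using ext_induction with
      | h₁ D =>
        refine ⟨⟨contractMulti b D δ, contractMulti_mem D (by
          rw [add_comm, h]; exact δ.2)⟩, fun η => ?_⟩
        induction η using ext_induction with
        | h₁ v =>
          rw [exteriorPower.pairingDual_ιMulti_ιMulti]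
          exact ιMulti_mul_contractMulti (b' := b') htop (by omega) D v δ.2
        | h₀ => simp
        | h₂ x y hx hy => simp only [Submodule.coe_add, add_mul, map_add, add_smul, hx, hy]
        | h₃ a x hx =>
          rw [Submodule.coe_smul, smul_mul_assoc, hx, map_smul, smul_assoc]; rfl
      | h₀ => exact ⟨0, fun η => by simp⟩
      | h₂ x y hx hy =>
        obtain ⟨w, hw⟩ := hx
        obtain ⟨w', hw'⟩ := hy
        exact ⟨w + w', fun η => by simp [mul_add, hw, hw', add_smul]⟩
      | h₃ a x hx =>
        obtain ⟨w, hw⟩ := hx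
        exact ⟨a • w, fun η => by simp [hw, mul_smul]⟩
  · intro w w' hw hw'
    rw [← sub_eq_zero]
    set z := w - w' with hz
    have hz0 : ∀ η : ⋀[R]^b M, (η : ExteriorAlgebra R M) * (z : ExteriorAlgebra R M) = 0 := by
      intro η
      rw [hz, Submodule.coe_sub, mul_sub, hw, hw', sub_self]
    -- The contraction formula is now used with `b'` covectors, so that it detects elements of `⋀ᵇ'
    -- M`.
    have h₁ : ∀ (D : Fin b' → Module.Dual R M) (y : ⋀[R]^b' M) (δ : ⋀[R]^d M),
        (y : ExteriorAlgebra R M) * contractMulti b' D δ =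
        exteriorPower.pairingDual R M b' (exteriorPower.ιMulti R b' D) y •
          (δ : ExteriorAlgebra R M) := by
      intro D y δ
      induction y using ext_induction with
      | h₁ v =>
        rw [exteriorPower.pairingDual_ιMulti_ιMulti]
        exact ιMulti_mul_contractMulti htop h D v δ.2
      | h₀ => simp
      | h₂ x y hx hy => simp only [Submodule.coe_add, add_mul, map_add, add_smul, hx, hy]
      | h₃ a x hx => rw [Submodule.coe_smul, smul_mul_assoc, hx, map_smul, smul_assoc]
    have h₂ : ∀ P, exteriorPower.pairingDual R M b' P z = 0 := by
      intro P
      induction P using ext_induction with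
      | h₁ D =>
        -- The contraction of `δ` by `b'` covectors has degree `b`, so its product with `z`
        -- vanishes. Hence the scalar `⟨D, z⟩` annihilates all top-degree elements, and these form a
        -- faithful module by `hf`.
        refine hf _ fun δ => Subtype.ext ?_
        have hc : contractMulti b' D (δ : ExteriorAlgebra R M) ∈ ⋀[R]^b M :=
          contractMulti_mem D (by rw [h]; exact δ.2)
        rw [Submodule.coe_smul, ← h₁, wedge_comm z.2 hc, hz0 ⟨_, hc⟩, smul_zero]
        rfl
      | h₀ => simp
      | h₂ x y hx hy => simp [hx, hy]
      | h₃ a x hx => simp [hx]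
    -- Elements of the projective module `⋀ᵇ' M` are detected by its linear forms, all of which are
    -- pairings.
    have h₃ : ∀ l : Module.Dual R (⋀[R]^b' M), l z = 0 := by
      intro l
      obtain ⟨P, rfl⟩ := (pairingDual_bijective (R := R) (M := M) b').2 l
      exact h₂ P
    exact (Module.forall_dual_apply_eq_zero_iff R z).1 h₃

end Contraction

end

section

/-! ### Alternating maps and determinants -/

section Alternating

variable {A : Type} [CommRing A] {M N : Type} [AddCommGroup M] [Module A M]
  [AddCommGroup N] [Module A N]

/-- Modulo `K` the entries of `m` are combinations of `v`, and an alternating map that ignores `K`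
is multiplied by the determinant of the coefficients. The factor `a` does not depend on `k`; this
uniformity allows two unrelated alternating maps to be compared later by their values at one point.
-/
lemma exists_alternating_eq_smul {r : ℕ} (v : Fin r → M)
    (K : Submodule A M) (hv : ∀ m, m ∈ Submodule.span A (Set.range v) ⊔ K) (m : Fin r → M) :
    ∃ a : A, ∀ k : M [⋀^Fin r]→ₗ[A] N, (∀ m j, m j ∈ K → k m = 0) → k m = a • k v := by
  classical
  let L : (Fin r → A) →ₗ[A] M := Fintype.linearCombination A v
  have hm : ∀ j, ∃ (a : Fin r → A) (y : M), y ∈ K ∧ L a + y = m j := by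
    intro j
    obtain ⟨x, hx, y, hy, hxy⟩ := Submodule.mem_sup.1 (hv (m j))
    rw [Submodule.mem_span_range_iff_exists_fun] at hx
    obtain ⟨a, ha⟩ := hx
    exact ⟨a, y, hy, by rw [← hxy, ← ha]; simp [L, Fintype.linearCombination_apply]⟩
  choose a y hy hay using hm
  refine ⟨(Pi.basisFun A (Fin r)).det a, fun k hk => ?_⟩
  have hL : k.compLinearMap L =
      (LinearMap.toSpanSingleton A N (k v)).compAlternatingMap (Pi.basisFun A (Fin r)).det := by
    refine Module.Basis.ext_alternating (Pi.basisFun A (Fin r)) fun σ hσ => ?_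
    set τ : Equiv.Perm (Fin r) := Equiv.ofBijective σ (Finite.injective_iff_bijective.1 hσ) with hτ
    have h₁ : (fun i => L (Pi.basisFun A (Fin r) (σ i))) = v ∘ τ := by
      funext i
      simp [L, hτ]
    have h₂ : (fun i => Pi.basisFun A (Fin r) (σ i)) = Pi.basisFun A (Fin r) ∘ τ := rfl
    change k (fun i => L (Pi.basisFun A (Fin r) (σ i))) =
      (Pi.basisFun A (Fin r)).det (fun i => Pi.basisFun A (Fin r) (σ i)) • k v
    rw [h₁, h₂, AlternatingMap.map_perm, AlternatingMap.map_perm, Module.Basis.det_self]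
    simp
  have h₂ : m = (fun j => L (a j)) + y := funext fun j => (hay j).symm
  rw [h₂]
  -- In the multilinear expansion every term except the one without entries from `y` has an argument
  -- in `K`.
  refine (k.toMultilinearMap.map_add_univ (fun j => L (a j)) y).trans ?_
  rw [Finset.sum_eq_single Finset.univ]
  · rw [Finset.piecewise_univ]
    exact DFunLike.congr_fun hL a
  · intro s _ hs
    obtain ⟨j, hj⟩ : ∃ j, j ∉ s := by
      by_contra! h; exact hs (Finset.eq_univ_iff_forall.2 h)
    exact hk _ j (by rw [Finset.piecewise_eq_of_notMem _ _ _ hj]; exact hy j)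
  · intro h; exact absurd (Finset.mem_univ _) h

/-- The determinant with respect to a basis, as a linear form on the top exterior power. -/
def detForm {r : ℕ} (b : Module.Basis (Fin r) A M) : (⋀[A]^r M) →ₗ[A] A :=
  exteriorPower.alternatingMapLinearEquiv b.det

lemma detForm_ιMulti {r : ℕ} (b : Module.Basis (Fin r) A M) (v : Fin r → M) :
    detForm b (exteriorPower.ιMulti A r v) = b.det v :=
  exteriorPower.alternatingMapLinearEquiv_apply_ιMulti _ _

lemma detForm_smul {r : ℕ} (b : Module.Basis (Fin r) A M) (x : ⋀[A]^r M) :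
    detForm b x • exteriorPower.ιMulti A r b = x := by
  have h : LinearMap.toSpanSingleton A _ (exteriorPower.ιMulti A r b) ∘ₗ detForm b =
      LinearMap.id := by
    refine exteriorPower.linearMap_ext ?_
    refine Module.Basis.ext_alternating b fun σ hσ => ?_
    set τ : Equiv.Perm (Fin r) := Equiv.ofBijective σ (Finite.injective_iff_bijective.1 hσ) with hτ
    have h₂ : (fun i => b (σ i)) = b ∘ τ := rfl
    change detForm b (exteriorPower.ιMulti A r fun i => b (σ i)) • exteriorPower.ιMulti A r b =
      exteriorPower.ιMulti A r fun i => b (σ i)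
    rw [h₂, detForm_ιMulti, AlternatingMap.map_perm, AlternatingMap.map_perm, Module.Basis.det_self]
    simp
  exact LinearMap.congr_fun h x

lemma detForm_bijective {r : ℕ} (b : Module.Basis (Fin r) A M) :
    Function.Bijective (detForm b) := by
  constructor
  · intro x y h
    rw [← detForm_smul b x, h, detForm_smul]
  · intro a
    exact ⟨a • exteriorPower.ιMulti A r b, by
      rw [map_smul, detForm_ιMulti, Module.Basis.det_self, smul_eq_mul, mul_one]⟩

end Alternating

/-- For a quotient `B = A/I`, right exactness of the tensor product identifies `B ⊗ M` with `M / I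
M`. -/
lemma one_tmul_eq_zero_iff {A B : Type} [CommRing A] [CommRing B] [Algebra A B] (h : Function.Surjective (algebraMap A B))
    {M : Type} [AddCommGroup M] [Module A M] (x : M) :
    (1 : B) ⊗ₜ[A] x = 0 ↔ x ∈ RingHom.ker (algebraMap A B) • (⊤ : Submodule A M) := by
  have h₁ : Function.Exact (RingHom.ker (algebraMap A B)).subtype (Algebra.linearMap A B) := by
    intro a
    simp [RingHom.mem_ker]
  have h₂ := rTensor_exact M h₁ h
  constructor
  · intro hx
    have h₃ : LinearMap.rTensor M (Algebra.linearMap A B) ((1 : A) ⊗ₜ x) = 0 := by simpa using hx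
    obtain ⟨t, ht⟩ := (h₂ _).1 h₃
    have h₄ : ∀ t : RingHom.ker (algebraMap A B) ⊗[A] M,
        TensorProduct.lid A M (LinearMap.rTensor M (RingHom.ker (algebraMap A B)).subtype t) ∈
          RingHom.ker (algebraMap A B) • (⊤ : Submodule A M) := by
      intro t
      induction t using TensorProduct.induction_on with
      | zero => simp
      | add t t' h h' => rw [map_add, map_add]; exact Submodule.add_mem _ h h'
      | tmul a m => exact Submodule.smul_mem_smul a.2 trivial
    have := h₄ t
    rw [ht] at this
    simpa using this
  · intro hx
    refine Submodule.smul_induction_on hx (fun a ha m _ => ?_) fun x y hx hy => ?_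
    · rw [← TensorProduct.smul_tmul, Algebra.smul_def, (RingHom.mem_ker.1 ha), zero_mul,
        TensorProduct.zero_tmul]
    · rw [TensorProduct.tmul_add, hx, hy, add_zero]

/-! ### Differentials of localizations and quotients -/

section Kaehler

variable {A B : Type} [CommRing A] [CommRing B] [Algebra ℂ A] [Algebra ℂ B]

lemma IsLocRing.kaehlerMap {φ : A →ₐ[ℂ] B} {s : A} (h : IsLocRing (φ : A →+* B) s) :
    IsLoc s (kaehlerMap φ) where
  unit := h.unit
  surj y := by
    let _ : Algebra A B := (φ : A →+* B).toAlgebra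
    have : IsScalarTower ℂ A B := IsScalarTower.of_algebraMap_eq fun x => (φ.commutes x).symm
    have := h.isLocalization
    obtain ⟨⟨x, _, k, rfl⟩, hx⟩ := IsLocalizedModule.surj (.powers s)
      (KaehlerDifferential.map ℂ ℂ A B) y
    refine ⟨x, k, ?_⟩
    change KaehlerDifferential.map ℂ ℂ A B x = _
    rw [← hx, ← map_pow]
    exact (IsScalarTower.algebraMap_smul B (s ^ k) y).symm
  inj x hx := by
    let _ : Algebra A B := (φ : A →+* B).toAlgebra
    have : IsScalarTower ℂ A B := IsScalarTower.of_algebraMap_eq fun x => (φ.commutes x).symm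
    have := h.isLocalization
    obtain ⟨⟨_, k, rfl⟩, hk⟩ := IsLocalizedModule.exists_of_eq (S := .powers s)
      (f := KaehlerDifferential.map ℂ ℂ A B) (x₁ := x) (x₂ := 0) (by rw [map_zero]; exact hx)
    rw [smul_zero] at hk
    exact ⟨k, hk⟩

lemma kaehlerMap_surjective {φ : A →ₐ[ℂ] B} (hφ : Function.Surjective φ) :
    Function.Surjective (kaehlerMap φ) := by
  intro y
  induction y using kaehler_induction with
  | h₁ b =>
    obtain ⟨a, rfl⟩ := hφ b
    exact ⟨_, kaehlerMap_D φ a⟩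
  | h₀ => exact ⟨0, map_zero _⟩
  | h₂ x y hx hy =>
    obtain ⟨x', rfl⟩ := hx
    obtain ⟨y', rfl⟩ := hy
    exact ⟨x' + y', map_add _ _ _⟩
  | h₃ b x hx =>
    obtain ⟨x', rfl⟩ := hx
    obtain ⟨a, rfl⟩ := hφ b
    exact ⟨a • x', map_smulₛₗ _ _ _⟩

/-- The kernel of a homomorphism of complex algebras. -/
abbrev algKer (φ : A →ₐ[ℂ] B) : Ideal A := RingHom.ker (φ : A →+* B)

/-- The kernel of `Ω_A → Ω_B`, for a surjection `A → B` with kernel `I`, is `dI + I Ω_A`. -/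
lemma exists_D_sub_mem {φ : A →ₐ[ℂ] B} (hφ : Function.Surjective φ) {θ : Ω[A⁄ℂ]}
    (h : kaehlerMap φ θ = 0) :
    ∃ x ∈ algKer φ, θ - KaehlerDifferential.D ℂ A x ∈ algKer φ • (⊤ : Submodule A Ω[A⁄ℂ]) := by
  let _ : Algebra A B := (φ : A →+* B).toAlgebra
  have : IsScalarTower ℂ A B := IsScalarTower.of_algebraMap_eq fun x => (φ.commutes x).symm
  -- Exactness of the conormal sequence `I/I² → B ⊗ Ω_A → Ω_B` in the middle.
  have h₁ : (1 : B) ⊗ₜ[A] θ ∈ LinearMap.range (KaehlerDifferential.kerCotangentToTensor ℂ A B) := by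
    rw [KaehlerDifferential.range_kerCotangentToTensor ℂ A B hφ]
    change KaehlerDifferential.mapBaseChange ℂ A B (1 ⊗ₜ θ) = 0
    rw [KaehlerDifferential.mapBaseChange_tmul, one_smul]
    exact h
  obtain ⟨y, hy⟩ := h₁
  obtain ⟨x, rfl⟩ := Ideal.toCotangent_surjective _ y
  rw [KaehlerDifferential.kerCotangentToTensor_toCotangent] at hy
  refine ⟨x.1, x.2, (one_tmul_eq_zero_iff hφ _).1 ?_⟩
  rw [TensorProduct.tmul_sub, hy, sub_self]

lemma D_mem_of_mem_sq {φ : A →ₐ[ℂ] B} {x : A} (hx : x ∈ algKer φ ^ 2) :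
    KaehlerDifferential.D ℂ A x ∈ algKer φ • (⊤ : Submodule A Ω[A⁄ℂ]) := by
  rw [pow_two] at hx
  refine Submodule.mul_induction_on hx (fun a ha b hb => ?_) fun x y hx hy => ?_
  · rw [Derivation.leibniz]
    exact Submodule.add_mem _ (Submodule.smul_mem_smul ha trivial)
      (Submodule.smul_mem_smul hb trivial)
  · rw [map_add]; exact Submodule.add_mem _ hx hy

/-- The differential `I/I² → Ω_A / I Ω_A` is injective if `A` and `A/I` are smooth. -/
lemma mem_sq_of_D_mem {φ : A →ₐ[ℂ] B} (hφ : Function.Surjective φ)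
    [Algebra.FormallySmooth ℂ A] [Algebra.FormallySmooth ℂ B] {x : A} (hx : x ∈ algKer φ)
    (h : KaehlerDifferential.D ℂ A x ∈ algKer φ • (⊤ : Submodule A Ω[A⁄ℂ])) :
    x ∈ algKer φ ^ 2 := by
  let _ : Algebra A B := (φ : A →+* B).toAlgebra
  have : IsScalarTower ℂ A B := IsScalarTower.of_algebraMap_eq fun x => (φ.commutes x).symm
  -- Smoothness of `B` splits the conormal sequence on the left; `l` is a retraction.
  obtain ⟨l, hl⟩ := (Algebra.FormallySmooth.iff_split_injection (R := ℂ) (P := A) (A := B) hφ).1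
    inferInstance
  have h₁ : Function.Injective (KaehlerDifferential.kerCotangentToTensor ℂ A B) :=
    Function.LeftInverse.injective (g := l) fun y => LinearMap.congr_fun hl y
  have h₂ : (RingHom.ker (algebraMap A B)).toCotangent ⟨x, hx⟩ = 0 := by
    apply h₁
    rw [KaehlerDifferential.kerCotangentToTensor_toCotangent, map_zero]
    exact (one_tmul_eq_zero_iff hφ _).2 h
  exact (Ideal.toCotangent_eq_zero _ _).1 h₂

end Kaehler

/-! ### Wedge products in fixed degrees and coefficients of top forms -/

section TopForm

variable {A : Type} [CommRing A] {M : Type} [AddCommGroup M] [Module A M]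

/-- The wedge product, in fixed degrees. -/
def wedge {r t n : ℕ} (h : r + t = n) (x : ⋀[A]^r M) (y : ⋀[A]^t M) : ⋀[A]^n M :=
  ⟨(x : ExteriorAlgebra A M) * y, h ▸ wedge_mem x.2 y.2⟩

/-- The coefficient with respect to a generator `ω` of a free module of rank one. -/
def topCoeff {L : Type} [AddCommGroup L] [Module A L] {ω : L}
    (hω : Function.Bijective fun a : A => a • ω) : L →ₗ[A] A :=
  (LinearEquiv.ofBijective (LinearMap.toSpanSingleton A L ω) hω).symm

lemma topCoeff_smul {L : Type} [AddCommGroup L] [Module A L] {ω : L}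
    (hω : Function.Bijective fun a : A => a • ω) (x : L) : topCoeff hω x • ω = x :=
  LinearEquiv.apply_symm_apply (LinearEquiv.ofBijective (LinearMap.toSpanSingleton A L ω) hω) x

lemma topCoeff_eq {L : Type} [AddCommGroup L] [Module A L] {ω : L}
    (hω : Function.Bijective fun a : A => a • ω) {x : L} {a : A} (h : a • ω = x) :
    topCoeff hω x = a :=
  hω.1 ((topCoeff_smul hω x).trans h.symm)

end TopForm

end

section

/-! ### Determinants of values of normal fields -/

section EvalPair

variable {R S : Type} [CommRing R] [CommRing S] {ψ : R →+* S} {N : Type} [AddCommGroup N]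
  [Module R N] {r : ℕ}

/-- The function `ν₁ ∧ ⋯ ∧ νᵣ ↦ det (ev νⱼ k)`. -/
def evalPair (ev : N →ₛₗ[ψ] (Fin r → S)) : (⋀[R]^r N) →ₛₗ[ψ] S :=
  (detForm (Pi.basisFun S (Fin r))).comp (extMap ev r)

lemma evalPair_ιMulti (ev : N →ₛₗ[ψ] (Fin r → S)) (ν : Fin r → N) :
    evalPair ev (exteriorPower.ιMulti R r ν) = (Matrix.of fun j k => ev (ν j) k).det := by
  rw [evalPair, LinearMap.comp_apply, extMap_ιMulti, detForm_ιMulti, Pi.basisFun_det]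
  rfl

/-- If the values are coordinates, the pairing is the determinant in the basis with these
coordinates. -/
lemma evalPair_bijective {N : Type} [AddCommGroup N] [Module S N] (ev : N →ₗ[S] (Fin r → S))
    (h : Function.Bijective ev) : Function.Bijective (evalPair ev) := by
  let b : Module.Basis (Fin r) S N := Module.Basis.ofEquivFun (LinearEquiv.ofBijective ev h)
  have : evalPair ev = detForm b := by
    refine exteriorPower.linearMap_ext ?_
    ext v
    change evalPair ev (exteriorPower.ιMulti S r v) = detForm b (exteriorPower.ιMulti S r v)
    rw [evalPair_ιMulti, detForm_ιMulti, Module.Basis.det_apply, ← Matrix.det_transpose]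
    rfl
  rw [this]
  exact detForm_bijective b

end EvalPair

variable {A B : Type} [CommRing A] [CommRing B] [Algebra ℂ A] [Algebra ℂ B]

lemma ιMulti_mul_ιMulti {R M : Type} [CommRing R] [AddCommGroup M] [Module R M] {r t : ℕ}
    (v : Fin r → M) (w : Fin t → M) :
    ExteriorAlgebra.ιMulti R r v * ExteriorAlgebra.ιMulti R t w =
      ExteriorAlgebra.ιMulti R (r + t) (Fin.append v w) := by
  rw [ExteriorAlgebra.ιMulti_apply, ExteriorAlgebra.ιMulti_apply, ExteriorAlgebra.ιMulti_apply,
    ← List.prod_append, ← List.ofFn_fin_append]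
  congr 2
  funext i
  refine Fin.addCases (fun i => ?_) (fun i => ?_) i <;> simp

/-- For `a, b` in the ideal, `ν (a b) = ρ a · ν b = 0`. The ring `B'` is kept general because the
fact is also applied to normal fields composed with restriction to a smaller open subset. -/
lemma normal_sq_eq_zero {φ : A →ₐ[ℂ] B} {B' : Type} [CommRing B'] {ρ : A →+* B'}
    (hρ : ∀ x ∈ algKer φ, ρ x = 0) (ν : algKer φ →ₛₗ[ρ] B') {x : algKer φ}
    (hx : x ∈ Submodule.comap (Submodule.subtype (algKer φ)) (algKer φ ^ 2)) : ν x = 0 := by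
  obtain ⟨x, hx'⟩ := x
  have h : x ∈ algKer φ ^ 2 := hx
  -- The membership proof is put under the quantifier so that the induction over products and sums
  -- can supply it.
  suffices ∃ hx' : x ∈ algKer φ, ν ⟨x, hx'⟩ = 0 from this.2
  rw [pow_two] at h
  refine Submodule.mul_induction_on h (fun a ha b hb => ?_) fun x y hx hy => ?_
  · refine ⟨Ideal.mul_mem_left _ _ hb, ?_⟩
    have h₁ : ν (a • ⟨b, hb⟩) = ρ a • ν ⟨b, hb⟩ := map_smulₛₗ _ _ _
    rw [hρ a ha, zero_smul] at h₁
    exact h₁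
  · obtain ⟨hx, hx'⟩ := hx
    obtain ⟨hy, hy'⟩ := hy
    refine ⟨add_mem hx hy, ?_⟩
    have := map_add ν ⟨x, hx⟩ ⟨y, hy⟩
    rw [hx', hy', add_zero] at this
    exact this

/-- Equations and differential forms that describe a closed subscheme with ring of functions `B`
of a smooth affine scheme with ring of functions `A`, in terms of a generator `ω` of the forms of
top degree. -/
structure AlgChart (φ : A →ₐ[ℂ] B) {n : ℕ} (ω : Form n A) (c d : ℕ) where
  surj : Function.Surjective φ
  deg : c + d = n
  gen : Function.Bijective fun a : A => a • ω
  /-- The equations. -/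
  eqn : Fin c → algKer φ
  /-- The forms. -/
  form : Fin d → Ω[A⁄ℂ]
  /-- The restrictions of the forms are a basis. -/
  basis : Module.Basis (Fin d) B Ω[B⁄ℂ]
  basis_eq : ∀ j, basis j = kaehlerMap φ (form j)
  -- Generation up to `I²` is enough, since normal fields kill `I²` and `d(I²)` lies in `I Ω`.
  span : ∀ x ∈ algKer φ, x ∈ Ideal.span (Set.range fun k => (eqn k : A)) ⊔ algKer φ ^ 2
  /-- The ratio of the product of the forms with `ω`. -/
  vol : A
  vol_unit : IsUnit (φ vol)
  vol_eq : vol • ω = wedge deg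
    (exteriorPower.ιMulti A c fun k => KaehlerDifferential.D ℂ A (eqn k : A))
    (exteriorPower.ιMulti A d form)

/-! ### Coefficients of `di₁ ∧ ⋯ ∧ di_c ∧ α` along the subscheme -/

namespace AlgChart

variable {φ : A →ₐ[ℂ] B} {n c d : ℕ} {ω : Form n A} (C : AlgChart φ ω c d)

lemma eqn_span (x : algKer φ) : x ∈ Submodule.span A (Set.range C.eqn) ⊔
    Submodule.comap (Submodule.subtype (algKer φ)) (algKer φ ^ 2) := by
  obtain ⟨y, hy, z, hz, hyz⟩ := Submodule.mem_sup.1 (C.span x x.2)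
  have h₁ : Set.range (fun k => (C.eqn k : A)) =
      Submodule.subtype (algKer φ) '' Set.range C.eqn := by
    rw [← Set.range_comp]; rfl
  rw [h₁, Ideal.span, Submodule.span_image] at hy
  obtain ⟨y', hy', rfl⟩ := hy
  have hz' : z ∈ algKer φ := Ideal.pow_le_self two_ne_zero hz
  have : x = y' + ⟨z, hz'⟩ := Subtype.ext hyz.symm
  rw [this]
  exact Submodule.add_mem_sup hy' hz

/-- The coefficient in `B` of a product of differentials of functions with a form. -/
def pf (x : Fin c → A) (α : Form d A) : B :=
  φ (topCoeff C.gen (wedge C.deg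
    (exteriorPower.ιMulti A c fun k => KaehlerDifferential.D ℂ A (x k)) α))

lemma pf_eq {x : Fin c → A} {α : Form d A} {a : A}
    (h : a • ω = wedge C.deg
      (exteriorPower.ιMulti A c fun k => KaehlerDifferential.D ℂ A (x k)) α) :
    C.pf x α = φ a := by
  rw [pf, topCoeff_eq C.gen h]

lemma pf_spec (x : Fin c → A) (α : Form d A) : ∃ a : A, φ a = C.pf x α ∧
    a • ω = wedge C.deg (exteriorPower.ιMulti A c fun k => KaehlerDifferential.D ℂ A (x k)) α :=
  ⟨_, rfl, topCoeff_smul C.gen _⟩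

/-- The coefficient of a product of forms, as a linear map in the second factor. -/
def coeffRight (x : Form c A) : Form d A →ₗ[A] A :=
  topCoeff C.gen ∘ₗ
    { toFun := wedge C.deg x
      map_add' := fun _ _ => Subtype.ext (mul_add _ _ _)
      map_smul' := fun _ _ => Subtype.ext (mul_smul_comm _ _ _) }

/-- The coefficient of a product of forms, as a linear map in the first factor. -/
def coeffLeft (y : Form d A) : Form c A →ₗ[A] A :=
  topCoeff C.gen ∘ₗ
    { toFun := fun x => wedge C.deg x y
      map_add' := fun _ _ => Subtype.ext (add_mul _ _ _)
      map_smul' := fun _ _ => Subtype.ext (smul_mul_assoc _ _ _) }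

/-- The differential of the same equation occurs twice in the product. -/
lemma coeffRight_D_eqn_eq_zero (θ : Fin d → Ω[A⁄ℂ]) (j : Fin d) (k : Fin c)
    (h : θ j = KaehlerDifferential.D ℂ A (C.eqn k)) :
    C.coeffRight (exteriorPower.ιMulti A c fun k => KaehlerDifferential.D ℂ A (C.eqn k : A))
      (exteriorPower.ιMulti A d θ) = 0 := by
  have : wedge C.deg (exteriorPower.ιMulti A c fun k => KaehlerDifferential.D ℂ A (C.eqn k : A))
      (exteriorPower.ιMulti A d θ) = 0 := by
    apply Subtype.ext
    change ExteriorAlgebra.ιMulti A c _ * ExteriorAlgebra.ιMulti A d θ = 0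
    rw [ιMulti_mul_ιMulti]
    refine AlternatingMap.map_eq_zero_of_eq _ _ (i := Fin.castAdd d k) (j := Fin.natAdd c j) ?_ ?_
    · rw [Fin.append_left, Fin.append_right, h]
    · exact fun h => by
        have := congrArg Fin.val h
        simp only [Fin.val_castAdd, Fin.val_natAdd] at this
        omega
  change topCoeff C.gen (wedge C.deg _ _) = 0
  rw [this, map_zero]

/-- The coefficient of `d i₁ ∧ ⋯ ∧ d i_c ∧ α`, for the equations `i` of a chart, is the
coefficient of the restriction of `α`. -/
lemma pf_eqn (α : Form d A) : C.pf (fun k => C.eqn k) α =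
    φ C.vol * detForm C.basis (extMap (kaehlerMap φ) d α) := by
  let _ : Algebra A B := (φ : A →+* B).toAlgebra
  let X : Form c A := exteriorPower.ιMulti A c fun k => KaehlerDifferential.D ℂ A (C.eqn k : A)
  let L : Form d A →ₗ[A] B := Algebra.linearMap A B ∘ₗ C.coeffRight X
  let k₁ : Ω[A⁄ℂ] [⋀^Fin d]→ₗ[A] B := L.compAlternatingMap (exteriorPower.ιMulti A d)
  let K : Ω[A⁄ℂ] →ₛₗ[(φ : A →+* B)] Ω[B⁄ℂ] := kaehlerMap φ
  let L₂ : Form d A →ₗ[A] B :=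
    { toFun := fun α => detForm C.basis (extMap (kaehlerMap φ) d α)
      map_add' := fun x y => by rw [map_add, map_add]
      map_smul' := fun a x => by rw [map_smulₛₗ, map_smul]; rfl }
  let k₂ : Ω[A⁄ℂ] [⋀^Fin d]→ₗ[A] B := L₂.compAlternatingMap (exteriorPower.ιMulti A d)
  have hk₂ : ∀ θ, k₂ θ = C.basis.det fun j => kaehlerMap φ (θ j) := fun θ => by
    change detForm C.basis (extMap (kaehlerMap φ) d (exteriorPower.ιMulti A d θ)) = _
    rw [extMap_ιMulti, detForm_ιMulti]
  have hI : ∀ a ∈ algKer φ, ∀ b : B, a • b = 0 := fun a ha b => by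
    have ha : φ a = 0 := ha
    change φ a * b = 0
    rw [ha, zero_mul]
  -- The coordinates of the restriction of `θ` in the basis of `Ω_B` lift to `A`, so the chosen
  -- forms span modulo the kernel of restriction.
  have hform : ∀ θ : Ω[A⁄ℂ], θ ∈ Submodule.span A (Set.range C.form) ⊔ LinearMap.ker K := by
    intro θ
    obtain ⟨a, ha⟩ : ∃ a : Fin d → A, ∀ j, φ (a j) = C.basis.repr (K θ) j :=
      ⟨fun j => (C.surj _).choose, fun j => (C.surj _).choose_spec⟩
    have h₁ : K (∑ j, a j • C.form j) = K θ := by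
      rw [map_sum]
      conv_rhs => rw [← C.basis.sum_repr (K θ)]
      refine Finset.sum_congr rfl fun j _ => ?_
      rw [map_smulₛₗ, ← ha, C.basis_eq]
      rfl
    rw [← add_sub_cancel (∑ j, a j • C.form j) θ]
    refine Submodule.add_mem_sup (Submodule.sum_mem _ fun j _ =>
      Submodule.smul_mem _ _ (Submodule.subset_span ⟨j, rfl⟩)) ?_
    rw [LinearMap.mem_ker, map_sub, h₁, sub_self]
  -- A form that restricts to zero is `dy` plus an element of `I Ω`, with `y` in `I`. The second
  -- part contributes nothing over `B`. Modulo `I²` the function `y` is a combination of equations,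
  -- whose differentials already occur in the product.
  have hv₁ : ∀ θ j, θ j ∈ LinearMap.ker K → k₁ θ = 0 := by
    intro θ j hj
    let p : Ω[A⁄ℂ] →ₗ[A] B := k₁.toMultilinearMap.toLinearMap θ j
    have hp : ∀ y, p y = k₁ (Function.update θ j y) := fun y => rfl
    have h₀ : algKer φ • (⊤ : Submodule A Ω[A⁄ℂ]) ≤ LinearMap.ker p := by
      rw [Submodule.smul_le]
      intro a ha y _
      rw [LinearMap.mem_ker, map_smul, hI a ha]
    have h₁ : ∀ k, p (KaehlerDifferential.D ℂ A (C.eqn k)) = 0 := fun k => by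
      rw [hp]
      change φ (C.coeffRight X (exteriorPower.ιMulti A d (Function.update θ j _))) = 0
      rw [C.coeffRight_D_eqn_eq_zero _ j k (by simp), map_zero]
    have h₂ : ∀ y : algKer φ, p (KaehlerDifferential.D ℂ A y) = 0 := by
      let q : algKer φ →ₗ[A] B :=
        { toFun := fun y => p (KaehlerDifferential.D ℂ A y)
          map_add' := fun y z => by rw [Submodule.coe_add, map_add, map_add]
          -- In the Leibniz rule for `d(a y)` the term `y da` has its coefficient in `I` and
          -- disappears in `B`.
          map_smul' := fun a y => by
            rw [Submodule.coe_smul, smul_eq_mul, Derivation.leibniz, map_add, map_smul, map_smul,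
              hI _ y.2, add_zero]; rfl }
      have hq : Submodule.span A (Set.range C.eqn) ⊔
          Submodule.comap (Submodule.subtype (algKer φ)) (algKer φ ^ 2) ≤ LinearMap.ker q := by
        refine sup_le (Submodule.span_le.2 ?_) fun y hy => h₀ (D_mem_of_mem_sq hy)
        rintro _ ⟨k, rfl⟩
        exact h₁ k
      exact fun y => hq (C.eqn_span y)
    obtain ⟨y, hy, hy'⟩ := exists_D_sub_mem C.surj hj
    have h₃ := h₀ hy'
    rw [LinearMap.mem_ker, map_sub, h₂ ⟨y, hy⟩, sub_zero, hp, Function.update_eq_self] at h₃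
    exact h₃
  have hv₂ : ∀ θ j, θ j ∈ LinearMap.ker K → k₂ θ = 0 := by
    intro θ j hj
    rw [hk₂]
    exact C.basis.det.map_coord_zero j hj
  have h₁ : k₁ C.form = φ C.vol := by
    change φ (topCoeff C.gen (wedge C.deg _ _)) = _
    rw [topCoeff_eq C.gen C.vol_eq]
  have h₂ : k₂ C.form = 1 := by
    rw [hk₂, ← C.basis.det_self]
    congr 1
    funext j
    exact (C.basis_eq j).symm
  -- Both alternating maps ignore forms that restrict to zero, so they are compared on the chosen
  -- forms alone, where they take the values `φ vol` and `1`.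
  have h₃ : L = φ C.vol • L₂ := by
    refine exteriorPower.linearMap_ext ?_
    ext θ
    obtain ⟨a, ha⟩ := exists_alternating_eq_smul (N := B) C.form (LinearMap.ker K) hform θ
    change k₁ θ = φ C.vol * k₂ θ
    rw [ha k₁ hv₁, ha k₂ hv₂, h₁, h₂, mul_smul_comm, mul_one]
  exact LinearMap.congr_fun h₃ α

lemma D_update [DecidableEq (Fin c)] (x : Fin c → algKer φ) (j : Fin c) (y : algKer φ) :
    (fun k => KaehlerDifferential.D ℂ A (Function.update x j y k : A)) =
      Function.update (fun k => KaehlerDifferential.D ℂ A (x k : A)) j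
        (KaehlerDifferential.D ℂ A (y : A)) := by
  funext k
  by_cases hk : k = j
  · subst hk; simp
  · simp [hk]

lemma pf_def (x : Fin c → A) (α : Form d A) : C.pf x α = φ (C.coeffLeft α
    (exteriorPower.ιMulti A c fun k => KaehlerDifferential.D ℂ A (x k))) := rfl

lemma pf_update_add [DecidableEq (Fin c)] (x : Fin c → algKer φ) (j : Fin c) (y z : algKer φ)
    (α : Form d A) : C.pf (fun k => Function.update x j (y + z) k) α =
      C.pf (fun k => Function.update x j y k) α + C.pf (fun k => Function.update x j z k) α := by
  simp only [pf_def]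
  rw [D_update, D_update, D_update, Submodule.coe_add, map_add, AlternatingMap.map_update_add,
    map_add, map_add]

/-- Although `d` is not `A`-linear, the extra term `y db` vanishes in `B` because `y` is in the
ideal; so the coefficient is multilinear in functions of the ideal. -/
lemma pf_update_smul [DecidableEq (Fin c)] (x : Fin c → algKer φ) (j : Fin c) (b : A)
    (y : algKer φ) (α : Form d A) : C.pf (fun k => Function.update x j (b • y) k) α =
      φ b * C.pf (fun k => Function.update x j y k) α := by
  simp only [pf_def]
  have hy : φ y = 0 := y.2
  rw [D_update, D_update, Submodule.coe_smul, smul_eq_mul, Derivation.leibniz,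
    AlternatingMap.map_update_add, AlternatingMap.map_update_smul,
    AlternatingMap.map_update_smul, map_add, map_smul, map_smul, map_add, smul_eq_mul, smul_eq_mul,
    map_mul, map_mul, hy, zero_mul, add_zero]

lemma pf_eq_zero_of_eq (x : Fin c → algKer φ) {i j : Fin c} (h : x i = x j) (hij : i ≠ j)
    (α : Form d A) : C.pf (fun k => x k) α = 0 := by
  rw [pf_def, AlternatingMap.map_eq_zero_of_eq _ _ (by rw [h]) hij, map_zero, map_zero]

/-- By the Leibniz rule `d(I²)` lies in `I Ω`, which gives coefficients in `I`. -/
lemma pf_eq_zero_of_mem_sq (x : Fin c → algKer φ) (j : Fin c)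
    (h : (x j : A) ∈ algKer φ ^ 2) (α : Form d A) : C.pf (fun k => x k) α = 0 := by
  let p : Ω[A⁄ℂ] →ₗ[A] A := ((C.coeffLeft α).compAlternatingMap
    (exteriorPower.ιMulti A c)).toMultilinearMap.toLinearMap
      (fun k => KaehlerDifferential.D ℂ A (x k : A)) j
  have h₀ : algKer φ • (⊤ : Submodule A Ω[A⁄ℂ]) ≤ Submodule.comap p (algKer φ) := by
    rw [Submodule.smul_le]
    intro a ha y _
    rw [Submodule.mem_comap, map_smul]
    exact Ideal.mul_mem_right _ _ ha
  have h₁ : φ (p (KaehlerDifferential.D ℂ A (x j : A))) = 0 := h₀ (D_mem_of_mem_sq h)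
  have h₂ := Function.update_eq_self j (fun k => KaehlerDifferential.D ℂ A (x k : A))
  rw [pf_def, ← h₂]
  exact h₁

section Normal

variable {R N : Type} [CommRing R] [AddCommGroup N] [Module R N] {ψ : R →+* B}
  (e : N →ₛₗ[ψ] (algKer φ →ₛₗ[(φ : A →+* B)] B))

/-- The values of normal fields at functions in the ideal. -/
def valuesAt (x : Fin c → algKer φ) : N →ₛₗ[ψ] (Fin c → B) where
  toFun ν k := e ν (x k)
  map_add' ν μ := by funext k; rw [map_add]; rfl
  map_smul' a ν := by funext k; rw [map_smulₛₗ]; rfl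

/-- The pairing of `⋀ᶜ` of the normal fields with functions in the ideal. -/
def normalPair (x : Fin c → algKer φ) : (⋀[R]^c N) →ₛₗ[ψ] B := evalPair (valuesAt e x)

lemma normalPair_eq_zero (x : Fin c → algKer φ) (j : Fin c) (h : ∀ μ, e μ (x j) = 0)
    (ν : ⋀[R]^c N) : normalPair e x ν = 0 := by
  induction ν using ext_induction with
  | h₁ ν =>
    rw [normalPair, evalPair_ιMulti]
    exact Matrix.det_eq_zero_of_column_eq_zero j fun i => h (ν i)
  | h₀ => exact map_zero _
  | h₂ ν μ hν hμ => rw [map_add, hν, hμ, add_zero]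
  | h₃ b ν hν => rw [map_smulₛₗ, hν, smul_zero]

/-- As functions of `x`, the coefficient of `dx₁ ∧ ⋯ ∧ dx_c ∧ α` and the pairing with `ν` are both
alternating and both vanish once an entry is in `I²`. By `exists_alternating_eq_smul` passing from
the equations to `x` multiplies them by one common factor. This is why the correspondence need only
be tested on the equations. -/
lemma exists_pf_eq_smul (x : Fin c → algKer φ) : ∃ a : A,
    (∀ α, C.pf (fun k => x k) α = φ a * C.pf (fun k => C.eqn k) α) ∧
    ∀ ν, normalPair e x ν = φ a * normalPair e C.eqn ν := by
  let _ : Algebra A B := (φ : A →+* B).toAlgebra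
  obtain ⟨a, ha⟩ := exists_alternating_eq_smul (N := B) C.eqn
    (Submodule.comap (Submodule.subtype (algKer φ)) (algKer φ ^ 2)) C.eqn_span x
  refine ⟨a, fun α => ?_, fun ν => ?_⟩
  · let k₁ : algKer φ [⋀^Fin c]→ₗ[A] B :=
      { toFun := fun x => C.pf (fun k => x k) α
        map_update_add' := fun x j y z => C.pf_update_add x j y z α
        map_update_smul' := fun x j b y => C.pf_update_smul x j b y α
        map_eq_zero_of_eq' := fun x i j hx hij => C.pf_eq_zero_of_eq x hx hij α }
    exact ha k₁ fun m j hj => C.pf_eq_zero_of_mem_sq m j hj α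
  -- Induction on `ν` only has to exhibit the pairing as an alternating map; for a decomposable `ν`
  -- it is the determinant composed with `x ↦ (e (νⱼ) x)ⱼ`.
  · obtain ⟨k, hk⟩ : ∃ k : algKer φ [⋀^Fin c]→ₗ[A] B, ∀ x, k x = normalPair e x ν := by
      induction ν using ext_induction with
      | h₁ ν =>
        let E : algKer φ →ₗ[A] (Fin c → B) :=
          { toFun := fun x j => e (ν j) x
            map_add' := fun x y => by funext j; exact map_add _ _ _
            map_smul' := fun a x => by funext j; exact (e (ν j)).map_smulₛₗ a x }
        let D : (Fin c → B) [⋀^Fin c]→ₗ[A] B :=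
          { MultilinearMap.restrictScalars A
              (Matrix.detRowAlternating (n := Fin c) (R := B)).toMultilinearMap with
            map_eq_zero_of_eq' := fun v i j h hij =>
              Matrix.detRowAlternating.map_eq_zero_of_eq v h hij }
        refine ⟨D.compLinearMap E, fun x => ?_⟩
        rw [normalPair, evalPair_ιMulti, ← Matrix.det_transpose]
        rfl
      | h₀ => exact ⟨0, fun x => by rw [map_zero]; rfl⟩
      | h₂ ν μ hν hμ =>
        obtain ⟨k, hk⟩ := hν
        obtain ⟨l, hl⟩ := hμ
        exact ⟨k + l, fun x => by rw [map_add, ← hk, ← hl]; rfl⟩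
      | h₃ b ν hν =>
        obtain ⟨k, hk⟩ := hν
        exact ⟨ψ b • k, fun x => by rw [map_smulₛₗ, ← hk]; rfl⟩
    rw [← hk, ← hk, ha k]
    · rfl
    exact fun m j hj => (hk m).trans
      (normalPair_eq_zero e m j (fun μ => normal_sq_eq_zero (fun _ hx => hx) (e μ) hj) ν)

end Normal

end AlgChart

end

section

/-! ### The correspondence between `⋀ᶜ N` and top forms in a chart -/

section IsDual

variable {A B : Type} [CommRing A] [CommRing B] [Algebra ℂ A] [Algebra ℂ B] {φ : A →ₐ[ℂ] B}
variable {R N : Type} [CommRing R] [AddCommGroup N] [Module R N] {ψ : R →+* B}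
  (e : N →ₛₗ[ψ] (algKer φ →ₛₗ[(φ : A →+* B)] B))

/-- The element `ν` of `⋀ᶜ` of the normal fields and the form `w` correspond to each other:
`d i₁ ∧ ⋯ ∧ d i_c ∧ α = ⟨i₁ ∧ ⋯ ∧ i_c, ν⟩ ω` on the subscheme, for all functions `i₁, …, i_c` in
the ideal and all extensions `α` of `w`. -/
def IsDual {n c d : ℕ} (h : c + d = n) (ω : Form n A) (ν : ⋀[R]^c N) (w : Form d B) : Prop :=
  ∀ (x : Fin c → algKer φ) (α : Form d A) (a : A), extMap (kaehlerMap φ) d α = w →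
    a • ω = wedge h (exteriorPower.ιMulti A c fun k => KaehlerDifferential.D ℂ A (x k : A)) α →
      φ a = AlgChart.normalPair e x ν

variable {n c d : ℕ} {ω : Form n A} (C : AlgChart φ ω c d)

namespace AlgChart

lemma exists_extMap_eq {ω : Form n A} (C : AlgChart φ ω c d) (w : Form d B) : ∃ α, extMap (kaehlerMap φ) d α = w := by
  induction w using ext_induction with
  | h₁ v =>
    choose u hu using fun j => kaehlerMap_surjective C.surj (v j)
    exact ⟨exteriorPower.ιMulti A d u, by rw [extMap_ιMulti]; congr 1; funext j; exact hu j⟩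
  | h₀ => exact ⟨0, map_zero _⟩
  | h₂ x y hx hy =>
    obtain ⟨x, rfl⟩ := hx
    obtain ⟨y, rfl⟩ := hy
    exact ⟨x + y, map_add _ _ _⟩
  | h₃ b x hx =>
    obtain ⟨x, rfl⟩ := hx
    obtain ⟨a, rfl⟩ := C.surj b
    exact ⟨a • x, map_smulₛₗ _ _ _⟩

/-- `exists_pf_eq_smul` removes the choice of the functions and `pf_eqn` that of the extension: one
scalar equation remains. -/
lemma isDual_iff (ν : ⋀[R]^c N) (w : Form d B) : IsDual e C.deg ω ν w ↔
    φ C.vol * detForm C.basis w = normalPair e C.eqn ν := by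
  constructor
  · intro h
    obtain ⟨α, rfl⟩ := C.exists_extMap_eq w
    obtain ⟨a, ha, ha'⟩ := C.pf_spec (fun k => C.eqn k) α
    rw [← C.pf_eqn, ← ha]
    exact h _ _ _ rfl ha'
  · rintro h x α a rfl ha
    obtain ⟨b, hb, hb'⟩ := C.exists_pf_eq_smul e x
    rw [← C.pf_eq ha, hb, hb', C.pf_eqn, h]

/-- In the scalar equation `φ vol` is invertible and the determinant is an isomorphism on top forms,
so it can be solved for `w`. -/
lemma existsUnique_isDual (ν : ⋀[R]^c N) : ∃! w, IsDual e C.deg ω ν w := by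
  obtain ⟨u, hu⟩ := C.vol_unit
  obtain ⟨w, hw⟩ := (detForm_bijective C.basis).2 ((u⁻¹ : Bˣ) * normalPair e C.eqn ν)
  refine ⟨w, ?_, fun w' hw' => ?_⟩
  · change IsDual e C.deg ω ν w
    rw [isDual_iff, hw, ← hu, ← mul_assoc, Units.mul_inv, one_mul]
  · have h := (C.isDual_iff e ν w').1 hw'
    apply (detForm_bijective C.basis).1
    rw [hw, ← h, ← hu, ← mul_assoc, Units.inv_mul, one_mul]

/-- Solving the same equation for `ν` requires that the values at the equations be coordinates on
the normal fields. -/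
lemma existsUnique_isDual' {N : Type} [AddCommGroup N] [Module B N]
    (e : N →ₗ[B] (algKer φ →ₛₗ[(φ : A →+* B)] B))
    (h : Function.Bijective (valuesAt e C.eqn)) (w : Form d B) : 
    ∃! ν : ⋀[B]^c N, IsDual e C.deg ω ν w := by
  obtain ⟨h₁, h₂⟩ := evalPair_bijective _ h
  obtain ⟨ν, hν⟩ := h₂ (φ C.vol * detForm C.basis w)
  refine ⟨ν, (C.isDual_iff e ν w).2 hν.symm, fun ν' hν' => ?_⟩
  exact h₁ (((C.isDual_iff e ν' w).1 hν').symm.trans hν.symm)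

/-- The difference `ν - μ` vanishes on the equations and on `I²`, hence on the ideal. -/
lemma normal_ext {B' : Type} [CommRing B'] {ρ : A →+* B'} (hρ : ∀ x ∈ algKer φ, ρ x = 0)
    {ν μ : algKer φ →ₛₗ[ρ] B'} (h : ∀ k, ν (C.eqn k) = μ (C.eqn k)) : ν = μ := by
  have h : Submodule.span A (Set.range C.eqn) ⊔
      Submodule.comap (Submodule.subtype (algKer φ)) (algKer φ ^ 2) ≤ LinearMap.ker (ν - μ) := by
    refine sup_le (Submodule.span_le.2 ?_) fun x hx => normal_sq_eq_zero hρ (ν - μ) hx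
    rintro _ ⟨k, rfl⟩
    change ν _ - μ _ = 0
    rw [h, sub_self]
  ext x
  exact sub_eq_zero.1 (h (C.eqn_span x))

/-- Normal fields on a chart are determined by arbitrary values at the equations. -/
lemma existsUnique_normal (y : Fin c → B) :
    ∃! ν : algKer φ →ₛₗ[(φ : A →+* B)] B, ∀ k, ν (C.eqn k) = y k := by
  refine existsUnique_of_exists_of_unique ?_ ?_
  · obtain ⟨u, hu⟩ := C.vol_unit
    let α : Form d A := exteriorPower.ιMulti A d C.form
    -- A multiple of the dual frame: `ν k` maps `x` to the coefficient of the product in which the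
    -- `k`-th equation is replaced by `x`. At the `l`-th equation it is `φ vol` if `l = k`, and
    -- otherwise a factor is repeated.
    let ν (k : Fin c) : algKer φ →ₛₗ[(φ : A →+* B)] B :=
      { toFun := fun x => C.pf (fun l => Function.update C.eqn k x l) α
        map_add' := fun x y => C.pf_update_add _ _ _ _ _
        map_smul' := fun a x => C.pf_update_smul _ _ _ _ _ }
    have hν : ∀ k l, ν k (C.eqn l) = if l = k then φ C.vol else 0 := by
      intro k l
      change C.pf (fun m => Function.update C.eqn k (C.eqn l) m) α = _
      split_ifs with hkl
      · subst hkl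
        rw [Function.update_eq_self]
        exact C.pf_eq C.vol_eq
      · exact C.pf_eq_zero_of_eq _ (i := k) (j := l) (by simp [hkl]) (Ne.symm hkl) α
    refine ⟨∑ k, ((u⁻¹ : Bˣ) * y k) • ν k, fun l => ?_⟩
    rw [LinearMap.sum_apply, Finset.sum_eq_single l]
    · rw [LinearMap.smul_apply, hν, if_pos rfl, ← hu, smul_eq_mul, mul_right_comm, Units.inv_mul,
        one_mul]
    · intro k _ hk
      rw [LinearMap.smul_apply, hν, if_neg hk.symm, smul_zero]
    · simp
  · intro ν μ hν hμ
    exact C.normal_ext (fun _ hx => hx) fun k => (hν k).trans (hμ k).symm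

end AlgChart

end IsDual

/-! ### Charts on basic open subsets -/

section Restrict

lemma extMap_wedge {A B M N : Type} [CommRing A] [CommRing B] [AddCommGroup M] [Module A M]
    [AddCommGroup N] [Module B N] {φ : A →+* B} (f : M →ₛₗ[φ] N) {r t n : ℕ} (h : r + t = n)
    (v : Fin r → M) (w : Fin t → M) :
    extMap f n (wedge h (exteriorPower.ιMulti A r v) (exteriorPower.ιMulti A t w)) =
      wedge h (exteriorPower.ιMulti B r fun i => f (v i))
        (exteriorPower.ιMulti B t fun i => f (w i)) := by
  subst h
  have h₁ : ∀ {A M : Type} [CommRing A] [AddCommGroup M] [Module A M] (v : Fin r → M)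
      (w : Fin t → M), wedge rfl (exteriorPower.ιMulti A r v) (exteriorPower.ιMulti A t w) =
        exteriorPower.ιMulti A (r + t) (Fin.append v w) := fun v w =>
    Subtype.ext (ιMulti_mul_ιMulti v w)
  rw [h₁, h₁, extMap_ιMulti]
  congr 1
  funext i
  refine Fin.addCases (fun i => ?_) (fun i => ?_) i <;> simp

lemma IsLoc.exists_basis {A B M N : Type} [CommRing A] [CommRing B] [AddCommGroup M] [Module A M]
    [AddCommGroup N] [Module B N] {φ : A →+* B} {s : A} (hφ : IsLocRing φ s) {f : M →ₛₗ[φ] N}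
    (h : IsLoc s f) {r : ℕ} (b : Module.Basis (Fin r) A M) :
    ∃ b' : Module.Basis (Fin r) B N, ∀ j, b' j = f (b j) := by
  let _ : Algebra A B := φ.toAlgebra
  let _ : Module A N := Module.compHom N φ
  have _ : IsScalarTower A B N := IsScalarTower.of_algebraMap_smul fun _ _ => rfl
  have _ := hφ.isLocalization
  let f' : M →ₗ[A] N := { toFun := f, map_add' := f.map_add, map_smul' := f.map_smulₛₗ }
  have _ : IsLocalizedModule (.powers s) f' := h.isLocalizedModule
  exact ⟨b.ofIsLocalizedModule B (.powers s) f', fun j =>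
    b.ofIsLocalizedModule_apply B (.powers s) f' j⟩

variable {A B A' B' : Type} [CommRing A] [CommRing B] [CommRing A'] [CommRing B'] [Algebra ℂ A]
  [Algebra ℂ B] [Algebra ℂ A'] [Algebra ℂ B'] {φ : A →ₐ[ℂ] B} {φ' : A' →ₐ[ℂ] B'} {σ : A →ₐ[ℂ] A'}
  {τ : B →ₐ[ℂ] B'} {n c d : ℕ} {ω : Form n A} {ω' : Form n A'}

/-- The restriction of a chart to a basic open subset. -/
lemma AlgChart.restrict (C : AlgChart φ ω c d) (h : ∀ a, τ (φ a) = φ' (σ a)) {t : A}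
    (hσ : IsLocRing (σ : A →+* A') t) (hτ : IsLocRing (τ : B →+* B') (φ t))
    (hω : extMap (kaehlerMap σ) n ω = ω')
    (hω' : Function.Bijective fun a : A' => a • ω') : 
    ∃ C' : AlgChart φ' ω' c d, ∀ k, (C'.eqn k : A') = σ (C.eqn k) := by
  have hut : IsUnit (φ' (σ t)) := hσ.unit.map (φ' : A' →+* B')
  have hm : ∀ x ∈ algKer φ, σ x ∈ algKer φ' := fun x hx => by
    have hx : φ x = 0 := hx
    change φ' (σ x) = 0
    rw [← h, hx, map_zero]
  obtain ⟨b', hb'⟩ := hτ.kaehlerMap.exists_basis hτ C.basis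
  refine ⟨{ surj := ?_
            deg := C.deg
            gen := hω'
            eqn := fun k => ⟨σ (C.eqn k), hm _ (C.eqn k).2⟩
            form := fun j => kaehlerMap σ (C.form j)
            basis := b'
            basis_eq := ?_
            span := ?_
            vol := σ C.vol
            vol_unit := ?_
            vol_eq := ?_ }, fun k => rfl⟩
  · intro y
    obtain ⟨x, k, hx⟩ := hτ.surj y
    obtain ⟨a, rfl⟩ := C.surj x
    obtain ⟨u, hu⟩ := hσ.unit
    refine ⟨(u⁻¹ : A'ˣ) ^ k * σ a, ?_⟩
    have hu : (u : A') = σ t := hu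
    have hx : τ (φ a) = τ (φ t) ^ k * y := hx
    rw [map_mul, ← h, hx, h, ← hu, ← mul_assoc, ← map_pow φ', ← map_mul φ', ← mul_pow,
      Units.inv_mul, one_pow, map_one, one_mul]
  · intro j
    rw [hb', C.basis_eq, kaehlerMap_comp φ τ (τ.comp φ) (fun _ => rfl),
      kaehlerMap_comp σ φ' (τ.comp φ) (fun a => (h a).symm)]
  · intro x hx
    have hx : φ' x = 0 := hx
    obtain ⟨a, k, ha⟩ := hσ.surj x
    have ha : σ a = σ t ^ k * x := ha
    have h₁ : τ (φ a) = 0 := by rw [h, ha, map_mul, hx, mul_zero]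
    obtain ⟨l, hl⟩ := hτ.inj _ h₁
    -- Clearing denominators: up to a unit, `x` is the image of the element `t ^ l * a` of the
    -- original ideal, to which the spanning property of `C` applies.
    have h₂ : t ^ l * a ∈ algKer φ := by
      change φ (t ^ l * a) = 0
      rw [map_mul, map_pow, hl]
    have h₃ := Ideal.mem_map_of_mem (σ : A →+* A') (C.span _ h₂)
    rw [Ideal.map_sup, Ideal.map_span, Ideal.map_pow] at h₃
    have h₄ : (σ : A →+* A') (t ^ l * a) = σ t ^ (l + k) * x := by
      change σ (t ^ l * a) = _
      rw [map_mul, map_pow, ha, pow_add, mul_assoc]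
    rw [h₄] at h₃
    have h₅ : IsUnit (σ t ^ (l + k)) := hσ.unit.pow _
    have h₆ := (Ideal.unit_mul_mem_iff_mem _ h₅).1 h₃
    refine SetLike.le_def.1 (sup_le_sup (le_of_eq ?_) ?_) h₆
    · rw [← Set.range_comp]; rfl
    · have h₇ : Ideal.map (σ : A →+* A') (algKer φ) ≤ algKer φ' :=
        Ideal.map_le_iff_le_comap.2 fun x hx => hm x hx
      exact Ideal.pow_right_mono h₇ 2
  · rw [← h]
    exact C.vol_unit.map (τ : B →+* B')
  · have h₁ := congrArg (extMap (kaehlerMap σ) n) C.vol_eq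
    rw [map_smulₛₗ, hω, extMap_wedge] at h₁
    refine h₁.trans ?_
    simp only [kaehlerMap_D]

end Restrict

end

section

/-! ### Existence of charts -/

section Existence

/-- The set `S` maps onto the quotient by the span of `v`, which has dimension `c`; representatives
in `S` of a basis of the quotient complete `v`. -/
lemma exists_linearIndependent_sumElim {κ V : Type} [Field κ] [AddCommGroup V] [Module κ V]
    [FiniteDimensional κ V] {c d : ℕ} (hV : Module.finrank κ V = c + d) {v : Fin d → V}
    (hv : LinearIndependent κ v) (S : Set V)
    (hS : ∀ x, ∃ y ∈ S, x - y ∈ Submodule.span κ (Set.range v)) :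
    ∃ s : Fin c → V, (∀ k, s k ∈ S) ∧ LinearIndependent κ (Sum.elim s v) := by
  let P := Submodule.span κ (Set.range v)
  have h₁ : Module.finrank κ (V ⧸ P) = c := by
    have h₂ := P.finrank_quotient_add_finrank
    have h₃ : Module.finrank κ P = d := by
      rw [finrank_span_eq_card hv, Fintype.card_fin]
    omega
  let β := Module.finBasisOfFinrankEq κ (V ⧸ P) h₁
  choose z hz using fun k => Submodule.Quotient.mk_surjective P (β k)
  choose s hs hs' using fun k => hS (z k)
  refine ⟨s, hs, ?_⟩
  have h₂ : LinearIndependent κ (Sum.elim (fun j => v j) s) := by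
    refine LinearIndependent.sumElim_of_quotient (M' := P)
      (f := fun j => ⟨v j, Submodule.subset_span ⟨j, rfl⟩⟩) ?_ s ?_
    · exact LinearIndependent.of_comp P.subtype hv
    · have : (Submodule.Quotient.mk (p := P) ∘ s) = β := by
        funext k
        rw [← hz]
        exact ((Submodule.Quotient.eq P).2 (hs' k)).symm
      rw [this]
      exact β.linearIndependent
  have h₃ := h₂.comp (Sum.swap : Fin c ⊕ Fin d → _) Sum.swap_leftInverse.injective
  convert h₃ using 1
  funext x
  cases x <;> rfl

variable {A B : Type} [CommRing A] [CommRing B] [Algebra ℂ A] [Algebra ℂ B] {φ : A →ₐ[ℂ] B}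

/-- Everything is tested in the fibre of `Ω_A` at a maximal ideal. Lifts of a basis of `Ω_B` stay
independent there, and by the conormal sequence differentials of functions in the ideal fill the
rest of the fibre. Hence `c` of them complete the lifts to a basis, and the determinant is not in
`m`. -/
lemma exists_eqn {n c d : ℕ} (h : c + d = n) (hφ : Function.Surjective φ)
    {ω : Form n A} (gen : Function.Bijective fun a : A => a • ω)
    (ξ : Module.Basis (Fin n) A Ω[A⁄ℂ]) (b : Module.Basis (Fin d) B Ω[B⁄ℂ])
    (m : Ideal B) [m.IsMaximal] :
    ∃ (eqn : Fin c → algKer φ) (form : Fin d → Ω[A⁄ℂ]) (vol : A), φ vol ∉ m ∧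
      (∀ j, b j = kaehlerMap φ (form j)) ∧
      vol • ω = wedge h
        (exteriorPower.ιMulti A c fun k => KaehlerDifferential.D ℂ A (eqn k : A))
        (exteriorPower.ιMulti A d form) := by
  subst h
  choose form hform using fun j => kaehlerMap_surjective hφ (b j)
  let _ : Field (B ⧸ m) := Ideal.Quotient.field m
  let π : A →+* B ⧸ m := (Ideal.Quotient.mk m).comp (φ : A →+* B)
  have hπ : Function.Surjective π := Ideal.Quotient.mk_surjective.comp hφ
  -- Reduction of a form to the fibre at `m`, in the coordinates of the frame `ξ`.
  let Ψ : Ω[A⁄ℂ] →ₛₗ[π] (Fin (c + d) → B ⧸ m) :=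
    { toFun := fun θ i => π (ξ.repr θ i)
      map_add' := fun x y => by funext i; simp
      map_smul' := fun a x => by funext i; simp }
  have hΨI : ∀ θ ∈ algKer φ • (⊤ : Submodule A Ω[A⁄ℂ]), Ψ θ = 0 := fun θ hθ => by
    refine Submodule.smul_induction_on hθ (fun a ha y _ => ?_) fun x y hx hy => ?_
    · have ha : φ a = 0 := ha
      have : π a = 0 := by
        change Ideal.Quotient.mk m (φ a) = 0
        rw [ha, map_zero]
      rw [map_smulₛₗ, this, zero_smul]
    · rw [map_add, hx, hy, add_zero]
  -- If the coordinates of `θ` vanish at `m`, so do those of its restriction; this makes the fibre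
  -- values of the lifted basis independent.
  have hΨ : ∀ θ, Ψ θ = 0 → ∀ j, b.repr (kaehlerMap φ θ) j ∈ m := by
    intro θ hθ j
    rw [← ξ.sum_repr θ, map_sum, map_sum, Finsupp.finsetSum_apply]
    refine Ideal.sum_mem _ fun i _ => ?_
    rw [map_smulₛₗ, map_smul, Finsupp.smul_apply, smul_eq_mul]
    exact Ideal.mul_mem_right _ _ (Ideal.Quotient.eq_zero_iff_mem.1 (congrFun hθ i))
  have hind : LinearIndependent (B ⧸ m) fun j => Ψ (form j) := by
    rw [Fintype.linearIndependent_iff]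
    intro g hg j
    choose a ha using fun j => hπ (g j)
    have h₁ : Ψ (∑ j, a j • form j) = 0 := by
      rw [map_sum, ← hg]
      refine Finset.sum_congr rfl fun j _ => ?_
      rw [map_smulₛₗ, ha]
    have h₂ := hΨ _ h₁ j
    have h₃ : kaehlerMap φ (∑ j, a j • form j) = ∑ j, φ (a j) • b j := by
      rw [map_sum]
      refine Finset.sum_congr rfl fun j _ => ?_
      rw [map_smulₛₗ, hform]
      rfl
    rw [h₃, b.repr_sum_self] at h₂
    rw [← ha]
    exact Ideal.Quotient.eq_zero_iff_mem.2 h₂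
  obtain ⟨s, hs, hs'⟩ := exists_linearIndependent_sumElim (c := c) (by simp) hind
    (Set.range fun x : algKer φ => Ψ (KaehlerDifferential.D ℂ A (x : A))) (by
      intro x
      choose y hy using fun i => hπ (x i)
      obtain ⟨θ, rfl⟩ : ∃ θ, Ψ θ = x := by
        refine ⟨∑ i, y i • ξ i, ?_⟩
        funext i
        change π (ξ.repr _ i) = x i
        rw [ξ.repr_sum_self, hy]
      choose a ha using fun j => hφ (b.repr (kaehlerMap φ θ) j)
      have h₁ : kaehlerMap φ (θ - ∑ j, a j • form j) = 0 := by
        rw [map_sub, sub_eq_zero]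
        conv_lhs => rw [← b.sum_repr (kaehlerMap φ θ)]
        rw [map_sum]
        refine Finset.sum_congr rfl fun j _ => ?_
        rw [map_smulₛₗ, ← ha, hform]
        rfl
      obtain ⟨z, hz, hz'⟩ := exists_D_sub_mem hφ h₁
      refine ⟨_, ⟨⟨z, hz⟩, rfl⟩, ?_⟩
      have h₂ := hΨI _ hz'
      rw [map_sub, map_sub, sub_right_comm, sub_eq_zero] at h₂
      change Ψ θ - Ψ (KaehlerDifferential.D ℂ A z) ∈ _
      rw [h₂, map_sum]
      refine Submodule.sum_mem _ fun j _ => ?_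
      rw [map_smulₛₗ]
      exact Submodule.smul_mem _ _ (Submodule.subset_span ⟨j, rfl⟩))
  choose eqn heqn using hs
  let Θ : Fin (c + d) → Ω[A⁄ℂ] :=
    Fin.append (fun k => KaehlerDifferential.D ℂ A (eqn k : A)) form
  -- The ratio of the frame `ξ` to `ω`. It is a unit because both generate the top forms.
  let r : A := topCoeff gen (exteriorPower.ιMulti A (c + d) ξ)
  have hr : r • ω = exteriorPower.ιMulti A (c + d) ξ := topCoeff_smul gen _
  have hr' : IsUnit r := by
    refine IsUnit.of_mul_eq_one_right (detForm ξ ω) (gen.1 ?_)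
    change (detForm ξ ω * r) • ω = (1 : A) • ω
    rw [mul_smul, hr, detForm_smul, one_smul]
  refine ⟨eqn, form, ξ.det Θ * r, fun hm => ?_, fun j => (hform j).symm, ?_⟩
  · have h₁ : IsUnit (π r) := hr'.map π
    have h₂ : π (ξ.det Θ) * π r = 0 := by
      rw [← map_mul]
      exact Ideal.Quotient.eq_zero_iff_mem.2 hm
    have h₃ : π (ξ.det Θ) = (Matrix.of fun i j => Ψ (Θ i) j).det := by
      rw [Module.Basis.det_apply, RingHom.map_det, ← Matrix.det_transpose]
      rfl
    -- The differentials and forms are a basis of the fibre, so their determinant is nonzero in the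
    -- residue field.
    have h₄ : LinearIndependent (B ⧸ m) fun i => Ψ (Θ i) := by
      have h₅ : (fun i => Ψ (Θ i)) =
          (Sum.elim s fun j => Ψ (form j)) ∘ finSumFinEquiv.symm := by
        funext i
        refine Fin.addCases (fun i => ?_) (fun i => ?_) i
        · simp [Θ, ← heqn]
        · simp [Θ]
      rw [h₅]
      exact hs'.comp _ finSumFinEquiv.symm.injective
    have h₅ : IsUnit (Matrix.of fun i j => Ψ (Θ i) j) :=
      Matrix.linearIndependent_rows_iff_isUnit.1 h₄
    rw [Matrix.isUnit_iff_isUnit_det, ← h₃] at h₅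
    exact (h₅.mul h₁).ne_zero h₂
  · rw [mul_smul, hr]
    apply Subtype.ext
    have h₁ := detForm_smul ξ (exteriorPower.ιMulti A (c + d) Θ)
    rw [detForm_ιMulti] at h₁
    refine (congrArg Subtype.val h₁).trans ?_
    exact (ιMulti_mul_ιMulti _ _).symm

/-- With `vol` invertible, the differentials of the equations and the forms are a basis of `Ω_A`.
Expanding `dx` for `x` in the ideal shows that `x` is a combination of equations up to a function
with differential in `I Ω`, and smoothness of both rings puts that function in `I²`. -/
lemma exists_algChart_of_isUnit {n c d : ℕ} (h : c + d = n) (hφ : Function.Surjective φ)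
    [Algebra.FormallySmooth ℂ A] [Algebra.FormallySmooth ℂ B]
    {ω : Form n A} (gen : Function.Bijective fun a : A => a • ω)
    (ξ : Module.Basis (Fin n) A Ω[A⁄ℂ]) (b : Module.Basis (Fin d) B Ω[B⁄ℂ])
    (eqn : Fin c → algKer φ) (form : Fin d → Ω[A⁄ℂ]) (vol : A) (hvol : IsUnit vol)
    (hform : ∀ j, b j = kaehlerMap φ (form j))
    (hω : vol • ω = wedge h
        (exteriorPower.ιMulti A c fun k => KaehlerDifferential.D ℂ A (eqn k : A))
        (exteriorPower.ιMulti A d form)) : Nonempty (AlgChart φ ω c d) := by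
  refine ⟨⟨hφ, h, gen, eqn, form, b, hform, fun x hx => ?_, vol, hvol.map _, hω⟩⟩
  subst h
  let Θ : Fin (c + d) → Ω[A⁄ℂ] :=
    Fin.append (fun k => KaehlerDifferential.D ℂ A (eqn k : A)) form
  have h₁ : IsUnit (ξ.det Θ) := by
    have h₂ : vol • ω = exteriorPower.ιMulti A (c + d) Θ :=
      hω.trans (Subtype.ext (ιMulti_mul_ιMulti _ _))
    rw [← detForm_ιMulti, ← h₂, map_smul, smul_eq_mul]
    refine hvol.mul (IsUnit.of_mul_eq_one (topCoeff gen (exteriorPower.ιMulti A (c + d) ξ))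
      (gen.1 ?_))
    change (_ * _) • ω = (1 : A) • ω
    rw [mul_comm, mul_comm, mul_smul, topCoeff_smul, detForm_smul, one_smul]
  have h₂ := ((Module.Basis.is_basis_iff_det ξ).2 h₁).2
  have h₃ : KaehlerDifferential.D ℂ A x ∈ Submodule.span A (Set.range Θ) := h₂ ▸ trivial
  obtain ⟨a, ha⟩ := (Submodule.mem_span_range_iff_exists_fun A).1 h₃
  rw [Fin.sum_univ_add] at ha
  simp only [Θ, Fin.append_left, Fin.append_right] at ha
  have hφx : φ x = 0 := hx
  -- Restriction of the expansion of `dx` to `B` kills `dx` and the differentials of the equations;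
  -- the remaining forms restrict to a basis.
  have h₄ : ∀ j, φ (a (Fin.natAdd c j)) = 0 := by
    have h₅ := congrArg (kaehlerMap φ) ha
    have h₆ : ∑ j, φ (a (Fin.natAdd c j)) • b j = 0 := by
      rw [kaehlerMap_D, hφx, map_zero, map_add, map_sum, Finset.sum_eq_zero, zero_add,
        map_sum] at h₅
      · refine (Finset.sum_congr rfl fun j _ => ?_).trans h₅
        rw [map_smulₛₗ, hform]; rfl
      · intro k _
        have : φ (eqn k) = 0 := (eqn k).2
        rw [map_smulₛₗ, kaehlerMap_D, this, map_zero, smul_zero]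
    exact Fintype.linearIndependent_iff.1 b.linearIndependent _ h₆
  let y : A := ∑ k, a (Fin.castAdd d k) * eqn k
  have hy : y ∈ Ideal.span (Set.range fun k => (eqn k : A)) :=
    Ideal.sum_mem _ fun k _ => Ideal.mul_mem_left _ _ (Ideal.subset_span ⟨k, rfl⟩)
  have hy' : y ∈ algKer φ := Ideal.sum_mem _ fun k _ => Ideal.mul_mem_left _ _ (eqn k).2
  -- The coefficients of the forms lie in `I`, and the Leibniz terms of `dy` have the equations as
  -- coefficients, so the differential is in `I Ω`.
  have h₅ : x - y ∈ algKer φ ^ 2 := by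
    refine mem_sq_of_D_mem hφ (sub_mem hx hy') ?_
    have h₆ : KaehlerDifferential.D ℂ A (x - y) = ∑ j, a (Fin.natAdd c j) • form j -
        ∑ k, (eqn k : A) • KaehlerDifferential.D ℂ A (a (Fin.castAdd d k)) := by
      rw [map_sub, ← ha, map_sum]
      simp only [Derivation.leibniz, Finset.sum_add_distrib]
      abel
    rw [h₆]
    exact sub_mem (Submodule.sum_mem _ fun j _ => Submodule.smul_mem_smul (h₄ j) trivial)
      (Submodule.sum_mem _ fun k _ => Submodule.smul_mem_smul (eqn k).2 trivial)
  rw [← add_sub_cancel y x]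
  exact Submodule.add_mem_sup hy h₅

/-- Charts exist near every point of a smooth closed subscheme of a smooth scheme. -/
lemma exists_algChart {n c d : ℕ} (h : c + d = n) (hφ : Function.Surjective φ)
    {ω : Form n A} (gen : Function.Bijective fun a : A => a • ω)
    (ξ : Module.Basis (Fin n) A Ω[A⁄ℂ]) (b : Module.Basis (Fin d) B Ω[B⁄ℂ])
    (p : Ideal B) [p.IsPrime] : ∃ t : A, φ t ∉ p ∧
      -- All models of the localizations are allowed, so that the statement applies directly to
      -- rings of functions on basic open subsets.
      ∀ {A' B' : Type} [CommRing A'] [CommRing B'] [Algebra ℂ A'] [Algebra ℂ B']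
        [Algebra.FormallySmooth ℂ A'] [Algebra.FormallySmooth ℂ B'] {φ' : A' →ₐ[ℂ] B'}
        {σ : A →ₐ[ℂ] A'} {τ : B →ₐ[ℂ] B'} {ω' : Form n A'}, (∀ a, τ (φ a) = φ' (σ a)) →
        IsLocRing (σ : A →+* A') t → IsLocRing (τ : B →+* B') (φ t) → Function.Surjective φ' →
        extMap (kaehlerMap σ) n ω = ω' → (Function.Bijective fun a : A' => a • ω') →
        Nonempty (AlgChart φ' ω' c d) := by
  -- A function that does not vanish at a closed point specializing `p` does not vanish at `p`
  -- either; at `m` the residue ring is a field.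
  obtain ⟨m, hm, hpm⟩ := Ideal.exists_le_maximal p (Ideal.IsPrime.ne_top inferInstance)
  obtain ⟨eqn, form, vol, hvol, hform, hω⟩ := exists_eqn h hφ gen ξ b m
  refine ⟨vol, fun h => hvol (hpm h), ?_⟩
  intro A' B' _ _ _ _ _ _ φ' σ τ ω' hστ hσ hτ hφ' hσω gen'
  obtain ⟨ξ', -⟩ := hσ.kaehlerMap.exists_basis hσ ξ
  obtain ⟨b', hb'⟩ := hτ.kaehlerMap.exists_basis hτ b
  have hm : ∀ x ∈ algKer φ, σ x ∈ algKer φ' := fun x hx => by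
    have hx : φ x = 0 := hx
    change φ' (σ x) = 0
    rw [← hστ, hx, map_zero]
  refine exists_algChart_of_isUnit h hφ' gen' ξ' b' (fun k => ⟨σ (eqn k), hm _ (eqn k).2⟩)
    (fun j => kaehlerMap σ (form j)) (σ vol) hσ.unit (fun j => ?_) ?_
  · rw [hb', hform, kaehlerMap_comp φ τ (τ.comp φ) (fun _ => rfl),
      kaehlerMap_comp σ φ' (τ.comp φ) (fun a => (hστ a).symm)]
  · have h₁ := congrArg (extMap (kaehlerMap σ) n) hω
    rw [map_smulₛₗ, hσω, extMap_wedge] at h₁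
    refine h₁.trans ?_
    simp only [kaehlerMap_D]

end Existence

end

section

/-! ### Functions and differentials on smooth complex schemes -/

section Local

variable {Y : Over SpecC}

lemma res_eq_map {V W : Y.left.Opens} (h : V ≤ W) (x : Γ(Y.left, W)) :
    res Y h x = (Y.left.presheaf.map (homOfLE h).op).hom x := by
  change ((𝟙 Y : Y ⟶ Y).left.appLE W V h).hom x = _
  have : (𝟙 Y : Y ⟶ Y).left.appLE W V h = Y.left.presheaf.map (homOfLE h).op := by
    simp only [Scheme.Hom.appLE, Over.id_left, Scheme.Hom.id_app]
    exact Category.id_comp _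
  rw [this]

lemma res_res {U V W : Y.left.Opens} (h : V ≤ W) (h' : U ≤ V) (x : Γ(Y.left, W)) :
    res Y h' (res Y h x) = res Y (h'.trans h) x :=
  pull_pull (𝟙 Y) (𝟙 Y) (𝟙 Y) (Category.comp_id _) _ _ _ _ _ _ x

lemma res_self {W : Y.left.Opens} (h : W ≤ W) (x : Γ(Y.left, W)) : res Y h x = x :=
  pull_id Y W h x

lemma res_isLocRing {W : Y.left.Opens} (hW : IsAffineOpen W) (t : Γ(Y.left, W))
    {V : Y.left.Opens} (hV : V = Y.left.basicOpen t) (h : V ≤ W) :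
    IsLocRing (res Y h : Γ(Y.left, W) →+* Γ(Y.left, V)) t := by
  let _ := (Y.left.presheaf.map (homOfLE h).op).hom.toAlgebra
  have _ := hW.isLocalization_of_eq_basicOpen t (homOfLE h) hV
  have h₁ := isLocRing_of_isLocalization (A := Γ(Y.left, W)) (B := Γ(Y.left, V)) t
  convert h₁ using 1
  ext x
  exact res_eq_map h x

lemma mem_basicOpen_res {V W : Y.left.Opens} (h : V ≤ W) (t : Γ(Y.left, W)) :
    Y.left.basicOpen (res Y h t) = V ⊓ Y.left.basicOpen t := by
  rw [res_eq_map]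
  exact Scheme.basicOpen_res _ _ _

lemma preimage_basicOpen_pull {Z : Over SpecC} (f : Z ⟶ Y) (W : Y.left.Opens)
    (t : Γ(Y.left, W)) : f.left ⁻¹ᵁ (Y.left.basicOpen t) =
      Z.left.basicOpen (pull f W (f.left ⁻¹ᵁ W) le_rfl t) := by
  rw [Scheme.preimage_basicOpen]
  congr 1
  change _ = (f.left.appLE W _ le_rfl).hom t
  rw [Scheme.Hom.appLE_eq_app]

lemma formallySmooth_sections {n : ℕ} (hY : SmoothOfRelativeDimension n Y.hom) {W : Y.left.Opens}
    (hW : IsAffineOpen W) : Algebra.FormallySmooth ℂ Γ(Y.left, W) := by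
  have := SmoothOfRelativeDimension.smooth n Y.hom
  have h₁ := Y.hom.smooth_appLE (isAffineOpen_top SpecC) hW (le_preimage_top Y W)
  have h₂ : (Scheme.ΓSpecIso (CommRingCat.of ℂ)).inv.hom.Smooth :=
    RingHom.Smooth.of_bijective
      ((Scheme.ΓSpecIso (CommRingCat.of ℂ)).symm.commRingCatIsoToRingEquiv.bijective)
  exact (h₂.comp h₁).formallySmooth

/-- A smooth morphism is locally standard smooth, for which the differentials are free of rank the
relative dimension. -/
lemma exists_basis_kaehler {n : ℕ} (hY : SmoothOfRelativeDimension n Y.hom) (y : Y.left) :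
    ∃ V : Y.left.Opens, IsAffineOpen V ∧ y ∈ V ∧
      Nonempty (Module.Basis (Fin n) Γ(Y.left, V) Ω[Γ(Y.left, V)⁄ℂ]) := by
  obtain ⟨U, hU, V, hV, hy, e, h⟩ :=
    hY.exists_isStandardSmoothOfRelativeDimension y
  -- `Spec ℂ` is a single point, so an open subset containing the image of `y` is everything.
  have hU' : U = ⊤ := by
    have : Subsingleton SpecC := inferInstanceAs (Subsingleton (PrimeSpectrum ℂ))
    refine top_le_iff.1 fun x _ => ?_
    rw [Subsingleton.elim x (Y.hom y)]
    exact e hy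
  subst hU'
  refine ⟨V, hV, hy, ?_⟩
  have h₂ := RingHom.IsStandardSmoothOfRelativeDimension.equiv
      ((Scheme.ΓSpecIso (CommRingCat.of ℂ)).symm.commRingCatIsoToRingEquiv)
  -- The identification of the functions on `Spec ℂ` with `ℂ` is standard smooth of relative
  -- dimension `0`; this is the summand `0`.
  have h₃ : Algebra.IsStandardSmoothOfRelativeDimension (n + 0) ℂ Γ(Y.left, V) := h.comp h₂
  rw [add_zero] at h₃
  have : Nonempty V := ⟨⟨y, hy⟩⟩
  have : Nontrivial Γ(Y.left, V) := inferInstance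
  have h₄ := h₃.isStandardSmooth
  have h₅ := Algebra.IsStandardSmoothOfRelativeDimension.rank_kaehlerDifferential (R := ℂ)
    (S := Γ(Y.left, V)) n
  have : Module.Finite Γ(Y.left, V) Ω[Γ(Y.left, V)⁄ℂ] := Module.finite_of_rank_eq_nat h₅
  exact ⟨Module.finBasisOfFinrankEq _ _ (Module.finrank_eq_of_rank_eq h₅)⟩

lemma exists_basis_kaehler_basicOpen {V U : Y.left.Opens} (hV : IsAffineOpen V) {n : ℕ}
    (b : Module.Basis (Fin n) Γ(Y.left, V) Ω[Γ(Y.left, V)⁄ℂ]) (t : Γ(Y.left, V))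
    (hU : U = Y.left.basicOpen t) :
    Nonempty (Module.Basis (Fin n) Γ(Y.left, U) Ω[Γ(Y.left, U)⁄ℂ]) := by
  have h : U ≤ V := hU.trans_le (Y.left.basicOpen_le t)
  have h₁ := res_isLocRing hV t hU h
  obtain ⟨b', -⟩ := h₁.kaehlerMap.exists_basis h₁ b
  exact ⟨b'⟩

/-- Equality of functions can be checked locally. -/
lemma eq_of_locally_eq {V : Y.left.Opens} {x y : Γ(Y.left, V)}
    (h : ∀ z ∈ V, ∃ (V' : Y.left.Opens) (h : V' ≤ V), z ∈ V' ∧ res Y h x = res Y h y) :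
    x = y := by
  refine Y.left.sheaf.eq_of_locally_eq' (ι := V) (fun z => (h z.1 z.2).choose) V
    (fun z => homOfLE (h z.1 z.2).choose_spec.choose) (fun z hz => ?_) x y fun z => ?_
  · exact Opens.mem_iSup.2 ⟨⟨z, hz⟩, (h z hz).choose_spec.choose_spec.1⟩
  · have := (h z.1 z.2).choose_spec.choose_spec.2
    rw [res_eq_map, res_eq_map] at this
    exact this

/-- Compatible local functions can be glued. -/
lemma exists_glue {ι : Type} {V : Y.left.Opens} (U : ι → Y.left.Opens) (hU : ∀ i, U i ≤ V)
    (hV : ∀ z ∈ V, ∃ i, z ∈ U i) (x : ∀ i, Γ(Y.left, U i))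
    (hx : ∀ i j, ∀ z ∈ U i ⊓ U j, ∃ (V' : Y.left.Opens) (hi : V' ≤ U i) (hj : V' ≤ U j), z ∈ V' ∧
      res Y hi (x i) = res Y hj (x j)) :
    ∃ y : Γ(Y.left, V), ∀ i, res Y (hU i) y = x i := by
  obtain ⟨y, hy, -⟩ := Y.left.sheaf.existsUnique_gluing' U V (fun i => homOfLE (hU i))
    (fun z hz => Opens.mem_iSup.2 (hV z hz)) x (by
      intro i j
      have : res Y (inf_le_left : U i ⊓ U j ≤ U i) (x i) =
          res Y (inf_le_right : U i ⊓ U j ≤ U j) (x j) := by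
        refine eq_of_locally_eq fun z hz => ?_
        obtain ⟨V', hi, hj, hz', h⟩ := hx i j z hz
        refine ⟨V', le_inf hi hj, hz', ?_⟩
        rw [res_res, res_res]
        exact h
      rw [res_eq_map, res_eq_map] at this
      exact this)
  exact ⟨y, fun i => (res_eq_map _ _).trans (hy i)⟩

end Local

/-- An immersion of codimension `c` of a smooth scheme of dimension `d` into a smooth scheme of
dimension `n` with a nowhere vanishing form `ω` of top degree. -/
structure IsVolumeImmersion (f : Mor) (n c d : ℕ)
    (ω : ∀ U : f.tgt.left.affineOpens, Form n Γ(f.tgt.left, U.1)) : Prop where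
  deg : c + d = n
  smooth_tgt : SmoothOfRelativeDimension n f.tgt.hom
  smooth_src : SmoothOfRelativeDimension d f.src.hom
  imm : IsImmersion f.hom.left
  form_res : ∀ (U V : f.tgt.left.affineOpens) (hV : V.1 ≤ U.1), formPull (𝟙 f.tgt) n hV (ω U) = ω V
  gen : ∀ U : f.tgt.left.affineOpens, Function.Bijective fun a : Γ(f.tgt.left, U.1) => a • ω U

/-- A chart of the target: an affine open subset with affine preimage on which the immersion is
described by equations. -/
structure IsChart (f : Mor) {n : ℕ} (ω : ∀ U : f.tgt.left.affineOpens, Form n Γ(f.tgt.left, U.1))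
    (c d : ℕ) (W : f.tgt.left.affineOpens) : Prop where
  affine : IsAffineOpen (f.hom.left ⁻¹ᵁ W.1)
  chart : Nonempty (AlgChart (f.sharp W.1) (ω W) c d)

/-! ### Charts of an immersion into a scheme with a volume form -/

section Chart

variable {f : Mor} {n c d : ℕ} {ω : ∀ U : f.tgt.left.affineOpens, Form n Γ(f.tgt.left, U.1)}

/-- An immersion is a closed immersion into the open set `coborderRange`. Over an affine open subset
of it the preimage is therefore closed in an affine scheme. -/
lemma isAffineOpen_and_surjective (h : IsImmersion f.hom.left) {W : f.tgt.left.Opens}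
    (hW : IsAffineOpen W) (hW' : W ≤ f.hom.left.coborderRange) :
    IsAffineOpen (f.hom.left ⁻¹ᵁ W) ∧ Function.Surjective (f.sharp W) := by
  set g := f.hom.left with hg
  let ι := g.coborderRange.ι
  have hr : W ≤ ι.opensRange := by
    rw [Scheme.Opens.opensRange_ι]; exact hW'
  have h₀ : IsAffineOpen (ι ⁻¹ᵁ W) := hW.preimage_of_isOpenImmersion ι hr
  have h₁ : IsAffineOpen (g.liftCoborder ⁻¹ᵁ (ι ⁻¹ᵁ W)) := h₀.preimage g.liftCoborder
  have h₂ : g.liftCoborder ⁻¹ᵁ (ι ⁻¹ᵁ W) = g ⁻¹ᵁ W := by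
    conv_rhs => rw [← g.liftCoborder_ι]
    rfl
  refine ⟨h₂ ▸ h₁, ?_⟩
  have h₃ := g.liftCoborder.app_surjective _ h₀
  have h₄ : IsIso (ι.app W) := Scheme.Hom.isIso_app ι W hr
  -- The open subset and the morphism are made variables so that the factorization of `g` can be
  -- substituted.
  have h₅ : ∀ (V : f.src.left.Opens) (_ : V = g.liftCoborder ⁻¹ᵁ (ι ⁻¹ᵁ W))
      (k : f.src.left ⟶ f.tgt.left) (_ : k = g.liftCoborder ≫ ι) (e : V ≤ k ⁻¹ᵁ W),
      Function.Surjective (k.appLE W V e).hom := by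
    rintro V rfl k rfl e
    have h₆ : (g.liftCoborder ≫ ι).appLE W (g.liftCoborder ⁻¹ᵁ (ι ⁻¹ᵁ W)) e =
        (g.liftCoborder ≫ ι).app W := Scheme.Hom.appLE_eq_app _
    rw [h₆, Scheme.Hom.comp_app]
    exact h₃.comp (ConcreteCategory.bijective_of_isIso (ι.app W)).2
  exact h₅ _ h₂.symm g g.liftCoborder_ι.symm le_rfl

lemma IsVolumeImmersion.restrict (H : IsVolumeImmersion f n c d ω) {W W' : f.tgt.left.affineOpens}
    (hW : IsAffineOpen (f.hom.left ⁻¹ᵁ W.1)) (C : AlgChart (f.sharp W.1) (ω W) c d)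
    (t : f.Fun W.1) (hW' : W'.1 = f.tgt.left.basicOpen t) (h : W'.1 ≤ W.1) :
    ∃ C' : AlgChart (f.sharp W'.1) (ω W') c d, ∀ k, (C'.eqn k : f.Fun W'.1) =
      res f.tgt h (C.eqn k) := by
  have h₁ : f.hom.left ⁻¹ᵁ W'.1 = f.src.left.basicOpen (f.sharp W.1 t) := by
    rw [hW', preimage_basicOpen_pull]
  exact C.restrict (σ := res f.tgt h)
    (τ := res f.src (f.preimage_mono h)) (fun a => (f.sharp_res h a).symm)
    (res_isLocRing W.2 t hW' h) (res_isLocRing hW _ h₁ _) (H.form_res W W' h) (H.gen W')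

lemma IsVolumeImmersion.isChart_basicOpen (H : IsVolumeImmersion f n c d ω)
    {W W' : f.tgt.left.affineOpens} (h : IsChart f ω c d W) (t : f.Fun W.1)
    (hW' : W'.1 = f.tgt.left.basicOpen t) : IsChart f ω c d W' where
  affine := by
    rw [hW', preimage_basicOpen_pull]
    exact h.affine.basicOpen _
  chart := by
    obtain ⟨C⟩ := h.chart
    obtain ⟨C', -⟩ := H.restrict h.affine C t hW' (hW'.trans_le (f.tgt.left.basicOpen_le t))
    exact ⟨C'⟩

/-- The target is shrunk until the immersion is closed over it, then until the differentials of
target and source are free, and then as `exists_algChart` demands. The last shrinking makes the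
preimage also a basic open subset of the given affine `V`. -/
lemma IsVolumeImmersion.exists_chart (H : IsVolumeImmersion f n c d ω) {V : f.src.left.Opens}
    (hV : IsAffineOpen V) {z : f.src.left} (hz : z ∈ V) (W₀ : f.tgt.left.Opens)
    (hz₀ : f.hom.left z ∈ W₀) : ∃ W, IsChart f ω c d W ∧ W.1 ≤ W₀ ∧
      ∃ s : Γ(f.src.left, V), z ∈ f.src.left.basicOpen s ∧
        f.hom.left ⁻¹ᵁ W.1 = f.src.left.basicOpen s := by
  have := H.imm
  have hz' : f.hom.left z ∈ f.hom.left.coborderRange := subset_coborder ⟨z, rfl⟩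
  obtain ⟨W₁, hW₁, hzW₁, hle₁⟩ := exists_isAffineOpen_mem_and_subset
    (U := W₀ ⊓ f.hom.left.coborderRange) ⟨hz₀, hz'⟩
  obtain ⟨Y₁, hY₁, hzY₁, ⟨b₁⟩⟩ := exists_basis_kaehler H.smooth_tgt (f.hom.left z)
  obtain ⟨t₁, t₁', ht₁, hzt₁⟩ := exists_basicOpen_le_affine_inter hW₁ hY₁ _ ⟨hzW₁, hzY₁⟩
  obtain ⟨b₂⟩ := exists_basis_kaehler_basicOpen hY₁ b₁ t₁' ht₁
  have hW₂ : IsAffineOpen (f.tgt.left.basicOpen t₁) := hW₁.basicOpen t₁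
  have hle₂ : f.tgt.left.basicOpen t₁ ≤ W₀ ⊓ f.hom.left.coborderRange :=
    (f.tgt.left.basicOpen_le t₁).trans hle₁
  generalize f.tgt.left.basicOpen t₁ = W₂ at *
  obtain ⟨hV₂, hs₂⟩ := isAffineOpen_and_surjective H.imm hW₂ (hle₂.trans inf_le_right)
  obtain ⟨V₁, hV₁, hzV₁, ⟨b₃⟩⟩ := exists_basis_kaehler H.smooth_src z
  obtain ⟨s₂, s₂', hs₂', hzs₂⟩ := exists_basicOpen_le_affine_inter hV₂ hV₁ z ⟨hzt₁, hzV₁⟩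
  obtain ⟨t₂, rfl⟩ := hs₂ s₂
  rw [← preimage_basicOpen_pull] at hs₂' hzs₂
  obtain ⟨b₄⟩ := exists_basis_kaehler_basicOpen hW₂ b₂ t₂ rfl
  have hW₃ : IsAffineOpen (f.tgt.left.basicOpen t₂) := hW₂.basicOpen t₂
  have hle₃ : f.tgt.left.basicOpen t₂ ≤ W₀ ⊓ f.hom.left.coborderRange :=
    (f.tgt.left.basicOpen_le t₂).trans hle₂
  generalize f.tgt.left.basicOpen t₂ = W₃ at *
  obtain ⟨b₅⟩ := exists_basis_kaehler_basicOpen hV₁ b₃ s₂' hs₂'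
  obtain ⟨hV₃, hs₃⟩ := isAffineOpen_and_surjective H.imm hW₃ (hle₃.trans inf_le_right)
  -- The prime ideal of the point `z` in the ring of functions on the preimage.
  let p : Ideal (f.Fib W₃) := (IsLocalRing.maximalIdeal (f.src.left.presheaf.stalk z)).comap
    (f.src.left.presheaf.germ (f.hom.left ⁻¹ᵁ W₃) z hzs₂).hom
  obtain ⟨t, ht, ht'⟩ := exists_algChart H.deg hs₃ (H.gen ⟨W₃, hW₃⟩) b₄ b₅ p
  let W₄ : f.tgt.left.affineOpens := ⟨f.tgt.left.basicOpen t, hW₃.basicOpen t⟩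
  have hle₄ : W₄.1 ≤ W₃ := f.tgt.left.basicOpen_le t
  have hV₄ : f.hom.left ⁻¹ᵁ W₄.1 = f.src.left.basicOpen (f.sharp W₃ t) :=
    preimage_basicOpen_pull _ _ _
  have hz₄ : z ∈ f.hom.left ⁻¹ᵁ W₄.1 := by
    rw [hV₄, Scheme.mem_basicOpen _ _ _ hzs₂]
    exact IsLocalRing.notMem_maximalIdeal.1 ht
  have hc : IsChart f ω c d W₄ := by
    obtain ⟨hV₅, hs₅⟩ := isAffineOpen_and_surjective H.imm W₄.2
      ((hle₄.trans hle₃).trans inf_le_right)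
    have := formallySmooth_sections H.smooth_tgt W₄.2
    have := formallySmooth_sections H.smooth_src hV₅
    exact ⟨hV₅, ht' (σ := res f.tgt hle₄)
      (τ := res f.src (f.preimage_mono hle₄)) (fun a => (f.sharp_res hle₄ a).symm)
      (res_isLocRing hW₃ t rfl hle₄) (res_isLocRing hV₃ _ hV₄ _) hs₅ (H.form_res ⟨W₃, hW₃⟩ W₄ hle₄)
      (H.gen W₄)⟩
  -- A common basic open subset of `V` and of the preimage. Its equation `s'` lifts to the target by
  -- surjectivity of `f^♯`, so it is itself the preimage of a basic open subset.
  obtain ⟨s', s, hss, hzs⟩ := exists_basicOpen_le_affine_inter hc.affine hV z ⟨hz₄, hz⟩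
  obtain ⟨C⟩ := hc.chart
  obtain ⟨t₅, rfl⟩ := C.surj s'
  refine ⟨⟨f.tgt.left.basicOpen t₅, W₄.2.basicOpen t₅⟩, H.isChart_basicOpen hc t₅ rfl,
    (f.tgt.left.basicOpen_le t₅).trans (hle₄.trans (hle₃.trans inf_le_left)), s, ?_, ?_⟩
  · rw [← hss]; exact hzs
  · rw [← hss]; exact preimage_basicOpen_pull _ _ _

end Chart

end

section

/-! ### Restriction and gluing of normal fields -/

section Nor

variable {f : Mor}

/-- Restriction of normal fields. -/
abbrev norRes (f : Mor) {V V' : f.src.left.Opens} (h : V' ≤ V) :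
    f.Nor V →ₛₗ[(res f.src h : Γ(f.src.left, V) →+* Γ(f.src.left, V'))] f.Nor V' :=
  Mor.norPull (MorIso.refl f) h

lemma norRes_ev {V V' : f.src.left.Opens} (h : V' ≤ V) (ν : f.Nor V) (W : f.Idx V')
    (a : f.ideal W.1) : (norRes f h ν).1.ev W a = ν.1.ev ⟨W.1, W.2.trans h⟩ a := by
  refine (Mor.norPull_apply (MorIso.refl f) h ν W a).trans ?_
  have h₁ : (⟨Mor.isoFun (MorIso.refl f) W.1 a.1, Mor.isoFun_mem (MorIso.refl f) W.1 a.1 a.2⟩ :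
      f.ideal (Mor.isoIdx (MorIso.refl f) h W).1) =
      ⟨res f.tgt (Mor.isoIdx_id_le (MorIso.refl f) rfl W.1) a.1, f.res_mem_ideal _ a.2⟩ :=
    Subtype.ext (Mor.isoFun_id (MorIso.refl f) rfl W.1 a.1)
  rw [h₁, ν.2 ⟨W.1, W.2.trans h⟩ (Mor.isoIdx (MorIso.refl f) h W)
    (Mor.isoIdx_id_le (MorIso.refl f) rfl W.1) a]
  exact Mor.isoFib_id (MorIso.refl f) rfl rfl W.1 _

lemma norRes_smul {V V' : f.src.left.Opens} (h : V' ≤ V) (a : Γ(f.src.left, V)) (ν : f.Nor V) :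
    norRes f h (a • ν) = res f.src h a • norRes f h ν := map_smulₛₗ _ _ _

lemma norRes_norRes {V V' V'' : f.src.left.Opens} (h : V' ≤ V) (h' : V'' ≤ V') (ν : f.Nor V) :
    norRes f h' (norRes f h ν) = norRes f (h'.trans h) ν := by
  apply Subtype.ext
  apply Mor.nor_ext
  intro W a
  rw [norRes_ev, norRes_ev, norRes_ev]

/-- The value of a normal field on an open subset. -/
def norEv {V : f.src.left.Opens} (W : f.Idx V) :
    f.Nor V →ₛₗ[(res f.src W.2 : Γ(f.src.left, V) →+* f.Fib W.1)]
      (f.ideal W.1 →ₛₗ[(f.sharp W.1 : f.Fun W.1 →+* f.Fib W.1)] f.Fib W.1) where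
  toFun ν := ν.1.ev W
  map_add' _ _ := rfl
  map_smul' _ _ := rfl

/-- The values are functions on the source, and functions can be compared on a cover. -/
lemma nor_eq_of_basis {V : f.src.left.Opens} (J : f.tgt.left.Opens → Prop)
    (hJ : ∀ W, J W → f.hom.left ⁻¹ᵁ W ≤ V)
    (hJ' : ∀ z ∈ V, ∀ W, f.hom.left z ∈ W → ∃ W', J W' ∧ f.hom.left z ∈ W' ∧ W' ≤ W)
    {ν μ : f.Nor V} (h : ∀ W (hW : J W), ν.1.ev ⟨W, hJ W hW⟩ = μ.1.ev ⟨W, hJ W hW⟩) : ν = μ := by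
  apply Subtype.ext
  apply Mor.nor_ext
  intro W a
  refine eq_of_locally_eq fun z hz => ?_
  obtain ⟨W', hW', hz', hle⟩ := hJ' z (W.2 hz) W.1 hz
  refine ⟨f.hom.left ⁻¹ᵁ W', f.preimage_mono hle, hz', ?_⟩
  have h₁ := ν.2 W ⟨W', hJ W' hW'⟩ hle a
  have h₂ := μ.2 W ⟨W', hJ W' hW'⟩ hle a
  rw [h W' hW'] at h₁
  exact h₁.symm.trans h₂

/-- Normal fields can be glued from a basis of open subsets. -/
lemma exists_nor_of_basis {V : f.src.left.Opens} (J : f.tgt.left.Opens → Prop)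
    (hJ : ∀ W, J W → f.hom.left ⁻¹ᵁ W ≤ V)
    (hJ' : ∀ z ∈ V, ∀ W, f.hom.left z ∈ W → ∃ W', J W' ∧ f.hom.left z ∈ W' ∧ W' ≤ W)
    (ν : ∀ W, J W → (f.ideal W →ₛₗ[(f.sharp W : f.Fun W →+* f.Fib W)] f.Fib W))
    (hν : ∀ W W' (hW : J W) (hW' : J W') (h : W' ≤ W) (a : f.ideal W),
      ν W' hW' ⟨res f.tgt h a.1, f.res_mem_ideal h a.2⟩ = res f.src (f.preimage_mono h) (ν W hW a)) :
    ∃ μ : f.Nor V, ∀ W (hW : J W), μ.1.ev ⟨W, hJ W hW⟩ = ν W hW := by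
  -- The value at an arbitrary `W` is glued from the given values at the members of `J` inside `W`.
  have key : ∀ (W : f.Idx V) (a : f.ideal W.1), ∃ y : f.Fib W.1, ∀ W' (hW' : J W')
      (h : W' ≤ W.1), res f.src (f.preimage_mono h) y =
        ν W' hW' ⟨res f.tgt h a.1, f.res_mem_ideal h a.2⟩ := by
    intro W a
    obtain ⟨y, hy⟩ := exists_glue (Y := f.src) (V := f.hom.left ⁻¹ᵁ W.1)
      (ι := {W' : f.tgt.left.Opens // J W' ∧ W' ≤ W.1}) (fun W' => f.hom.left ⁻¹ᵁ W'.1)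
      (fun W' => f.preimage_mono W'.2.2) (fun z hz => by
        obtain ⟨W', hW', hz', hle⟩ := hJ' z (W.2 hz) W.1 hz
        exact ⟨⟨W', hW', hle⟩, hz'⟩)
      (fun W' => ν W'.1 W'.2.1 ⟨res f.tgt W'.2.2 a.1, f.res_mem_ideal W'.2.2 a.2⟩) (by
        intro i j z hz
        obtain ⟨W', hW', hz', hle⟩ := hJ' z (hJ _ i.2.1 hz.1) (i.1 ⊓ j.1) hz
        refine ⟨f.hom.left ⁻¹ᵁ W', f.preimage_mono (hle.trans inf_le_left),
          f.preimage_mono (hle.trans inf_le_right), hz', ?_⟩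
        rw [← hν i.1 W' i.2.1 hW' (hle.trans inf_le_left),
          ← hν j.1 W' j.2.1 hW' (hle.trans inf_le_right)]
        congr 1
        apply Subtype.ext
        exact (res_res _ _ _).trans (res_res _ _ _).symm)
    exact ⟨y, fun W' hW' h => hy ⟨W', hW', h⟩⟩
  -- Linearity and compatibility of the glued values are identities of functions, so they may be
  -- checked on the members of `J`.
  have uniq : ∀ (W : f.Idx V) (x y : f.Fib W.1), (∀ W' (_ : J W') (h : W' ≤ W.1),
      res f.src (f.preimage_mono h) x = res f.src (f.preimage_mono h) y) → x = y := by
    intro W x y h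
    refine eq_of_locally_eq fun z hz => ?_
    obtain ⟨W', hW', hz', hle⟩ := hJ' z (W.2 hz) W.1 hz
    exact ⟨f.hom.left ⁻¹ᵁ W', f.preimage_mono hle, hz', h W' hW' hle⟩
  choose y hy using key
  refine ⟨⟨fun W =>
    { toFun := y W
      map_add' := fun a b => uniq W _ _ fun W' hW' h => ?_
      map_smul' := fun r a => uniq W _ _ fun W' hW' h => ?_ }, ?_⟩, ?_⟩
  · rw [map_add, hy W _ W' hW' h, hy W _ W' hW' h, hy W _ W' hW' h, ← map_add]
    congr 1
    exact Subtype.ext (map_add (res f.tgt h) _ _)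
  · rw [smul_eq_mul, map_mul, hy W _ W' hW' h, hy W _ W' hW' h]
    have h₁ : (⟨res f.tgt h (r • a).1, f.res_mem_ideal h (r • a).2⟩ : f.ideal W') =
        res f.tgt h r • ⟨res f.tgt h a.1, f.res_mem_ideal h a.2⟩ :=
      Subtype.ext (map_mul (res f.tgt h) _ _)
    rw [h₁, map_smulₛₗ, smul_eq_mul]
    congr 1
    exact f.sharp_res h r
  · intro W W' h a
    refine uniq W' _ _ fun W'' hW'' h' => ?_
    change res f.src _ (y W' _) = res f.src _ (res f.src _ (y W a))
    refine (hy W' _ W'' hW'' h').trans ?_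
    refine Eq.trans ?_ (res_res (f.preimage_mono h) (f.preimage_mono h') (y W a)).symm
    refine Eq.trans ?_ (hy W a W'' hW'' (h'.trans h)).symm
    congr 1
    exact Subtype.ext (res_res _ _ _)
  · intro W hW
    ext a
    refine uniq ⟨W, hJ W hW⟩ _ _ fun W' hW' h => ?_
    change res f.src _ (y ⟨W, hJ W hW⟩ a) = _
    rw [hy ⟨W, hJ W hW⟩ a W' hW' h]
    exact hν W W' hW hW' h a

/-- An immersion is a topological embedding, so `V` is the preimage of an open set `O`, which may be
intersected with `W`. -/
lemma exists_preimage_le (hf : IsImmersion f.hom.left) {V : f.src.left.Opens} {z : f.src.left}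
    (hz : z ∈ V) (W : f.tgt.left.Opens) (hW : f.hom.left z ∈ W) :
    ∃ W' : f.tgt.left.Opens, f.hom.left z ∈ W' ∧ W' ≤ W ∧ f.hom.left ⁻¹ᵁ W' ≤ V := by
  obtain ⟨O, hO, hO'⟩ := f.hom.left.isEmbedding.isInducing.isOpen_iff.1 V.2
  have h : ∀ x, f.hom.left x ∈ O ↔ x ∈ V := fun x => Set.ext_iff.1 hO' x
  exact ⟨⟨O, hO⟩ ⊓ W, ⟨(h z).2 hz, hW⟩, inf_le_right, fun x hx => (h x).1 hx.1⟩

lemma nor_eq_of_cover (hf : IsImmersion f.hom.left) {ι : Type} {V : f.src.left.Opens}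
    (U : ι → f.src.left.Opens) (hU : ∀ i, U i ≤ V) (hV : ∀ z ∈ V, ∃ i, z ∈ U i) {ν μ : f.Nor V}
    (h : ∀ i, norRes f (hU i) ν = norRes f (hU i) μ) : ν = μ := by
  refine nor_eq_of_basis (fun W => ∃ i, f.hom.left ⁻¹ᵁ W ≤ U i)
    (fun W ⟨i, hi⟩ => hi.trans (hU i)) (fun z hz W hW => ?_) ?_
  · obtain ⟨i, hi⟩ := hV z hz
    obtain ⟨W', h₁, h₂, h₃⟩ := exists_preimage_le hf hi W hW
    exact ⟨W', ⟨i, h₃⟩, h₁, h₂⟩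
  · rintro W ⟨i, hi⟩
    ext a
    have h₁ := norRes_ev (hU i) ν ⟨W, hi⟩ a
    rw [h i, norRes_ev] at h₁
    exact h₁.symm

lemma exists_nor_glue (hf : IsImmersion f.hom.left) {ι : Type} {V : f.src.left.Opens}
    (U : ι → f.src.left.Opens) (hU : ∀ i, U i ≤ V) (hV : ∀ z ∈ V, ∃ i, z ∈ U i)
    (ν : ∀ i, f.Nor (U i)) (h : ∀ i j, norRes f (inf_le_left : U i ⊓ U j ≤ U i) (ν i) =
      norRes f (inf_le_right : U i ⊓ U j ≤ U j) (ν j)) :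
    ∃ μ : f.Nor V, ∀ i, norRes f (hU i) μ = ν i := by
  -- The value at `W` does not depend on the member of the cover that contains the preimage of `W`,
  -- so an arbitrary choice of that member is harmless below.
  have key : ∀ i j W (hi : f.hom.left ⁻¹ᵁ W ≤ U i) (hj : f.hom.left ⁻¹ᵁ W ≤ U j),
      (ν i).1.ev ⟨W, hi⟩ = (ν j).1.ev ⟨W, hj⟩ := by
    intro i j W hi hj
    ext a
    have h₁ := norRes_ev (inf_le_left : U i ⊓ U j ≤ U i) (ν i) ⟨W, le_inf hi hj⟩ a
    rw [h i j, norRes_ev] at h₁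
    exact h₁.symm
  obtain ⟨μ, hμ⟩ := exists_nor_of_basis (V := V) (fun W => ∃ i, f.hom.left ⁻¹ᵁ W ≤ U i)
    (fun W ⟨i, hi⟩ => hi.trans (hU i)) (fun z hz W hW => by
      obtain ⟨i, hi⟩ := hV z hz
      obtain ⟨W', h₁, h₂, h₃⟩ := exists_preimage_le hf hi W hW
      exact ⟨W', ⟨i, h₃⟩, h₁, h₂⟩) (fun W hW => (ν hW.choose).1.ev ⟨W, hW.choose_spec⟩) (by
      intro W W' hW hW' hle a
      rw [key _ hW.choose W' hW'.choose_spec ((f.preimage_mono hle).trans hW.choose_spec)]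
      exact (ν hW.choose).2 ⟨W, hW.choose_spec⟩ ⟨W', _⟩ hle a)
  refine ⟨μ, fun i => ?_⟩
  apply Subtype.ext
  apply Mor.nor_ext
  intro W a
  rw [norRes_ev]
  have hW : ∃ i, f.hom.left ⁻¹ᵁ W.1 ≤ U i := ⟨i, W.2⟩
  exact (LinearMap.congr_fun (hμ W.1 hW) a).trans
    (LinearMap.congr_fun (key hW.choose i W.1 hW.choose_spec W.2) a)

end Nor

/-! ### Normal fields on a chart -/

section NorChart

variable {f : Mor} {n c d : ℕ} {ω : ∀ U : f.tgt.left.affineOpens, Form n Γ(f.tgt.left, U.1)}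
  (H : IsVolumeImmersion f n c d ω)

include H

/-- The normal fields on a chart are free, with coordinates the values at the equations. -/
lemma nor_chart_bijective {W : f.tgt.left.affineOpens} (hW : IsAffineOpen (f.hom.left ⁻¹ᵁ W.1))
    (C : AlgChart (f.sharp W.1) (ω W) c d) :
    Function.Bijective fun (ν : f.Nor (f.hom.left ⁻¹ᵁ W.1)) (k : Fin c) =>
      ν.1.ev ⟨W.1, le_rfl⟩ (C.eqn k) := by
  have hJ : ∀ W', (∃ t : f.Fun W.1, W' = f.tgt.left.basicOpen t) → W' ≤ W.1 := by
    rintro _ ⟨t, rfl⟩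
    exact f.tgt.left.basicOpen_le t
  have hJ₁ : ∀ z ∈ f.hom.left ⁻¹ᵁ W.1, ∀ W', f.hom.left z ∈ W' →
      ∃ W'', (∃ t : f.Fun W.1, W'' = f.tgt.left.basicOpen t) ∧ f.hom.left z ∈ W'' ∧ W'' ≤ W' := by
    intro z hz W' hW'
    obtain ⟨t, h₁, h₂⟩ := W.2.exists_basicOpen_le ⟨_, hW'⟩ hz
    exact ⟨_, ⟨t, rfl⟩, h₂, h₁⟩
  -- Each basic open subset carries the restricted chart, with the same equations.
  have hC : ∀ W' (hW' : ∃ t : f.Fun W.1, W' = f.tgt.left.basicOpen t), 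
      ∃ (hA : IsAffineOpen W') (C' : AlgChart (f.sharp W') (ω ⟨W', hA⟩) c d),
        ∀ k, (C'.eqn k : f.Fun W') = res f.tgt (hJ W' hW') (C.eqn k) := by
    rintro W' ⟨t, rfl⟩
    exact ⟨W.2.basicOpen t, H.restrict (W' := ⟨_, W.2.basicOpen t⟩) hW C t rfl _⟩
  choose hA C' hC' using hC
  constructor
  · intro ν μ h
    refine nor_eq_of_basis _ (fun W' h => f.preimage_mono (hJ W' h)) hJ₁ fun W' hW' => ?_
    refine (C' W' hW').normal_ext (fun _ hx => hx) fun k => ?_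
    have h₁ := ν.2 ⟨W.1, le_rfl⟩ ⟨W', f.preimage_mono (hJ W' hW')⟩ (hJ W' hW') (C.eqn k)
    have h₂ := μ.2 ⟨W.1, le_rfl⟩ ⟨W', f.preimage_mono (hJ W' hW')⟩ (hJ W' hW') (C.eqn k)
    have h₃ : (C' W' hW').eqn k = ⟨res f.tgt (hJ W' hW') (C.eqn k), f.res_mem_ideal _
      (C.eqn k).2⟩ := Subtype.ext (hC' W' hW' k)
    rw [h₃]
    refine h₁.trans (Eq.trans ?_ h₂.symm)
    exact congrArg _ (congrFun h k)
  · intro y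
    choose ν hν using fun W' hW' => ((C' W' hW').existsUnique_normal fun k =>
      res f.src (f.preimage_mono (hJ W' hW')) (y k)).exists
    obtain ⟨μ, hμ⟩ := exists_nor_of_basis _ (fun W' h => f.preimage_mono (hJ W' h)) hJ₁ ν (by
      intro W₁ W₂ h₁ h₂ hle
      -- Compatibility of the local fields compares two maps on the larger ideal with values in the
      -- smaller ring. Both are semilinear over the composite `ρ`, so agreement at the equations
      -- suffices.
      let ρ : f.Fun W₁ →+* f.Fib W₂ :=
        (res f.src (f.preimage_mono hle) : f.Fib W₁ →+* f.Fib W₂).comp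
          (f.sharp W₁ : f.Fun W₁ →+* f.Fib W₁)
      let α : f.ideal W₁ →ₛₗ[ρ] f.Fib W₂ :=
        { toFun := fun a => res f.src (f.preimage_mono hle) (ν W₁ h₁ a)
          map_add' := fun a b => by rw [map_add, map_add]
          map_smul' := fun r a => by rw [map_smulₛₗ, smul_eq_mul, map_mul]; rfl }
      let β : f.ideal W₁ →ₛₗ[ρ] f.Fib W₂ :=
        { toFun := fun a => ν W₂ h₂ ⟨res f.tgt hle a.1, f.res_mem_ideal hle a.2⟩
          map_add' := fun a b => by
            rw [← map_add]
            congr 1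
            exact Subtype.ext (map_add (res f.tgt hle) _ _)
          map_smul' := fun r a => by
            have h₁ : (⟨res f.tgt hle (r • a).1, f.res_mem_ideal hle (r • a).2⟩ : f.ideal W₂) =
                res f.tgt hle r • ⟨res f.tgt hle a.1, f.res_mem_ideal hle a.2⟩ :=
              Subtype.ext (map_mul (res f.tgt hle) _ _)
            rw [h₁, map_smulₛₗ]
            exact congrArg (· • _) (f.sharp_res hle r) }
      have h₃ : β = α := by
        refine (C' W₁ h₁).normal_ext (fun x hx => ?_) fun k => ?_
        · have hx : f.sharp W₁ x = 0 := hx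
          change res f.src _ (f.sharp W₁ x) = 0
          rw [hx, map_zero]
        · change ν W₂ h₂ ⟨res f.tgt hle ((C' W₁ h₁).eqn k).1, _⟩ =
            res f.src (f.preimage_mono hle) (ν W₁ h₁ ((C' W₁ h₁).eqn k))
          rw [hν, res_res, ← hν W₂ h₂]
          congr 1
          apply Subtype.ext
          rw [hC' W₂ h₂]
          exact (congrArg _ (hC' W₁ h₁ k)).trans (res_res _ _ _)
      exact fun a => LinearMap.congr_fun h₃ a)
    refine ⟨μ, ?_⟩
    funext k
    -- `W` itself belongs to the family, as the basic open subset of `1`.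
    have hW₁ : ∃ t : f.Fun W.1, W.1 = f.tgt.left.basicOpen t :=
      ⟨1, (Scheme.basicOpen_of_isUnit _ isUnit_one).symm⟩
    have h₁ := LinearMap.congr_fun (hμ W.1 hW₁) (C.eqn k)
    have h₂ := hν W.1 hW₁ k
    have h₃ : (C' W.1 hW₁).eqn k = C.eqn k := Subtype.ext ((hC' W.1 hW₁ k).trans (res_self _ _))
    rw [h₃, res_self] at h₂
    exact h₁.trans h₂

end NorChart

end

/-! ### Normal fields on affine open subsets localize -/

section

lemma IsLocRing.isLoc {A B : Type} [CommRing A] [CommRing B] {φ : A →+* B} {s : A}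
    (h : IsLocRing φ s) :
    IsLoc s ({ toFun := φ, map_add' := map_add φ, map_smul' := map_mul φ } : A →ₛₗ[φ] B) :=
  ⟨h.unit, h.surj, h.inj⟩

section

variable {f : Mor} {n c d : ℕ} {ω : ∀ U : f.tgt.left.affineOpens, Form n Γ(f.tgt.left, U.1)}
  (H : IsVolumeImmersion f n c d ω)

include H

/-- Restriction of normal fields from a chart to a basic open subset is a localization. -/
lemma norRes_isLoc_chart {W : f.tgt.left.affineOpens} (hW : IsChart f ω c d W)
    (t : f.Fun W.1) {V' : f.src.left.Opens} (hV' : V' = f.src.left.basicOpen (f.sharp W.1 t))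
    (h : V' ≤ f.hom.left ⁻¹ᵁ W.1) : IsLoc (f.sharp W.1 t) (norRes f h) := by
  obtain ⟨C⟩ := hW.chart
  let W' : f.tgt.left.affineOpens := ⟨f.tgt.left.basicOpen t, W.2.basicOpen t⟩
  have hW' : W'.1 = f.tgt.left.basicOpen t := rfl
  obtain rfl : V' = f.hom.left ⁻¹ᵁ W'.1 := by
    rw [hV', hW', preimage_basicOpen_pull]
  have hle : W'.1 ≤ W.1 := hW'.trans_le (f.tgt.left.basicOpen_le t)
  obtain ⟨C', hC'⟩ := H.restrict hW.affine C t hW' hle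
  have h₁ : f.hom.left ⁻¹ᵁ W'.1 = f.src.left.basicOpen (f.sharp W.1 t) := by
    rw [hW', preimage_basicOpen_pull]
  have h₂ := res_isLocRing hW.affine _ h₁ h
  have b := nor_chart_bijective H hW.affine C
  have b' := nor_chart_bijective H (h₁ ▸ hW.affine.basicOpen _) C'
  -- In the coordinates given by the equations, restriction of normal fields is restriction of
  -- `c`-tuples of functions, which is known to be a localization.
  have key : ∀ (ν : f.Nor (f.hom.left ⁻¹ᵁ W.1)) k,
      (norRes f h ν).1.ev ⟨W'.1, le_rfl⟩ (C'.eqn k) =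
        res f.src h (ν.1.ev ⟨W.1, le_rfl⟩ (C.eqn k)) := by
    intro ν k
    rw [norRes_ev]
    have h₃ : C'.eqn k = ⟨res f.tgt hle (C.eqn k), f.res_mem_ideal _ (C.eqn k).2⟩ :=
      Subtype.ext (hC' k)
    rw [h₃]
    exact ν.2 ⟨W.1, le_rfl⟩ ⟨W'.1, h⟩ hle (C.eqn k)
  refine ⟨h₂.unit, fun y => ?_, fun x hx => ?_⟩
  · obtain ⟨x, k, hx⟩ := h₂.isLoc.surj_finite fun l => y.1.ev ⟨W'.1, le_rfl⟩ (C'.eqn l)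
    obtain ⟨ν, hν⟩ := b.2 x
    refine ⟨ν, k, b'.1 ?_⟩
    funext l
    refine (key ν l).trans ?_
    refine (congrArg _ (congrFun hν l)).trans ((hx l).trans ?_)
    change _ = res f.src le_rfl _ * _
    rw [res_self]
    rfl
  · have h₃ : ∀ l, ∃ k : ℕ, f.sharp W.1 t ^ k * x.1.ev ⟨W.1, le_rfl⟩ (C.eqn l) = 0 := by
      intro l
      refine h₂.inj _ ?_
      refine (key x l).symm.trans ?_
      rw [hx]; rfl
    choose k hk using h₃
    refine ⟨∑ l, k l, b.1 ?_⟩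
    funext l
    change res f.src le_rfl _ * _ = 0
    rw [res_self, ← Finset.sum_erase_add _ _ (Finset.mem_univ l), pow_add, mul_assoc]
    exact (congrArg _ (hk l)).trans (mul_zero _)

/-- An affine open subset of the source is covered by finitely many charts. -/
lemma exists_chart_cover {V : f.src.left.Opens} (hV : IsAffineOpen V) :
    ∃ (m : ℕ) (s : Fin m → Γ(f.src.left, V)) (W : Fin m → f.tgt.left.affineOpens),
      (∀ i, IsChart f ω c d (W i)) ∧ (∀ i, f.hom.left ⁻¹ᵁ (W i).1 = f.src.left.basicOpen (s i)) ∧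
        Ideal.span (Set.range s) = ⊤ := by
  have h := fun z : V => H.exists_chart hV z.2 ⊤ trivial
  choose W hW _ s hs hs' using h
  have h₁ : Ideal.span (Set.range s) = ⊤ := by
    rw [← hV.iSup_basicOpen_eq_self_iff]
    refine le_antisymm (iSup_le fun x => f.src.left.basicOpen_le _) fun z hz => ?_
    exact Opens.mem_iSup.2 ⟨⟨_, ⟨⟨z, hz⟩, rfl⟩⟩, hs ⟨z, hz⟩⟩
  -- Quasi-compactness in algebraic form: finitely many of the functions already generate the unit
  -- ideal.
  obtain ⟨T, hT, hT'⟩ := (Ideal.span_eq_top_iff_finite _).1 h₁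
  choose z hz using fun x : T => hT x.2
  let e := T.equivFin
  refine ⟨T.card, fun i => (e.symm i).1, fun i => W (z (e.symm i)), fun i => hW _, fun i => ?_, ?_⟩
  · rw [hs', hz]
  · rw [← hT']
    congr 1
    have : (fun i => (e.symm i).1) = Subtype.val ∘ e.symm := rfl
    rw [this, Set.range_comp, e.symm.surjective.range_eq, Set.image_univ, Subtype.range_coe]

omit H in
lemma mem_of_span_eq_top {V : f.src.left.Opens} (hV : IsAffineOpen V) {ι : Type}
    {s : ι → Γ(f.src.left, V)} (hs : Ideal.span (Set.range s) = ⊤) {z : f.src.left} (hz : z ∈ V) :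
    ∃ i, z ∈ f.src.left.basicOpen (s i) := by
  rw [← hV.iSup_basicOpen_eq_self_iff] at hs
  obtain ⟨⟨_, i, rfl⟩, hi⟩ := Opens.mem_iSup.1 (hs ▸ hz)
  exact ⟨i, hi⟩

/-- On each chart of a finite cover a power of `s` kills the field; the sum of the exponents works
on all charts, and normal fields are determined on a cover. -/
lemma norRes_isLoc_inj {V V' : f.src.left.Opens} (hV : IsAffineOpen V) (s : Γ(f.src.left, V))
    (hV' : V' = f.src.left.basicOpen s) (h : V' ≤ V) (ν : f.Nor V) (hν : norRes f h ν = 0) :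
    ∃ k : ℕ, s ^ k • ν = 0 := by
  obtain ⟨m, r, W, hW, hr, hr'⟩ := exists_chart_cover H hV
  have hle : ∀ i, f.hom.left ⁻¹ᵁ (W i).1 ≤ V := fun i =>
    (hr i).trans_le (f.src.left.basicOpen_le _)
  have key : ∀ i, ∃ k : ℕ, (res f.src (hle i) s) ^ k • norRes f (hle i) ν = 0 := by
    intro i
    obtain ⟨C⟩ := (hW i).chart
    obtain ⟨t, ht⟩ := C.surj (res f.src (hle i) s)
    have h₁ := norRes_isLoc_chart H (hW i) t (V' := f.hom.left ⁻¹ᵁ (W i).1 ⊓ V')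
      (by rw [hV', ht, mem_basicOpen_res]) inf_le_left
    rw [ht] at h₁
    refine h₁.inj _ ?_
    rw [norRes_norRes]
    have h₂ := norRes_norRes h (inf_le_right : f.hom.left ⁻¹ᵁ (W i).1 ⊓ V' ≤ V') ν
    rw [hν, map_zero] at h₂
    exact h₂.symm
  choose k hk using key
  refine ⟨∑ i, k i, ?_⟩
  refine nor_eq_of_cover H.imm (fun i => f.hom.left ⁻¹ᵁ (W i).1) hle (fun z hz => ?_) fun i => ?_
  · obtain ⟨i, hi⟩ := mem_of_span_eq_top hV hr' hz
    exact ⟨i, by rw [hr i]; exact hi⟩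
  · rw [norRes_smul, map_pow, map_zero, ← Finset.sum_erase_add _ _ (Finset.mem_univ i), pow_add,
      mul_smul, hk, smul_zero]

/-- Restriction of normal fields from an affine open subset to a basic open subset is a
localization. -/
lemma norRes_isLoc {V V' : f.src.left.Opens} (hV : IsAffineOpen V) (s : Γ(f.src.left, V))
    (hV' : V' = f.src.left.basicOpen s) (h : V' ≤ V) : IsLoc s (norRes f h) := by
  have hu : IsUnit (res f.src h s) := (res_isLocRing hV s hV' h).unit
  refine ⟨hu, fun μ => ?_, norRes_isLoc_inj H hV s hV' h⟩
  obtain ⟨m, r, W, hW, hr, hr'⟩ := exists_chart_cover H hV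
  let U : Fin m → f.src.left.Opens := fun i => f.hom.left ⁻¹ᵁ (W i).1
  have hle : ∀ i, U i ≤ V := fun i => (hr i).trans_le (f.src.left.basicOpen_le _)
  have hcov : ∀ z ∈ V, ∃ i, z ∈ U i := fun z hz => by
    obtain ⟨i, hi⟩ := mem_of_span_eq_top hV hr' hz
    exact ⟨i, by change z ∈ f.hom.left ⁻¹ᵁ (W i).1; rw [hr i]; exact hi⟩
  -- On each chart, `μ` extends from the part inside `V'` after multiplication by a power of `s`.
  have key : ∀ i, ∃ (ν : f.Nor (U i)) (k : ℕ),
      norRes f (inf_le_left : U i ⊓ V' ≤ U i) ν =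
        res f.src ((inf_le_right : U i ⊓ V' ≤ V').trans h) s ^ k • norRes f (inf_le_right : U i ⊓ V' ≤ V') μ := by
    intro i
    obtain ⟨C⟩ := (hW i).chart
    obtain ⟨t, ht⟩ := C.surj (res f.src (hle i) s)
    have h₁ := norRes_isLoc_chart H (hW i) t (V' := U i ⊓ V')
      (by rw [hV', ht, mem_basicOpen_res]) inf_le_left
    rw [ht] at h₁
    obtain ⟨ν, k, hν⟩ := h₁.surj (norRes f (inf_le_right : U i ⊓ V' ≤ V') μ)
    refine ⟨ν, k, hν.trans ?_⟩
    congr 2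
    exact res_res _ _ _
  choose ν₀ k₀ hν₀ using key
  obtain ⟨ν, k, hν⟩ : ∃ (ν : ∀ i, f.Nor (U i)) (k : ℕ), ∀ i,
      norRes f (inf_le_left : U i ⊓ V' ≤ U i) (ν i) =
        res f.src ((inf_le_right : U i ⊓ V' ≤ V').trans h) s ^ k • norRes f (inf_le_right : U i ⊓ V' ≤ V') μ := by
    refine ⟨fun i => res f.src (hle i) s ^ (∑ j ∈ Finset.univ.erase i, k₀ j) • ν₀ i,
      ∑ j, k₀ j, fun i => ?_⟩
    rw [norRes_smul, hν₀, map_pow, res_res, smul_smul, ← pow_add,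
      Finset.sum_erase_add _ _ (Finset.mem_univ i)]
  have hres : ∀ {U₁ U₂ : f.src.left.Opens} (h₁ : U₁ ≤ V) (h₂ : U₂ ≤ U₁) (a : ℕ) (x : f.Nor U₁),
      norRes f h₂ (res f.src h₁ s ^ a • x) =
        res f.src (h₂.trans h₁) s ^ a • norRes f h₂ x := fun h₁ h₂ a x => by
    rw [norRes_smul, map_pow, res_res]
  have hdown : ∀ i {V'' : f.src.left.Opens} (h₁ : V'' ≤ U i ⊓ V'),
      norRes f (h₁.trans inf_le_left) (ν i) =
        res f.src ((h₁.trans inf_le_right).trans h) s ^ k •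
          norRes f (h₁.trans inf_le_right) μ := fun i V'' h₁ => by
    have h₂ := congrArg (norRes f h₁) (hν i)
    rw [norRes_norRes, norRes_smul, map_pow, res_res, norRes_norRes] at h₂
    exact h₂
  -- Over `V'` the extensions agree on overlaps, so by `norRes_isLoc_inj` their difference on an
  -- overlap is killed by a power of `s`.
  have hover : ∀ i j, ∃ l : ℕ, res f.src ((inf_le_left : U i ⊓ U j ≤ U i).trans (hle i)) s ^ l •
      (norRes f (inf_le_left : U i ⊓ U j ≤ U i) (ν i) -
        norRes f (inf_le_right : U i ⊓ U j ≤ U j) (ν j)) = 0 := by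
    intro i j
    have h₁ : U i ⊓ U j = f.src.left.basicOpen (r i * r j) := by
      rw [Scheme.basicOpen_mul]
      exact congrArg₂ _ (hr i) (hr j)
    have h₂ : IsAffineOpen (U i ⊓ U j) := h₁ ▸ hV.basicOpen _
    refine norRes_isLoc_inj H h₂ _ (V' := (U i ⊓ U j) ⊓ V')
      (by rw [hV', mem_basicOpen_res]) inf_le_left _ ?_
    rw [map_sub, norRes_norRes, norRes_norRes,
      hdown i (inf_le_inf_right V' (inf_le_left : U i ⊓ U j ≤ U i)),
      hdown j (inf_le_inf_right V' (inf_le_right : U i ⊓ U j ≤ U j)), sub_self]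
  choose l hl using hover
  let L := ∑ i, ∑ j, l i j
  have hL : ∀ i j, l i j ≤ L := fun i j =>
    (Finset.single_le_sum (f := fun j => l i j) (fun _ _ => Nat.zero_le _) (Finset.mem_univ j)).trans
      (Finset.single_le_sum (f := fun i => ∑ j, l i j) (fun _ _ => Nat.zero_le _)
        (Finset.mem_univ i))
  -- The further factor `s ^ L` makes the extensions agree exactly on all overlaps.
  obtain ⟨y, hy⟩ := exists_nor_glue H.imm U hle hcov (fun i => res f.src (hle i) s ^ L • ν i) (by
    intro i j
    rw [hres, hres, ← sub_eq_zero, ← smul_sub]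
    obtain ⟨m, hm⟩ := Nat.exists_eq_add_of_le (hL i j)
    rw [hm, add_comm, pow_add, mul_smul, hl, smul_zero])
  refine ⟨y, L + k, nor_eq_of_cover H.imm (fun i => U i ⊓ V') (fun i => inf_le_right)
    (fun z hz => ?_) fun i => ?_⟩
  · obtain ⟨i, hi⟩ := hcov z (h hz)
    exact ⟨i, hi, hz⟩
  · have h₁ := congrArg (norRes f (inf_le_left : U i ⊓ V' ≤ U i)) (hy i)
    rw [norRes_norRes, hres, hν, smul_smul, ← pow_add] at h₁
    rw [norRes_norRes, h₁, norRes_smul]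
    change _ = res f.src _ (res f.src h s ^ (L + k)) • _
    rw [map_pow, res_res]

end

end

/-! ### Naturality of the correspondence between `⋀ᶜ N` and top forms -/

section

lemma extMap_wedge_right {A B M N : Type} [CommRing A] [CommRing B] [AddCommGroup M] [Module A M]
    [AddCommGroup N] [Module B N] {φ : A →+* B} (f : M →ₛₗ[φ] N) {r t n : ℕ} (h : r + t = n)
    (v : Fin r → M) (y : ⋀[A]^t M) :
    extMap f n (wedge h (exteriorPower.ιMulti A r v) y) =
      wedge h (exteriorPower.ιMulti B r fun i => f (v i)) (extMap f t y) := by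
  have h₁ : ∀ {A M : Type} [CommRing A] [AddCommGroup M] [Module A M] (x : ⋀[A]^r M)
      (y z : ⋀[A]^t M), wedge h x (y + z) = wedge h x y + wedge h x z := fun x y z =>
    Subtype.ext (mul_add _ _ _)
  have h₂ : ∀ {A M : Type} [CommRing A] [AddCommGroup M] [Module A M] (x : ⋀[A]^r M)
      (a : A) (y : ⋀[A]^t M), wedge h x (a • y) = a • wedge h x y := fun x a y =>
    Subtype.ext (mul_smul_comm _ _ _)
  induction y using ext_induction with
  | h₁ w => rw [extMap_wedge, extMap_ιMulti]
  | h₀ =>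
    have h₃ : ∀ {A M : Type} [CommRing A] [AddCommGroup M] [Module A M] (x : ⋀[A]^r M),
      wedge h x (0 : ⋀[A]^t M) = 0 := fun x => Subtype.ext (mul_zero _)
    rw [h₃, map_zero, map_zero, h₃]
  | h₂ x y hx hy => rw [h₁, map_add, hx, hy, map_add, h₁]
  | h₃ a x hx => rw [h₂, map_smulₛₗ, hx, map_smulₛₗ, h₂]

lemma formPull_wedge {Z Y : Over SpecC} (f : Z ⟶ Y) {c d n : ℕ} (h : c + d = n)
    {W : Y.left.Opens} {V : Z.left.Opens} (hV : V ≤ f.left ⁻¹ᵁ W) (x : Fin c → Γ(Y.left, W))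
    (α : Form d Γ(Y.left, W)) :
    formPull f n hV (wedge h (exteriorPower.ιMulti _ c fun k => KaehlerDifferential.D ℂ _ (x k)) α) =
      wedge h (exteriorPower.ιMulti _ c fun k => KaehlerDifferential.D ℂ _ (pull f W V hV (x k)))
        (formPull f d hV α) := by
  refine (extMap_wedge_right _ _ _ _).trans ?_
  simp only [kaehlerMap_D]
  rfl

/-- By `isDual_iff`, a single extension of the form, tested on the equations, already decides the
correspondence. -/
lemma AlgChart.isDual_of {A B : Type} [CommRing A] [CommRing B] [Algebra ℂ A] [Algebra ℂ B]
    {φ : A →ₐ[ℂ] B} {R N : Type} [CommRing R] [AddCommGroup N] [Module R N] {ψ : R →+* B}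
    {e : N →ₛₗ[ψ] (algKer φ →ₛₗ[(φ : A →+* B)] B)} {n c d : ℕ} {ω : Form n A}
    (C : AlgChart φ ω c d) {ν : ⋀[R]^c N} {w : Form d B} {α : Form d A} {a : A}
    (hα : extMap (kaehlerMap φ) d α = w)
    (ha : a • ω = wedge C.deg
      (exteriorPower.ιMulti A c fun k => KaehlerDifferential.D ℂ A (C.eqn k : A)) α)
    (h : φ a = AlgChart.normalPair e C.eqn ν) : IsDual e C.deg ω ν w := by
  rw [C.isDual_iff, ← h, ← C.pf_eq ha, C.pf_eqn, hα]

section Normal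

variable {A B A' B' : Type} [CommRing A] [CommRing B] [CommRing A'] [CommRing B'] [Algebra ℂ A]
  [Algebra ℂ B] [Algebra ℂ A'] [Algebra ℂ B'] {φ : A →ₐ[ℂ] B} {φ' : A' →ₐ[ℂ] B'} 
  {R N R' N' : Type} [CommRing R] [AddCommGroup N] [Module R N] [CommRing R'] [AddCommGroup N']
  [Module R' N'] {ψ : R →+* B} {ψ' : R' →+* B'} {χ : R →+* R'}

lemma normalPair_extMap (e : N →ₛₗ[ψ] (algKer φ →ₛₗ[(φ : A →+* B)] B))
    (e' : N' →ₛₗ[ψ'] (algKer φ' →ₛₗ[(φ' : A' →+* B')] B')) (g : N →ₛₗ[χ] N') (τ : B →+* B')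
    (hψ : ∀ r, ψ' (χ r) = τ (ψ r)) {c : ℕ} (x : Fin c → algKer φ) (x' : Fin c → algKer φ')
    (h : ∀ ν k, e' (g ν) (x' k) = τ (e ν (x k))) (ν : ⋀[R]^c N) :
    AlgChart.normalPair e' x' (extMap g c ν) = τ (AlgChart.normalPair e x ν) := by
  induction ν using ext_induction with
  | h₁ ν =>
    rw [extMap_ιMulti, AlgChart.normalPair, AlgChart.normalPair, evalPair_ιMulti, evalPair_ιMulti,
      RingHom.map_det]
    congr 1
    ext i j
    exact h _ _
  | h₀ => simp only [map_zero]
  | h₂ x y hx hy => simp only [map_add, hx, hy]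
  | h₃ a x hx => simp only [map_smulₛₗ, hx, hψ, smul_eq_mul, map_mul]

end Normal

section IsKap

variable {f f' : Mor} {n c d : ℕ}

/-- The element `ν` of `⋀ᶜ` of the normal fields and the form `w` correspond to each other on all
affine open subsets of the target. -/
def IsKap (f : Mor) (h : c + d = n)
    (ω : ∀ U : f.tgt.left.affineOpens, Form n Γ(f.tgt.left, U.1)) {V : f.src.left.Opens}
    (ν : ⋀[Γ(f.src.left, V)]^c (f.Nor V)) (w : Form d Γ(f.src.left, V)) : Prop :=
  ∀ (W : f.tgt.left.affineOpens) (hW : f.hom.left ⁻¹ᵁ W.1 ≤ V),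
    IsDual (norEv ⟨W.1, hW⟩) h (ω W) ν (formPull (𝟙 f.src) d hW w)

/-- The condition quantifies over all functions in the ideal and all extensions, so it is
transported by moving these data along the isomorphism. The only input about the volume forms is
that they correspond to each other. -/
lemma IsKap.pull {h : c + d = n} {ω : ∀ U : f.tgt.left.affineOpens, Form n Γ(f.tgt.left, U.1)}
    {ω' : ∀ U : f'.tgt.left.affineOpens, Form n Γ(f'.tgt.left, U.1)} (e : MorIso f f')
    (hω : ∀ (W : f.tgt.left.affineOpens) (W' : f'.tgt.left.affineOpens)
      (hW : W'.1 ≤ e.right.inv.left ⁻¹ᵁ W.1), formPull e.right.inv n hW (ω W) = ω' W')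
    {V : f.src.left.Opens} {V' : f'.src.left.Opens} (hV : V ≤ e.left.hom.left ⁻¹ᵁ V')
    {ν : ⋀[Γ(f'.src.left, V')]^c (f'.Nor V')} {w : Form d Γ(f'.src.left, V')}
    (hk : IsKap f' h ω' ν w) :
    IsKap f h ω (extMap (Mor.norPull e hV) c ν) (formPull e.left.hom d hV w) := by
  intro W hW x α a hα ha
  have : IsIso e.right.inv.left := inferInstanceAs (IsIso e.right.symm.hom.left)
  let W' : f'.tgt.left.affineOpens := ⟨e.right.inv.left ⁻¹ᵁ W.1, W.2.preimage_of_isIso _⟩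
  have h₁ : f'.hom.left ⁻¹ᵁ W'.1 ≤ V' := Mor.iso_idx_le e hV ⟨W.1, hW⟩
  -- The condition for `f'` is applied to the transported functions, extension and coefficient. It
  -- must be checked that the transported form extends the given one and that the coefficient
  -- relation is preserved.
  have h₂ := hk W' h₁ (fun k => ⟨Mor.isoFun e W.1 (x k), Mor.isoFun_mem e W.1 _ (x k).2⟩)
    (formPull e.right.inv d le_rfl α) (Mor.isoFun e W.1 a) (by
      have hle : f'.hom.left ⁻¹ᵁ W'.1 ≤ (f'.hom ≫ e.right.inv).left ⁻¹ᵁ W.1 := le_rfl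
      have hle' : f'.hom.left ⁻¹ᵁ W'.1 ≤ e.left.inv.left ⁻¹ᵁ (f.hom.left ⁻¹ᵁ W.1) :=
        (Mor.iso_inv_preimage e W.1).le
      have h₃ : formPull f'.hom d le_rfl (formPull e.right.inv d le_rfl α) =
          formPull (f'.hom ≫ e.right.inv) d hle α := formPull_comp _ _ _ rfl _ _ _ _ _
      have h₄ : formPull e.left.inv d hle' (formPull f.hom d le_rfl α) =
          formPull (f'.hom ≫ e.right.inv) d hle α := formPull_comp _ _ _ e.w_inv _ _ _ _ _
      refine h₃.trans (h₄.symm.trans ?_)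
      have h₅ : formPull f.hom d le_rfl α =
        formPull (𝟙 f.src) d hW (formPull e.left.hom d hV w) := hα
      rw [h₅, formPull_comp (𝟙 f.src) e.left.hom e.left.hom (Category.id_comp _) d hV hW
        (hW.trans hV)]
      exact formPull_comp e.left.inv e.left.hom (𝟙 f'.src) e.left.inv_hom_id d _ _ _ w) (by
      have h₃ := congrArg (formPull e.right.inv n (V := W'.1) le_rfl) ha
      rw [map_smulₛₗ, hω W W' le_rfl] at h₃
      exact h₃.trans (formPull_wedge _ _ _ _ _))
  have h₃ := congrArg (Mor.isoFib e W.1) h₂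
  refine (Mor.isoFib_sharp e W.1 a).symm.trans (h₃.trans ?_)
  symm
  exact normalPair_extMap (norEv ⟨W'.1, h₁⟩) (norEv ⟨W.1, hW⟩) (Mor.norPull e hV)
    ((Mor.isoFib e W.1 : f'.Fib (e.right.inv.left ⁻¹ᵁ W.1) →ₐ[ℂ] f.Fib W.1) :
      f'.Fib (e.right.inv.left ⁻¹ᵁ W.1) →+* f.Fib W.1)
    (fun r => (Mor.iso_res_smul e hV ⟨W.1, hW⟩ r).symm)
    (fun k => ⟨Mor.isoFun e W.1 (x k), Mor.isoFun_mem e W.1 _ (x k).2⟩) x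
    (fun ν k => Mor.norPull_apply e hV ν ⟨W.1, hW⟩ (x k)) ν

variable {ω : ∀ U : f.tgt.left.affineOpens, Form n Γ(f.tgt.left, U.1)}

lemma normalPair_res {V : f.src.left.Opens} (W W' : f.Idx V) (h : W'.1 ≤ W.1)
    (x : Fin c → f.ideal W.1) (ν : ⋀[Γ(f.src.left, V)]^c (f.Nor V)) :
    AlgChart.normalPair (norEv W') (fun k => ⟨res f.tgt h (x k), f.res_mem_ideal h (x k).2⟩) ν =
      res f.src (f.preimage_mono h) (AlgChart.normalPair (norEv W) x ν) := by
  have h₁ := normalPair_extMap (norEv W) (norEv W') (LinearMap.id : f.Nor V →ₗ[_] f.Nor V)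
    ((OrbifoldHodge.res f.src (f.preimage_mono h) : f.Fib W.1 →ₐ[ℂ] f.Fib W'.1) :
      f.Fib W.1 →+* f.Fib W'.1) (fun r => (res_res _ _ r).symm) x
    (fun k => ⟨res f.tgt h (x k), f.res_mem_ideal h (x k).2⟩) (fun ν k => ν.2 W W' h (x k)) ν
  rwa [extMap_id _ (fun _ => rfl) (fun _ => rfl)] at h₁

/-- The assertion is an equality of functions on the preimage of `W`, hence local on it. -/
lemma isKap_of_basis (H : IsVolumeImmersion f n c d ω) {V : f.src.left.Opens}
    (J : f.tgt.left.Opens → Prop) (hJ : ∀ W, J W → f.hom.left ⁻¹ᵁ W ≤ V)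
    (hJ' : ∀ z ∈ V, ∀ W, f.hom.left z ∈ W → ∃ W' : f.tgt.left.affineOpens, J W'.1 ∧
      f.hom.left z ∈ W'.1 ∧ W'.1 ≤ W)
    {ν : ⋀[Γ(f.src.left, V)]^c (f.Nor V)} {w : Form d Γ(f.src.left, V)}
    (h : ∀ (W : f.tgt.left.affineOpens) (hW : J W.1),
      IsDual (norEv ⟨W.1, hJ _ hW⟩) H.deg (ω W) ν (formPull (𝟙 f.src) d (hJ _ hW) w)) :
    IsKap f H.deg ω ν w := by
  intro W hW x α a hα ha
  refine eq_of_locally_eq fun z hz => ?_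
  obtain ⟨W', hW', hz', hle⟩ := hJ' z (hW hz) W.1 hz
  refine ⟨f.hom.left ⁻¹ᵁ W'.1, f.preimage_mono hle, hz', ?_⟩
  refine (f.sharp_res hle a).symm.trans (Eq.trans ?_ (normalPair_res ⟨W.1, hW⟩
    ⟨W'.1, hJ _ hW'⟩ hle x ν))
  refine h W' hW' _ (formPull (𝟙 f.tgt) d hle α) _ ?_ ?_
  · have h₁ : formPull f.hom d le_rfl (formPull (𝟙 f.tgt) d hle α) =
        formPull f.hom d (f.preimage_mono hle) α :=
      formPull_comp _ _ _ (Category.comp_id _) _ _ _ _ _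
    have h₂ : formPull (𝟙 f.src) d (f.preimage_mono hle) (formPull f.hom d le_rfl α) =
        formPull f.hom d (f.preimage_mono hle) α :=
      formPull_comp _ _ _ (Category.id_comp _) _ _ _ _ _
    have h₃ : formPull f.hom d le_rfl α = formPull (𝟙 f.src) d hW w := hα
    refine h₁.trans (h₂.symm.trans ?_)
    rw [h₃]
    exact formPull_comp _ _ _ (Category.comp_id _) _ _ _ _ _
  · have h₁ := congrArg (formPull (𝟙 f.tgt) n hle) ha
    rw [map_smulₛₗ, H.form_res W W' hle] at h₁
    exact h₁.trans (formPull_wedge _ _ _ _ _)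

lemma IsKap.res (H : IsVolumeImmersion f n c d ω) {V V' : f.src.left.Opens} (hV : V' ≤ V)
    {ν : ⋀[Γ(f.src.left, V)]^c (f.Nor V)} {w : Form d Γ(f.src.left, V)}
    (hk : IsKap f H.deg ω ν w) :
    IsKap f H.deg ω (extMap (norRes f hV) c ν) (formPull (𝟙 f.src) d hV w) :=
  hk.pull (MorIso.refl f) (fun W W' hW => H.form_res W W' hW) hV

lemma isKap_of_cover (H : IsVolumeImmersion f n c d ω) {V : f.src.left.Opens} {ι : Type}
    (U : ι → f.src.left.Opens) (hU : ∀ i, U i ≤ V) (hV : ∀ z ∈ V, ∃ i, z ∈ U i)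
    {ν : ⋀[Γ(f.src.left, V)]^c (f.Nor V)} {w : Form d Γ(f.src.left, V)}
    (h : ∀ i, IsKap f H.deg ω (extMap (norRes f (hU i)) c ν) (formPull (𝟙 f.src) d (hU i) w)) :
    IsKap f H.deg ω ν w := by
  refine isKap_of_basis H (fun W => ∃ i, f.hom.left ⁻¹ᵁ W ≤ U i)
    (fun W ⟨i, hi⟩ => hi.trans (hU i)) (fun z hz W hW => ?_) ?_
  · obtain ⟨i, hi⟩ := hV z hz
    obtain ⟨W', h₁, h₂, h₃⟩ := exists_preimage_le H.imm hi W hW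
    obtain ⟨W'', h₄, h₅, h₆⟩ := exists_isAffineOpen_mem_and_subset (U := W') h₁
    exact ⟨⟨W'', h₄⟩, ⟨i, (f.preimage_mono h₆).trans h₃⟩, h₅, h₆.trans h₂⟩
  · rintro W ⟨i, hi⟩ x α a hα ha
    have h₁ := h i W hi x α a (by
      rw [hα]
      symm
      exact formPull_comp _ _ _ (Category.comp_id _) _ _ _ _ _) ha
    rw [h₁]
    refine (normalPair_extMap (norEv ⟨W.1, hi.trans (hU i)⟩) (norEv ⟨W.1, hi⟩) (norRes f (hU i))
      (RingHom.id _) (fun r => ?_) x x (fun ν k => ?_) ν)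
    · exact res_res _ _ _
    · exact norRes_ev _ _ _ _

lemma exists_chart_le (H : IsVolumeImmersion f n c d ω) {V : f.src.left.Opens}
    {z : f.src.left} (hz : z ∈ V) (W₀ : f.tgt.left.Opens) (hz₀ : f.hom.left z ∈ W₀) :
    ∃ W, IsChart f ω c d W ∧ f.hom.left z ∈ W.1 ∧ W.1 ≤ W₀ ∧ f.hom.left ⁻¹ᵁ W.1 ≤ V := by
  obtain ⟨V₁, hV₁, hz₁, hle⟩ := exists_isAffineOpen_mem_and_subset hz
  obtain ⟨W, hW, hW₀, s, hs, hs'⟩ := H.exists_chart hV₁ hz₁ W₀ hz₀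
  refine ⟨W, hW, ?_, hW₀, ?_⟩
  · change z ∈ f.hom.left ⁻¹ᵁ W.1
    rw [hs']; exact hs
  · rw [hs']; exact (f.src.left.basicOpen_le s).trans hle

/-- On charts it suffices to check the correspondence for one extension of the form. -/
lemma isKap_chart_iff (H : IsVolumeImmersion f n c d ω) {W : f.tgt.left.affineOpens}
    (hW : IsChart f ω c d W) (ν : ⋀[f.Fib W.1]^c (f.Nor (f.hom.left ⁻¹ᵁ W.1)))
    (w : Form d (f.Fib W.1)) :
    IsKap f H.deg ω ν w ↔ IsDual (norEv ⟨W.1, le_rfl⟩) H.deg (ω W) ν w := by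
  constructor
  · intro h
    have h₁ := h W le_rfl
    have h₂ := formPull_id d le_rfl w
    rwa [h₂] at h₁
  · intro h
    refine isKap_of_basis H (fun W' => ∃ t : f.Fun W.1, W' = f.tgt.left.basicOpen t) ?_ ?_ ?_
    · rintro _ ⟨t, rfl⟩
      exact f.preimage_mono (f.tgt.left.basicOpen_le t)
    · intro z hz W' hW'
      obtain ⟨t, h₁, h₂⟩ := W.2.exists_basicOpen_le ⟨_, hW'⟩ hz
      exact ⟨⟨_, W.2.basicOpen t⟩, ⟨t, rfl⟩, h₂, h₁⟩
    · rintro W' ⟨t, ht⟩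
      have hle : W'.1 ≤ W.1 := ht.trans_le (f.tgt.left.basicOpen_le t)
      obtain ⟨C⟩ := hW.chart
      obtain ⟨C', hC'⟩ := H.restrict hW.affine C t ht hle
      -- One extension over `W` and the equations of `W` restrict to every smaller chart, where they
      -- suffice by `AlgChart.isDual_of`.
      obtain ⟨α, rfl⟩ := C.exists_extMap_eq w
      obtain ⟨a, ha, ha'⟩ := C.pf_spec (fun k => C.eqn k) α
      have h₁ := h _ _ _ rfl ha'
      have h₂ : extMap (kaehlerMap (f.sharp W'.1)) d (formPull (𝟙 f.tgt) d hle α) =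
          formPull (𝟙 f.src) d (f.preimage_mono hle) (extMap (kaehlerMap (f.sharp W.1)) d α) := by
        have h₁ : formPull f.hom d le_rfl (formPull (𝟙 f.tgt) d hle α) =
            formPull f.hom d (f.preimage_mono hle) α :=
          formPull_comp _ _ _ (Category.comp_id _) _ _ _ _ _
        have h₂ : formPull (𝟙 f.src) d (f.preimage_mono hle) (formPull f.hom d le_rfl α) =
            formPull f.hom d (f.preimage_mono hle) α :=
          formPull_comp _ _ _ (Category.id_comp _) _ _ _ _ _
        exact h₁.trans h₂.symm
      have h₃ := congrArg (formPull (𝟙 f.tgt) n hle) ha'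
      rw [map_smulₛₗ, H.form_res W W' hle] at h₃
      have h₄ := h₃.trans (formPull_wedge _ _ _ _ _)
      have h₅ : C'.eqn = fun k => ⟨OrbifoldHodge.res f.tgt hle (C.eqn k),
        f.res_mem_ideal hle (C.eqn k).2⟩ := funext fun k => Subtype.ext (hC' k)
      refine C'.isDual_of h₂ (a := OrbifoldHodge.res f.tgt hle a) ?_ ?_
      · rw [h₅]
        exact h₄
      · rw [h₅]
        refine (f.sharp_res hle a).trans ?_
        refine (congrArg (OrbifoldHodge.res f.src (f.preimage_mono hle)) h₁).trans ?_
        exact (normalPair_res ⟨W.1, le_rfl⟩ ⟨W'.1, _⟩ hle _ ν).symm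

end IsKap

end

/-! ### The isomorphism `⋀ᶜ N ≅ Ωᵈ` on affine open subsets -/

section

/-- `norEv` is semilinear over a restriction map from an open subset to itself, which is the
identity only up to a proof; a variable `ψ` allows the substitution. -/
lemma AlgChart.existsUnique_isDual_of_id {A B : Type} [CommRing A] [CommRing B] [Algebra ℂ A]
    [Algebra ℂ B] {φ : A →ₐ[ℂ] B} {N : Type} [AddCommGroup N] [Module B N] {ψ : B →+* B}
    (hψ : ψ = RingHom.id B) (e : N →ₛₗ[ψ] (algKer φ →ₛₗ[(φ : A →+* B)] B)) {n c d : ℕ}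
    {ω : Form n A} (C : AlgChart φ ω c d)
    (h : Function.Bijective fun (ν : N) (k : Fin c) => e ν (C.eqn k)) (w : Form d B) :
    ∃! ν : ⋀[B]^c N, IsDual e C.deg ω ν w := by
  subst hψ
  exact C.existsUnique_isDual' e h w

section IsDual

variable {A B : Type} [CommRing A] [CommRing B] [Algebra ℂ A] [Algebra ℂ B] {φ : A →ₐ[ℂ] B}
  {R N : Type} [CommRing R] [AddCommGroup N] [Module R N] {ψ : R →+* B}
  {e : N →ₛₗ[ψ] (algKer φ →ₛₗ[(φ : A →+* B)] B)} {n c d : ℕ} {ω : Form n A}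

lemma AlgChart.isDual_add (C : AlgChart φ ω c d) {ν μ : ⋀[R]^c N} {w v : Form d B}
    (h : IsDual e C.deg ω ν w) (h' : IsDual e C.deg ω μ v) :
    IsDual e C.deg ω (ν + μ) (w + v) := by
  rw [C.isDual_iff] at *
  rw [map_add, map_add, mul_add, h, h']

lemma AlgChart.isDual_smul (C : AlgChart φ ω c d) {ν : ⋀[R]^c N} {w : Form d B}
    (h : IsDual e C.deg ω ν w) (a : R) : IsDual e C.deg ω (a • ν) (ψ a • w) := by
  rw [C.isDual_iff] at *
  rw [map_smul, map_smulₛₗ, smul_eq_mul, smul_eq_mul, mul_left_comm, h]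

end IsDual

lemma formPull_isLoc {Y : Over SpecC} {W : Y.left.Opens} (hW : IsAffineOpen W) (t : Γ(Y.left, W))
    {V : Y.left.Opens} (hV : V = Y.left.basicOpen t) (h : V ≤ W) (r : ℕ) :
    IsLoc t (formPull (𝟙 Y) r h) :=
  IsLoc.extMap (res_isLocRing hW t hV h) (res_isLocRing hW t hV h).kaehlerMap r

/-- Exterior powers of differentials of rings of functions are only a presheaf. On an affine open
subset they localize, so gluing over a finite cover by basic open subsets is possible before
sheafification. -/
lemma exists_form_glue {Y : Over SpecC} {V : Y.left.Opens} (hV : IsAffineOpen V) {ι : Type}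
    [Finite ι] (s : ι → Γ(Y.left, V)) (hs : Ideal.span (Set.range s) = ⊤) (U : ι → Y.left.Opens)
    (hU : ∀ i, U i = Y.left.basicOpen (s i)) (hle : ∀ i, U i ≤ V) {d : ℕ}
    (x : ∀ i, Form d Γ(Y.left, U i))
    (hx : ∀ i j (T : Y.left.Opens) (hi : T ≤ U i) (hj : T ≤ U j), IsAffineOpen T →
      formPull (𝟙 Y) d hi (x i) = formPull (𝟙 Y) d hj (x j)) :
    ∃ y : Form d Γ(Y.left, V), ∀ i, formPull (𝟙 Y) d (hle i) y = x i := by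
  refine exists_of_isLoc s hs (fun i => formPull_isLoc hV (s i) (hU i) (hle i) d) x
    fun i j y z k hy hz => ?_
  obtain ⟨T, hT⟩ : ∃ T, T = Y.left.basicOpen (s i * s j) := ⟨_, rfl⟩
  have hT' : T = Y.left.basicOpen (s i) ⊓ Y.left.basicOpen (s j) :=
    hT.trans (Y.left.basicOpen_mul _ _)
  have hi : T ≤ U i := by rw [hU i, hT']; exact inf_le_left
  have hj : T ≤ U j := by rw [hU j, hT']; exact inf_le_right
  have hTV : T ≤ V := hi.trans (hle i)
  have key := hx i j T hi hj (by rw [hT]; exact hV.basicOpen _)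
  refine (formPull_isLoc hV (s i * s j) hT hTV d).inj _ ?_
  have h₀ : ∀ i (hi : T ≤ U i) (y : Form d Γ(Y.left, V)), formPull (𝟙 Y) d (hle i) y =
      ((res Y (hle i) : Γ(Y.left, V) →ₐ[ℂ] Γ(Y.left, U i)) : Γ(Y.left, V) →+* Γ(Y.left, U i))
        (s i) ^ k • x i → formPull (𝟙 Y) d hTV y = res Y hTV (s i) ^ k • formPull (𝟙 Y) d hi (x i) :=
    fun i hi y h => by
      have h₁ := formPull_comp (𝟙 Y) (𝟙 Y) (𝟙 Y) (Category.comp_id _) d (hle i) hi hTV y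
      have h₂ : res Y hi (res Y (hle i) (s i)) = res Y hTV (s i) := res_res _ _ _
      rw [← h₁, h, map_smulₛₗ, map_pow, ← h₂]
      rfl
  rw [map_sub, map_smulₛₗ, map_smulₛₗ, h₀ i hi y hy, h₀ j hj z hz, key, map_pow, map_pow]
  exact sub_eq_zero.2 (smul_comm _ _ _)

lemma extMap_norRes {f : Mor} {V V' V'' : f.src.left.Opens} (h : V' ≤ V) (h' : V'' ≤ V') (r : ℕ)
    (ν : ⋀[Γ(f.src.left, V)]^r (f.Nor V)) : extMap (norRes f h') r (extMap (norRes f h) r ν) =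
      extMap (norRes f (h'.trans h)) r ν :=
  extMap_comp _ _ _ (fun a => res_res _ _ a) (fun m => norRes_norRes _ _ m) r ν

variable {f : Mor} {n c d : ℕ} {ω : ∀ U : f.tgt.left.affineOpens, Form n Γ(f.tgt.left, U.1)}
  (H : IsVolumeImmersion f n c d ω)

include H

lemma extMap_norRes_isLoc {V V' : f.src.left.Opens} (hV : IsAffineOpen V) (s : Γ(f.src.left, V))
    (hV' : V' = f.src.left.basicOpen s) (h : V' ≤ V) (r : ℕ) :
    IsLoc s (extMap (norRes f h) r) :=
  IsLoc.extMap (res_isLocRing hV s hV' h) (norRes_isLoc H hV s hV' h) r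

lemma isKap_of_charts {V : f.src.left.Opens} {ν : ⋀[Γ(f.src.left, V)]^c (f.Nor V)}
    {w : Form d Γ(f.src.left, V)}
    (h : ∀ (W : f.tgt.left.affineOpens) (hW : f.hom.left ⁻¹ᵁ W.1 ≤ V), IsChart f ω c d W →
      IsDual (norEv ⟨W.1, hW⟩) H.deg (ω W) ν (formPull (𝟙 f.src) d hW w)) :
    IsKap f H.deg ω ν w := by
  refine isKap_of_basis H (fun W => f.hom.left ⁻¹ᵁ W ≤ V ∧
    ∃ hW : IsAffineOpen W, IsChart f ω c d ⟨W, hW⟩) (fun W hW => hW.1) (fun z hz W hW => ?_)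
    fun W ⟨hW, hW', hc⟩ => h W hW hc
  obtain ⟨W', h₁, h₂, h₃, h₄⟩ := exists_chart_le H hz W hW
  exact ⟨W', ⟨h₄, W'.2, h₁⟩, h₂, h₃⟩

lemma IsKap.add {V : f.src.left.Opens} {ν μ : ⋀[Γ(f.src.left, V)]^c (f.Nor V)}
    {w v : Form d Γ(f.src.left, V)} (h : IsKap f H.deg ω ν w) (h' : IsKap f H.deg ω μ v) :
    IsKap f H.deg ω (ν + μ) (w + v) := by
  refine isKap_of_charts H fun W hW hc => ?_
  obtain ⟨C⟩ := hc.chart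
  rw [map_add]
  exact C.isDual_add (h W hW) (h' W hW)

lemma IsKap.smul {V : f.src.left.Opens} {ν : ⋀[Γ(f.src.left, V)]^c (f.Nor V)}
    {w : Form d Γ(f.src.left, V)} (h : IsKap f H.deg ω ν w) (a : Γ(f.src.left, V)) :
    IsKap f H.deg ω (a • ν) (a • w) := by
  refine isKap_of_charts H fun W hW hc => ?_
  obtain ⟨C⟩ := hc.chart
  rw [map_smulₛₗ]
  exact C.isDual_smul (h W hW) a

lemma existsUnique_form_chart {W : f.tgt.left.affineOpens} (hW : IsChart f ω c d W)
    (ν : ⋀[f.Fib W.1]^c (f.Nor (f.hom.left ⁻¹ᵁ W.1))) :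
    ∃! w : Form d (f.Fib W.1), IsKap f H.deg ω ν w := by
  obtain ⟨C⟩ := hW.chart
  obtain ⟨w, hw, hw'⟩ := C.existsUnique_isDual (norEv ⟨W.1, le_rfl⟩) ν
  exact ⟨w, (isKap_chart_iff H hW ν w).2 hw, fun v hv => hw' v ((isKap_chart_iff H hW ν v).1 hv)⟩

lemma existsUnique_normal_chart {W : f.tgt.left.affineOpens} (hW : IsChart f ω c d W)
    (w : Form d (f.Fib W.1)) :
    ∃! ν : ⋀[f.Fib W.1]^c (f.Nor (f.hom.left ⁻¹ᵁ W.1)), IsKap f H.deg ω ν w := by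
  obtain ⟨C⟩ := hW.chart
  obtain ⟨ν, hν, hν'⟩ := C.existsUnique_isDual_of_id (N := f.Nor (f.hom.left ⁻¹ᵁ W.1))
    (RingHom.ext fun a => res_self le_rfl a) (norEv ⟨W.1, le_rfl⟩)
    (nor_chart_bijective H hW.affine C) w
  exact ⟨ν, (isKap_chart_iff H hW ν w).2 hν, fun μ hμ => hν' μ ((isKap_chart_iff H hW μ w).1 hμ)⟩

/-- Uniqueness holds on charts, and forms on an affine open subset are determined on a cover by
basic open subsets. -/
lemma IsKap.form_unique {V : f.src.left.Opens} (hV : IsAffineOpen V)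
    {ν : ⋀[Γ(f.src.left, V)]^c (f.Nor V)} {w v : Form d Γ(f.src.left, V)}
    (h : IsKap f H.deg ω ν w) (h' : IsKap f H.deg ω ν v) : w = v := by
  obtain ⟨m, s, W, hW, hs, hs'⟩ := exists_chart_cover H hV
  have hle : ∀ i, f.hom.left ⁻¹ᵁ (W i).1 ≤ V := fun i =>
    (hs i).trans_le (f.src.left.basicOpen_le _)
  refine sub_eq_zero.1 (eq_zero_of_isLoc s hs' (fun i => formPull_isLoc hV (s i) (hs i) (hle i) d)
    _ fun i => ?_)
  rw [map_sub, sub_eq_zero]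
  exact (existsUnique_form_chart H (hW i) _).unique (h.res H (hle i)) (h'.res H (hle i))

/-- The forms that exist on charts agree on affine overlaps by uniqueness, so they glue, and the
correspondence itself is local. -/
lemma exists_isKap {V : f.src.left.Opens} (hV : IsAffineOpen V)
    (ν : ⋀[Γ(f.src.left, V)]^c (f.Nor V)) : ∃ w, IsKap f H.deg ω ν w := by
  obtain ⟨m, s, W, hW, hs, hs'⟩ := exists_chart_cover H hV
  have hle : ∀ i, f.hom.left ⁻¹ᵁ (W i).1 ≤ V := fun i =>
    (hs i).trans_le (f.src.left.basicOpen_le _)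
  choose x hx using fun i => (existsUnique_form_chart H (hW i) (extMap (norRes f (hle i)) c ν)).exists
  obtain ⟨y, hy⟩ := exists_form_glue hV s hs' (fun i => f.hom.left ⁻¹ᵁ (W i).1) hs hle x
    fun i j T hi hj hT => by
      have h₁ := (hx i).res H hi
      have h₂ := (hx j).res H hj
      have h₃ := extMap_norRes (hle i) hi c ν
      have h₄ := extMap_norRes (hle j) hj c ν
      exact IsKap.form_unique H hT (h₃ ▸ h₁) (h₄ ▸ h₂)
  refine ⟨y, isKap_of_cover H _ hle (fun z hz => ?_) fun i => ?_⟩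
  · obtain ⟨i, hi⟩ := mem_of_span_eq_top hV hs' hz
    exact ⟨i, by rw [hs i]; exact hi⟩
  · rw [hy i]
    exact hx i

/-- The linear map `⋀ᶜ N → Ωᵈ` on an affine open subset. -/
def kapHom {V : f.src.left.Opens} (hV : IsAffineOpen V) :
    (⋀[Γ(f.src.left, V)]^c (f.Nor V)) →ₗ[Γ(f.src.left, V)] Form d Γ(f.src.left, V) where
  toFun ν := (exists_isKap H hV ν).choose
  map_add' ν μ := IsKap.form_unique H hV (exists_isKap H hV (ν + μ)).choose_spec
    ((exists_isKap H hV ν).choose_spec.add H (exists_isKap H hV μ).choose_spec)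
  map_smul' a ν := IsKap.form_unique H hV (exists_isKap H hV (a • ν)).choose_spec
    ((exists_isKap H hV ν).choose_spec.smul H a)

lemma isKap_kapHom {V : f.src.left.Opens} (hV : IsAffineOpen V)
    (ν : ⋀[Γ(f.src.left, V)]^c (f.Nor V)) : IsKap f H.deg ω ν (kapHom H hV ν) :=
  (exists_isKap H hV ν).choose_spec

/-- Source and target both localize, so bijectivity is checked on charts, where each of `ν` and `w`
determines the other. -/
lemma kapHom_bijective {V : f.src.left.Opens} (hV : IsAffineOpen V) :
    Function.Bijective (kapHom H hV) := by
  obtain ⟨m, s, W, hW, hs, hs'⟩ := exists_chart_cover H hV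
  have hle : ∀ i, f.hom.left ⁻¹ᵁ (W i).1 ≤ V := fun i =>
    (hs i).trans_le (f.src.left.basicOpen_le _)
  refine bijective_of_isLoc s hs' (fun i => extMap_norRes_isLoc H hV (s i) (hs i) (hle i) c)
    (fun i => formPull_isLoc hV (s i) (hs i) (hle i) d) _ (fun i => kapHom H (hW i).affine)
    (fun i x => ?_) fun i => ?_
  · exact IsKap.form_unique H (hW i).affine ((isKap_kapHom H hV x).res H (hle i))
      (isKap_kapHom H (hW i).affine _)
  · refine ⟨fun ν μ h => ?_, fun w => ?_⟩
    · refine (existsUnique_normal_chart H (hW i) (kapHom H (hW i).affine ν)).unique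
        (isKap_kapHom H _ ν) ?_
      rw [h]
      exact isKap_kapHom H _ μ
    · obtain ⟨ν, hν⟩ := (existsUnique_normal_chart H (hW i) w).exists
      exact ⟨ν, IsKap.form_unique H (hW i).affine (isKap_kapHom H _ ν) hν⟩

/-- The isomorphism `⋀ᶜ N ≅ Ωᵈ` on an affine open subset. -/
def kap {V : f.src.left.Opens} (hV : IsAffineOpen V) :
    (⋀[Γ(f.src.left, V)]^c (f.Nor V)) ≃ₗ[Γ(f.src.left, V)] Form d Γ(f.src.left, V) :=
  LinearEquiv.ofBijective (kapHom H hV) (kapHom_bijective H hV)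

lemma isKap_kap {V : f.src.left.Opens} (hV : IsAffineOpen V)
    (ν : ⋀[Γ(f.src.left, V)]^c (f.Nor V)) : IsKap f H.deg ω ν (kap H hV ν) :=
  isKap_kapHom H hV ν

lemma IsKap.kap_eq {V : f.src.left.Opens} (hV : IsAffineOpen V)
    {ν : ⋀[Γ(f.src.left, V)]^c (f.Nor V)} {w : Form d Γ(f.src.left, V)}
    (h : IsKap f H.deg ω ν w) : kap H hV ν = w :=
  IsKap.form_unique H hV (isKap_kap H hV ν) h

end

section

/-! ### Vector fields on an affine open subset as the dual of the differentials -/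

section Lift

variable {A B C M N P : Type} [CommRing A] [CommRing B] [CommRing C] [AddCommGroup M] [Module A M]
  [AddCommGroup N] [Module B N] [AddCommGroup P] [Module C P] {φ : A →+* B} {ρ : B →+* C}
  {χ : A →+* C} {s : A} {g : M →ₛₗ[φ] N}

lemma IsLoc.hom_ext (hg : IsLoc s g) {h h' : N →ₛₗ[ρ] P} (H : ∀ x, h (g x) = h' (g x)) :
    h = h' := by
  ext y
  obtain ⟨x, k, hx⟩ := hg.surj y
  have h₁ := H x
  rw [hx, map_smulₛₗ, map_smulₛₗ, map_pow] at h₁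
  exact ((hg.unit.map ρ).pow k).smul_left_cancel.1 h₁

/-- The universal property of localization for a map to a module over a third ring in which `s`
becomes invertible. That `φ` is a localization too is needed for linearity over `B`, whose elements
must be written as fractions. -/
lemma IsLoc.exists_lift (hg : IsLoc s g) (hφ : IsLocRing φ s) (hχ : ∀ a, ρ (φ a) = χ a) (h : M →ₛₗ[χ] P) :
    ∃ h' : N →ₛₗ[ρ] P, ∀ x, h' (g x) = h x := by
  have hu : ∀ k : ℕ, IsUnit (χ s ^ k) := fun k => by
    rw [← hχ]; exact (hg.unit.map ρ).pow k
  have key : ∀ (x x' : M) (k l : ℕ) (y : N), g x = φ s ^ k • y → g x' = φ s ^ l • y →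
      χ s ^ l • h x = χ s ^ k • h x' := by
    intro x x' k l y hx hx'
    obtain ⟨m, hm⟩ := hg.inj (s ^ l • x - s ^ k • x') (by
      rw [map_sub, map_smulₛₗ, map_smulₛₗ, hx, hx', map_pow, map_pow, smul_comm, sub_self])
    have h₁ := congrArg h hm
    rw [map_smulₛₗ, map_sub, map_smulₛₗ, map_smulₛₗ, map_zero, map_pow, map_pow, map_pow] at h₁
    exact sub_eq_zero.1 ((hu m).smul_left_cancel.1 (h₁.trans (smul_zero _).symm))
  choose x k hx using hg.surj
  choose u hu' using hu
  let h' : N → P := fun y => ((u (k y))⁻¹ : Cˣ) • h (x y)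
  -- The chosen formula is independent of the representation of `y` as a fraction; additivity and
  -- linearity follow by comparing representations.
  have hh' : ∀ y z (l : ℕ), g z = φ s ^ l • y → χ s ^ l • h' y = h z := by
    intro y z l hz
    have h₁ := key _ _ _ _ _ (hx y) hz
    change χ s ^ l • ((u (k y))⁻¹ : Cˣ) • h (x y) = _
    rw [smul_comm, h₁, ← hu', ← Units.smul_def, inv_smul_smul]
  have hu'' : ∀ (l : ℕ) (p q : P), χ s ^ l • p = χ s ^ l • q → p = q := fun l p q hpq => by
    rw [← hu' l, ← Units.smul_def, ← Units.smul_def] at hpq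
    exact smul_left_cancel _ hpq
  refine ⟨{ toFun := h', map_add' := fun y z => ?_, map_smul' := fun b y => ?_ }, fun x => ?_⟩
  · have h₁ := hh' (y + z) (s ^ k z • x y + s ^ k y • x z) (k y + k z) (by
      rw [map_add, map_smulₛₗ, map_smulₛₗ, hx y, hx z, map_pow, map_pow, smul_smul, smul_smul,
        smul_add, ← pow_add, ← pow_add, add_comm (k z)])
    refine hu'' _ _ _ (h₁.trans ?_)
    rw [map_add, map_smulₛₗ, map_smulₛₗ, map_pow, map_pow, ← hh' y (x y) (k y) (hx y),
      ← hh' z (x z) (k z) (hx z), smul_smul, smul_smul, smul_add, ← pow_add, ← pow_add,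
      add_comm (k z)]
  · obtain ⟨a, m, ha⟩ := hφ.surj b
    have h₁ := hh' (b • y) (a • x y) (m + k y) (by
      rw [map_smulₛₗ, ha, hx, smul_smul, smul_smul, pow_add]
      congr 1
      ring)
    refine hu'' _ _ _ (h₁.trans ?_)
    rw [map_smulₛₗ, ← hχ, ha, ← hh' y (x y) (k y) (hx y), map_mul, map_pow, hχ, smul_smul, smul_smul]
    congr 1
    ring
  · have h₁ := hh' (g x) x 0 (by rw [pow_zero, one_smul])
    rwa [pow_zero, one_smul] at h₁

end Lift

section Tan

variable {f : Mor}

/-- Derivations can be compared on a basis of open subsets. -/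
lemma tan_eq_of_basis {V : f.src.left.Opens} (J : f.tgt.left.Opens → Prop)
    (hJ : ∀ W, J W → f.hom.left ⁻¹ᵁ W ≤ V)
    (hJ' : ∀ z ∈ V, ∀ W, f.hom.left z ∈ W → ∃ W', J W' ∧ f.hom.left z ∈ W' ∧ W' ≤ W)
    {ν μ : f.Tan V} (h : ∀ W (hW : J W), ν.1.ev ⟨W, hJ W hW⟩ = μ.1.ev ⟨W, hJ W hW⟩) : ν = μ := by
  apply Subtype.ext
  apply Mor.tan_ext
  intro W a
  refine eq_of_locally_eq fun z hz => ?_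
  obtain ⟨W', hW', hz', hle⟩ := hJ' z (W.2 hz) W.1 hz
  refine ⟨f.hom.left ⁻¹ᵁ W', f.preimage_mono hle, hz', ?_⟩
  have h₁ := ν.2.2 W ⟨W', hJ W' hW'⟩ hle a
  have h₂ := μ.2.2 W ⟨W', hJ W' hW'⟩ hle a
  rw [h W' hW'] at h₁
  exact h₁.symm.trans h₂

/-- Derivations can be glued from a basis of open subsets. -/
lemma exists_tan_of_basis {V : f.src.left.Opens} (J : f.tgt.left.Opens → Prop)
    (hJ : ∀ W, J W → f.hom.left ⁻¹ᵁ W ≤ V)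
    (hJ' : ∀ z ∈ V, ∀ W, f.hom.left z ∈ W → ∃ W', J W' ∧ f.hom.left z ∈ W' ∧ W' ≤ W)
    (ν : ∀ W, J W → (f.Fun W →ₗ[ℂ] f.Fib W))
    (hν₀ : ∀ W (hW : J W) (a b : f.Fun W),
      ν W hW (a * b) = f.sharp W a * ν W hW b + f.sharp W b * ν W hW a)
    (hν : ∀ W W' (hW : J W) (hW' : J W') (h : W' ≤ W) (a : f.Fun W),
      ν W' hW' (res f.tgt h a) = res f.src (f.preimage_mono h) (ν W hW a)) :
    ∃ μ : f.Tan V, ∀ W (hW : J W), μ.1.ev ⟨W, hJ W hW⟩ = ν W hW := by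
  have key : ∀ (W : f.Idx V) (a : f.Fun W.1), ∃ y : f.Fib W.1, ∀ W' (hW' : J W')
      (h : W' ≤ W.1), res f.src (f.preimage_mono h) y = ν W' hW' (res f.tgt h a) := by
    intro W a
    obtain ⟨y, hy⟩ := exists_glue (Y := f.src) (V := f.hom.left ⁻¹ᵁ W.1)
      (ι := {W' : f.tgt.left.Opens // J W' ∧ W' ≤ W.1}) (fun W' => f.hom.left ⁻¹ᵁ W'.1)
      (fun W' => f.preimage_mono W'.2.2) (fun z hz => by
        obtain ⟨W', hW', hz', hle⟩ := hJ' z (W.2 hz) W.1 hz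
        exact ⟨⟨W', hW', hle⟩, hz'⟩)
      (fun W' => ν W'.1 W'.2.1 (res f.tgt W'.2.2 a)) (by
        intro i j z hz
        obtain ⟨W', hW', hz', hle⟩ := hJ' z (hJ _ i.2.1 hz.1) (i.1 ⊓ j.1) hz
        refine ⟨f.hom.left ⁻¹ᵁ W', f.preimage_mono (hle.trans inf_le_left),
          f.preimage_mono (hle.trans inf_le_right), hz', ?_⟩
        rw [← hν i.1 W' i.2.1 hW' (hle.trans inf_le_left),
          ← hν j.1 W' j.2.1 hW' (hle.trans inf_le_right)]
        congr 1
        exact (res_res _ _ _).trans (res_res _ _ _).symm)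
    exact ⟨y, fun W' hW' h => hy ⟨W', hW', h⟩⟩
  have uniq : ∀ (W : f.Idx V) (x y : f.Fib W.1), (∀ W' (_ : J W') (h : W' ≤ W.1),
      res f.src (f.preimage_mono h) x = res f.src (f.preimage_mono h) y) → x = y := by
    intro W x y h
    refine eq_of_locally_eq fun z hz => ?_
    obtain ⟨W', hW', hz', hle⟩ := hJ' z (W.2 hz) W.1 hz
    exact ⟨f.hom.left ⁻¹ᵁ W', f.preimage_mono hle, hz', h W' hW' hle⟩
  choose y hy using key
  refine ⟨⟨fun W =>
    { toFun := y W
      map_add' := fun a b => uniq W _ _ fun W' hW' h => ?_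
      map_smul' := fun r a => uniq W _ _ fun W' hW' h => ?_ }, ?_, ?_⟩, ?_⟩
  · rw [map_add, hy W _ W' hW' h, hy W _ W' hW' h, hy W _ W' hW' h, map_add, map_add]
  · rw [RingHom.id_apply, map_smul, hy W _ W' hW' h, hy W _ W' hW' h, map_smul, map_smul]
  · intro W a b
    refine uniq W _ _ fun W' hW' h => ?_
    change res f.src _ (y W _) = res f.src _ (f.sharp W.1 a * y W b + f.sharp W.1 b * y W a)
    rw [map_add, map_mul, map_mul, hy W _ W' hW' h, hy W _ W' hW' h, hy W _ W' hW' h, map_mul,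
      hν₀, f.sharp_res h, f.sharp_res h]
  · intro W W' h a
    refine uniq W' _ _ fun W'' hW'' h' => ?_
    change res f.src _ (y W' _) = res f.src _ (res f.src _ (y W a))
    refine (hy W' _ W'' hW'' h').trans ?_
    refine Eq.trans ?_ (res_res (f.preimage_mono h) (f.preimage_mono h') (y W a)).symm
    refine Eq.trans ?_ (hy W a W'' hW'' (h'.trans h)).symm
    congr 1
    exact res_res _ _ _
  · intro W hW
    ext a
    refine uniq ⟨W, hJ W hW⟩ _ _ fun W' hW' h => ?_
    change res f.src _ (y ⟨W, hJ W hW⟩ a) = _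
    rw [hy ⟨W, hJ W hW⟩ a W' hW' h]
    exact hν W W' hW hW' h a

end Tan

section Vec

variable (f : Mor) {V : f.src.left.Opens}

lemma basicOpen_basis (hV : IsAffineOpen V) (z : f.src.left) (hz : z ∈ V) (W : f.src.left.Opens)
    (hW : z ∈ W) : ∃ W', (∃ s : Γ(f.src.left, V), W' = f.src.left.basicOpen s) ∧ z ∈ W' ∧
      W' ≤ W := by
  obtain ⟨s, h₁, h₂⟩ := hV.exists_basicOpen_le ⟨z, hW⟩ hz
  exact ⟨_, ⟨s, rfl⟩, h₂, h₁⟩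

/-- The value of a vector field on an open subset, as a map on differentials. -/
lemma vec_der {W : f.idSrc.Idx V} (D : f.Vec V) :
    ∃ θ : Ω[f.idSrc.Fun W.1⁄ℂ] →ₛₗ[(f.idSrc.sharp W.1 : f.idSrc.Fun W.1 →+* f.idSrc.Fib W.1)]
      f.idSrc.Fib W.1, ∀ a, θ (KaehlerDifferential.D ℂ _ a) = D.1.ev W a := by
  let _ : Algebra (f.idSrc.Fun W.1) (f.idSrc.Fib W.1) :=
    (f.idSrc.sharp W.1 : f.idSrc.Fun W.1 →+* f.idSrc.Fib W.1).toAlgebra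
  have _ : IsScalarTower ℂ (f.idSrc.Fun W.1) (f.idSrc.Fib W.1) :=
    IsScalarTower.of_algebraMap_eq fun x => ((f.idSrc.sharp W.1).commutes x).symm
  let δ : Derivation ℂ (f.idSrc.Fun W.1) (f.idSrc.Fib W.1) :=
    Derivation.mk' (D.1.ev W) fun a b => D.2.1 W a b
  exact ⟨{ toFun := δ.liftKaehlerDifferential
           map_add' := map_add _
           map_smul' := fun a x => map_smul δ.liftKaehlerDifferential a x },
    fun a => δ.liftKaehlerDifferential_comp_D a⟩

lemma vecDual_D (D : f.Vec V) (a : Γ(f.src.left, V)) :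
    vecDual f V D (KaehlerDifferential.D ℂ _ a) = res f.src le_rfl (D.1.ev ⟨V, le_rfl⟩ a) :=
  (vecDer f V D).liftKaehlerDifferential_comp_D a

/-- The dual form determines the derivation of `O(V)`. On a basic open subset the differentials are
localized from `V`, so the derivation there is determined as well. -/
lemma vecDual_injective (hV : IsAffineOpen V) : Function.Injective (vecDual f V) := by
  intro D E h
  refine tan_eq_of_basis (f := f.idSrc) (fun W => ∃ s : Γ(f.src.left, V), W = f.src.left.basicOpen s)
    (fun W ⟨s, hs⟩ => hs.trans_le (f.src.left.basicOpen_le s)) (basicOpen_basis f hV) ?_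
  rintro W ⟨s, hs⟩
  have hle : W ≤ V := hs.trans_le (f.src.left.basicOpen_le s)
  obtain ⟨θ, hθ⟩ := vec_der f (W := ⟨W, hle⟩) D
  obtain ⟨θ', hθ'⟩ := vec_der f (W := ⟨W, hle⟩) E
  have h₀ : ∀ a, D.1.ev ⟨V, le_rfl⟩ a = E.1.ev ⟨V, le_rfl⟩ a := fun a => by
    have h₁ := congrArg (fun l => l (KaehlerDifferential.D ℂ _ a)) h
    rw [vecDual_D, vecDual_D] at h₁
    have h₂ := congrArg (res f.src (V' := (𝟙 f.src : f.src ⟶ f.src).left ⁻¹ᵁ V) le_rfl) h₁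
    rwa [res_res, res_res, res_self, res_self] at h₂
  have h₁ : θ = θ' := (res_isLocRing hV s hs hle).kaehlerMap.hom_ext fun x => by
    induction x using kaehler_induction with
    | h₁ a =>
      rw [kaehlerMap_D, hθ, hθ']
      have h₁ := D.2.2 ⟨V, le_rfl⟩ ⟨W, hle⟩ hle a
      rw [h₀] at h₁
      exact h₁.trans (E.2.2 ⟨V, le_rfl⟩ ⟨W, hle⟩ hle a).symm
    | h₀ => simp only [map_zero]
    | h₂ x y hx hy => simp only [map_add, hx, hy]
    | h₃ a x hx => simp only [map_smulₛₗ, hx]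
  ext a
  rw [← hθ, ← hθ', h₁]

/-- A linear form on the differentials over `V` extends to every basic open subset by localization.
The extensions give derivations, compatible because localized maps are determined on `V`, and these
glue to a vector field. -/
lemma vecDual_surjective (hV : IsAffineOpen V) : Function.Surjective (vecDual f V) := by
  intro l
  have key : ∀ W, (∃ s : Γ(f.src.left, V), W = f.src.left.basicOpen s) →
      ∃ θ : Ω[f.idSrc.Fun W⁄ℂ] →ₛₗ[(f.idSrc.sharp W : f.idSrc.Fun W →+* f.idSrc.Fib W)]
        f.idSrc.Fib W, ∀ (hle : W ≤ V) (x : Ω[Γ(f.src.left, V)⁄ℂ]),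
          θ (kaehlerMap (res f.src hle) x) =
            res f.src (V' := (𝟙 f.src : f.src ⟶ f.src).left ⁻¹ᵁ W) hle (l x) := by
    rintro W ⟨s, hs⟩
    have hle : W ≤ V := hs.trans_le (f.src.left.basicOpen_le s)
    obtain ⟨θ, hθ⟩ := (res_isLocRing hV s hs hle).kaehlerMap.exists_lift
      (res_isLocRing hV s hs hle)
      (ρ := (f.idSrc.sharp W : f.idSrc.Fun W →+* f.idSrc.Fib W))
      (χ := ((res f.src (V' := (𝟙 f.src : f.src ⟶ f.src).left ⁻¹ᵁ W) hle :
        Γ(f.src.left, V) →ₐ[ℂ] f.idSrc.Fib W) : Γ(f.src.left, V) →+* f.idSrc.Fib W))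
      (fun a => res_res hle _ a)
      { toFun := fun x => res f.src (V' := (𝟙 f.src : f.src ⟶ f.src).left ⁻¹ᵁ W) hle (l x)
        map_add' := fun x y => by rw [map_add, map_add]
        map_smul' := fun a x => by rw [map_smul, smul_eq_mul, map_mul]; rfl }
    exact ⟨θ, fun _ => hθ⟩
  choose θ hθ using key
  obtain ⟨D, hD⟩ := exists_tan_of_basis (f := f.idSrc) (V := V)
    (fun W => ∃ s : Γ(f.src.left, V), W = f.src.left.basicOpen s)
    (fun W ⟨s, hs⟩ => hs.trans_le (f.src.left.basicOpen_le s)) (basicOpen_basis f hV)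
    (fun W hW =>
      { toFun := fun a => θ W hW (KaehlerDifferential.D ℂ _ a)
        map_add' := fun a b => by rw [map_add, map_add]
        map_smul' := fun z a => by
          rw [Derivation.map_smul, ← algebraMap_smul (f.idSrc.Fun W) z, map_smulₛₗ, smul_eq_mul,
            RingHom.id_apply, Algebra.smul_def]
          congr 1
          exact (f.idSrc.sharp W).commutes z })
    (fun W hW a b => by
      change θ W hW _ = f.idSrc.sharp W a * θ W hW _ + f.idSrc.sharp W b * θ W hW _
      rw [Derivation.leibniz, map_add, map_smulₛₗ, map_smulₛₗ]
      rfl)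
    (by
      intro W W' hW hW' h a
      obtain ⟨s, hs⟩ := id hW
      have hle : W ≤ V := hs.trans_le (f.src.left.basicOpen_le s)
      let θ₁ : Ω[f.idSrc.Fun W⁄ℂ] →ₛₗ[((res f.src (V' := (𝟙 f.src : f.src ⟶ f.src).left ⁻¹ᵁ W') h :
          f.idSrc.Fun W →ₐ[ℂ] f.idSrc.Fib W') : f.idSrc.Fun W →+* f.idSrc.Fib W')] f.idSrc.Fib W' :=
        { toFun := fun x => θ W' hW' (kaehlerMap (res f.src h) x)
          map_add' := fun x y => by rw [map_add, map_add]
          map_smul' := fun a x => by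
            rw [map_smulₛₗ, map_smulₛₗ]
            congr 1
            exact res_res h _ a }
      let θ₂ : Ω[f.idSrc.Fun W⁄ℂ] →ₛₗ[((res f.src (V' := (𝟙 f.src : f.src ⟶ f.src).left ⁻¹ᵁ W') h :
          f.idSrc.Fun W →ₐ[ℂ] f.idSrc.Fib W') : f.idSrc.Fun W →+* f.idSrc.Fib W')] f.idSrc.Fib W' :=
        { toFun := fun x => res f.src (f.idSrc.preimage_mono h) (θ W hW x)
          map_add' := fun x y => by rw [map_add, map_add]
          map_smul' := fun a x => by
            rw [map_smulₛₗ, smul_eq_mul, map_mul]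
            congr 1
            exact res_res _ _ a }
      have h₁ : θ₁ = θ₂ := (res_isLocRing hV s hs hle).kaehlerMap.hom_ext fun x => by
        change θ W' hW' (kaehlerMap (res f.src h) (kaehlerMap (res f.src hle) x)) =
          res f.src (f.idSrc.preimage_mono h) (θ W hW (kaehlerMap (res f.src hle) x))
        rw [kaehlerMap_comp (res f.src hle) (res f.src h) (res f.src (h.trans hle))
          (fun a => res_res _ _ a), hθ, hθ]
        exact (res_res _ _ _).symm
      have h₂ := congrArg (fun k => k (KaehlerDifferential.D ℂ _ a)) h₁
      refine Eq.trans ?_ h₂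
      change θ W' hW' _ = θ W' hW' _
      rw [kaehlerMap_D])
  refine ⟨D, ?_⟩
  -- `V` is the basic open subset of `1`, so the glued field can be evaluated on `V` itself.
  have hV' : ∃ s : Γ(f.src.left, V), V = f.src.left.basicOpen s :=
    ⟨1, by rw [Scheme.basicOpen_one]⟩
  refine LinearMap.ext fun x => ?_
  induction x using kaehler_induction with
  | h₁ a =>
    rw [vecDual_D, hD V hV']
    change res f.src le_rfl (θ V hV' (KaehlerDifferential.D ℂ _ a)) = _
    have h₁ := hθ V hV' le_rfl (KaehlerDifferential.D ℂ _ a)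
    have h₂ : res f.src le_rfl a = a := res_self le_rfl a
    rw [kaehlerMap_D, h₂] at h₁
    exact (congrArg _ h₁).trans ((res_res _ _ _).trans (res_self _ _))
  | h₀ => simp only [map_zero]
  | h₂ x y hx hy => simp only [map_add, hx, hy]
  | h₃ a x hx => simp only [map_smul, hx]

end Vec

end

section

/-! ### The isomorphism `⋀ᵇ T ⊗ L ≅ ⋀ᵇ' M` -/

section Algebra

variable {A M T L : Type} [CommRing A] [AddCommGroup M] [Module A M] [AddCommGroup T] [Module A T]
  [AddCommGroup L] [Module A L]

lemma exteriorPower_map_bijective {D : T →ₗ[A] M} (hD : Function.Bijective D) (b : ℕ) :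
    Function.Bijective (exteriorPower.map b D) := by
  let e := LinearEquiv.ofBijective D hD
  have h₁ : D ∘ₗ e.symm.toLinearMap = LinearMap.id := LinearMap.ext fun x => e.apply_symm_apply x
  have h₂ : e.symm.toLinearMap ∘ₗ D = LinearMap.id := LinearMap.ext fun x => e.symm_apply_apply x
  refine Function.bijective_iff_has_inverse.2 ⟨exteriorPower.map b e.symm.toLinearMap,
    fun x => ?_, fun x => ?_⟩
  · rw [← LinearMap.comp_apply, ← exteriorPower.map_comp, h₂, exteriorPower.map_id,
      LinearMap.id_apply]
  · rw [← LinearMap.comp_apply, ← exteriorPower.map_comp, h₁, exteriorPower.map_id,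
      LinearMap.id_apply]

/-- The wedge product of forms of complementary degrees. -/
def wedgeHom (M : Type) [AddCommGroup M] [Module A M] {b b' d : ℕ} (h : b + b' = d) :
    (⋀[A]^b' M) →ₗ[A] (⋀[A]^b M) →ₗ[A] (⋀[A]^d M) :=
  LinearMap.mk₂ A (fun w η => wedge h η w) (fun _ _ _ => Subtype.ext (mul_add _ _ _))
    (fun _ _ _ => Subtype.ext (mul_smul_comm _ _ _)) (fun _ _ _ => Subtype.ext (add_mul _ _ _))
    (fun _ _ _ => Subtype.ext (smul_mul_assoc _ _ _))

/-- The homomorphism of `⋀ᵇ M` to `⋀ᵈ M` given by an element of `⋀ᵇ T ⊗ L`, for `T → Mᵛ` and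
`L → ⋀ᵈ M`. -/
def pairHom (D : T →ₗ[A] Module.Dual A M) {d : ℕ} (K : L →ₗ[A] ⋀[A]^d M) (b : ℕ) :
    (⋀[A]^b T) ⊗[A] L →ₗ[A] (⋀[A]^b M) →ₗ[A] (⋀[A]^d M) :=
  dualTensorHom A (⋀[A]^b M) (⋀[A]^d M) ∘ₗ
    TensorProduct.map (exteriorPower.pairingDual A M b ∘ₗ exteriorPower.map b D) K

/-- Composite of the duality of exterior powers, the isomorphism `K`, and the identification of dual
tensor module with homomorphisms for the finitely generated projective module `⋀ᵇ M`. -/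
lemma pairHom_bijective [Module.Finite A M] [Module.Projective A M] {D : T →ₗ[A] Module.Dual A M}
    (hD : Function.Bijective D) {d : ℕ} {K : L →ₗ[A] ⋀[A]^d M} (hK : Function.Bijective K) (b : ℕ) :
    Function.Bijective (pairHom D K b) := by
  have h₁ : Function.Bijective (exteriorPower.pairingDual A M b ∘ₗ exteriorPower.map b D) :=
    (pairingDual_bijective b).comp (exteriorPower_map_bijective hD b)
  exact (dualTensorHom_bijective (M := ⋀[A]^b M) (N := ⋀[A]^d M) (R := A)).comp
    (TensorProduct.congr (LinearEquiv.ofBijective _ h₁) (LinearEquiv.ofBijective K hK)).bijective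

variable [Module.Finite A M] [Module.Projective A M] {b b' d : ℕ} (h : b + b' = d)
  (htop : ∀ x ∈ ⋀[A]^(d + 1) M, x = 0) (hf : ∀ a : A, (∀ x : ⋀[A]^d M, a • x = 0) → a = 0)
  (D : T →ₗ[A] Module.Dual A M) (hD : Function.Bijective D) (K : L →ₗ[A] ⋀[A]^d M)
  (hK : Function.Bijective K)

include htop hf in
lemma wedgeHom_bijective : Function.Bijective (wedgeHom (A := A) M h) := by
  rw [Function.bijective_iff_existsUnique]
  intro g
  obtain ⟨w, hw, hw'⟩ := existsUnique_wedge_eq M h htop hf g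
  exact ⟨w, LinearMap.ext fun η => Subtype.ext (hw η), fun v hv => hw' v fun η =>
    congrArg (fun k : (⋀[A]^b M) →ₗ[A] (⋀[A]^d M) => (k η : ExteriorAlgebra A M)) hv⟩

/-- The isomorphism `⋀ᵇ T ⊗ L ≅ ⋀ᵇ' M` given by the wedge pairing, for `T ≅ Mᵛ` and
`L ≅ ⋀ᵈ M`. -/
def wedgeDual : ((⋀[A]^b T) ⊗[A] L) ≃ₗ[A] ⋀[A]^b' M :=
  (LinearEquiv.ofBijective (pairHom D K b) (pairHom_bijective hD hK b)).trans
    (LinearEquiv.ofBijective (wedgeHom (A := A) M h) (wedgeHom_bijective h htop hf)).symm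

lemma wedge_wedgeDual (x : (⋀[A]^b T) ⊗[A] L) (η : ⋀[A]^b M) :
    wedge h η (wedgeDual h htop hf D hD K hK x) = pairHom D K b x η := by
  have h₁ : wedgeHom M h (wedgeDual h htop hf D hD K hK x) = pairHom D K b x :=
    (LinearEquiv.ofBijective (wedgeHom (A := A) M h) (wedgeHom_bijective h htop hf)).apply_symm_apply _
  rw [← h₁]
  rfl

omit [Module.Finite A M] [Module.Projective A M] in
lemma pairHom_tmul (P : ⋀[A]^b T) (ν : L) (η : ⋀[A]^b M) : pairHom D K b (P ⊗ₜ ν) η =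
    exteriorPower.pairingDual A M b (exteriorPower.map b D P) η • K ν := rfl

lemma eq_wedgeDual {x : (⋀[A]^b T) ⊗[A] L} {w : ⋀[A]^b' M}
    (hw : ∀ η, wedge h η w = pairHom D K b x η) : w = wedgeDual h htop hf D hD K hK x := by
  apply (wedgeHom_bijective h htop hf).1
  refine LinearMap.ext fun η => ?_
  exact (hw η).trans (wedge_wedgeDual h htop hf D hD K hK x η).symm

end Algebra

section Naturality

variable {A B M N : Type} [CommRing A] [CommRing B]
  [AddCommGroup M] [Module A M] [AddCommGroup N] [Module B N] {φ : A →+* B} (g : M →ₛₗ[φ] N)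

lemma extMap_wedge' {r t n : ℕ} (h : r + t = n) (x : ⋀[A]^r M) (y : ⋀[A]^t M) :
    extMap g n (wedge h x y) = wedge h (extMap g r x) (extMap g t y) := by
  induction x using ext_induction with
  | h₁ v => rw [extMap_wedge_right, extMap_ιMulti]
  | h₀ =>
    have h₁ : ∀ {A M : Type} [CommRing A] [AddCommGroup M] [Module A M] (y : ⋀[A]^t M),
      wedge h (0 : ⋀[A]^r M) y = 0 := fun y => Subtype.ext (zero_mul _)
    rw [h₁, map_zero, map_zero, h₁]
  | h₂ x x' hx hx' =>
    have h₁ : ∀ {A M : Type} [CommRing A] [AddCommGroup M] [Module A M] (x x' : ⋀[A]^r M)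
      (y : ⋀[A]^t M), wedge h (x + x') y = wedge h x y + wedge h x' y := fun x x' y =>
      Subtype.ext (add_mul _ _ _)
    rw [h₁, map_add, map_add, h₁, hx, hx']
  | h₃ a x hx =>
    have h₁ : ∀ {A M : Type} [CommRing A] [AddCommGroup M] [Module A M] (a : A) (x : ⋀[A]^r M)
      (y : ⋀[A]^t M), wedge h (a • x) y = a • wedge h x y := fun a x y =>
      Subtype.ext (smul_mul_assoc _ _ _)
    rw [h₁, map_smulₛₗ, map_smulₛₗ, h₁, hx]

variable {T T' L L' : Type} [AddCommGroup T] [Module A T] [AddCommGroup T'] [Module B T']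
  {D : T →ₗ[A] Module.Dual A M} {D' : T' →ₗ[B] Module.Dual B N} {gT : T →ₛₗ[φ] T'}
  (hD : ∀ t m, D' (gT t) (g m) = φ (D t m))

include hD

lemma pairingDual_extMap (b : ℕ) (P : ⋀[A]^b T) (η : ⋀[A]^b M) :
    exteriorPower.pairingDual B N b (exteriorPower.map b D' (extMap gT b P)) (extMap g b η) =
      φ (exteriorPower.pairingDual A M b (exteriorPower.map b D P) η) := by
  induction P using ext_induction with
  | h₁ P =>
    induction η using ext_induction with
    | h₁ η =>
      rw [extMap_ιMulti, extMap_ιMulti, exteriorPower.map_apply_ιMulti,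
        exteriorPower.map_apply_ιMulti, exteriorPower.pairingDual_ιMulti_ιMulti,
        exteriorPower.pairingDual_ιMulti_ιMulti, RingHom.map_det]
      congr 1
      ext i j
      exact hD _ _
    | h₀ => simp only [map_zero]
    | h₂ x y hx hy => simp only [map_add, hx, hy]
    | h₃ a x hx => simp only [map_smulₛₗ, hx, smul_eq_mul, map_mul, RingHom.id_apply]
  | h₀ => simp only [map_zero, LinearMap.zero_apply]
  | h₂ x y hx hy => simp only [map_add, hx, hy, LinearMap.add_apply]
  | h₃ a x hx =>
    simp only [map_smulₛₗ, hx, smul_eq_mul, map_mul, RingHom.id_apply, LinearMap.smul_apply]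

variable {R R' : Type} [AddCommGroup R] [Module A R] [AddCommGroup R'] [Module B R']
  {c d : ℕ} {K : (⋀[A]^c R) →ₗ[A] ⋀[A]^d M} {K' : (⋀[B]^c R') →ₗ[B] ⋀[B]^d N} {gR : R →ₛₗ[φ] R'}
  (hK : ∀ x, K' (extMap gR c x) = extMap g d (K x))

include hK

/-- The image is characterized by its wedge products with all elements of degree `b`. Both sides are
linear there, so it suffices to test the images of elements of `⋀ᵇ M`; this is what the spanning
hypothesis `hs` is for. -/
lemma wedgeDual_polMap [Module.Finite A M] [Module.Projective A M] [Module.Finite B N]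
    [Module.Projective B N] {b b' : ℕ} (h : b + b' = d)
    (htop : ∀ x ∈ ⋀[A]^(d + 1) M, x = 0) (hf : ∀ a : A, (∀ x : ⋀[A]^d M, a • x = 0) → a = 0)
    (hD₁ : Function.Bijective D) (hK₁ : Function.Bijective K)
    (htop' : ∀ x ∈ ⋀[B]^(d + 1) N, x = 0) (hf' : ∀ a : B, (∀ x : ⋀[B]^d N, a • x = 0) → a = 0)
    (hD₁' : Function.Bijective D') (hK₁' : Function.Bijective K')
    (hs : Submodule.span B (Set.range (extMap g b)) = ⊤) (x : (⋀[A]^b T) ⊗[A] (⋀[A]^c R)) :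
    wedgeDual h htop' hf' D' hD₁' K' hK₁' (polMap gT gR b c x) =
      extMap g b' (wedgeDual h htop hf D hD₁ K hK₁ x) := by
  symm
  apply eq_wedgeDual
  intro η
  have key : ∀ η, pairHom D' K' b (polMap gT gR b c x) (extMap g b η) =
      extMap g d (pairHom D K b x η) := by
    intro η
    induction x using TensorProduct.induction_on with
    | zero => simp only [map_zero, LinearMap.zero_apply]
    | add x y hx hy => simp only [map_add, hx, hy, LinearMap.add_apply]
    | tmul P ν =>
      rw [polMap_tmul, pairHom_tmul, pairHom_tmul, pairingDual_extMap g hD, hK, map_smulₛₗ]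
  have hη : η ∈ Submodule.span B (Set.range (extMap g b)) := by rw [hs]; trivial
  induction hη using Submodule.span_induction with
  | mem η h₁ =>
    obtain ⟨η, rfl⟩ := h₁
    rw [key, ← wedge_wedgeDual h htop hf D hD₁ K hK₁, extMap_wedge']
  | zero => exact (Subtype.ext (zero_mul _)).trans (map_zero _).symm
  | add η η' _ _ h₁ h₂ =>
    rw [map_add, ← h₁, ← h₂]
    exact Subtype.ext (add_mul _ _ _)
  | smul a η _ h₁ =>
    rw [map_smul, ← h₁]
    exact Subtype.ext (smul_mul_assoc _ _ _)

end Naturality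

/-! ### Forms on affine open subsets of a smooth scheme -/

section Smooth

variable {Y : Over SpecC} {d : ℕ} (hY : SmoothOfRelativeDimension d Y.hom) {V : Y.left.Opens}
  (hV : IsAffineOpen V)

include hY hV

lemma finite_kaehler : Module.Finite Γ(Y.left, V) Ω[Γ(Y.left, V)⁄ℂ] := by
  have _ := SmoothOfRelativeDimension.smooth d Y.hom
  have h₁ := Y.hom.finiteType_appLE (isAffineOpen_top SpecC) hV (le_preimage_top Y V)
  have h₂ : (Scheme.ΓSpecIso (CommRingCat.of ℂ)).inv.hom.FiniteType :=
    RingHom.FiniteType.of_surjective _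
      ((Scheme.ΓSpecIso (CommRingCat.of ℂ)).symm.commRingCatIsoToRingEquiv.surjective)
  have _ : Algebra.FiniteType ℂ Γ(Y.left, V) := h₁.comp h₂
  infer_instance

lemma projective_kaehler : Module.Projective Γ(Y.left, V) Ω[Γ(Y.left, V)⁄ℂ] := by
  have _ := formallySmooth_sections hY hV
  infer_instance

lemma exists_basis_cover : ∃ s : V → Γ(Y.left, V), Ideal.span (Set.range s) = ⊤ ∧
    ∀ z, Nonempty (Module.Basis (Fin d) Γ(Y.left, Y.left.basicOpen (s z))
      Ω[Γ(Y.left, Y.left.basicOpen (s z))⁄ℂ]) := by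
  have h : ∀ z : V, ∃ s : Γ(Y.left, V), z.1 ∈ Y.left.basicOpen s ∧
      Nonempty (Module.Basis (Fin d) Γ(Y.left, Y.left.basicOpen s)
        Ω[Γ(Y.left, Y.left.basicOpen s)⁄ℂ]) := by
    intro z
    obtain ⟨V₁, hV₁, hz, ⟨b⟩⟩ := exists_basis_kaehler hY z.1
    obtain ⟨s, s', hs, hs'⟩ := exists_basicOpen_le_affine_inter hV hV₁ z.1 ⟨z.2, hz⟩
    exact ⟨s, hs', exists_basis_kaehler_basicOpen hV₁ b s' hs⟩
  choose s hs hs' using h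
  refine ⟨s, ?_, hs'⟩
  rw [← hV.iSup_basicOpen_eq_self_iff]
  refine le_antisymm (iSup_le fun i => Y.left.basicOpen_le _) fun z hz => ?_
  exact Opens.mem_iSup.2 ⟨⟨_, ⟨z, hz⟩, rfl⟩, hs ⟨z, hz⟩⟩

lemma form_eq_zero_of_lt {r : ℕ} (hr : d < r) (x : Form r Γ(Y.left, V)) : x = 0 := by
  obtain ⟨s, hs, hs'⟩ := exists_basis_cover hY hV
  refine eq_zero_of_isLoc s hs (fun i => formPull_isLoc hV (s i) rfl (Y.left.basicOpen_le _) r) x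
    fun i => ?_
  obtain ⟨b⟩ := hs' i
  generalize formPull (𝟙 Y) r _ x = y
  have _ : IsEmpty (Set.powersetCard (Fin d) r) := ⟨fun ⟨t, ht⟩ => by
    -- The basis of `⋀ʳ` is indexed by the subsets of `Fin d` with `r` elements, of which there are
    -- none.
    have h₁ : t.card = r := ht
    have h₂ := t.card_le_univ
    rw [Fintype.card_fin] at h₂
    omega⟩
  exact (b.exteriorPower (n := r)).ext_elem fun i => isEmptyElim i

/-- Locally the top forms are free of rank one, so a function that annihilates them vanishes
locally. -/
lemma eq_zero_of_smul_form {a : Γ(Y.left, V)} (ha : ∀ x : Form d Γ(Y.left, V), a • x = 0) :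
    a = 0 := by
  obtain ⟨s, hs, hs'⟩ := exists_basis_cover hY hV
  refine eq_zero_of_isLoc s hs (fun i => (res_isLocRing hV (s i) rfl
    (Y.left.basicOpen_le _)).isLoc) a fun i => ?_
  obtain ⟨b⟩ := hs' i
  obtain ⟨w, hw⟩ := (detForm_bijective b).2 1
  obtain ⟨x, k, hx⟩ := (formPull_isLoc hV (s i) rfl (Y.left.basicOpen_le _) d).surj w
  have h₁ := congrArg (formPull (𝟙 Y) d (Y.left.basicOpen_le (s i))) (ha x)
  rw [map_smulₛₗ, hx, map_zero] at h₁
  have h₂ := congrArg (detForm b) h₁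
  rw [map_smul, map_smul, hw, map_zero, smul_eq_mul, smul_eq_mul, mul_one] at h₂
  exact (((res_isLocRing hV (s i) rfl (Y.left.basicOpen_le _)).unit.pow k).mul_left_eq_zero).1 h₂

omit hY in
-- `V'` need not be a basic open subset of `V`, but it is covered by basic open subsets of `V`,
-- which are also basic open subsets of `V'`. There every form is, up to a unit, a restriction from
-- `V`.
lemma formPull_span {V' : Y.left.Opens} (hV' : IsAffineOpen V') (h : V' ≤ V) (r : ℕ) :
    Submodule.span Γ(Y.left, V') (Set.range (formPull (𝟙 Y) r h)) = ⊤ := by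
  have h₁ : ∀ z : V', ∃ s : Γ(Y.left, V), z.1 ∈ Y.left.basicOpen s ∧ Y.left.basicOpen s ≤ V' := by
    intro z
    obtain ⟨s, h₁, h₂⟩ := hV.exists_basicOpen_le z (h z.2)
    exact ⟨s, h₂, h₁⟩
  choose s hs hs' using h₁
  have hs'' : ∀ z, Y.left.basicOpen (s z) = Y.left.basicOpen (res Y h (s z)) := fun z => by
    rw [mem_basicOpen_res]
    exact (inf_eq_right.2 (hs' z)).symm
  have ht : Ideal.span (Set.range fun z => res Y h (s z)) = ⊤ := by
    rw [← hV'.iSup_basicOpen_eq_self_iff]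
    refine le_antisymm (iSup_le fun i => Y.left.basicOpen_le _) fun z hz => ?_
    refine Opens.mem_iSup.2 ⟨⟨_, ⟨z, hz⟩, rfl⟩, ?_⟩
    have h₁ := hs ⟨z, hz⟩
    rwa [hs''] at h₁
  refine eq_top_iff.2 fun η _ => mem_of_pow_smul_mem _ ht _ η fun z => ?_
  obtain ⟨η₀, k, hη⟩ := (formPull_isLoc hV (s z) rfl (Y.left.basicOpen_le _) r).surj
    (formPull (𝟙 Y) r (hs' z) η)
  obtain ⟨l, hl⟩ := (formPull_isLoc hV' (res Y h (s z)) (hs'' z) (hs' z) r).inj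
    (formPull (𝟙 Y) r h η₀ - res Y h (s z) ^ k • η) (by
      have h₁ := formPull_comp (𝟙 Y) (𝟙 Y) (𝟙 Y) (Category.comp_id _) r h (hs' z)
        (Y.left.basicOpen_le _) η₀
      rw [map_sub, h₁, hη, map_smulₛₗ, map_pow, sub_eq_zero]
      congr 2
      exact (res_res _ _ _).symm)
  refine ⟨l + k, ?_⟩
  rw [smul_sub, smul_smul, ← pow_add, sub_eq_zero] at hl
  rw [← hl]
  exact Submodule.smul_mem _ _ (Submodule.subset_span ⟨η₀, rfl⟩)

end Smooth

lemma formPull_iso_span {Z Y : Over SpecC} (a : Z ≅ Y) {V : Z.left.Opens} (hV : IsAffineOpen V)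
    {V' : Y.left.Opens} (hV' : IsAffineOpen V') (h : V ≤ a.hom.left ⁻¹ᵁ V') (r : ℕ) :
    Submodule.span Γ(Z.left, V) (Set.range (formPull a.hom r h)) = ⊤ := by
  have _ : IsIso a.hom.left := inferInstanceAs (IsIso ((Over.forget SpecC).mapIso a).hom)
  rw [← formPull_span (hV'.preimage_of_isIso a.hom.left) hV h r]
  congr 1
  ext y
  constructor
  · rintro ⟨x, rfl⟩
    exact ⟨formPull a.hom r le_rfl x, formPull_comp _ _ _ (Category.id_comp _) _ _ _ _ _⟩
  · rintro ⟨x, rfl⟩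
    have h₁ : V' ≤ a.inv.left ⁻¹ᵁ (a.hom.left ⁻¹ᵁ V') :=
      (congrArg (fun k : Y ⟶ Y => k.left ⁻¹ᵁ V') a.inv_hom_id).ge
    refine ⟨formPull a.inv r h₁ x, ?_⟩
    rw [formPull_comp a.hom a.inv (𝟙 Z) a.hom_inv_id r h₁ h h]

/-! ### Naturality of the isomorphisms on affine open subsets -/

section Scheme

lemma vecDual_tanPull {f f' : Mor} (e : MorIso f f') {V : f.src.left.Opens}
    {V' : f'.src.left.Opens} (h : V ≤ e.left.hom.left ⁻¹ᵁ V') (D : f'.Vec V')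
    (m : Ω[Γ(f'.src.left, V')⁄ℂ]) :
    vecDual f V (Mor.tanPull (Mor.idIso e) h D) (kaehlerMap (pull e.left.hom V' V h) m) =
      pull e.left.hom V' V h (vecDual f' V' D m) := by
  induction m using kaehler_induction with
  | h₁ a =>
    rw [kaehlerMap_D, vecDual_D, vecDual_D, Mor.tanPull_apply]
    have hle : (Mor.isoIdx (Mor.idIso e) h ⟨V, le_rfl⟩).1 ≤ V' :=
      Mor.iso_idx_le (Mor.idIso e) h ⟨V, le_rfl⟩
    have h₁ : Mor.isoFun (Mor.idIso e) V (pull e.left.hom V' V h a) = res f'.src hle a :=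
      pull_pull _ _ _ e.left.inv_hom_id _ _ _ _ _ _ _
    have h₂ := D.2.2 ⟨V', le_rfl⟩ (Mor.isoIdx (Mor.idIso e) h ⟨V, le_rfl⟩) hle a
    refine (congrArg (fun y => res f.src le_rfl (Mor.isoFib (Mor.idIso e) V
      (D.1.ev (Mor.isoIdx (Mor.idIso e) h ⟨V, le_rfl⟩) y))) h₁).trans ?_
    refine (congrArg (fun y => res f.src le_rfl (Mor.isoFib (Mor.idIso e) V y)) h₂).trans ?_
    have h₃ : V ≤ e.left.hom.left ⁻¹ᵁ ((𝟙 f'.src : f'.src ⟶ f'.src).left ⁻¹ᵁ V') := h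
    refine (congrArg (res f.src le_rfl) (pull_pull e.left.hom (𝟙 f'.src) e.left.hom
      (Category.comp_id _) _ _ _ _ _ h₃ _)).trans ?_
    exact (pull_pull (𝟙 f.src) e.left.hom e.left.hom (Category.id_comp _) _ _ _ _ _ h₃ _).trans
      (pull_pull e.left.hom (𝟙 f'.src) e.left.hom (Category.comp_id _) _ _ _ _ _ _ _).symm
  | h₀ => simp only [map_zero]
  | h₂ x y hx hy => simp only [map_add, hx, hy]
  | h₃ a x hx =>
    simp only [map_smulₛₗ, hx, smul_eq_mul, map_mul, RingHom.id_apply]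
    rfl

variable {f f' : Mor} {n c d : ℕ} {ω : ∀ U : f.tgt.left.affineOpens, Form n Γ(f.tgt.left, U.1)}
  (H : IsVolumeImmersion f n c d ω)
  {ω' : ∀ U : f'.tgt.left.affineOpens, Form n Γ(f'.tgt.left, U.1)}
  (H' : IsVolumeImmersion f' n c d ω')

/-- The pulled-back pair satisfies the condition that characterizes `kap`, so uniqueness gives the
equality. -/
lemma kap_pull (e : MorIso f f')
    (hω : ∀ (W : f.tgt.left.affineOpens) (W' : f'.tgt.left.affineOpens)
      (hW : W'.1 ≤ e.right.inv.left ⁻¹ᵁ W.1), formPull e.right.inv n hW (ω W) = ω' W')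
    {V : f.src.left.Opens} (hV : IsAffineOpen V) {V' : f'.src.left.Opens} (hV' : IsAffineOpen V')
    (h : V ≤ e.left.hom.left ⁻¹ᵁ V') (ν : ⋀[Γ(f'.src.left, V')]^c (f'.Nor V')) :
    kap H hV (extMap (Mor.norPull e h) c ν) = formPull e.left.hom d h (kap H' hV' ν) :=
  ((isKap_kap H' hV' ν).pull e hω h).kap_eq H hV

lemma kap_res {V : f.src.left.Opens} (hV : IsAffineOpen V) {V' : f.src.left.Opens}
    (hV' : IsAffineOpen V') (h : V' ≤ V) (ν : ⋀[Γ(f.src.left, V)]^c (f.Nor V)) :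
    kap H hV' (extMap (norRes f h) c ν) = formPull (𝟙 f.src) d h (kap H hV ν) :=
  ((isKap_kap H hV ν).res H h).kap_eq H hV'

variable {b b' : ℕ} (h : b + b' = d)

/-- The isomorphism `⋀ᵇ T ⊗ ⋀ᶜ N ≅ Ωᵇ'` on an affine open subset. -/
def polIso {V : f.src.left.Opens} (hV : IsAffineOpen V) :
    f.Pol b c V ≃ₗ[Γ(f.src.left, V)] Form b' Γ(f.src.left, V) :=
  haveI := finite_kaehler H.smooth_src hV
  haveI := projective_kaehler H.smooth_src hV
  wedgeDual h (fun x hx => congrArg Subtype.val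
      (form_eq_zero_of_lt H.smooth_src hV (Nat.lt_succ_self d) ⟨x, hx⟩))
    (fun _ => eq_zero_of_smul_form H.smooth_src hV) (vecDual f V)
    ⟨vecDual_injective f hV, vecDual_surjective f hV⟩ (kap H hV).toLinearMap (kap H hV).bijective

lemma wedge_polIso {V : f.src.left.Opens} (hV : IsAffineOpen V)
    (P : ⋀[Γ(f.src.left, V)]^b (f.Vec V)) (ν : ⋀[Γ(f.src.left, V)]^c (f.Nor V))
    (η : Form b Γ(f.src.left, V)) :
    wedge h η (polIso H h hV (P ⊗ₜ ν)) = vecPairing f V b η P • kap H hV ν :=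
  haveI := finite_kaehler H.smooth_src hV
  haveI := projective_kaehler H.smooth_src hV
  wedge_wedgeDual h _ _ (vecDual f V) _ (kap H hV).toLinearMap _ (P ⊗ₜ ν) η

lemma polIso_pull (e : MorIso f f')
    (hω : ∀ (W : f.tgt.left.affineOpens) (W' : f'.tgt.left.affineOpens)
      (hW : W'.1 ≤ e.right.inv.left ⁻¹ᵁ W.1), formPull e.right.inv n hW (ω W) = ω' W')
    {V : f.src.left.Opens} (hV : IsAffineOpen V) {V' : f'.src.left.Opens} (hV' : IsAffineOpen V')
    (hVV' : V ≤ e.left.hom.left ⁻¹ᵁ V') (x : f'.Pol b c V') :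
    polIso H h hV (Mor.polPull e b c hVV' x) =
      formPull e.left.hom b' hVV' (polIso H' h hV' x) :=
  haveI := finite_kaehler H.smooth_src hV
  haveI := projective_kaehler H.smooth_src hV
  haveI := finite_kaehler H'.smooth_src hV'
  haveI := projective_kaehler H'.smooth_src hV'
  wedgeDual_polMap (kaehlerMap (pull e.left.hom V' V hVV')) (vecDual_tanPull e hVV')
    (kap_pull H H' e hω hV hV' hVV') h _ _ _ _ _ _ _ _
    (formPull_iso_span e.left hV hV' hVV' b) x

end Scheme

end

section

/-! ### From affine open subsets to sheaves and cohomology -/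

section Sheaves

variable {Y : Over SpecC}

lemma isBasis_range_affineOpens :
    Opens.IsBasis (Set.range (Subtype.val : Y.left.affineOpens → Y.left.Opens)) := by
  rw [Subtype.range_coe]
  exact Y.left.isBasis_affineOpens

lemma psh_hom_ext {P : Psh Y} {F : Shv Y} {α β : P ⟶ F.obj}
    (h : ∀ V : Y.left.affineOpens, α.app (op V.1) = β.app (op V.1)) : α = β :=
  TopCat.Sheaf.hom_ext (X := Y.left.toTopCat) P (show TopCat.Sheaf (ModuleCat.{0} ℂ) Y.left from F)
    isBasis_range_affineOpens h

lemma exists_psh_hom {P : Psh Y} {F : Shv Y}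
    (u : ∀ V : Y.left.affineOpens, P.obj (op V.1) ⟶ F.obj.obj (op V.1))
    (hu : ∀ (V V' : Y.left.affineOpens) (h : V'.1 ≤ V.1),
      P.map (homOfLE h).op ≫ u V' = u V ≫ F.obj.map (homOfLE h).op) :
    ∃ α : P ⟶ F.obj, ∀ V : Y.left.affineOpens, α.app (op V.1) = u V := by
  let B : Y.left.affineOpens → Opens Y.left := Subtype.val
  let F' : TopCat.Sheaf (ModuleCat.{0} ℂ) Y.left := F
  let α : (inducedFunctor B).op ⋙ P ⟶ (inducedFunctor B).op ⋙ F'.1 :=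
    { app := fun V => u V.unop
      naturality := fun V V' i => hu V.unop V'.unop (leOfHom i.unop.hom) }
  exact ⟨TopCat.Sheaf.restrictHomEquivHom P F' isBasis_range_affineOpens α, fun V =>
    TopCat.Sheaf.extend_hom_app P F' isBasis_range_affineOpens α V⟩

lemma shf_hom_ext {P : Psh Y} {F : Shv Y} {α β : shf P ⟶ F}
    (h : ∀ (V : Y.left.affineOpens) x, (α.hom.app (op V.1)).hom (toShf P V.1 x) =
      (β.hom.app (op V.1)).hom (toShf P V.1 x)) : α = β := by
  apply Sheaf.hom_ext
  refine sheafify_hom_ext _ _ _ F.property (psh_hom_ext fun V => ?_)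
  ext x
  exact h V x

/-- Affine open subsets are a basis, so a compatible family of maps into the sheaf associated with
`Q` extends to a map of presheaves, which factors through sheafification. -/
lemma exists_shf_hom {P Q : Psh Y} (u : ∀ V : Y.left.affineOpens, P.obj (op V.1) →ₗ[ℂ] Q.obj (op V.1))
    (hu : ∀ (V V' : Y.left.affineOpens) (h : V'.1 ≤ V.1) x,
      u V' ((P.map (homOfLE h).op).hom x) = (Q.map (homOfLE h).op).hom (u V x)) :
    ∃ α : shf P ⟶ shf Q, ∀ (V : Y.left.affineOpens) x,
      (α.hom.app (op V.1)).hom (toShf P V.1 x) = toShf Q V.1 (u V x) := by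
  obtain ⟨α, hα⟩ := exists_psh_hom (F := shf Q) (fun V => ModuleCat.ofHom (u V) ≫
    (toSheafify (Opens.grothendieckTopology Y.left) Q).app (op V.1)) (by
      intro V V' h
      rw [Category.assoc, ← (toSheafify (Opens.grothendieckTopology Y.left) Q).naturality,
        ← Category.assoc, ← Category.assoc]
      congr 1
      ext x
      exact hu V V' h x)
  refine ⟨⟨sheafifyLift _ α (shf Q).property⟩, fun V x => ?_⟩
  have h₁ := congrArg (fun k => (k.app (op V.1)).hom x)
    (toSheafify_sheafifyLift (Opens.grothendieckTopology Y.left) α (shf Q).property)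
  refine h₁.trans ?_
  change (α.app (op V.1)).hom x = _
  rw [hα]
  rfl

lemma exists_shf_iso {P Q : Psh Y} (u : ∀ V : Y.left.affineOpens, P.obj (op V.1) ≃ₗ[ℂ] Q.obj (op V.1))
    (hu : ∀ (V V' : Y.left.affineOpens) (h : V'.1 ≤ V.1) x,
      u V' ((P.map (homOfLE h).op).hom x) = (Q.map (homOfLE h).op).hom (u V x)) :
    ∃ α : shf P ≅ shf Q, ∀ (V : Y.left.affineOpens) x,
      (α.hom.hom.app (op V.1)).hom (toShf P V.1 x) = toShf Q V.1 (u V x) := by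
  obtain ⟨α, hα⟩ := exists_shf_hom (fun V => (u V).toLinearMap) hu
  obtain ⟨β, hβ⟩ := exists_shf_hom (fun V => (u V).symm.toLinearMap) (by
    intro V V' h x
    apply (u V').injective
    rw [LinearEquiv.coe_coe, LinearEquiv.coe_coe, LinearEquiv.apply_symm_apply, hu,
      LinearEquiv.apply_symm_apply])
  refine ⟨⟨α, β, shf_hom_ext fun V x => ?_, shf_hom_ext fun V x => ?_⟩, hα⟩
  · change (β.hom.app (op V.1)).hom ((α.hom.app (op V.1)).hom (toShf P V.1 x)) = toShf P V.1 x
    rw [hα, hβ]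
    exact congrArg _ ((u V).symm_apply_apply x)
  · change (α.hom.app (op V.1)).hom ((β.hom.app (op V.1)).hom (toShf Q V.1 x)) = toShf Q V.1 x
    rw [hβ, hα]
    exact congrArg _ ((u V).apply_symm_apply x)

/-- The sheaf associated with a presheaf that vanishes on affine open subsets is zero. -/
lemma coh_eq_zero {P : Psh Y} (h : ∀ (V : Y.left.affineOpens) (x : P.obj (op V.1)), x = 0) {n : ℕ}
    (x : Coh (shf P) n) : x = 0 := by
  have h₁ : 𝟙 (shf P) = 0 := shf_hom_ext fun V x => by
    rw [h V x, map_zero, map_zero, map_zero]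
  rw [← x.comp_mk₀_id, h₁, Abelian.Ext.mk₀_zero, Abelian.Ext.comp_zero]

end Sheaves

/-! ### Compatibility with transport along isomorphisms -/

section Transport

variable {Z Z' : Over SpecC} (a : Z ≅ Z')

/-- By adjunction the square may be checked on sections of the presheaf over affine open subsets.
The existential reflects that `α'` is only known to send presheaf sections to presheaf sections
there. -/
lemma shfMap_comm {P Q : Psh Z} {P' Q' : Psh Z'} (τ : P' ⟶ (opensEquiv a).functor.op ⋙ P)
    (σ : Q' ⟶ (opensEquiv a).functor.op ⋙ Q) (α : shf P ⟶ shf Q) (α' : shf P' ⟶ shf Q')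
    (h : ∀ (V' : Z'.left.affineOpens) x, ∃ y,
      (α'.hom.app (op V'.1)).hom (toShf P' V'.1 x) = toShf Q' V'.1 y ∧
      (α.hom.app (op (a.hom.left ⁻¹ᵁ V'.1))).hom
        (toShf P (a.hom.left ⁻¹ᵁ V'.1) ((τ.app (op V'.1)).hom x)) =
        toShf Q (a.hom.left ⁻¹ᵁ V'.1) ((σ.app (op V'.1)).hom y)) :
    (shvEquiv a).functor.map α' ≫ shfMap a σ = shfMap a τ ≫ α := by
  apply ((shvEquiv a).toAdjunction.homEquiv _ _).injective
  rw [Adjunction.homEquiv_naturality_left, Adjunction.homEquiv_naturality_right, shfMap, shfMap,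
    Equiv.apply_symm_apply, Equiv.apply_symm_apply]
  refine shf_hom_ext fun V' x => ?_
  have key : ∀ {P : Psh Z} {P' : Psh Z'} (τ : P' ⟶ (opensEquiv a).functor.op ⋙ P) x,
      (((((sheafificationAdjunction (Opens.grothendieckTopology Z'.left) (ModuleCat.{0} ℂ)).homEquiv
        P' ((shvEquiv a).inverse.obj (shf P))).symm
      (τ ≫ Functor.whiskerLeft (opensEquiv a).functor.op
        (toSheafify (Opens.grothendieckTopology Z.left) P))).hom.app (op V'.1)).hom
          (toShf P' V'.1 x) : (shf P).obj.obj (op (a.hom.left ⁻¹ᵁ V'.1))) =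
        toShf P (a.hom.left ⁻¹ᵁ V'.1) ((τ.app (op V'.1)).hom x) := by
    intro P P' τ x
    have h₁ := congrArg (fun k => (k.app (op V'.1)).hom x)
      (toSheafify_sheafifyLift (Opens.grothendieckTopology Z'.left)
        (τ ≫ Functor.whiskerLeft (opensEquiv a).functor.op
          (toSheafify (Opens.grothendieckTopology Z.left) P))
        ((shvEquiv a).inverse.obj (shf P)).property)
    exact h₁
  obtain ⟨y, hy, hy'⟩ := h V' x
  have h₁ := key σ y
  have h₂ := key τ x
  rw [← hy] at h₁
  refine h₁.trans (hy'.symm.trans ?_)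
  exact congrArg _ h₂.symm

/-- Exact functors respect composition of extension classes, and that composition is associative; so
only the square of sheaf maps enters. -/
lemma cohPull_comm {P Q : Psh Z} {P' Q' : Psh Z'} (τ : P' ⟶ (opensEquiv a).functor.op ⋙ P)
    (σ : Q' ⟶ (opensEquiv a).functor.op ⋙ Q) (α : shf P ⟶ shf Q) (α' : shf P' ⟶ shf Q')
    (h : (shvEquiv a).functor.map α' ≫ shfMap a σ = shfMap a τ ≫ α) {n : ℕ}
    (x : Coh (shf P') n) :
    cohPull a σ n (cohMap α' n x) = cohMap α n (cohPull a τ n x) := by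
  change ((Abelian.Ext.mk₀ (cstMap a)).comp ((x.comp (Abelian.Ext.mk₀ α') (add_zero n)).mapExactFunctor
      (shvEquiv a).functor) (zero_add n)).comp (Abelian.Ext.mk₀ (shfMap a σ)) (add_zero n) =
    (((Abelian.Ext.mk₀ (cstMap a)).comp (x.mapExactFunctor (shvEquiv a).functor) (zero_add n)).comp
      (Abelian.Ext.mk₀ (shfMap a τ)) (add_zero n)).comp (Abelian.Ext.mk₀ α) (add_zero n)
  rw [Abelian.Ext.mapExactFunctor_comp, Abelian.Ext.mapExactFunctor_mk₀,
    Abelian.Ext.comp_assoc_of_third_deg_zero, Abelian.Ext.comp_assoc_of_third_deg_zero,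
    Abelian.Ext.comp_assoc_of_third_deg_zero, Abelian.Ext.comp_assoc_of_third_deg_zero,
    Abelian.Ext.mk₀_comp_mk₀, Abelian.Ext.mk₀_comp_mk₀, h]

/-- The isomorphism on cohomology given by an isomorphism of sheaves. -/
def cohEquiv {Y : Over SpecC} {F F' : Shv Y} (φ : F ≅ F') (n : ℕ) : Coh F n ≃ₗ[ℂ] Coh F' n :=
  LinearEquiv.ofLinearMap (cohMap φ.hom n) (cohMap φ.inv n)
    (LinearMap.ext fun x => by
      change (x.comp (Abelian.Ext.mk₀ φ.inv) (add_zero n)).comp (Abelian.Ext.mk₀ φ.hom)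
        (add_zero n) = x
      rw [Abelian.Ext.comp_assoc_of_third_deg_zero, Abelian.Ext.mk₀_comp_mk₀, φ.inv_hom_id,
        Abelian.Ext.comp_mk₀_id])
    (LinearMap.ext fun x => by
      change (x.comp (Abelian.Ext.mk₀ φ.hom) (add_zero n)).comp (Abelian.Ext.mk₀ φ.inv)
        (add_zero n) = x
      rw [Abelian.Ext.comp_assoc_of_third_deg_zero, Abelian.Ext.mk₀_comp_mk₀, φ.hom_inv_id,
        Abelian.Ext.comp_mk₀_id])

end Transport

section PolSheaf

variable {f : Mor} {n c d : ℕ} {ω : ∀ U : f.tgt.left.affineOpens, Form n Γ(f.tgt.left, U.1)}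
  (H : IsVolumeImmersion f n c d ω) {b b' : ℕ} (h : b + b' = d)

lemma exists_polSheaf_iso : ∃ Φ : f.polSheaf b c ≅ formSheaf f.src b',
    ∀ (V : f.src.left.affineOpens) (x : f.Pol b c V.1),
      (Φ.hom.hom.app (op V.1)).hom (toShf (f.polPsh b c) V.1 x) =
        toShf (formPsh f.src b') V.1 (polIso H h V.2 x) :=
  exists_shf_iso (P := f.polPsh b c) (Q := formPsh f.src b')
    (fun V =>
      { toFun := fun x => (polIso H h V.2 (show f.Pol b c V.1 from x) : Form b' Γ(f.src.left, V.1))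
        invFun := fun x => ((polIso H h V.2).symm (show Form b' Γ(f.src.left, V.1) from x) :
          f.Pol b c V.1)
        left_inv := fun x => (polIso H h V.2).symm_apply_apply x
        right_inv := fun x => (polIso H h V.2).apply_symm_apply x
        map_add' := fun x y => (polIso H h V.2).map_add x y
        map_smul' := fun z x => (polIso H h V.2).map_smul (algebraMap ℂ _ z) x })
    (fun V V' hV x => polIso_pull H H h (MorIso.refl f) (fun W W' hW => H.form_res W W' hW) V'.2 V.2
      hV x)

end PolSheaf

end

/-! ### Smoothness of the strata and vanishing of summands -/

section

/-- Smoothness is local on the source. -/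
lemma smooth_opn_sSup {Y : Over SpecC} {d : ℕ} (S : Set Y.left.Opens)
    (hS : ∀ V ∈ S, SmoothOfRelativeDimension d (opn Y V).hom) :
    SmoothOfRelativeDimension d (opn Y (sSup S)).hom := by
  rw [sSup_eq_iSup']
  change SmoothOfRelativeDimension d ((⨆ V : S, V.1).ι ≫ Y.hom)
  have _ : IsZariskiLocalAtSource (@SmoothOfRelativeDimension d) :=
    HasRingHomProperty.instIsZariskiLocalAtSource
  refine IsZariskiLocalAtSource.of_openCover
    (Scheme.Opens.iSupOpenCover fun V : S => V.1) fun V => ?_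
  change SmoothOfRelativeDimension d (Y.left.homOfLE (le_iSup (fun V : S => V.1) V) ≫ (⨆ V : S, V.1).ι ≫ Y.hom)
  rw [Scheme.homOfLE_ι_assoc]
  exact hS V.1 V.2

section Coh

variable {f f' : Mor} {n c d : ℕ} {ω : ∀ U : f.tgt.left.affineOpens, Form n Γ(f.tgt.left, U.1)}
  (H : IsVolumeImmersion f n c d ω)
  {ω' : ∀ U : f'.tgt.left.affineOpens, Form n Γ(f'.tgt.left, U.1)}
  (H' : IsVolumeImmersion f' n c d ω') {a b b' : ℕ}

include H in
-- Polyvectors of degree `b`, with coefficients in `⋀ᶜ N`, embed in the homomorphisms out of the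
-- `b`-forms, and there are no nonzero `b`-forms for `b > d`.
lemma coh_pol_eq_zero_of_lt (h : d < b) (x : Coh (f.polSheaf b c) a) : x = 0 := by
  refine coh_eq_zero (P := f.polPsh b c) (fun V y => ?_) x
  have hD : Function.Bijective (vecDual f V.1) :=
    ⟨vecDual_injective _ V.2, vecDual_surjective _ V.2⟩
  have _ := finite_kaehler H.smooth_src V.2
  have _ := projective_kaehler H.smooth_src V.2
  refine (pairHom_bijective hD (kap H V.2).bijective b).1 (LinearMap.ext fun η => ?_)
  have h₁ : η = 0 := form_eq_zero_of_lt H.smooth_src V.2 h η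
  rw [h₁, map_zero, map_zero]

lemma coh_form_eq_zero_of_lt {Y : Over SpecC} (hY : SmoothOfRelativeDimension d Y.hom)
    (h : d < b) (x : Coh (formSheaf Y b) a) : x = 0 :=
  coh_eq_zero (P := formPsh Y b) (fun V y => form_eq_zero_of_lt hY V.2 h y) x

lemma coh_pol_eq_zero_of_subsingleton (h : ∀ V, Subsingleton Γ(f.src.left, V))
    (x : Coh (f.polSheaf b c) a) : x = 0 :=
  coh_eq_zero (P := f.polPsh b c) (fun V y => by
    have _ := h V.1
    have _ := Module.subsingleton Γ(f.src.left, V.1) (f.Pol b c V.1)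
    exact Subsingleton.elim (α := f.Pol b c V.1) y 0) x

lemma coh_form_eq_zero_of_subsingleton {Y : Over SpecC} (h : ∀ V, Subsingleton Γ(Y.left, V))
    (x : Coh (formSheaf Y b) a) : x = 0 :=
  coh_eq_zero (P := formPsh Y b) (fun V y => by
    have _ := h V.1
    have _ := Module.subsingleton Γ(Y.left, V.1) (Form b Γ(Y.left, V.1))
    exact Subsingleton.elim (α := Form b Γ(Y.left, V.1)) y 0) x

lemma cohPull_polSheaf_iso (h : b + b' = d) (e : MorIso f f')
    (hω : ∀ (W : f.tgt.left.affineOpens) (W' : f'.tgt.left.affineOpens)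
      (hW : W'.1 ≤ e.right.inv.left ⁻¹ᵁ W.1), formPull e.right.inv n hW (ω W) = ω' W')
    {Φ : f.polSheaf b c ⟶ formSheaf f.src b'}
    (hΦ : ∀ (V : f.src.left.affineOpens) (x : f.Pol b c V.1),
      (Φ.hom.app (op V.1)).hom (toShf (f.polPsh b c) V.1 x) =
        toShf (formPsh f.src b') V.1 (polIso H h V.2 x))
    {Φ' : f'.polSheaf b c ⟶ formSheaf f'.src b'}
    (hΦ' : ∀ (V : f'.src.left.affineOpens) (x : f'.Pol b c V.1),
      (Φ'.hom.app (op V.1)).hom (toShf (f'.polPsh b c) V.1 x) =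
        toShf (formPsh f'.src b') V.1 (polIso H' h V.2 x)) (x : Coh (f'.polSheaf b c) a) :
    cohPull e.left (formTrans e.left b') a (cohMap Φ' a x) =
      cohMap Φ a (cohPull e.left (polTrans e b c) a x) := by
  refine cohPull_comm _ _ _ _ _ (shfMap_comm _ _ _ _ _ fun V' y => ⟨_, hΦ' V' y, ?_⟩) x
  have hV : IsAffineOpen (e.left.hom.left ⁻¹ᵁ V'.1) := V'.2.preimage_of_isIso _
  refine (hΦ ⟨_, hV⟩ (Mor.polPull e b c le_rfl y)).trans ?_
  exact congrArg _ (polIso_pull H H' h e hω hV V'.2 le_rfl y)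

end Coh

section Strata

variable {X : Over SpecC} {G : Type} [Group G] (ρ : G →* Aut X) {n : ℕ} (g : G) (r : ℝ) {c : ℕ}

/-- The relation `d + c = n` fixes the dimension, so all open subsets in the union are smooth of the
same dimension. -/
lemma smooth_stratum {d : ℕ} (h : d + c = n) :
    SmoothOfRelativeDimension d (strMor ρ n g r c).src.hom := by
  refine smooth_opn_sSup _ ?_
  rintro V ⟨⟨d', hd', hV⟩, -⟩
  obtain rfl : d' = d := by omega
  exact hV

/-- For separated `X` the equalizer defining the fixed locus is closed in `X`, and the stratum is
open in it. -/
lemma isImmersion_strMor (hX : IsSeparated X.hom) : IsImmersion (strMor ρ n g r c).hom.left := by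
  change IsImmersion ((stratum ρ n g r c).ι ≫ (fixedι ρ g).left)
  infer_instance

lemma not_mem_of_lt (h : n < c) (z : (strMor ρ n g r c).src.left) : False := by
  obtain ⟨V, ⟨⟨d, hd, -⟩, -⟩, -⟩ := Opens.mem_sSup.1 z.2
  omega

lemma subsingleton_of_lt (h : n < c) (V : (strMor ρ n g r c).src.left.Opens) :
    Subsingleton Γ((strMor ρ n g r c).src.left, V) :=
  ⟨fun _ _ => eq_of_locally_eq fun z _ => (not_mem_of_lt ρ g r h z).elim⟩

end Strata

/-! ### The isomorphisms on the sectors of the orbifold -/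

section Main

variable {X : Over SpecC} {G : Type} [Group G] {ρ : G →* Aut X} {n : ℕ}

/-- A nowhere vanishing invariant form of top degree. -/
structure IsVolumeForm (ρ : G →* Aut X) (n : ℕ) (ω : ∀ U : X.left.affineOpens, Form n Γ(X.left, U.1)) :
    Prop where
  proper : IsProper X.hom
  smooth : SmoothOfRelativeDimension n X.hom
  res (U V : X.left.affineOpens) (hV : V.1 ≤ U.1) : formPull (𝟙 X) n hV (ω U) = ω V
  gen (U : X.left.affineOpens) : Function.Bijective fun f : Γ(X.left, U.1) => f • ω U
  inv (g : G) (U V : X.left.affineOpens) (hV : V.1 ≤ (ρ g).hom.left ⁻¹ᵁ U.1) :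
    formPull (ρ g).hom n hV (ω U) = ω V

variable {ω : ∀ U : X.left.affineOpens, Form n Γ(X.left, U.1)} (hω : IsVolumeForm ρ n ω)

include hω

lemma IsVolumeForm.immersion (s : Sector G) (hs : s.codim ≤ n) :
    IsVolumeImmersion (secMor ρ n s) n s.codim (n - s.codim) ω where
  deg := by omega
  smooth_tgt := hω.smooth
  smooth_src := smooth_stratum ρ _ _ (by omega)
  imm := isImmersion_strMor ρ _ _ hω.proper.toIsSeparated
  form_res := hω.res
  gen := hω.gen

lemma IsVolumeForm.inv_symm (h : G) (W W' : X.left.affineOpens)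
    (hW : W'.1 ≤ (ρ h).inv.left ⁻¹ᵁ W.1) : formPull (ρ h).inv n hW (ω W) = ω W' := by
  have h₁ : (ρ h).inv = (ρ h⁻¹).hom := by rw [map_inv]; rfl
  -- The morphism is made a variable so that the inverse of `ρ h` can be replaced by the action of
  -- `h⁻¹`.
  have h₂ : ∀ k : X ⟶ X, k = (ρ h⁻¹).hom → ∀ hk : W'.1 ≤ k.left ⁻¹ᵁ W.1,
      formPull k n hk (ω W) = ω W' := by
    rintro _ rfl hk
    exact hω.inv h⁻¹ W W' hk
  exact h₂ _ h₁ hW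

open Classical in
/-- The isomorphism `ω_g ≅ ω_{X^g}` given by an invariant volume form. -/
def dualizingIso : DualizingIso ρ n where
  iso s V :=
    if hs : s.codim ≤ n then kap (hω.immersion s hs) V.2
    -- For codimension above `n` the stratum is empty, all its function rings are trivial, and the
    -- zero map is an isomorphism; the truncated degree `n - s.codim = 0` does no harm.
    else
      haveI := subsingleton_of_lt ρ s.elt s.age (not_le.1 hs) V.1
      haveI := Module.subsingleton Γ((secMor ρ n s).src.left, V.1)
        (⋀[Γ((secMor ρ n s).src.left, V.1)]^s.codim ((secMor ρ n s).Nor V.1))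
      haveI := Module.subsingleton Γ((secMor ρ n s).src.left, V.1)
        (Form (n - s.codim) Γ((secMor ρ n s).src.left, V.1))
      0
  iso_res s V V' hV ν := by
    by_cases hs : s.codim ≤ n
    · simp only [dif_pos hs]
      exact (kap_res (hω.immersion s hs) V.2 V'.2 hV ν).symm
    · have _ := subsingleton_of_lt ρ s.elt s.age (not_le.1 hs) V'.1
      have _ := Module.subsingleton Γ((secMor ρ n s).src.left, V'.1)
        (Form (n - s.codim) Γ((secMor ρ n s).src.left, V'.1))
      exact Subsingleton.elim _ _
  iso_equivariant h s V V' hV ν := by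
    by_cases hs : s.codim ≤ n
    · simp only [dif_pos hs]
      exact (kap_pull (hω.immersion s hs) (hω.immersion (s.conj h) hs) (secIso ρ n h s)
        (fun W W' hW => hω.inv_symm h W W' hW) V.2 V'.2 hV ν).symm
    · have _ := subsingleton_of_lt ρ s.elt s.age (not_le.1 hs) V.1
      have _ := Module.subsingleton Γ((secMor ρ n s).src.left, V.1)
        (Form (n - s.codim) Γ((secMor ρ n s).src.left, V.1))
      exact Subsingleton.elim _ _

lemma dualizingIso_iso (s : Sector G) (hs : s.codim ≤ n)
    (V : (secMor ρ n s).src.left.affineOpens) :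
    (dualizingIso hω).iso s V = kap (hω.immersion s hs) V.2 := dif_pos hs

/-- These are the summands whose partner would have negative form degree. Either the stratum is
empty or `b` exceeds its dimension. -/
lemma HTSum_eq_zero (s : Sector G) {a b : ℕ} (h : n < b + s.codim)
    (x : HTSum ρ n s.elt s.age s.codim b a) : x = 0 := by
  by_cases hs : s.codim ≤ n
  · exact coh_pol_eq_zero_of_lt (hω.immersion s hs) (by omega) x
  · exact coh_pol_eq_zero_of_subsingleton (fun V =>
      subsingleton_of_lt ρ s.elt s.age (not_le.1 hs) V) x

lemma HΩSum_eq_zero (s : Sector G) {a b : ℕ} (h : n < b + s.codim)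
    (x : HΩSum ρ n s.elt s.age s.codim b a) : x = 0 := by
  by_cases hs : s.codim ≤ n
  · exact coh_form_eq_zero_of_lt (hω.immersion s hs).smooth_src (by omega) x
  · exact coh_form_eq_zero_of_subsingleton (fun V =>
      subsingleton_of_lt ρ s.elt s.age (not_le.1 hs) V) x

/-- The isomorphism of sheaves `⋀ᵇ T ⊗ ω_g ≅ Ωᵇ'`. -/
def sheafIso (s : Sector G) {b b' : ℕ} (h : b + b' + s.codim = n) :
    (secMor ρ n s).polSheaf b s.codim ≅ formSheaf (secMor ρ n s).src b' :=
  (exists_polSheaf_iso (hω.immersion s (by omega)) (b := b) (b' := b') (by omega)).choose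

lemma sheafIso_apply (s : Sector G) {b b' : ℕ} (h : b + b' + s.codim = n)
    (V : (secMor ρ n s).src.left.affineOpens) (x : (secMor ρ n s).Pol b s.codim V.1) :
    ((sheafIso hω s h).hom.hom.app (op V.1)).hom (toShf ((secMor ρ n s).polPsh b s.codim) V.1 x) =
      toShf (formPsh (secMor ρ n s).src b') V.1
        (polIso (hω.immersion s (by omega)) (by omega) V.2 x) :=
  (exists_polSheaf_iso (hω.immersion s (by omega)) (b := b) (b' := b') (by omega)).choose_spec V x

lemma isWedgeDual_sheafIso (s : Sector G) {b b' : ℕ} (h : b + b' + s.codim = n) :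
    IsWedgeDual (dualizingIso hω) s b b' (sheafIso hω s h).hom := by
  intro V P ν
  refine ⟨_, sheafIso_apply hω s h V (P ⊗ₜ ν), fun η => ?_⟩
  rw [dualizingIso_iso hω s (by omega) V]
  exact congrArg Subtype.val (wedge_polIso (hω.immersion s (by omega)) (by omega) V.2 P ν η)

/-- The isomorphism of summands given by the isomorphism of sheaves. -/
def sumIso (s : Sector G) {b b' : ℕ} (h : b + b' + s.codim = n) (a : ℕ) :
    HTSum ρ n s.elt s.age s.codim b a ≃ₗ[ℂ] HΩSum ρ n s.elt s.age s.codim b' a :=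
  cohEquiv (sheafIso hω s h) a

/-- The action of `k` is pull-back along the inverse isomorphism of strata, whose inverse on targets
is the action of `k`; thus invariance of `ω` under `k` itself is what naturality requires. -/
lemma sumIso_map (k : G) (s : Sector G) {b b' : ℕ} (h : b + b' + s.codim = n) (a : ℕ)
    (x : HTSum ρ n s.elt s.age s.codim b a) :
    sumIso hω (s.conj k) h a (HTSum.map ρ n k s.elt (k * s.elt * k⁻¹) (by simp) s.age s.codim b a x) =
      HΩSum.map ρ n k s.elt (k * s.elt * k⁻¹) (by simp) s.age s.codim b' a (sumIso hω s h a x) := by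
  have hs : s.codim ≤ n := by omega
  exact (cohPull_polSheaf_iso (hω.immersion (s.conj k) hs) (hω.immersion s hs)
    (by omega : b + b' = n - s.codim) (secIso ρ n k s).symm (fun W W' hW => hω.inv k W W' hW)
    (sheafIso_apply hω (s.conj k) h) (sheafIso_apply hω s h) x).symm

end Main

end

section

/-! ### Assembling the summands, equivariance and invariants -/

section Total

variable {X : Over SpecC} {G : Type} [Group G] {ρ : G →* Aut X} {n : ℕ}
  {ω : ∀ U : X.left.affineOpens, Form n Γ(X.left, U.1)} (hω : IsVolumeForm ρ n ω) {q p : ℤ}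

/-- The summand corresponding to a summand of `HT`. -/
abbrev HTIndex.dual (i : HTIndex G q p) (h : i.b + i.sec.codim ≤ n) : HΩIndex G (n - q) p :=
  ⟨i.sec, i.a, n - i.sec.codim - i.b, i.ha, by
    -- By `h` the subtractions are not truncated; then `n - c - (q + r - c) = (n - q) - r`.
    rw [Nat.cast_sub (by omega), Nat.cast_sub (by omega), i.hb]
    push_cast
    ring⟩

/-- The summand corresponding to a summand of `HΩ`. -/
abbrev HΩIndex.dual (i : HΩIndex G (n - q) p) (h : i.b + i.sec.codim ≤ n) : HTIndex G q p :=
  ⟨i.sec, i.a, n - i.sec.codim - i.b, i.ha, by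
    rw [Nat.cast_sub (by omega), Nat.cast_sub (by omega), i.hb]
    push_cast
    ring⟩

open Classical in
/-- The map `HT → HΩ` given by the isomorphisms of sheaves. -/
def totalHom (q p : ℤ) : HT ρ n q p →ₗ[ℂ] HΩ ρ n (n - q) p :=
  DirectSum.toModule ℂ (HTIndex G q p) (HΩ ρ n (n - q) p) fun i =>
    if h : i.b + i.sec.codim ≤ n then
      HΩ.of ρ n (i.dual h) ∘ₗ (sumIso hω i.sec (b := i.b) (b' := n - i.sec.codim - i.b) (by omega) i.a).toLinearMap
    -- Nothing is lost by this value, since the summand is zero by `HTSum_eq_zero`.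
    else 0

open Classical in
/-- The map `HΩ → HT` given by the isomorphisms of sheaves. -/
def totalInv (q p : ℤ) : HΩ ρ n (n - q) p →ₗ[ℂ] HT ρ n q p :=
  DirectSum.toModule ℂ (HΩIndex G (n - q) p) (HT ρ n q p) fun i =>
    if h : i.b + i.sec.codim ≤ n then
      HT.of ρ n (i.dual h) ∘ₗ
        (sumIso hω i.sec (b := n - i.sec.codim - i.b) (b' := i.b) (by omega) i.a).symm.toLinearMap
    else 0

variable {s : Sector G} {a b b' : ℕ} (ha : (a : ℝ) = p - s.age)
  (hb : (b : ℝ) = q + s.age - s.codim) (hb' : (b' : ℝ) = ((n - q : ℤ) : ℝ) - s.age)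

/-- The degree `b'` is left free and tied to `b` by an equation, so that later uses do not involve
the truncated subtraction in `HTIndex.dual`. -/
lemma totalHom_of (h : b + b' + s.codim = n) (x : HTSum ρ n s.elt s.age s.codim b a) :
    totalHom hω q p (HT.of ρ n ⟨s, a, b, ha, hb⟩ x) =
      HΩ.of ρ n ⟨s, a, b', ha, hb'⟩ (sumIso hω s h a x) := by
  obtain rfl : b' = n - s.codim - b := by omega
  have hle : b + s.codim ≤ n := by omega
  classical
  refine (DirectSum.toModule_lof ℂ (M := HT.Summand ρ n)
    (⟨s, a, b, ha, hb⟩ : HTIndex G q p) x).trans ?_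
  rw [dif_pos hle]
  rfl

lemma totalInv_of (h : b + b' + s.codim = n) (x : HΩSum ρ n s.elt s.age s.codim b' a) :
    totalInv hω q p (HΩ.of ρ n ⟨s, a, b', ha, hb'⟩ x) =
      HT.of ρ n ⟨s, a, b, ha, hb⟩ ((sumIso hω s h a).symm x) := by
  obtain rfl : b = n - s.codim - b' := by omega
  have hle : b' + s.codim ≤ n := by omega
  classical
  refine (DirectSum.toModule_lof ℂ (M := HΩ.Summand ρ n)
    (⟨s, a, b', ha, hb'⟩ : HΩIndex G (n - q) p) x).trans ?_
  rw [dif_pos hle]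
  rfl

/-- The isomorphism `HT → HΩ`. -/
def totalEquiv (q p : ℤ) : HT ρ n q p ≃ₗ[ℂ] HΩ ρ n (n - q) p := by
  classical
  refine LinearEquiv.ofLinearMap (totalHom hω q p) (totalInv hω q p) ?_ ?_
  · refine DirectSum.linearMap_ext ℂ fun i => LinearMap.ext fun x => ?_
    change totalHom hω q p (totalInv hω q p (HΩ.of ρ n i x)) = HΩ.of ρ n i x
    by_cases h : i.b + i.sec.codim ≤ n
    · have h₁ : n - i.sec.codim - i.b + i.b + i.sec.codim = n := by omega
      have h₂ := totalInv_of hω i.ha (i.dual h).hb i.hb h₁ x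
      have h₃ := totalHom_of hω i.ha (i.dual h).hb i.hb h₁ ((sumIso hω i.sec h₁ i.a).symm x)
      rw [LinearEquiv.apply_symm_apply] at h₃
      exact (congrArg _ h₂).trans h₃
    -- A summand of `HΩ` without partner is zero, so both composites agree on it.
    · rw [HΩSum_eq_zero hω i.sec (not_le.1 h) x, map_zero, map_zero, map_zero]
  · refine DirectSum.linearMap_ext ℂ fun i => LinearMap.ext fun x => ?_
    change totalInv hω q p (totalHom hω q p (HT.of ρ n i x)) = HT.of ρ n i x
    by_cases h : i.b + i.sec.codim ≤ n
    · have h₁ : i.b + (n - i.sec.codim - i.b) + i.sec.codim = n := by omega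
      have h₂ := totalHom_of hω i.ha i.hb (i.dual h).hb h₁ x
      have h₃ := totalInv_of hω i.ha i.hb (i.dual h).hb h₁ (sumIso hω i.sec h₁ i.a x)
      rw [LinearEquiv.symm_apply_apply] at h₃
      exact (congrArg _ h₂).trans h₃
    · rw [HTSum_eq_zero hω i.sec (not_le.1 h) x, map_zero, map_zero, map_zero]

lemma totalEquiv_of (h : b + b' + s.codim = n) (x : HTSum ρ n s.elt s.age s.codim b a) :
    totalEquiv hω q p (HT.of ρ n ⟨s, a, b, ha, hb⟩ x) =
      HΩ.of ρ n ⟨s, a, b', ha, hb'⟩ (sumIso hω s h a x) := totalHom_of hω ha hb hb' h x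

lemma totalEquiv_of_eq_cohMap (h : b + b' + s.codim = n)
    (x : HTSum ρ n s.elt s.age s.codim b a) :
    totalEquiv hω q p (HT.of ρ n ⟨s, a, b, ha, hb⟩ x) =
      HΩ.of ρ n ⟨s, a, b', ha, hb'⟩ (cohMap (sheafIso hω s h).hom a x) :=
  totalEquiv_of hω ha hb hb' h x

lemma totalEquiv_act (k : G) (x : HT ρ n q p) :
    totalEquiv hω q p (HT.act ρ n q p k x) = HΩ.act ρ n (n - q) p k (totalEquiv hω q p x) := by
  classical
  have key : (totalEquiv hω q p).toLinearMap ∘ₗ HT.act ρ n q p k =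
      HΩ.act ρ n (n - q) p k ∘ₗ (totalEquiv hω q p).toLinearMap := by
    refine DirectSum.linearMap_ext ℂ fun i => LinearMap.ext fun x => ?_
    change totalEquiv hω q p (HT.act ρ n q p k (HT.of ρ n i x)) =
      HΩ.act ρ n (n - q) p k (totalEquiv hω q p (HT.of ρ n i x))
    by_cases h : i.b + i.sec.codim ≤ n
    · have h₁ : i.b + (n - i.sec.codim - i.b) + i.sec.codim = n := by omega
      have h₂ : HT.act ρ n q p k (HT.of ρ n i x) =
          HT.of ρ n (i.conj k) (HT.actSummand ρ n k i x) := DirectSum.toModule_lof ℂ (M := HT.Summand ρ n) i x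
      have h₃ : totalEquiv hω q p (HT.of ρ n i x) =
          HΩ.of ρ n (i.dual h) (sumIso hω i.sec h₁ i.a x) :=
        totalEquiv_of hω i.ha i.hb (i.dual h).hb h₁ x
      have h₄ : ∀ y, HΩ.act ρ n (n - q) p k (HΩ.of ρ n (i.dual h) y) =
          HΩ.of ρ n ((i.dual h).conj k) (HΩ.actSummand ρ n k (i.dual h) y) := fun y =>
        DirectSum.toModule_lof ℂ (M := HΩ.Summand ρ n) (i.dual h) y
      rw [h₂, h₃, h₄]
      -- Conjugation changes only the group element, so the conjugate summand has the same degrees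
      -- and the same partner index.
      refine (totalEquiv_of hω (s := i.sec.conj k) i.ha i.hb (i.dual h).hb h₁ _).trans ?_
      exact congrArg _ (sumIso_map hω k i.sec h₁ i.a x)
    · rw [HTSum_eq_zero hω i.sec (not_le.1 h) x, map_zero, map_zero, map_zero, map_zero]
  exact LinearMap.congr_fun key x

end Total

lemma mem_invariants {G V : Type} [AddCommGroup V] [Module ℂ V] {T : G → V →ₗ[ℂ] V}
    {v : V} : v ∈ invariants T ↔ ∀ h, T h v = v := by
  simp only [invariants, Submodule.mem_iInf]
  rfl

/-- An equivariant isomorphism restricts to the invariants. -/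
lemma exists_invariants_equiv {G V W : Type} [AddCommGroup V] [Module ℂ V] [AddCommGroup W]
    [Module ℂ W] {T : G → V →ₗ[ℂ] V} {S : G → W →ₗ[ℂ] W} (e : V ≃ₗ[ℂ] W)
    (h : ∀ g x, e (T g x) = S g (e x)) :
    ∃ e' : invariants T ≃ₗ[ℂ] invariants S, ∀ x : invariants T, (e' x : W) = e x := by
  refine ⟨e.ofSubmodules _ _ ?_, fun x => e.ofSubmodules_apply _ x⟩
  ext w
  rw [Submodule.mem_map, mem_invariants]
  constructor
  · rintro ⟨v, hv, rfl⟩ g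
    rw [LinearEquiv.coe_coe, ← h, mem_invariants.1 hv g]
  · intro hw
    refine ⟨e.symm w, mem_invariants.2 fun g => e.injective ?_, e.apply_symm_apply w⟩
    rw [h, e.apply_symm_apply, hw]

lemma IsCalabiYau.exists_isVolumeForm {X : Over SpecC} {G : Type} [Group G] {ρ : G →* Aut X}
    {n : ℕ} (h : IsCalabiYau ρ n) :
    ∃ ω : ∀ U : X.left.affineOpens, Form n Γ(X.left, U.1), IsVolumeForm ρ n ω :=
  h.exists_form.elim fun ω hω => ⟨ω, h.proper, h.smooth, hω.1, hω.2.1, hω.2.2⟩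

end

end OrbifoldHodge

end

open OrbifoldHodge

theorem theoremC {X : Over SpecC} {G : Type} [Group G] [Finite G] (ρ : G →* Aut X) (n : ℕ)
    (hX : IsCalabiYau ρ n) :
    ∃ κ : DualizingIso ρ n, ∀ q p : ℤ, ∃ e : HT ρ n q p ≃ₗ[ℂ] HΩ ρ n (n - q) p,
      (∀ (s : Sector G) (a b b' : ℕ) (ha : (a : ℝ) = p - s.age)
        (hb : (b : ℝ) = q + s.age - s.codim) (hb' : (b' : ℝ) = ((n - q : ℤ) : ℝ) - s.age),
        ∃ Φ : (secMor ρ n s).polSheaf b s.codim ≅ formSheaf (secMor ρ n s).src b',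
          IsWedgeDual κ s b b' Φ.hom ∧
          ∀ x, e (HT.of ρ n ⟨s, a, b, ha, hb⟩ x) =
            HΩ.of ρ n ⟨s, a, b', ha, hb'⟩ (cohMap Φ.hom a x)) ∧
      (∀ (h : G) (x : HT ρ n q p), e (HT.act ρ n q p h x) = HΩ.act ρ n (n - q) p h (e x)) ∧
      ∃ e' : HTOrb ρ n q p ≃ₗ[ℂ] HΩOrb ρ n (n - q) p,
        ∀ x : HTOrb ρ n q p, (e' x : HΩ ρ n (n - q) p) = e x := by
  refine hX.exists_isVolumeForm.elim fun ω hω => ?_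
  refine ⟨dualizingIso hω, fun q p => ⟨totalEquiv hω q p, fun s a b b' ha hb hb' => ?_,
    totalEquiv_act hω, exists_invariants_equiv _ (totalEquiv_act hω)⟩⟩
  -- The ages cancel: `(q + r - c) + (n - q - r) + c = n`. The identity holds over the reals and
  -- descends to natural numbers.
  have h : b + b' + s.codim = n := by
    have h₄ : (b : ℝ) + b' + s.codim = n := by
      rw [hb, hb']
      push_cast
      ring
    exact_mod_cast h₄
  refine ⟨sheafIso hω s h, ?_, ?_⟩
  · exact isWedgeDual_sheafIso hω s h
  · intro x
    exact totalEquiv_of_eq_cohMap hω ha hb hb' h x
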